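/- Let $(X,\omega)$ be a compact connected symplectic manifold (smooth, Hausdorff, without boundary). For a symplectic form $\Omega$ on $X$ whose de Rham class is integral (i.e. lies in the image of $H^2(X;\mathbb Z)\to H^2(X;\mathbb R)$), a *Boothby–Wang fibration corresponding to $\Omega$* is a smooth principal $S^1$-bundle $\pi:P\to X$ together with a connection form $\theta$ on $P$ such that $d\theta=\pi^*\Omega$; here $S^1=\mathbb R/\mathbb Z$, so $\theta$ is a real-valued $S^1$-invariant $1$-form equal to $1$ on the generator of the action of $\mathbb R/\mathbb Z$. Let $S^1$ act on the unit sphere $S^3\subset\mathbb C^2$ by complex multiplication, and let $M:=P\times^{S^1}S^3$ be the associated $S^3$-bundle over $X$, with its quotient smooth structure. A *K-contact structure* on a manifold is a quadruple $(\eta,\xi,\phi,g)$ of a smooth $1$-form, vector field, endomorphism field of the tangent bundle and Riemannian metric with $\eta(\xi)=1$, $\phi^2=-\mathrm{Id}+\xi\otimes\eta$, $g(\phi V,\phi W)=g(V,W)-\eta(V)\eta(W)$, $g(\phi V,W)=d\eta(V,W)$ and $\mathcal L_\xi g=0$. (1) Let $c\neq 0$ be a real number (for example an integer) such that the class of the multiple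 $c\,\omega$ is integral. Then there is a Boothby–Wang fibration $S^1\to P\to X$ corresponding to $c\,\omega$ such that $M=P\times^{S^1}S^3$ admits a K-contact structure, $M$ is connected, and $\pi_1(M)\cong\pi_1(X)$. (2) Without any assumption on the class of $\omega$: for every smooth Riemannian metric $g$ on $X$ and every $\varepsilon>0$ there are a symplectic form $\omega'$ on $X$ with $|\omega'(v,w)-\omega(v,w)|\le\varepsilon$ for all tangent vectors $v,w$ at the same point of $g$-length at most $1$, and a positive integer $k$, such that the class of $k\,\omega'$ is integral and there is a Boothby–Wang fibration $S^1\to P\to X$ corresponding to $k\,\omega'$ for which $M=P\times^{S^1}S^3$ admits a K-contact structure, $M$ is connected, and $\pi_1(M)\cong\pi_1(X)$. -/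

import Mathlib

open Set Bundle
open scoped Manifold ContDiff Topology

universe u

/- Normed spaces carry their standard structure of a manifold with a single chart (Mathlib has a
second, definitionally equal instance, which instance search would otherwise find first). -/
attribute [local instance 2000] chartedSpaceSelf

noncomputable section

/-! ### Differential forms on manifolds -/

/-- (Not necessarily continuous) differential `k`-forms on a `d`-dimensional manifold `X`:
a choice of an alternating `k`-linear form on every tangent space. -/
abbrev DForm (d k : ℕ) (X : Type u) [TopologicalSpace X]
    [ChartedSpace (EuclideanSpace ℝ (Fin d)) X] : Type u :=
  ∀ x : X, TangentSpace (𝓡 d) x [⋀^Fin k]→L[ℝ] ℝ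

namespace DForm

variable {d k : ℕ} {X : Type u} [TopologicalSpace X] [ChartedSpace (EuclideanSpace ℝ (Fin d)) X]

/-- The coordinate expression of `σ` in the preferred chart at `x₀`, that is, the pullback of `σ`
under the inverse of that chart (meaningful on the target of the chart). -/
def inChart (σ : DForm d k X) (x₀ : X) (y : EuclideanSpace ℝ (Fin d)) :
    EuclideanSpace ℝ (Fin d) [⋀^Fin k]→L[ℝ] ℝ :=
  (σ ((extChartAt (𝓡 d) x₀).symm y)).compContinuousLinearMap
    (mfderiv 𝓘(ℝ, EuclideanSpace ℝ (Fin d)) (𝓡 d) (extChartAt (𝓡 d) x₀).symm y)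

/-- `σ` is smooth on the open set `U`: all its coordinate expressions are smooth there. -/
def SmoothOn (σ : DForm d k X) (U : Set X) : Prop :=
  ∀ x₀ : X, ContDiffOn ℝ ∞ (inChart σ x₀)
    ((extChartAt (𝓡 d) x₀).target ∩ (extChartAt (𝓡 d) x₀).symm ⁻¹' U)

/-- The exterior derivative, computed at `x` in the preferred chart at `x`. -/
def extD (σ : DForm d k X) : DForm d (k + 1) X := fun x =>
  (extDeriv (inChart σ x) (extChartAt (𝓡 d) x x)).compContinuousLinearMap
    (mfderiv (𝓡 d) 𝓘(ℝ, EuclideanSpace ℝ (Fin d)) (extChartAt (𝓡 d) x) x)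

/-- Symplectic forms: smooth, closed, nondegenerate `2`-forms. -/
structure IsSymplectic (σ : DForm d 2 X) : Prop where
  smooth : SmoothOn σ univ
  closed : extD σ = 0
  nondegenerate : ∀ (x : X) (v : TangentSpace (𝓡 d) x), (∀ w, σ x ![v, w] = 0) → v = 0

/-- A closed `2`-form is integral if its de Rham class lies in the image of `H²(X; ℤ)`. This is
written in Čech cohomology, through the Čech–de Rham isomorphism: on some open cover `U` there are
primitives `lam i` of `σ` and functions `f i j` on the overlaps with `d (f i j) = lam j - lam i`
such that the Čech `2`-cocycle `f j k - f i k + f i j`, which represents the class of `σ`,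
takes integer values. -/
def IsIntegral (σ : DForm d 2 X) : Prop :=
  ∃ (ι : Type u) (U : ι → Set X) (lam : ι → DForm d 1 X) (f : ι → ι → X → ℝ),
    (∀ i, IsOpen (U i)) ∧ (⋃ i, U i) = univ ∧
    (∀ i, SmoothOn (lam i) (U i)) ∧
    (∀ i, ∀ x ∈ U i, extD (lam i) x = σ x) ∧
    (∀ i j, ContMDiffOn (𝓡 d) 𝓘(ℝ, ℝ) ∞ (f i j) (U i ∩ U j)) ∧
    (∀ i j, ∀ x ∈ U i ∩ U j, ∀ v : TangentSpace (𝓡 d) x,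
      (mfderiv (𝓡 d) 𝓘(ℝ, ℝ) (f i j) x v : ℝ) = lam j x ![v] - lam i x ![v]) ∧
    (∀ i j k, ∀ x ∈ U i ∩ U j ∩ U k, ∃ m : ℤ, f j k x - f i k x + f i j x = m)

end DForm

/-! ### K-contact structures -/

/-- Smooth Riemannian metrics on the `d`-dimensional manifold `X`. -/
abbrev RMetric (d : ℕ) (X : Type u) [TopologicalSpace X]
    [ChartedSpace (EuclideanSpace ℝ (Fin d)) X] [IsManifold (𝓡 d) ∞ X] :=
  ContMDiffRiemannianMetric (𝓡 d) ∞ (EuclideanSpace ℝ (Fin d))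
    (fun x : X => TangentSpace (𝓡 d) x)

/-- Smoothness of a vector field. -/
def SmoothVectorField {d : ℕ} {X : Type u} [TopologicalSpace X]
    [ChartedSpace (EuclideanSpace ℝ (Fin d)) X] [IsManifold (𝓡 d) ∞ X]
    (V : ∀ x : X, TangentSpace (𝓡 d) x) : Prop :=
  ContMDiff (𝓡 d) (𝓡 d).tangent ∞ (fun x => (⟨x, V x⟩ : TangentBundle (𝓡 d) X))

/-- A K-contact structure `(η, ξ, φ, g)`: a contact metric structure whose Reeb vector field `ξ`
is a Killing field of `g`. -/
structure KContactStructure (d : ℕ) (M : Type u) [TopologicalSpace M]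
    [ChartedSpace (EuclideanSpace ℝ (Fin d)) M] [IsManifold (𝓡 d) ∞ M] where
  η : DForm d 1 M
  ξ : ∀ x : M, TangentSpace (𝓡 d) x
  φ : ∀ x : M, TangentSpace (𝓡 d) x →L[ℝ] TangentSpace (𝓡 d) x
  g : RMetric d M
  smooth_η : DForm.SmoothOn η univ
  smooth_ξ : SmoothVectorField ξ
  smooth_φ : ContMDiff (𝓡 d)
    ((𝓡 d).prod 𝓘(ℝ, EuclideanSpace ℝ (Fin d) →L[ℝ] EuclideanSpace ℝ (Fin d))) ∞
    (fun x => TotalSpace.mk' (EuclideanSpace ℝ (Fin d) →L[ℝ] EuclideanSpace ℝ (Fin d))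
      (E := fun x : M => TangentSpace (𝓡 d) x →L[ℝ] TangentSpace (𝓡 d) x) x (φ x))
  η_ξ : ∀ x, η x ![ξ x] = 1
  φ_sq : ∀ x (v : TangentSpace (𝓡 d) x), φ x (φ x v) = -v + η x ![v] • ξ x
  compatible : ∀ x (v w : TangentSpace (𝓡 d) x),
    g.inner x (φ x v) (φ x w) = g.inner x v w - η x ![v] * η x ![w]
  contact_metric : ∀ x (v w : TangentSpace (𝓡 d) x), g.inner x (φ x v) w = DForm.extD η x ![v, w]
  /-- `L_ξ g = 0`, that is, `ξ (g (V, W)) = g ([ξ, V], W) + g (V, [ξ, W])`. -/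
  killing : ∀ V W : ∀ x : M, TangentSpace (𝓡 d) x, SmoothVectorField V → SmoothVectorField W →
    ∀ x : M, (mfderiv (𝓡 d) 𝓘(ℝ, ℝ) (fun y => g.inner y (V y) (W y)) x (ξ x) : ℝ) =
      g.inner x (VectorField.mlieBracket (𝓡 d) ξ V x) (W x) +
      g.inner x (V x) (VectorField.mlieBracket (𝓡 d) ξ W x)

/-! ### Boothby–Wang fibrations -/

/-- A Boothby–Wang fibration with curvature form `Ω`: a smooth principal circle bundle
`proj : P → X` with a connection form `θ` such that `dθ = proj^* Ω`. The circle is normalized to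
have length one, so that its Lie algebra is `ℝ` with generator `t ↦ exp (2πit)`, and the real
characteristic class of `P` is the class of `Ω`. -/
structure BoothbyWang {n : ℕ} {X : Type u} [TopologicalSpace X]
    [ChartedSpace (EuclideanSpace ℝ (Fin n)) X] (Ω : DForm n 2 X) where
  P : Type u
  [topP : TopologicalSpace P]
  [chartedP : ChartedSpace (EuclideanSpace ℝ (Fin (n + 1))) P]
  [manifoldP : IsManifold (𝓡 (n + 1)) ∞ P]
  [actionP : MulAction Circle P]
  smooth_action : ContMDiff ((𝓡 1).prod (𝓡 (n + 1))) (𝓡 (n + 1)) ∞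
    (fun a : Circle × P => a.1 • a.2)
  proj : P → X
  /-- Smooth equivariant local trivializations. -/
  locally_trivial : ∀ x : X, ∃ e : Trivialization Circle proj, x ∈ e.baseSet ∧
    ContMDiffOn (𝓡 (n + 1)) ((𝓡 n).prod (𝓡 1)) ∞ e e.source ∧
    ContMDiffOn ((𝓡 n).prod (𝓡 1)) (𝓡 (n + 1)) ∞ e.toOpenPartialHomeomorph.symm e.target ∧
    ∀ p ∈ e.source, ∀ z : Circle, z • p ∈ e.source ∧ e (z • p) = ((e p).1, z * (e p).2)
  θ : DForm (n + 1) 1 P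
  smooth_θ : DForm.SmoothOn θ univ
  invariant_θ : ∀ (z : Circle) (p : P) (v : TangentSpace (𝓡 (n + 1)) p),
    θ (z • p) ![mfderiv (𝓡 (n + 1)) (𝓡 (n + 1)) (fun q : P => z • q) p v] = θ p ![v]
  /-- `θ` takes the value `1` on the velocity vector at `t = 0` of `t ↦ exp (2πit) • p`. -/
  vertical_θ : ∀ p : P,
    θ (Circle.exp (2 * Real.pi * 0) • p) ![mfderiv 𝓘(ℝ, ℝ) (𝓡 (n + 1))
      (fun t : ℝ => Circle.exp (2 * Real.pi * t) • p) 0 (1 : ℝ)] = 1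
  curvature : ∀ (p : P) (v w : TangentSpace (𝓡 (n + 1)) p),
    DForm.extD θ p ![v, w] =
      Ω (proj p) ![mfderiv (𝓡 (n + 1)) (𝓡 n) proj p v, mfderiv (𝓡 (n + 1)) (𝓡 n) proj p w]

attribute [instance] BoothbyWang.topP BoothbyWang.chartedP BoothbyWang.manifoldP
  BoothbyWang.actionP

instance fact_finrank_complexPlane :
    Fact (Module.finrank ℝ (EuclideanSpace ℂ (Fin 2)) = 3 + 1) :=
  ⟨by rw [← Module.finrank_mul_finrank ℝ ℂ (EuclideanSpace ℂ (Fin 2))]; simp⟩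

/-- The unit sphere `S³` of `ℂ²`. -/
abbrev S3 : Type := Metric.sphere (0 : EuclideanSpace ℂ (Fin 2)) 1

/-- The Hopf action of the circle on `S³` by complex multiplication. -/
def hopf (z : Circle) (v : S3) : S3 :=
  ⟨(z : ℂ) • (v : EuclideanSpace ℂ (Fin 2)), by
    rw [mem_sphere_zero_iff_norm, norm_smul, Circle.norm_coe, one_mul]
    exact mem_sphere_zero_iff_norm.mp v.2⟩

namespace BoothbyWang

variable {n : ℕ} {X : Type u} [TopologicalSpace X]
  [ChartedSpace (EuclideanSpace ℝ (Fin n)) X] {Ω : DForm n 2 X}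

/-- The equivalence relation on `P × S³` whose classes are the orbits of the circle action
`z • (p, v) = (z • p, z⁻¹ v)`. -/
def assocSetoid (B : BoothbyWang Ω) : Setoid (B.P × S3) where
  r a b := ∃ z : Circle, b = (z • a.1, hopf z⁻¹ a.2)
  iseqv :=
    { refl := fun a => ⟨1, by ext <;> simp [hopf]⟩
      symm := by
        rintro a _ ⟨z, rfl⟩
        refine ⟨z⁻¹, ?_⟩
        ext <;> simp [hopf]
      trans := by
        rintro a _ _ ⟨z, rfl⟩ ⟨w, rfl⟩
        refine ⟨w * z, Prod.ext (mul_smul w z a.1).symm (Subtype.ext ?_)⟩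
        simp [hopf, mul_smul, mul_comm w z] }

/-- The associated bundle `P ×^{S¹} S³`, with the quotient topology. -/
def SphereBundle (B : BoothbyWang Ω) : Type u := Quotient B.assocSetoid

instance (B : BoothbyWang Ω) : TopologicalSpace B.SphereBundle :=
  inferInstanceAs (TopologicalSpace (Quotient B.assocSetoid))

/-- The quotient map `P × S³ → P ×^{S¹} S³`. -/
def quot (B : BoothbyWang Ω) (a : B.P × S3) : B.SphereBundle := Quotient.mk B.assocSetoid a

/-- With its smooth structure as a quotient of `P × S³` (the unique one for which the quotient map
is a smooth submersion), the associated `S³`-bundle is a manifold with a K-contact structure. -/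
def SphereBundleIsKContact (B : BoothbyWang Ω) : Prop :=
  ∃ (_ : ChartedSpace (EuclideanSpace ℝ (Fin (n + 3))) B.SphereBundle)
    (_ : IsManifold (𝓡 (n + 3)) ∞ B.SphereBundle),
    ContMDiff ((𝓡 (n + 1)).prod (𝓡 3)) (𝓡 (n + 3)) ∞ B.quot ∧
    (∀ a, Function.Surjective (mfderiv ((𝓡 (n + 1)).prod (𝓡 3)) (𝓡 (n + 3)) B.quot a)) ∧
    Nonempty (KContactStructure (n + 3) B.SphereBundle)

/-- The associated `S³`-bundle is connected and has the same fundamental group as the base. -/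
def SphereBundleHasPi1OfBase (B : BoothbyWang Ω) : Prop :=
  ConnectedSpace B.SphereBundle ∧
    ∀ (m : B.SphereBundle) (x : X), Nonempty (FundamentalGroup B.SphereBundle m ≃* FundamentalGroup X x)

end BoothbyWang

end

/-! An integral closed form `Ω` comes with local primitives `lam i` and functions `f i j` satisfying
d(f i j) = lam j - lam i, whose defect on triple overlaps is an integer. Hence the numbers exp(-2πi
f i j) are transition functions of a principal circle bundle, and the `lam i` glue to a connection
form with curvature `Ω`. The associated S³-bundle has the same transition functions, acting on ℂ² by
complex multiplication. Both bundles are instances of `SphereFibration`: locally a point is a base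
point together with a unit vector `fib i` in a space V with complex structure J. The covariant
derivative `vert i` of `fib i` rotates in the same way as `fib i` under a change of trivialization
(`vert_change`), so expressions in `fib`, `vert`, J and the inner product define global tensors.

The contact form is η = (2π)⁻¹⟨J fib, vert⟩, and its Reeb field ξ rotates the fibres. Because η(ξ) =
1 is constant, the curvature enters with constant coefficient: dη = π^*Ω + π⁻¹⟨J vert, vert⟩
(`extD_eta`, `inner_J_vert_vert`). On the kernel of η the first term is nondegenerate in the base
directions and the second in the complex directions of the fibre. An almost complex structure and a
metric on X compatible with `Ω`, obtained by polar decomposition with respect to an auxiliary metric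
(`nonempty_compatibleTriple`), complete η and ξ to a contact metric structure. The flow of ξ covers
the identity of X and acts on the fibres by rotations commuting with J, so ξ is Killing
(`fderiv_metHat`). On the circle bundle the second term of dη vanishes, since the fibres are
one-dimensional.

The three-sphere is simply connected, so lifting of paths and of homotopies (`cornerLifting_unit`)
shows that the projection to X is an isomorphism on fundamental groups.

For (2), rational classes must be shown to be dense. By compactness a finite cover carries
primitives whose Čech cocycle takes only finitely many values. A ℚ-linear map ψ from ℝ to ℚ moves
these values as little as desired, and being additive it sends cocycles to cocycles. The difference
E = ψ - id therefore yields a small cocycle, which a partition of unity turns into a small closed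
two-form. Adding it to the symplectic form gives a nearby symplectic form with rational class
(`exists_integral_multiple`). A positive multiple of it is integral, and the construction of (1)
applies. -/

set_option linter.unusedSectionVars false

/-! ### Differential forms in charts: pullback and exterior derivative. -/

noncomputable section

section alternating

variable {E F : Type*} [NormedAddCommGroup E] [NormedSpace ℝ E]
  [NormedAddCommGroup F] [NormedSpace ℝ F] [FiniteDimensional ℝ F] {k : ℕ}

/-- Smoothness of a family of alternating maps can be checked pointwise. -/
theorem contDiffAt_alternating {α : E → F [⋀^Fin k]→L[ℝ] ℝ} {x : E}
    (h : ∀ v : Fin k → F, ContDiffAt ℝ ∞ (fun y => α y v) x) : ContDiffAt ℝ ∞ α x := by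
  let e := Module.finBasis ℝ F
  -- Evaluation on tuples of basis vectors is injective, so it has a linear left inverse, through
  -- which smoothness of the values gives smoothness of the form.
  let J : (F [⋀^Fin k]→L[ℝ] ℝ) →ₗ[ℝ] ((Fin k → Fin (Module.finrank ℝ F)) → ℝ) :=
    { toFun := fun a i => a fun j => e (i j)
      map_add' := fun _ _ => rfl
      map_smul' := fun _ _ => rfl }
  have hJ : LinearMap.ker J = ⊥ := by
    refine LinearMap.ker_eq_bot'.2 fun a ha => ?_
    have : a.toAlternatingMap = 0 := by
      refine e.ext_alternating fun i _ => ?_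
      exact congrFun ha i
    ext v
    exact DFunLike.congr_fun this v
  obtain ⟨K, hK⟩ := J.exists_leftInverse_of_injective hJ
  have h1 : ContDiffAt ℝ ∞ (fun y => J (α y)) x := contDiffAt_pi.2 fun i => h _
  have h2 := (LinearMap.toContinuousLinearMap K).contDiff.contDiffAt.comp x h1
  refine h2.congr_of_eventuallyEq (Filter.Eventually.of_forall fun y => ?_)
  exact (DFunLike.congr_fun hK (α y)).symm

theorem ContDiffAt.alternating_comp {G : Type*} [NormedAddCommGroup G] [NormedSpace ℝ G]
    {α : E → G [⋀^Fin k]→L[ℝ] ℝ} {A : E → F →L[ℝ] G} {x : E}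
    (hα : ContDiffAt ℝ ∞ α x) (hA : ContDiffAt ℝ ∞ A x) :
    ContDiffAt ℝ ∞ (fun y => (α y).compContinuousLinearMap (A y)) x := by
  refine contDiffAt_alternating fun v => ?_
  have h1 : ContDiffAt ℝ ∞ (fun y => (ContinuousMultilinearMap.compContinuousLinearMapContinuousMultilinear
      ℝ (fun _ : Fin k => F) (fun _ : Fin k => G) ℝ) (fun _ => A y)) x :=
    (ContinuousMultilinearMap.contDiff _).contDiffAt.comp x (contDiffAt_pi.2 fun _ => hA)
  have h2 : ContDiffAt ℝ ∞
      (fun y => ContinuousAlternatingMap.toContinuousMultilinearMapCLM ℝ (α y)) x :=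
    (ContinuousLinearMap.contDiff _).contDiffAt.comp x hα
  exact ((ContinuousMultilinearMap.apply ℝ (fun _ : Fin k => F) ℝ v).contDiff.contDiffAt).comp x
    (h1.clm_apply h2)

theorem ContDiffAt.alternating_apply {α : E → F [⋀^Fin k]→L[ℝ] ℝ} {x : E}
    (h : ContDiffAt ℝ ∞ α x) (v : Fin k → F) : ContDiffAt ℝ ∞ (fun y => α y v) x :=
  (ContinuousAlternatingMap.apply ℝ F ℝ v).contDiff.contDiffAt.comp x h

end alternating

namespace DForm

variable {d k m : ℕ} {X : Type u} [TopologicalSpace X] [ChartedSpace (EuclideanSpace ℝ (Fin d)) X]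
  {Y : Type u} [TopologicalSpace Y] [ChartedSpace (EuclideanSpace ℝ (Fin m)) Y]

theorem two_le_infty : minSmoothness ℝ 2 ≤ ∞ := by
  simpa using (show ((2 : ℕ∞) : ℕ∞ω) ≤ ∞ from mod_cast le_top)

section charts

variable [IsManifold (𝓡 d) ∞ X]

theorem mdifferentiableAt_chart {x₀ x : X} (hx : x ∈ (extChartAt (𝓡 d) x₀).source) :
    MDifferentiableAt (𝓡 d) 𝓘(ℝ, EuclideanSpace ℝ (Fin d)) (extChartAt (𝓡 d) x₀) x :=
  (contMDiffAt_extChartAt' (n := ∞) (by simpa using hx)).mdifferentiableAt (by simp)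

theorem contMDiffAt_chart_symm {x₀ : X} {b : EuclideanSpace ℝ (Fin d)}
    (hb : b ∈ (extChartAt (𝓡 d) x₀).target) :
    ContMDiffAt 𝓘(ℝ, EuclideanSpace ℝ (Fin d)) (𝓡 d) ∞ (extChartAt (𝓡 d) x₀).symm b :=
  (contMDiffOn_extChartAt_symm x₀).contMDiffAt
    ((isOpen_extChartAt_target x₀).mem_nhds hb)

theorem mdifferentiableAt_chart_symm {x₀ : X} {b : EuclideanSpace ℝ (Fin d)}
    (hb : b ∈ (extChartAt (𝓡 d) x₀).target) :
    MDifferentiableAt 𝓘(ℝ, EuclideanSpace ℝ (Fin d)) (𝓡 d) (extChartAt (𝓡 d) x₀).symm b :=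
  (contMDiffAt_chart_symm hb).mdifferentiableAt (by simp)

theorem mfderiv_chart_comp_symm {x₀ : X} {b : EuclideanSpace ℝ (Fin d)}
    (hb : b ∈ (extChartAt (𝓡 d) x₀).target) (v : EuclideanSpace ℝ (Fin d)) :
    (mfderiv (𝓡 d) 𝓘(ℝ, EuclideanSpace ℝ (Fin d)) (extChartAt (𝓡 d) x₀)
      ((extChartAt (𝓡 d) x₀).symm b)
      (mfderiv 𝓘(ℝ, EuclideanSpace ℝ (Fin d)) (𝓡 d) (extChartAt (𝓡 d) x₀).symm b v) :
      EuclideanSpace ℝ (Fin d)) = v := by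
  have : IsManifold (𝓡 d) 1 X := .of_le (n := ∞) (by simp)
  have h := mfderiv_extChartAt_comp_mfderivWithin_extChartAt_symm (I := 𝓡 d) hb
  simp only [modelWithCornersSelf_coe, range_id, mfderivWithin_univ] at h
  exact DFunLike.congr_fun h v

theorem mfderiv_chart_comp_symm' {x₀ x : X} (hx : x ∈ (extChartAt (𝓡 d) x₀).source)
    (v : EuclideanSpace ℝ (Fin d)) :
    (mfderiv (𝓡 d) 𝓘(ℝ, EuclideanSpace ℝ (Fin d)) (extChartAt (𝓡 d) x₀) x
      (mfderiv 𝓘(ℝ, EuclideanSpace ℝ (Fin d)) (𝓡 d) (extChartAt (𝓡 d) x₀).symm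
        (extChartAt (𝓡 d) x₀ x) v) : EuclideanSpace ℝ (Fin d)) = v := by
  have : IsManifold (𝓡 d) 1 X := .of_le (n := ∞) (by simp)
  have h := mfderiv_extChartAt_comp_mfderivWithin_extChartAt_symm' (I := 𝓡 d) hx
  simp only [modelWithCornersSelf_coe, range_id, mfderivWithin_univ] at h
  exact DFunLike.congr_fun h v

theorem mfderiv_symm_comp_chart {x₀ x : X} (hx : x ∈ (extChartAt (𝓡 d) x₀).source)
    (v : TangentSpace (𝓡 d) x) :
    mfderiv 𝓘(ℝ, EuclideanSpace ℝ (Fin d)) (𝓡 d) (extChartAt (𝓡 d) x₀).symm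
      (extChartAt (𝓡 d) x₀ x)
      (mfderiv (𝓡 d) 𝓘(ℝ, EuclideanSpace ℝ (Fin d)) (extChartAt (𝓡 d) x₀) x v) = v := by
  have : IsManifold (𝓡 d) 1 X := .of_le (n := ∞) (by simp)
  have h := mfderivWithin_extChartAt_symm_comp_mfderiv_extChartAt' (I := 𝓡 d) hx
  simp only [modelWithCornersSelf_coe, range_id, mfderivWithin_univ] at h
  exact DFunLike.congr_fun h v

end charts

/-- The pullback of a differential form under a map. -/
def pullback (f : Y → X) (σ : DForm d k X) : DForm m k Y := fun y =>
  (σ (f y)).compContinuousLinearMap (mfderiv (𝓡 m) (𝓡 d) f y)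

variable [IsManifold (𝓡 d) ∞ X] [IsManifold (𝓡 m) ∞ Y]

theorem inChart_chart_apply (σ : DForm d k X) {x₀ x : X} (hx : x ∈ (extChartAt (𝓡 d) x₀).source)
    (v : Fin k → EuclideanSpace ℝ (Fin d)) :
    inChart σ x₀ (extChartAt (𝓡 d) x₀ x) v =
      σ x (fun i => mfderiv 𝓘(ℝ, EuclideanSpace ℝ (Fin d)) (𝓡 d) (extChartAt (𝓡 d) x₀).symm
        (extChartAt (𝓡 d) x₀ x) (v i)) := by
  -- The base point in `inChart` is equal to `x` only propositionally. The form is transported along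
  -- this equality while its arguments stay in the model space.
  have key : ∀ x' : X, x' = x → ∀ w : Fin k → EuclideanSpace ℝ (Fin d), σ x' w = σ x w := by
    rintro _ rfl _; rfl
  exact key _ ((extChartAt (𝓡 d) x₀).left_inv hx) _

/-- Inserting the chart of `X` and its inverse between `f` and `σ` changes nothing, as their
derivatives cancel. What remains is the chain rule. -/
theorem inChart_pullback {f : Y → X} (σ : DForm d k X) {y₀ : Y} {x₀ : X}
    {b : EuclideanSpace ℝ (Fin m)} (hb : b ∈ (extChartAt (𝓡 m) y₀).target)
    (hf : MDifferentiableAt (𝓡 m) (𝓡 d) f ((extChartAt (𝓡 m) y₀).symm b))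
    (hx : f ((extChartAt (𝓡 m) y₀).symm b) ∈ (extChartAt (𝓡 d) x₀).source) :
    inChart (pullback f σ) y₀ b =
      (inChart σ x₀ ((extChartAt (𝓡 d) x₀ ∘ f ∘ (extChartAt (𝓡 m) y₀).symm) b)).compContinuousLinearMap
        (fderiv ℝ (extChartAt (𝓡 d) x₀ ∘ f ∘ (extChartAt (𝓡 m) y₀).symm) b) := by
  have hc := mdifferentiableAt_chart hx
  have hs := mdifferentiableAt_chart_symm hb
  rw [← mfderiv_eq_fderiv]
  ext v
  have e1 : ∀ w : EuclideanSpace ℝ (Fin m),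
      mfderiv 𝓘(ℝ, EuclideanSpace ℝ (Fin m)) 𝓘(ℝ, EuclideanSpace ℝ (Fin d))
        (extChartAt (𝓡 d) x₀ ∘ f ∘ (extChartAt (𝓡 m) y₀).symm) b w =
      mfderiv (𝓡 d) 𝓘(ℝ, EuclideanSpace ℝ (Fin d)) (extChartAt (𝓡 d) x₀) _
        (mfderiv (𝓡 m) (𝓡 d) f _
          (mfderiv 𝓘(ℝ, EuclideanSpace ℝ (Fin m)) (𝓡 m) (extChartAt (𝓡 m) y₀).symm b w)) := by
    intro w
    rw [mfderiv_comp b hc (hf.comp b hs), mfderiv_comp b hf hs]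
    rfl
  refine Eq.trans ?_ (inChart_chart_apply σ hx _).symm
  refine congrArg (σ (f ((extChartAt (𝓡 m) y₀).symm b))) (funext fun i => ?_)
  refine Eq.trans ?_ (congrArg _ (e1 (v i)).symm)
  exact (mfderiv_symm_comp_chart hx _).symm

theorem contDiffAt_chart_comp {f : Y → X} {y₀ : Y} {x₀ : X}
    {b : EuclideanSpace ℝ (Fin m)} (hb : b ∈ (extChartAt (𝓡 m) y₀).target)
    (hf : ContMDiffAt (𝓡 m) (𝓡 d) ∞ f ((extChartAt (𝓡 m) y₀).symm b))
    (hx : f ((extChartAt (𝓡 m) y₀).symm b) ∈ (extChartAt (𝓡 d) x₀).source) :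
    ContDiffAt ℝ ∞ (extChartAt (𝓡 d) x₀ ∘ f ∘ (extChartAt (𝓡 m) y₀).symm) b := by
  rw [← contMDiffAt_iff_contDiffAt]
  exact (contMDiffAt_extChartAt' (by simpa using hx)).comp b
    (hf.comp b (contMDiffAt_chart_symm hb))

/-- `inChart_pullback` in a neighbourhood. -/
theorem eventually_inChart_pullback {f : Y → X} (σ : DForm d k X) {y₀ : Y} {x₀ : X}
    {b : EuclideanSpace ℝ (Fin m)} (hb : b ∈ (extChartAt (𝓡 m) y₀).target)
    (hf : ContMDiffAt (𝓡 m) (𝓡 d) ∞ f ((extChartAt (𝓡 m) y₀).symm b))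
    (hx : f ((extChartAt (𝓡 m) y₀).symm b) ∈ (extChartAt (𝓡 d) x₀).source) :
    inChart (pullback f σ) y₀ =ᶠ[𝓝 b] fun b =>
      (inChart σ x₀ ((extChartAt (𝓡 d) x₀ ∘ f ∘ (extChartAt (𝓡 m) y₀).symm) b)).compContinuousLinearMap
        (fderiv ℝ (extChartAt (𝓡 d) x₀ ∘ f ∘ (extChartAt (𝓡 m) y₀).symm) b) := by
  have hs := (contMDiffAt_chart_symm hb).continuousAt
  have h1 := hs.eventually ((contMDiffAt_iff_contMDiffAt_nhds (by simp)).1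
    (hf.of_le (m := 1) (by simp)))
  have h2 := (hf.continuousAt.comp hs).eventually
    ((isOpen_extChartAt_source x₀).mem_nhds hx)
  filter_upwards [h1, h2, (isOpen_extChartAt_target y₀).mem_nhds hb] with b' h1 h2 h3
  exact inChart_pullback σ h3 (h1.mdifferentiableAt (by simp)) h2

/-- Smoothness of a form at a point. -/
def SmoothAt (σ : DForm d k X) (x : X) : Prop :=
  ContDiffAt ℝ ∞ (inChart σ x) (extChartAt (𝓡 d) x x)

theorem SmoothAt.contDiffAt_pullback {σ : DForm d k X} {f : Y → X} {y₀ : Y}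
    {b : EuclideanSpace ℝ (Fin m)} (hb : b ∈ (extChartAt (𝓡 m) y₀).target)
    (hf : ContMDiffAt (𝓡 m) (𝓡 d) ∞ f ((extChartAt (𝓡 m) y₀).symm b))
    (hσ : SmoothAt σ (f ((extChartAt (𝓡 m) y₀).symm b))) :
    ContDiffAt ℝ ∞ (inChart (pullback f σ) y₀) b := by
  have hx := mem_extChartAt_source (I := 𝓡 d) (f ((extChartAt (𝓡 m) y₀).symm b))
  refine ContDiffAt.congr_of_eventuallyEq ?_ (eventually_inChart_pullback σ hb hf hx)
  have hφ := contDiffAt_chart_comp hb hf hx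
  refine ContDiffAt.alternating_comp ?_ (hφ.fderiv_right (by simp))
  exact ContDiffAt.comp b (g := inChart σ (f ((extChartAt (𝓡 m) y₀).symm b))) hσ hφ

theorem pullback_id (σ : DForm d k X) : pullback id σ = σ := by
  funext x
  ext v
  simp [pullback]

/-- A change of charts is the coordinate expression of the identity, so independence of the chart is
the pullback statement for `id`. -/
theorem SmoothAt.contDiffAt {σ : DForm d k X} {x₀ : X} {b : EuclideanSpace ℝ (Fin d)}
    (hb : b ∈ (extChartAt (𝓡 d) x₀).target)
    (hσ : SmoothAt σ ((extChartAt (𝓡 d) x₀).symm b)) : ContDiffAt ℝ ∞ (inChart σ x₀) b := by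
  rw [← pullback_id σ]
  exact SmoothAt.contDiffAt_pullback hb contMDiffAt_id hσ

theorem smoothOn_iff {σ : DForm d k X} {U : Set X} (hU : IsOpen U) :
    SmoothOn σ U ↔ ∀ x ∈ U, SmoothAt σ x := by
  constructor
  · intro h x hx
    refine (h x).contDiffAt (IsOpen.mem_nhds ?_ ?_)
    · exact (continuousOn_extChartAt_symm x).isOpen_inter_preimage (isOpen_extChartAt_target x) hU
    · exact ⟨mem_extChartAt_target x, by simpa using hx⟩
  · intro h x₀ b hb
    exact (SmoothAt.contDiffAt hb.1 (h _ hb.2)).contDiffWithinAt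

theorem SmoothAt.pullback {σ : DForm d k X} {f : Y → X} {y : Y}
    (hσ : SmoothAt σ (f y)) (hf : ContMDiffAt (𝓡 m) (𝓡 d) ∞ f y) :
    SmoothAt (DForm.pullback (m := m) f σ) y := by
  refine SmoothAt.contDiffAt_pullback (σ := σ) (m := m) (mem_extChartAt_target (I := 𝓡 m) y) ?_ ?_ <;> simpa

/-- Naturality of the exterior derivative between vector spaces, read in the preferred chart at the
image point, which is the chart that defines `extD σ` there. -/
theorem SmoothAt.extDeriv_inChart_pullback {σ : DForm d k X} {f : Y → X} {y₀ : Y}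
    {b : EuclideanSpace ℝ (Fin m)} (hb : b ∈ (extChartAt (𝓡 m) y₀).target)
    (hf : ContMDiffAt (𝓡 m) (𝓡 d) ∞ f ((extChartAt (𝓡 m) y₀).symm b))
    (hσ : SmoothAt σ (f ((extChartAt (𝓡 m) y₀).symm b))) :
    extDeriv (inChart (DForm.pullback f σ) y₀) b =
      inChart (DForm.pullback f (extD σ)) y₀ b := by
  have hx := mem_extChartAt_source (I := 𝓡 d) (f ((extChartAt (𝓡 m) y₀).symm b))
  have hφ := contDiffAt_chart_comp hb hf hx
  rw [(eventually_inChart_pullback σ hb hf hx).extDeriv_eq,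
    inChart_pullback _ hb (hf.mdifferentiableAt (by simp)) hx,
    extDeriv_pullback (r := ∞) (f := extChartAt (𝓡 d) (f ((extChartAt (𝓡 m) y₀).symm b)) ∘ f ∘
      (extChartAt (𝓡 m) y₀).symm) (ContDiffAt.differentiableAt hσ (by simp)) hφ two_le_infty]
  ext v
  refine Eq.trans ?_ (inChart_chart_apply (extD σ) hx
    (fun i => fderiv ℝ (extChartAt (𝓡 d) (f ((extChartAt (𝓡 m) y₀).symm b)) ∘ f ∘
      (extChartAt (𝓡 m) y₀).symm) b (v i))).symm
  refine congrArg (extDeriv _ _) (funext fun i => ?_)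
  exact (mfderiv_chart_comp_symm' hx _).symm

/-- The exterior derivative can be computed in any chart. -/
theorem SmoothAt.extDeriv_inChart {σ : DForm d k X} {x₀ : X} {b : EuclideanSpace ℝ (Fin d)}
    (hb : b ∈ (extChartAt (𝓡 d) x₀).target)
    (hσ : SmoothAt σ ((extChartAt (𝓡 d) x₀).symm b)) :
    extDeriv (inChart σ x₀) b = inChart (extD σ) x₀ b := by
  have := SmoothAt.extDeriv_inChart_pullback hb contMDiffAt_id hσ
  rwa [pullback_id, pullback_id] at this

theorem extD_eq_of_inChart_eq {σ : DForm d k X} {τ : DForm d (k + 1) X} {x : X}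
    (h : extDeriv (inChart σ x) (extChartAt (𝓡 d) x x) = inChart τ x (extChartAt (𝓡 d) x x)) :
    extD σ x = τ x := by
  ext v
  rw [extD, h]
  refine (inChart_chart_apply _ (mem_extChartAt_source x) _).trans ?_
  refine congrArg (τ x) (funext fun i => ?_)
  exact mfderiv_symm_comp_chart (mem_extChartAt_source x) _

theorem SmoothAt.extD_pullback {σ : DForm d k X} {f : Y → X} {y : Y}
    (hσ : SmoothAt σ (f y)) (hf : ContMDiffAt (𝓡 m) (𝓡 d) ∞ f y) :
    DForm.extD (DForm.pullback (m := m) f σ) y = DForm.pullback f (DForm.extD σ) y := by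
  refine extD_eq_of_inChart_eq
    (SmoothAt.extDeriv_inChart_pullback (σ := σ) (m := m) (mem_extChartAt_target (I := 𝓡 m) y) ?_ ?_) <;> simpa

theorem eventually_inChart_congr {σ τ : DForm d k X} {x₀ : X} {b : EuclideanSpace ℝ (Fin d)}
    (hb : b ∈ (extChartAt (𝓡 d) x₀).target)
    (h : ∀ᶠ x in 𝓝 ((extChartAt (𝓡 d) x₀).symm b), σ x = τ x) :
    inChart σ x₀ =ᶠ[𝓝 b] inChart τ x₀ := by
  filter_upwards [(contMDiffAt_chart_symm hb).continuousAt.eventually h] with b' h'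
  simp only [inChart, h']

theorem extD_congr {σ τ : DForm d k X} {x : X} (h : ∀ᶠ y in 𝓝 x, σ y = τ y) :
    extD σ x = extD τ x := by
  rw [extD, extD, (eventually_inChart_congr (mem_extChartAt_target x) (by simpa)).extDeriv_eq]

theorem SmoothAt.congr {σ τ : DForm d k X} {x : X} (hσ : SmoothAt σ x)
    (h : ∀ᶠ y in 𝓝 x, σ y = τ y) : SmoothAt τ x :=
  ContDiffAt.congr_of_eventuallyEq hσ
    (eventually_inChart_congr (mem_extChartAt_target x) (by simpa)).symm

theorem inChart_add (σ τ : DForm d k X) (x₀ : X) :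
    inChart (σ + τ) x₀ = inChart σ x₀ + inChart τ x₀ := rfl

theorem inChart_smul (c : ℝ) (σ : DForm d k X) (x₀ : X) :
    inChart (c • σ) x₀ = c • inChart σ x₀ := rfl

theorem SmoothAt.add {σ τ : DForm d k X} {x : X} (hσ : SmoothAt σ x) (hτ : SmoothAt τ x) :
    SmoothAt (σ + τ) x := ContDiffAt.add hσ hτ

theorem SmoothAt.smul {σ : DForm d k X} {x : X} (c : ℝ) (hσ : SmoothAt σ x) :
    SmoothAt (c • σ) x := ContDiffAt.const_smul c hσ

theorem SmoothAt.extD_add {σ τ : DForm d k X} {x : X} (hσ : SmoothAt σ x) (hτ : SmoothAt τ x) :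
    extD (σ + τ) x = extD σ x + extD τ x := by
  rw [extD, inChart_add, extDeriv_add (ContDiffAt.differentiableAt hσ (by simp))
    (ContDiffAt.differentiableAt hτ (by simp))]
  rfl

theorem extD_smul (c : ℝ) (σ : DForm d k X) (x : X) : extD (c • σ) x = c • extD σ x := by
  rw [extD, inChart_smul, extDeriv_smul]
  rfl

theorem eventually_extDeriv_inChart {σ : DForm d k X} {x₀ : X} {b : EuclideanSpace ℝ (Fin d)}
    (hb : b ∈ (extChartAt (𝓡 d) x₀).target)
    (h : ∀ᶠ y in 𝓝 ((extChartAt (𝓡 d) x₀).symm b), SmoothAt σ y) :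
    extDeriv (inChart σ x₀) =ᶠ[𝓝 b] inChart (extD σ) x₀ := by
  filter_upwards [(contMDiffAt_chart_symm hb).continuousAt.eventually h,
    (isOpen_extChartAt_target x₀).mem_nhds hb] with b' h' hb' using h'.extDeriv_inChart hb'

/-- At nearby points `extD σ` is computed in charts that vary with the point. Independence of the
chart replaces them by one fixed chart, where d² = 0. This uses smoothness on a neighbourhood. -/
theorem extD_extD {σ : DForm d k X} {x : X} (h : ∀ᶠ y in 𝓝 x, SmoothAt σ y) :
    extD (extD σ) x = 0 := by
  have h1 := eventually_extDeriv_inChart (mem_extChartAt_target x) (σ := σ) (by simpa)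
  rw [extD, ← h1.extDeriv_eq, extDeriv_extDeriv_apply (r := ∞) h.self_of_nhds two_le_infty]
  rfl

theorem SmoothAt.extD {σ : DForm d k X} {x : X} (h : ∀ᶠ y in 𝓝 x, SmoothAt σ y) :
    SmoothAt (DForm.extD σ) x := by
  have h1 := eventually_extDeriv_inChart (mem_extChartAt_target x) (σ := σ) (by simpa)
  refine ContDiffAt.congr_of_eventuallyEq ?_ h1.symm
  have h2 : ContDiffAt ℝ ∞ (fderiv ℝ (inChart σ x)) (extChartAt (𝓡 d) x x) :=
    ContDiffAt.fderiv_right h.self_of_nhds (by simp)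
  exact (ContinuousAlternatingMap.alternatizeUncurryFinCLM ℝ
    (EuclideanSpace ℝ (Fin d)) ℝ).contDiff.contDiffAt.comp _ h2

end DForm

end

/-! ### Tensor fields in charts and the chain rule in model spaces. -/

noncomputable section

section tensors

variable {d : ℕ} {X : Type u} [TopologicalSpace X] [ChartedSpace (EuclideanSpace ℝ (Fin d)) X]

/-- The derivative of a chart. -/
abbrev dChart (x₀ x : X) : TangentSpace (𝓡 d) x →L[ℝ] EuclideanSpace ℝ (Fin d) :=
  mfderiv (𝓡 d) 𝓘(ℝ, EuclideanSpace ℝ (Fin d)) (extChartAt (𝓡 d) x₀) x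

/-- The derivative of the inverse of a chart. -/
abbrev dSymm (x₀ : X) (b : EuclideanSpace ℝ (Fin d)) :
    EuclideanSpace ℝ (Fin d) →L[ℝ] TangentSpace (𝓡 d) ((extChartAt (𝓡 d) x₀).symm b) :=
  mfderiv 𝓘(ℝ, EuclideanSpace ℝ (Fin d)) (𝓡 d) (extChartAt (𝓡 d) x₀).symm b

theorem contDiffAt_congr_iff {E F : Type*} [NormedAddCommGroup E] [NormedSpace ℝ E]
    [NormedAddCommGroup F] [NormedSpace ℝ F] {f g : E → F} {x : E} (h : f =ᶠ[𝓝 x] g) :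
    ContDiffAt ℝ ∞ f x ↔ ContDiffAt ℝ ∞ g x :=
  ⟨fun hf => hf.congr_of_eventuallyEq h.symm, fun hg => hg.congr_of_eventuallyEq h⟩

theorem contDiffAt_clm_iff {E F G : Type*} [NormedAddCommGroup E] [NormedSpace ℝ E]
    [NormedAddCommGroup F] [NormedSpace ℝ F] [FiniteDimensional ℝ F]
    [NormedAddCommGroup G] [NormedSpace ℝ G] {f : E → F →L[ℝ] G} {x : E} :
    ContDiffAt ℝ ∞ f x ↔ ∀ v, ContDiffAt ℝ ∞ (fun y => f y v) x := by
  refine ⟨fun h v => h.clm_apply contDiffAt_const, fun h => ?_⟩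
  let e := Module.finBasis ℝ F
  have h1 : f = fun y => ∑ i, (ContinuousLinearMap.smulRightL ℝ F G
      ((LinearMap.toContinuousLinearMap (e.coord i)))) (f y (e i)) := by
    funext y
    ext v
    have h2 := congrArg (f y) (e.sum_repr v).symm
    rw [map_sum] at h2
    simpa using h2
  rw [h1]
  refine ContDiffAt.sum fun i _ => ?_
  exact ContDiffAt.comp x (ContinuousLinearMap.contDiff _).contDiffAt (h _)

variable [IsManifold (𝓡 d) ∞ X]

/-- The trivialization of the tangent bundle at `x₀` is the derivative of the chart at `x₀`, so
smoothness of a section is smoothness of its components in that chart. -/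
theorem smoothVectorField_iff (V : ∀ x : X, TangentSpace (𝓡 d) x) :
    SmoothVectorField V ↔ ∀ x₀ : X, ContDiffAt ℝ ∞
      (fun b => dChart x₀ ((extChartAt (𝓡 d) x₀).symm b) (V ((extChartAt (𝓡 d) x₀).symm b)))
      (extChartAt (𝓡 d) x₀ x₀) := by
  have : IsManifold (𝓡 d) 1 X := .of_le (n := ∞) (by simp)
  refine forall_congr' fun x₀ => ?_
  rw [Bundle.contMDiffAt_section, contMDiffAt_iff_source]
  simp only [modelWithCornersSelf_coe, range_id, contMDiffWithinAt_univ, contMDiffAt_iff_contDiffAt]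
  refine contDiffAt_congr_iff ?_
  filter_upwards [(isOpen_extChartAt_target x₀).mem_nhds (mem_extChartAt_target x₀)] with b hb
  have hx : (extChartAt (𝓡 d) x₀).symm b ∈ (chartAt (EuclideanSpace ℝ (Fin d)) x₀).source := by
    simpa using (extChartAt (𝓡 d) x₀).map_target hb
  rw [dChart, ← TangentBundle.continuousLinearMapAt_trivializationAt hx, Function.comp_apply,
    Trivialization.continuousLinearMapAt_apply,
    Trivialization.coe_linearMapAt_of_mem _ (by simpa using hx)]

theorem symm_trivializationAt {x₀ : X} {b : EuclideanSpace ℝ (Fin d)}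
    (hb : b ∈ (extChartAt (𝓡 d) x₀).target) (v : EuclideanSpace ℝ (Fin d)) :
    (trivializationAt (EuclideanSpace ℝ (Fin d)) (TangentSpace (𝓡 d)) x₀).symm
      ((extChartAt (𝓡 d) x₀).symm b) v = dSymm x₀ b v := by
  have : IsManifold (𝓡 d) 1 X := .of_le (n := ∞) (by simp)
  have hx : (extChartAt (𝓡 d) x₀).symm b ∈ (chartAt (EuclideanSpace ℝ (Fin d)) x₀).source := by
    simpa using (extChartAt (𝓡 d) x₀).map_target hb
  have h2 := DFunLike.congr_fun (TangentBundle.symmL_trivializationAt (I := 𝓡 d) hx) v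
  simp only [modelWithCornersSelf_coe, range_id, mfderivWithin_univ] at h2
  rw [Trivialization.symmL_apply _ (by simpa using hx)] at h2
  exact h2.trans (congrArg (fun b' => (mfderiv 𝓘(ℝ, EuclideanSpace ℝ (Fin d)) (𝓡 d)
    (extChartAt (𝓡 d) x₀).symm b' : EuclideanSpace ℝ (Fin d) →L[ℝ] EuclideanSpace ℝ (Fin d)) v)
    ((extChartAt (𝓡 d) x₀).right_inv hb))

theorem contMDiff_endo {φ : ∀ x : X, TangentSpace (𝓡 d) x →L[ℝ] TangentSpace (𝓡 d) x}
    (h : ∀ x₀ : X, ∀ v : EuclideanSpace ℝ (Fin d), ContDiffAt ℝ ∞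
      (fun b => dChart x₀ ((extChartAt (𝓡 d) x₀).symm b)
        (φ ((extChartAt (𝓡 d) x₀).symm b) (dSymm x₀ b v)))
      (extChartAt (𝓡 d) x₀ x₀)) :
    ContMDiff (𝓡 d)
    ((𝓡 d).prod 𝓘(ℝ, EuclideanSpace ℝ (Fin d) →L[ℝ] EuclideanSpace ℝ (Fin d))) ∞
    (fun x => TotalSpace.mk' (EuclideanSpace ℝ (Fin d) →L[ℝ] EuclideanSpace ℝ (Fin d))
      (E := fun x : X => TangentSpace (𝓡 d) x →L[ℝ] TangentSpace (𝓡 d) x) x (φ x)) := by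
  have : IsManifold (𝓡 d) 1 X := .of_le (n := ∞) (by simp)
  intro x₀
  rw [contMDiffAt_hom_bundle]
  refine ⟨contMDiffAt_id, ?_⟩
  rw [contMDiffAt_iff_source]
  simp only [modelWithCornersSelf_coe, range_id, contMDiffWithinAt_univ, contMDiffAt_iff_contDiffAt]
  refine contDiffAt_clm_iff.2 fun v => ?_
  refine (contDiffAt_congr_iff ?_).2 (h x₀ v)
  filter_upwards [(isOpen_extChartAt_target x₀).mem_nhds (mem_extChartAt_target x₀)] with b hb
  have hx : (extChartAt (𝓡 d) x₀).symm b ∈ (chartAt (EuclideanSpace ℝ (Fin d)) x₀).source := by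
    simpa using (extChartAt (𝓡 d) x₀).map_target hb
  have hx' : (extChartAt (𝓡 d) x₀).symm b ∈ (trivializationAt (EuclideanSpace ℝ (Fin d))
      (TangentSpace (𝓡 d)) x₀).baseSet := by simpa using hx
  rw [Function.comp_apply, ContinuousLinearMap.inCoordinates_eq hx' hx',
    dChart, ← TangentBundle.continuousLinearMapAt_trivializationAt hx, ← symm_trivializationAt hb]
  rw [Trivialization.coe_continuousLinearEquivAt_eq', Trivialization.symm_continuousLinearEquivAt_eq',
    ContinuousLinearMap.comp_apply, ContinuousLinearMap.comp_apply, Trivialization.symmL_apply _ hx']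

theorem contMDiff_bilin_iff {g : ∀ x : X, TangentSpace (𝓡 d) x →L[ℝ] TangentSpace (𝓡 d) x →L[ℝ] ℝ} :
    ContMDiff (𝓡 d)
    ((𝓡 d).prod 𝓘(ℝ, EuclideanSpace ℝ (Fin d) →L[ℝ] EuclideanSpace ℝ (Fin d) →L[ℝ] ℝ)) ∞
    (fun x => TotalSpace.mk' (EuclideanSpace ℝ (Fin d) →L[ℝ] EuclideanSpace ℝ (Fin d) →L[ℝ] ℝ)
      (E := fun x : X => TangentSpace (𝓡 d) x →L[ℝ] TangentSpace (𝓡 d) x →L[ℝ] ℝ) x (g x)) ↔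
    ∀ x₀ : X, ∀ v w : EuclideanSpace ℝ (Fin d), ContDiffAt ℝ ∞
      (fun b => g ((extChartAt (𝓡 d) x₀).symm b) (dSymm x₀ b v) (dSymm x₀ b w))
      (extChartAt (𝓡 d) x₀ x₀) := by
  have : IsManifold (𝓡 d) 1 X := .of_le (n := ∞) (by simp)
  refine forall_congr' fun x₀ => ?_
  rw [contMDiffAt_hom_bundle]
  refine (and_iff_right contMDiffAt_id).trans ?_
  rw [contMDiffAt_iff_source]
  simp only [modelWithCornersSelf_coe, range_id, contMDiffWithinAt_univ, contMDiffAt_iff_contDiffAt]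
  rw [contDiffAt_clm_iff]
  refine forall_congr' fun v => ?_
  rw [contDiffAt_clm_iff]
  refine forall_congr' fun w => contDiffAt_congr_iff ?_
  filter_upwards [(isOpen_extChartAt_target x₀).mem_nhds (mem_extChartAt_target x₀)] with b hb
  have hx : (extChartAt (𝓡 d) x₀).symm b ∈ (chartAt (EuclideanSpace ℝ (Fin d)) x₀).source := by
    simpa using (extChartAt (𝓡 d) x₀).map_target hb
  rw [Function.comp_apply, inCoordinates_apply_eq₂ (by simpa using hx) (by simpa using hx) (by simp),
    symm_trivializationAt hb, symm_trivializationAt hb]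
  simp

section chain

variable {E : Type*} [NormedAddCommGroup E] [NormedSpace ℝ E] {H : Type*} [TopologicalSpace H]
  {I : ModelWithCorners ℝ E H} {M : Type*} [TopologicalSpace M] [ChartedSpace H M]
  {E' : Type*} [NormedAddCommGroup E'] [NormedSpace ℝ E'] {H' : Type*} [TopologicalSpace H']
  {I' : ModelWithCorners ℝ E' H'} {M' : Type*} [TopologicalSpace M'] [ChartedSpace H' M']
  {E'' : Type*} [NormedAddCommGroup E''] [NormedSpace ℝ E''] {H'' : Type*} [TopologicalSpace H'']
  {I'' : ModelWithCorners ℝ E'' H''} {M'' : Type*} [TopologicalSpace M''] [ChartedSpace H'' M'']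

/-- The chain rule, with all tangent spaces identified with the model spaces. -/
theorem mfderiv_comp_model {f : M → M'} {g : M' → M''} {h : M → M''} {x : M} {z : M'}
    (hh : h =ᶠ[𝓝 x] g ∘ f) (hz : f x = z) (hg : MDifferentiableAt I' I'' g z)
    (hf : MDifferentiableAt I I' f x) (v : E) :
    (mfderiv I I'' h x : E →L[ℝ] E'') v =
      (mfderiv I' I'' g z : E' →L[ℝ] E'') ((mfderiv I I' f x : E →L[ℝ] E') v) := by
  subst hz
  have h1 := hh.mfderiv_eq (I := I) (I' := I'')
  have h2 := mfderiv_comp x hg hf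
  exact DFunLike.congr_fun (h1.trans h2) v

theorem mfderiv_comp_fderiv {f : M → E'} {g : E' → E''} {h : M → E''} {x : M} {z : E'}
    {g' : E' →L[ℝ] E''} (hh : h =ᶠ[𝓝 x] g ∘ f) (hz : f x = z) (hg : HasFDerivAt g g' z)
    (hf : MDifferentiableAt I 𝓘(ℝ, E') f x) (v : E) :
    (mfderiv I 𝓘(ℝ, E'') h x : E →L[ℝ] E'') v = g' ((mfderiv I 𝓘(ℝ, E') f x : E →L[ℝ] E') v) := by
  rw [mfderiv_comp_model hh hz hg.differentiableAt.mdifferentiableAt hf, mfderiv_eq_fderiv, hg.fderiv]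
  rfl

theorem mfderiv_prodMk_space {f : M → E'} {g : M → E''} {x : M}
    (hf : MDifferentiableAt I 𝓘(ℝ, E') f x) (hg : MDifferentiableAt I 𝓘(ℝ, E'') g x) (v : E) :
    (mfderiv I 𝓘(ℝ, E' × E'') (fun y => (f y, g y)) x : E →L[ℝ] E' × E'') v =
      ((mfderiv I 𝓘(ℝ, E') f x : E →L[ℝ] E') v, (mfderiv I 𝓘(ℝ, E'') g x : E →L[ℝ] E'') v) := by
  refine Prod.ext ?_ ?_
  · exact (mfderiv_comp_fderiv (f := fun y => (f y, g y)) (g := Prod.fst) (Filter.EventuallyEq.refl _ _) rfl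
      hasFDerivAt_fst (hf.prodMk_space hg) v).symm
  · exact (mfderiv_comp_fderiv (f := fun y => (f y, g y)) (g := Prod.snd) (Filter.EventuallyEq.refl _ _) rfl
      hasFDerivAt_snd (hf.prodMk_space hg) v).symm

end chain

end tensors

end

/-! ### Linear algebra: polar decomposition of a skew form. -/

noncomputable section

open scoped RealInnerProductSpace

section linearAlgebra

variable {F : Type*} [NormedAddCommGroup F] [InnerProductSpace ℝ F] [FiniteDimensional ℝ F]

/-- On an eigenvector b of `R'` with eigenvalue μ > 0 the relation reads R(Hb) = -μ Hb, which
contradicts the positivity of `R` unless Hb = 0. This one fact yields the uniqueness of square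
roots, their commutation properties and the invertibility of the derivative of squaring. -/
theorem eq_zero_of_anticommute_inner {R R' H : F →ₗ[ℝ] F} (hR : ∀ v, v ≠ 0 → 0 < ⟪R v, v⟫)
    (hR' : R'.IsSymmetric) (hpos : ∀ v, v ≠ 0 → 0 < ⟪R' v, v⟫)
    (h : ∀ v, R (H v) + H (R' v) = 0) : H = 0 := by
  refine (hR'.eigenvectorBasis rfl).toBasis.ext fun i => ?_
  simp only [OrthonormalBasis.coe_toBasis, LinearMap.zero_apply]
  set b := hR'.eigenvectorBasis rfl i
  have h0 : b ≠ 0 := (hR'.eigenvectorBasis rfl).orthonormal.ne_zero i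
  have h1 : R' b = (hR'.eigenvalues rfl i) • b := hR'.apply_eigenvectorBasis rfl i
  have h2 : 0 < hR'.eigenvalues rfl i := by
    have := hpos b h0
    rw [h1, inner_smul_left] at this
    exact pos_of_mul_pos_left this real_inner_self_nonneg
  by_contra hb
  have h3 := h b
  rw [h1, map_smul] at h3
  have h4 := hR _ hb
  rw [eq_neg_of_add_eq_zero_left h3, inner_neg_left, inner_smul_left] at h4
  have h5 : 0 ≤ hR'.eigenvalues rfl i * ‖H b‖ ^ 2 := mul_nonneg h2.le (sq_nonneg _)
  simp at h4
  linarith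

theorem exists_sqrt_inner {S : F →ₗ[ℝ] F} (hS : S.IsSymmetric) (hpos : ∀ v, v ≠ 0 → 0 < ⟪S v, v⟫) :
    ∃ R : F →ₗ[ℝ] F, R.IsSymmetric ∧ (∀ v, v ≠ 0 → 0 < ⟪R v, v⟫) ∧ ∀ v, R (R v) = S v := by
  set b := hS.eigenvectorBasis rfl
  set μ := hS.eigenvalues rfl
  have h1 : ∀ i, S (b i) = μ i • b i := hS.apply_eigenvectorBasis rfl
  have h2 : ∀ i, 0 < μ i := by
    intro i
    have := hpos (b i) (b.orthonormal.ne_zero i)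
    rw [h1, inner_smul_left] at this
    exact pos_of_mul_pos_left this real_inner_self_nonneg
  let R : F →ₗ[ℝ] F := b.toBasis.constr ℝ fun i => √(μ i) • b i
  have hR : ∀ i, R (b i) = √(μ i) • b i := by
    intro i
    simpa only [OrthonormalBasis.coe_toBasis] using
      b.toBasis.constr_basis ℝ (fun i => √(μ i) • b i) i
  have hRe : ∀ v, R v = ∑ i, (√(μ i) * ⟪b i, v⟫) • b i := by
    intro v
    conv_lhs => rw [← b.sum_repr' v, map_sum]
    refine Finset.sum_congr rfl fun i _ => ?_
    rw [map_smul, hR, smul_smul, mul_comm]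
  have hin : ∀ v w, ⟪R v, w⟫ = ∑ i, √(μ i) * (⟪b i, v⟫ * ⟪b i, w⟫) := by
    intro v w
    rw [hRe, sum_inner]
    refine Finset.sum_congr rfl fun i _ => ?_
    rw [inner_smul_left]
    simp [mul_assoc]
  refine ⟨R, fun v w => ?_, fun v hv => ?_, fun v => ?_⟩
  · rw [hin, real_inner_comm, hin]
    exact Finset.sum_congr rfl fun i _ => by ring
  · rw [hin]
    refine Finset.sum_pos' (fun i _ => mul_nonneg (Real.sqrt_nonneg _) (mul_self_nonneg _)) ?_
    by_contra! hc
    refine hv (b.toBasis.ext_elem fun i => ?_)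
    have h3 := hc i (Finset.mem_univ i)
    have h4 : 0 ≤ ⟪b i, v⟫ * ⟪b i, v⟫ := mul_self_nonneg _
    have h5 : 0 < √(μ i) := Real.sqrt_pos.2 (h2 i)
    have h6 : ⟪b i, v⟫ * ⟪b i, v⟫ = 0 := by nlinarith
    simpa [b.repr_apply_apply] using h6
  · have : R ∘ₗ R = S := by
      refine b.toBasis.ext fun i => ?_
      simp only [OrthonormalBasis.coe_toBasis, LinearMap.comp_apply]
      rw [hR, map_smul, hR, h1, smul_smul, Real.mul_self_sqrt (h2 i).le]
    exact LinearMap.congr_fun this v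

end linearAlgebra

section bilinear

variable {E : Type*} [NormedAddCommGroup E] [NormedSpace ℝ E] [FiniteDimensional ℝ E]

theorem exists_coercive (B : E →L[ℝ] E →L[ℝ] ℝ) (hB : ∀ v, v ≠ 0 → 0 < B v v) :
    ∃ c, 0 < c ∧ ∀ v, c * ‖v‖ ^ 2 ≤ B v v := by
  have hc : Continuous fun v => B v v := by fun_prop
  rcases (Metric.sphere (0 : E) 1).eq_empty_or_nonempty with h0 | h0
  · refine ⟨1, one_pos, fun v => ?_⟩
    have : v = 0 := by
      by_contra hv
      have : (‖v‖⁻¹ • v) ∈ Metric.sphere (0 : E) 1 := by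
        simp [norm_smul, norm_ne_zero_iff.2 hv]
      simp [h0] at this
    simp [this]
  obtain ⟨v₀, hv₀, hmin⟩ := (isCompact_sphere (0 : E) 1).exists_isMinOn h0 hc.continuousOn
  refine ⟨B v₀ v₀, hB v₀ (by rintro rfl; simp at hv₀), fun v => ?_⟩
  by_cases h : v = 0
  · simp [h]
  have h1 : B v₀ v₀ ≤ B (‖v‖⁻¹ • v) (‖v‖⁻¹ • v) := hmin (by simp [norm_smul, norm_ne_zero_iff.2 h])
  have hn : 0 < ‖v‖ := norm_pos_iff.2 h
  simp only [map_smul, smul_apply, smul_eq_mul] at h1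
  calc _ ≤ ‖v‖⁻¹ * (‖v‖⁻¹ * B v v) * ‖v‖ ^ 2 := by gcongr
    _ = B v v := by field_simp

/-- Positivity on the compact unit sphere is an open condition, and it extends to all nonzero
vectors by scaling. -/
theorem eventually_posDef {P : Type*} [TopologicalSpace P] {B : P → E →L[ℝ] E →L[ℝ] ℝ} {p : P}
    (hc : ∀ v, ContinuousAt (fun q : P × E => B q.1 q.2 q.2) (p, v))
    (hB : ∀ v, v ≠ 0 → 0 < B p v v) :
    ∀ᶠ q in 𝓝 p, ∀ v, v ≠ 0 → 0 < B q v v := by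
  have h1 : ∀ᶠ q in 𝓝 p, ∀ v ∈ Metric.sphere (0 : E) 1, 0 < B q v v :=
    (isCompact_sphere (0 : E) 1).eventually_forall_of_forall_eventually fun v hv =>
      (hc v).eventually_const_lt (hB v (by rintro rfl; simp at hv))
  filter_upwards [h1] with q hq v hv
  have h2 := hq (‖v‖⁻¹ • v) (by simp [norm_smul, norm_ne_zero_iff.2 hv])
  simp only [map_smul, smul_apply, smul_eq_mul] at h2
  have hn : 0 < ‖v‖⁻¹ := inv_pos.2 (norm_pos_iff.2 hv)
  exact pos_of_mul_pos_right (pos_of_mul_pos_right h2 hn.le) hn.le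

/-- Inner products, as bilinear maps. -/
structure IsInner (G : E →L[ℝ] E →L[ℝ] ℝ) : Prop where
  symm : ∀ v w, G v w = G w v
  pos : ∀ v, v ≠ 0 → 0 < G v v

/-- A linear isometry to a Euclidean space. -/
theorem IsInner.exists_isometry {G : E →L[ℝ] E →L[ℝ] ℝ} (hG : IsInner G) :
    ∃ L : E ≃ₗ[ℝ] EuclideanSpace ℝ (Fin (Module.finrank ℝ E)), ∀ v w, G v w = ⟪L v, L w⟫ := by
  let B : LinearMap.BilinForm ℝ E :=
    LinearMap.mk₂ ℝ (fun v w => G v w) (by simp) (by simp) (by simp) (by simp)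
  have hB : LinearMap.IsSymm B := ⟨fun v w => hG.symm v w⟩
  obtain ⟨e, he⟩ := LinearMap.BilinForm.exists_orthogonal_basis hB
  have hp : ∀ i, 0 < G (e i) (e i) := fun i => hG.pos _ (e.ne_zero i)
  let e' := e.unitsSMul fun i => Units.mk0 (√(G (e i) (e i)))⁻¹ (inv_ne_zero (Real.sqrt_pos.2 (hp i)).ne')
  have he' : ∀ i, e' i = (√(G (e i) (e i)))⁻¹ • e i := fun i => by
    simp [e', Module.Basis.unitsSMul_apply, Units.smul_def]
  have ho : ∀ i j, G (e' i) (e' j) = if i = j then 1 else 0 := by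
    intro i j
    rw [he', he']
    by_cases h : i = j
    · subst h
      have := Real.mul_self_sqrt (hp i).le
      have h0 := (Real.sqrt_pos.2 (hp i)).ne'
      simp only [map_smul, smul_apply, smul_eq_mul, if_true]
      field_simp
      rw [sq, this]
    · have : G (e i) (e j) = 0 := he h
      simp [h, this]
  refine ⟨e'.equivFun.trans (WithLp.linearEquiv 2 ℝ _).symm, fun v w => ?_⟩
  conv_lhs => rw [← e'.sum_equivFun v, ← e'.sum_equivFun w]
  simp only [map_sum, map_smul, sum_apply, smul_apply, ho, smul_eq_mul]
  simp [PiLp.inner_apply, mul_comm]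

/-- Positive symmetric operators with respect to an inner product. -/
structure IsPosSymm (G : E →L[ℝ] E →L[ℝ] ℝ) (R : E →L[ℝ] E) : Prop where
  symm : ∀ v w, G (R v) w = G v (R w)
  pos : ∀ v, v ≠ 0 → 0 < G (R v) v

namespace IsPosSymm

variable {G : E →L[ℝ] E →L[ℝ] ℝ} (hG : IsInner G) {R R' S H : E →L[ℝ] E}

omit [FiniteDimensional ℝ E] in
theorem injective (hR : IsPosSymm G R) {v : E} (h : R v = 0) : v = 0 := by
  by_contra hv
  have := hR.pos v hv
  simp [h] at this

include hG

theorem eq_zero_of_anticommute (hR : ∀ v, v ≠ 0 → 0 < G (R v) v) (hR' : IsPosSymm G R')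
    (h : ∀ v, R (H v) + H (R' v) = 0) : H = 0 := by
  obtain ⟨L, hL⟩ := hG.exists_isometry
  have key : ∀ {R : E →L[ℝ] E}, (∀ v, v ≠ 0 → 0 < G (R v) v) → ∀ v, v ≠ 0 →
      0 < ⟪(L.toLinearMap ∘ₗ R.toLinearMap ∘ₗ L.symm.toLinearMap) v, v⟫ := by
    intro R hR v hv
    have := hR (L.symm v) (by simpa using hv)
    rw [hL] at this
    simpa using this
  have h2 := eq_zero_of_anticommute_inner (R := L.toLinearMap ∘ₗ R.toLinearMap ∘ₗ L.symm.toLinearMap)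
    (R' := L.toLinearMap ∘ₗ R'.toLinearMap ∘ₗ L.symm.toLinearMap)
    (H := L.toLinearMap ∘ₗ H.toLinearMap ∘ₗ L.symm.toLinearMap) (key hR) ?_ (key hR'.pos) ?_
  · ext1 v
    have := LinearMap.congr_fun h2 (L v)
    simpa using this
  · intro v w
    have := hR'.symm (L.symm v) (L.symm w)
    rw [hL, hL] at this
    simpa using this
  · intro v
    simpa using congrArg L (h (L.symm v))

/-- For H = R - R' the expression RH + HR' telescopes to R² - R'² = 0. Only `R'` has to be
symmetric, which is what `contDiffAt_sqrt` needs. -/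
theorem unique (hR : ∀ v, v ≠ 0 → 0 < G (R v) v) (hR' : IsPosSymm G R') (h : ∀ v, R (R v) = R' (R' v)) :
    R = R' := by
  refine sub_eq_zero.1 (eq_zero_of_anticommute hG hR hR' (H := R - R') fun v => ?_)
  simp [h]

theorem exists_sqrt (hS : IsPosSymm G S) : ∃ R, IsPosSymm G R ∧ ∀ v, R (R v) = S v := by
  obtain ⟨L, hL⟩ := hG.exists_isometry
  obtain ⟨R, h1, h2, h3⟩ := exists_sqrt_inner (S := L.toLinearMap ∘ₗ S.toLinearMap ∘ₗ L.symm.toLinearMap)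
    (fun v w => by
      have := hS.symm (L.symm v) (L.symm w)
      rw [hL, hL] at this
      simpa using this)
    (fun v hv => by
      have := hS.pos (L.symm v) (by simpa using hv)
      rw [hL] at this
      simpa using this)
  refine ⟨(L.symm.toLinearMap ∘ₗ R ∘ₗ L.toLinearMap).toContinuousLinearMap, ⟨fun v w => ?_, fun v hv => ?_⟩,
    fun v => ?_⟩
  · rw [hL, hL]
    simpa using h1 (L v) (L w)
  · rw [hL]
    simpa using h2 (L v) (by simpa using hv)
  · simp [h3]

end IsPosSymm

/-- The polar data of a nondegenerate skew form `W` with respect to an inner product `G`: the skew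
operator `A`, its modulus `R`, and its phase `T`. -/
structure IsPolar (G W : E →L[ℝ] E →L[ℝ] ℝ) (A R T : E →L[ℝ] E) : Prop where
  apply_A : ∀ v w, G (A v) w = W v w
  posSymm : IsPosSymm G R
  sq : ∀ v, R (R v) = -A (A v)
  apply_T : ∀ v, R (T v) = A v

namespace IsPolar

variable {G W : E →L[ℝ] E →L[ℝ] ℝ} (hG : IsInner G) {A R T : E →L[ℝ] E}

include hG

omit [FiniteDimensional ℝ E] in
theorem _root_.IsInner.ext {v w : E} (h : ∀ u, G v u = G w u) : v = w := by
  by_contra hne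
  have := hG.pos (v - w) (sub_ne_zero.2 hne)
  simp [h] at this

theorem _root_.IsInner.exists_repr (f : E →L[ℝ] ℝ) : ∃ v, ∀ w, G v w = f w := by
  obtain ⟨L, hL⟩ := hG.exists_isometry
  refine ⟨L.symm ((InnerProductSpace.toDual ℝ _).symm
    ((f.toLinearMap ∘ₗ L.symm.toLinearMap).toContinuousLinearMap)), fun w => ?_⟩
  rw [hL]
  simp

/-- `A` represents the form, -A² is symmetric and positive because `A` is skew and injective, `R` is
its square root and T = R⁻¹A. -/
theorem exists_polar (hW : ∀ v w, W v w = -W w v) (hn : ∀ v, (∀ w, W v w = 0) → v = 0) :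
    ∃ A R T, IsPolar G W A R T := by
  choose a ha using fun v => hG.exists_repr (W v)
  let A : E →L[ℝ] E := LinearMap.toContinuousLinearMap
    { toFun := a
      map_add' := fun v w => hG.ext fun u => by simp [ha]
      map_smul' := fun c v => hG.ext fun u => by simp [ha] }
  have hA : ∀ v w, G (A v) w = W v w := ha
  have hA0 : ∀ v, A v = 0 → v = 0 := fun v hv => hn v fun w => by rw [← hA, hv]; simp
  have hskew : ∀ v w, G (A v) w = -G v (A w) := fun v w => by
    rw [hA, hW, ← hA, hG.symm]
  have hS : IsPosSymm G (-(A.comp A)) := by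
    refine ⟨fun v w => ?_, fun v hv => ?_⟩
    · simp only [neg_apply, ContinuousLinearMap.comp_apply, map_neg]
      rw [hskew, hskew, neg_neg]
    · simp only [neg_apply, ContinuousLinearMap.comp_apply, map_neg]
      rw [hskew, neg_neg]
      exact hG.pos _ fun h => hv (hA0 v h)
  obtain ⟨R, hR, hRR⟩ := hS.exists_sqrt hG
  have hinj : Function.Injective R.toLinearMap :=
    (injective_iff_map_eq_zero R.toLinearMap).2 fun v hv => hR.injective hv
  let e := LinearEquiv.ofInjectiveEndo R.toLinearMap hinj
  refine ⟨A, R, (e.symm.toLinearMap ∘ₗ A.toLinearMap).toContinuousLinearMap, hA, hR, hRR, fun v => ?_⟩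
  exact e.apply_symm_apply (A v)

variable (h : IsPolar G W A R T)

include h

/-- For H = RA - AR the sum RH + HR equals R²A - AR², which vanishes since R² = -A². -/
theorem commute (v : E) : R (A v) = A (R v) := by
  have := IsPosSymm.eq_zero_of_anticommute hG h.posSymm.pos h.posSymm (H := R.comp A - A.comp R) fun v => by
    simp [h.sq]
    abel
  exact sub_eq_zero.1 (DFunLike.congr_fun this v)

theorem A_T (v : E) : A (T v) = -R v := by
  refine sub_eq_zero.1 (h.posSymm.injective ?_)
  rw [map_sub, h.commute hG, h.apply_T, map_neg, h.sq, neg_neg, sub_self]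

theorem T_T (v : E) : T (T v) = -v := by
  refine sub_eq_zero.1 (h.posSymm.injective ?_)
  rw [map_sub, h.apply_T, h.A_T hG, map_neg, sub_self]

theorem R_T (v w : E) : G (R (T v)) w = W v w := by rw [h.apply_T, h.apply_A]

/-- Together with `T_T` and `R_T` this says that `T` is a complex structure compatible with the
form, with associated inner product G(R·, ·). -/
theorem map_T (hW : ∀ v w, W v w = -W w v) (v w : E) : G (R (T v)) (T w) = G (R v) w := by
  rw [h.R_T hG, hW, ← h.apply_A, h.A_T hG, map_neg, neg_apply, neg_neg, h.posSymm.symm, hG.symm]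

end IsPolar

end bilinear

end

/-! ### Smooth dependence of the polar decomposition on parameters. -/

noncomputable section

open scoped RealInnerProductSpace

section smooth

variable {P E F : Type*} [NormedAddCommGroup P] [NormedSpace ℝ P] [NormedAddCommGroup E]
  [NormedSpace ℝ E] [NormedAddCommGroup F] [NormedSpace ℝ F]

/-- Invertible maps form an open set on which inversion is smooth, so A = B⁻¹C near `p`. -/
theorem contDiffAt_of_comp_eq [CompleteSpace E] {B C : P → E →L[ℝ] F} {A : P → E →L[ℝ] E} {p : P}
    (hB : ContDiffAt ℝ ∞ B p) (hC : ContDiffAt ℝ ∞ C p) {e : E ≃L[ℝ] F} (he : B p = e)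
    (h : ∀ᶠ q in 𝓝 p, ∀ v, B q (A q v) = C q v) : ContDiffAt ℝ ∞ A p := by
  have h1 : ContDiffAt ℝ ∞ (fun q => (B q).inverse.comp (C q)) p := by
    refine ContDiffAt.clm_comp ?_ hC
    refine ContDiffAt.comp (g := ContinuousLinearMap.inverse) p ?_ hB
    rw [he]
    exact contDiffAt_map_inverse e
  refine h1.congr_of_eventuallyEq ?_
  have h2 : ∀ᶠ q in 𝓝 p, B q ∈ range ((↑) : (E ≃L[ℝ] F) → E →L[ℝ] F) :=
    hB.continuousAt.eventually (by rw [he]; exact ContinuousLinearEquiv.nhds e)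
  filter_upwards [h, h2] with q hq ⟨e', he'⟩
  ext1 v
  rw [ContinuousLinearMap.comp_apply, ← hq, ← he', ContinuousLinearMap.inverse_equiv]
  simp

variable [FiniteDimensional ℝ E]

-- The derivative H ↦ RH + HR of squaring at `R p` is injective by `eq_zero_of_anticommute`, so
-- squaring has a smooth local inverse there. Applied to `S` it gives a smooth square root that
-- stays positive near `p`, hence coincides with `R` by uniqueness.
set_option synthInstance.maxHeartbeats 200000 in
theorem contDiffAt_sqrt {G : P → E →L[ℝ] E →L[ℝ] ℝ} {R S : P → E →L[ℝ] E} {p : P}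
    (hG : ContDiffAt ℝ ∞ G p) (hS : ContDiffAt ℝ ∞ S p) (hi : ∀ᶠ q in 𝓝 p, IsInner (G q))
    (hR : ∀ᶠ q in 𝓝 p, IsPosSymm (G q) (R q)) (hRS : ∀ᶠ q in 𝓝 p, ∀ v, R q (R q v) = S q v) :
    ContDiffAt ℝ ∞ R p := by
  let f : (E →L[ℝ] E) → E →L[ℝ] E := fun Q => Q.comp Q
  have hf : ContDiff ℝ ∞ f := contDiff_id.clm_comp contDiff_id
  let D : (E →L[ℝ] E) →ₗ[ℝ] (E →L[ℝ] E) :=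
    { toFun := fun H => (R p).comp H + H.comp (R p)
      map_add' := fun H K => by ext; simp; abel
      map_smul' := fun c H => by ext; simp }
  have hD : Function.Injective D := (injective_iff_map_eq_zero D).2 fun H hH =>
    IsPosSymm.eq_zero_of_anticommute hi.self_of_nhds hR.self_of_nhds.pos hR.self_of_nhds
      fun v => DFunLike.congr_fun hH v
  let e : (E →L[ℝ] E) ≃L[ℝ] (E →L[ℝ] E) := (LinearEquiv.ofInjectiveEndo D hD).toContinuousLinearEquiv
  have he : HasFDerivAt f (e : (E →L[ℝ] E) →L[ℝ] (E →L[ℝ] E)) (R p) := by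
    refine ((hasFDerivAt_id (R p)).clm_comp (hasFDerivAt_id (R p))).congr_fderiv ?_
    ext1 H
    rfl
  have hfR := hf.contDiffAt (x := R p)
  let ψ := hfR.localInverse he (by simp)
  have hψ : ContDiffAt ℝ ∞ ψ (f (R p)) := hfR.to_localInverse he (by simp)
  have hψr : ∀ᶠ T in 𝓝 (f (R p)), f (ψ T) = T :=
    (hfR.hasStrictFDerivAt' he (by simp)).eventually_right_inverse
  have hψp : ψ (f (R p)) = R p := hfR.localInverse_apply_image he (by simp)
  have hSp : S p = f (R p) := (ContinuousLinearMap.ext fun v => hRS.self_of_nhds v).symm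
  have hψS : ContDiffAt ℝ ∞ (fun q => ψ (S q)) p :=
    ContDiffAt.comp (g := ψ) p (by rw [hSp]; exact hψ) hS
  have hpos : ∀ᶠ q in 𝓝 p, ∀ v, v ≠ 0 → 0 < G q (ψ (S q) v) v := by
    refine eventually_posDef (B := fun q => (G q).comp (ψ (S q))) ?_ ?_
    · intro v
      have h1 : ContDiffAt ℝ ∞ (fun q : P × E => G q.1 (ψ (S q.1) q.2) q.2) (p, v) :=
        ((ContDiffAt.comp (g := G) (p, v) hG contDiffAt_fst).clm_apply
          ((ContDiffAt.comp (g := fun q => ψ (S q)) (p, v) hψS contDiffAt_fst).clm_apply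
            contDiffAt_snd)).clm_apply contDiffAt_snd
      exact h1.continuousAt
    · intro v hv
      change 0 < G p (ψ (S p) v) v
      rw [hSp, hψp]
      exact hR.self_of_nhds.pos v hv
  refine hψS.congr_of_eventuallyEq ?_
  filter_upwards [hi, hR, hRS, hpos, hS.continuousAt.eventually (by rw [hSp]; exact hψr)]
    with q h1 h2 h3 h4 h5
  refine (IsPosSymm.unique h1 h4 h2 fun v => ?_).symm
  rw [h3]
  exact DFunLike.congr_fun h5 v

-- Each ingredient depends smoothly on the previous ones: A = G⁻¹W, then R as the square root of
-- -A², then T = R⁻¹A.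
set_option synthInstance.maxHeartbeats 200000 in
theorem IsPolar.contDiffAt {G W : P → E →L[ℝ] E →L[ℝ] ℝ} {A R T : P → E →L[ℝ] E} {p : P}
    (hG : ContDiffAt ℝ ∞ G p) (hW : ContDiffAt ℝ ∞ W p) (hi : ∀ᶠ q in 𝓝 p, IsInner (G q))
    (h : ∀ᶠ q in 𝓝 p, IsPolar (G q) (W q) (A q) (R q) (T q)) :
    ContDiffAt ℝ ∞ R p ∧ ContDiffAt ℝ ∞ T p := by
  have hGp := hi.self_of_nhds
  let e : E ≃L[ℝ] (E →L[ℝ] ℝ) := (LinearEquiv.ofBijective (G p).toLinearMap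
    ⟨fun v w hvw => hGp.ext fun u => DFunLike.congr_fun hvw u, fun f => by
      obtain ⟨v, hv⟩ := hGp.exists_repr f
      exact ⟨v, ContinuousLinearMap.ext hv⟩⟩).toContinuousLinearEquiv
  have hA : ContDiffAt ℝ ∞ A p := by
    refine contDiffAt_of_comp_eq (B := G) (C := W) (e := e) hG hW (by ext; rfl) ?_
    filter_upwards [h] with q hq v
    ext1 w
    exact hq.apply_A v w
  have hR : ContDiffAt ℝ ∞ R p := by
    refine contDiffAt_sqrt (S := fun q => -(A q).comp (A q)) hG
      (hA.clm_comp hA).neg hi ?_ ?_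
    · filter_upwards [h] with q hq using hq.posSymm
    · filter_upwards [h] with q hq v using hq.sq v
  refine ⟨hR, ?_⟩
  let e' : E ≃L[ℝ] E := (LinearEquiv.ofInjectiveEndo (R p).toLinearMap
    ((injective_iff_map_eq_zero (R p).toLinearMap).2 fun v hv =>
      h.self_of_nhds.posSymm.injective hv)).toContinuousLinearEquiv
  refine contDiffAt_of_comp_eq (B := R) (C := A) (e := e') hR hA (by ext; rfl) ?_
  filter_upwards [h] with q hq v using hq.apply_T v

end smooth

end

/-! ### Sphere fibrations defined by an integral cocycle. -/

noncomputable section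

open scoped RealInnerProductSpace

variable {n m : ℕ} {X : Type u} [TopologicalSpace X] [ChartedSpace (EuclideanSpace ℝ (Fin n)) X]
  {Ω : DForm n 2 X}

/-- The data in the definition of integrality of a closed two-form. -/
structure IntegralCocycle (Ω : DForm n 2 X) where
  ι : Type u
  U : ι → Set X
  lam : ι → DForm n 1 X
  f : ι → ι → X → ℝ
  isOpen_U : ∀ i, IsOpen (U i)
  iUnion_U : (⋃ i, U i) = univ
  smooth_lam : ∀ i, DForm.SmoothOn (lam i) (U i)
  extD_lam : ∀ i, ∀ x ∈ U i, DForm.extD (lam i) x = Ω x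
  smooth_f : ∀ i j, ContMDiffOn (𝓡 n) 𝓘(ℝ, ℝ) ∞ (f i j) (U i ∩ U j)
  mfderiv_f : ∀ i j, ∀ x ∈ U i ∩ U j, ∀ v : TangentSpace (𝓡 n) x,
    (mfderiv (𝓡 n) 𝓘(ℝ, ℝ) (f i j) x v : ℝ) = lam j x ![v] - lam i x ![v]
  int_f : ∀ i j k, ∀ x ∈ U i ∩ U j ∩ U k, ∃ r : ℤ, f j k x - f i k x + f i j x = r

theorem DForm.IsIntegral.nonempty_cocycle (h : DForm.IsIntegral Ω) :
    Nonempty (IntegralCocycle Ω) := by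
  obtain ⟨ι, U, lam, f, h1, h2, h3, h4, h5, h6, h7⟩ := h
  exact ⟨⟨ι, U, lam, f, h1, h2, h3, h4, h5, h6, h7⟩⟩

namespace IntegralCocycle

variable (D : IntegralCocycle Ω)

/-- The primitives as linear functionals. -/
def fn (i : D.ι) (x : X) : TangentSpace (𝓡 n) x →L[ℝ] ℝ :=
  (ContinuousAlternatingMap.ofSubsingleton ℝ _ ℝ (0 : Fin 1)).symm (D.lam i x)

theorem fn_apply (i : D.ι) (x : X) (v : TangentSpace (𝓡 n) x) :
    D.fn i x v = D.lam i x ![v] := by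
  refine congrArg (D.lam i x) (funext fun j => ?_)
  fin_cases j
  rfl

theorem exists_mem (x : X) : ∃ i, x ∈ D.U i := by
  have : x ∈ ⋃ i, D.U i := D.iUnion_U ▸ mem_univ x
  simpa using this

/-- A member of the cover containing a given point. -/
def idx (x : X) : D.ι := (D.exists_mem x).choose

theorem mem_idx (x : X) : x ∈ D.U (D.idx x) := (D.exists_mem x).choose_spec

end IntegralCocycle

variable {V : Type*} [NormedAddCommGroup V] [InnerProductSpace ℝ V]

/-- Orthogonal complex structures on a real inner product space. -/
structure IsComplexStructure (J : V →L[ℝ] V) : Prop where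
  inner_map : ∀ a b, ⟪J a, J b⟫ = ⟪a, b⟫
  sq : ∀ a, J (J a) = -a

namespace IsComplexStructure

variable {J : V →L[ℝ] V} (h : IsComplexStructure J)

include h

theorem inner_left (a b : V) : ⟪J a, b⟫ = -⟪a, J b⟫ := by
  have := h.inner_map a (J b)
  rw [h.sq, inner_neg_right] at this
  linarith

theorem inner_self (a : V) : ⟪J a, a⟫ = 0 := by
  have := h.inner_left a a
  rw [real_inner_comm] at this
  have h2 := real_inner_comm a (J a)
  linarith

theorem inner_self' (a : V) : ⟪a, J a⟫ = 0 := by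
  rw [real_inner_comm, h.inner_self]

end IsComplexStructure

/-- A circle bundle with fibres spheres in `V`, associated to an integral cocycle; `par` are the
inverses of the local trivializations, extended homogeneously to all nonzero vectors. -/
structure SphereFibration (D : IntegralCocycle Ω) (m : ℕ) (Y : Type u) [TopologicalSpace Y]
    [ChartedSpace (EuclideanSpace ℝ (Fin m)) Y] (J : V →L[ℝ] V) where
  proj : Y → X
  fib : D.ι → Y → V
  par : D.ι → X × V → Y
  smooth_proj : ContMDiff (𝓡 m) (𝓡 n) ∞ proj
  smooth_fib : ∀ i, ContMDiffOn (𝓡 m) 𝓘(ℝ, V) ∞ (fib i) (proj ⁻¹' D.U i)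
  norm_fib : ∀ i y, proj y ∈ D.U i → ‖fib i y‖ = 1
  smooth_par : ∀ i, ContMDiffOn ((𝓡 n).prod 𝓘(ℝ, V)) (𝓡 m) ∞ (par i) (D.U i ×ˢ {0}ᶜ)
  proj_par : ∀ i x v, x ∈ D.U i → v ≠ 0 → proj (par i (x, v)) = x
  fib_par : ∀ i x v, x ∈ D.U i → v ≠ 0 → fib i (par i (x, v)) = ‖v‖⁻¹ • v
  par_fib : ∀ i y, proj y ∈ D.U i → par i (proj y, fib i y) = y
  -- The right-hand side is exp(-2π f J) applied to the fibre coordinate, when J² = -1.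
  fib_change : ∀ i j y, proj y ∈ D.U i ∩ D.U j → fib j y =
    Real.cos (2 * Real.pi * D.f i j (proj y)) • fib i y -
      Real.sin (2 * Real.pi * D.f i j (proj y)) • J (fib i y)

namespace SphereFibration

variable {D : IntegralCocycle Ω} {Y : Type u} [TopologicalSpace Y]
    [ChartedSpace (EuclideanSpace ℝ (Fin m)) Y] {J : V →L[ℝ] V}
    (S : SphereFibration D m Y J)

/-- The derivative of the projection. -/
def dproj (y : Y) : TangentSpace (𝓡 m) y →L[ℝ] TangentSpace (𝓡 n) (S.proj y) :=
  mfderiv (𝓡 m) (𝓡 n) S.proj y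

/-- The derivative of a fibre coordinate. -/
def dfib (i : D.ι) (y : Y) : TangentSpace (𝓡 m) y →L[ℝ] V :=
  mfderiv (𝓡 m) 𝓘(ℝ, V) (S.fib i) y

/-- The derivative of a local parametrization. -/
def lift (i : D.ι) (y : Y) : TangentSpace (𝓡 n) (S.proj y) × V →L[ℝ] TangentSpace (𝓡 m) y :=
  (mfderiv ((𝓡 n).prod 𝓘(ℝ, V)) (𝓡 m) (S.par i) (S.proj y, S.fib i y) :
    EuclideanSpace ℝ (Fin n) × V →L[ℝ] EuclideanSpace ℝ (Fin m))

/-- The vertical part of a tangent vector. -/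
def vert (i : D.ι) (y : Y) : TangentSpace (𝓡 m) y →L[ℝ] V :=
  -- The covariant derivative of the fibre coordinate: the term with the primitive of `Ω` absorbs
  -- the inhomogeneous part of a change of trivialization.
  S.dfib i y + (2 * Real.pi) • ((D.fn i (S.proj y)).comp (S.dproj y)).smulRight (J (S.fib i y))

theorem vert_apply (i : D.ι) (y : Y) (a : TangentSpace (𝓡 m) y) :
    S.vert i y a = S.dfib i y a +
      (2 * Real.pi * D.fn i (S.proj y) (S.dproj y a)) • J (S.fib i y) := by
  simp [vert, smul_smul]

section

variable {S} {i j : D.ι} {y : Y}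

theorem isOpen_preimage (i : D.ι) : IsOpen (S.proj ⁻¹' D.U i) :=
  (D.isOpen_U i).preimage S.smooth_proj.continuous

theorem mdiff_proj (y : Y) : MDifferentiableAt (𝓡 m) (𝓡 n) S.proj y :=
  S.smooth_proj.mdifferentiable (by simp) y

theorem contMDiffAt_fib (hy : S.proj y ∈ D.U i) : ContMDiffAt (𝓡 m) 𝓘(ℝ, V) ∞ (S.fib i) y :=
  (S.smooth_fib i).contMDiffAt ((S.isOpen_preimage i).mem_nhds hy)

theorem mdiff_fib (hy : S.proj y ∈ D.U i) : MDifferentiableAt (𝓡 m) 𝓘(ℝ, V) (S.fib i) y :=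
  (S.contMDiffAt_fib hy).mdifferentiableAt (by simp)

theorem fib_ne_zero (hy : S.proj y ∈ D.U i) : S.fib i y ≠ 0 := by
  intro h
  simpa [h] using S.norm_fib i y hy

theorem eventually_mem (hy : S.proj y ∈ D.U i) : ∀ᶠ y' in 𝓝 y, S.proj y' ∈ D.U i :=
  (S.isOpen_preimage i).mem_nhds hy

theorem contMDiffAt_par {p : X × V} (hp : p.1 ∈ D.U i) (hp2 : p.2 ≠ 0) :
    ContMDiffAt ((𝓡 n).prod 𝓘(ℝ, V)) (𝓡 m) ∞ (S.par i) p :=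
  (S.smooth_par i).contMDiffAt
    (((D.isOpen_U i).prod isOpen_compl_singleton).mem_nhds ⟨hp, by simpa using hp2⟩)

theorem mdiff_par (hy : S.proj y ∈ D.U i) :
    MDifferentiableAt ((𝓡 n).prod 𝓘(ℝ, V)) (𝓡 m) (S.par i) (S.proj y, S.fib i y) :=
  (S.contMDiffAt_par (p := (S.proj y, S.fib i y)) hy (S.fib_ne_zero hy)).mdifferentiableAt
    (by simp)

theorem inner_fib_self (hy : S.proj y ∈ D.U i) : ⟪S.fib i y, S.fib i y⟫ = 1 := by
  rw [real_inner_self_eq_norm_sq, S.norm_fib i y hy, one_pow]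

theorem lift_dproj (hy : S.proj y ∈ D.U i) (a : TangentSpace (𝓡 m) y) :
    S.lift i y (S.dproj y a, S.dfib i y a) = a := by
  have h1 : (S.par i ∘ fun y => (S.proj y, S.fib i y)) =ᶠ[𝓝 y] id := by
    filter_upwards [S.eventually_mem hy] with y' hy' using S.par_fib i y' hy'
  have h2 := h1.mfderiv_eq (I := 𝓡 m) (I' := 𝓡 m)
  rw [mfderiv_comp y (S.mdiff_par hy) ((S.mdiff_proj y).prodMk (S.mdiff_fib hy)),
    mfderiv_prodMk (S.mdiff_proj y) (S.mdiff_fib hy), mfderiv_id] at h2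
  exact DFunLike.congr_fun h2 a

theorem dproj_lift (hy : S.proj y ∈ D.U i) (v : TangentSpace (𝓡 n) (S.proj y)) (w : V) :
    S.dproj y (S.lift i y (v, w)) = v := by
  have h1 : (S.proj ∘ S.par i) =ᶠ[𝓝 (S.proj y, S.fib i y)] Prod.fst := by
    filter_upwards [((D.isOpen_U i).prod isOpen_compl_singleton).mem_nhds
      (show (S.proj y, S.fib i y) ∈ D.U i ×ˢ {0}ᶜ from ⟨hy, by simpa using S.fib_ne_zero hy⟩)]
      with p hp using S.proj_par i p.1 p.2 hp.1 (by simpa using hp.2)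
  have h2 := mfderiv_comp_model h1.symm (S.par_fib i y hy) (S.mdiff_proj y) (S.mdiff_par hy) (v, w)
  rw [mfderiv_fst] at h2
  exact h2.symm

/-- The parametrization involves the radial retraction, whose derivative at a unit vector is the
projection onto its orthogonal complement. Hence the condition on `w`. -/
theorem dfib_lift (hy : S.proj y ∈ D.U i) (v : TangentSpace (𝓡 n) (S.proj y)) {w : V}
    (hw : ⟪S.fib i y, w⟫ = 0) :
    S.dfib i y (S.lift i y (v, w)) = w := by
  have h0 := S.fib_ne_zero hy
  have h1 : (S.fib i ∘ S.par i) =ᶠ[𝓝 (S.proj y, S.fib i y)] (fun v : V => ‖v‖⁻¹ • v) ∘ Prod.snd := by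
    filter_upwards [((D.isOpen_U i).prod isOpen_compl_singleton).mem_nhds
      (show (S.proj y, S.fib i y) ∈ D.U i ×ˢ {0}ᶜ from ⟨hy, by simpa using S.fib_ne_zero hy⟩)]
      with p hp using S.fib_par i p.1 p.2 hp.1 (by simpa using hp.2)
  have h3 : HasFDerivAt (fun v : V => ‖v‖⁻¹ • v)
      (‖S.fib i y‖⁻¹ • ContinuousLinearMap.id ℝ V +
        (-(‖S.fib i y‖ ^ 2)⁻¹ • (‖S.fib i y‖⁻¹ • innerSL ℝ (S.fib i y))).smulRight (S.fib i y))
      (S.fib i y) := by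
    have h4 : HasFDerivAt (fun v : V => ‖v‖) (‖S.fib i y‖⁻¹ • innerSL ℝ (S.fib i y)) (S.fib i y) := by
      have h5 := (hasStrictFDerivAt_norm_sq (S.fib i y)).hasFDerivAt.sqrt (by positivity)
      simp only [Real.sqrt_sq (norm_nonneg _)] at h5
      refine h5.congr_fderiv ?_
      ext w
      simp
      field_simp
    exact ((hasDerivAt_inv (norm_ne_zero_iff.2 h0)).comp_hasFDerivAt _ h4).smul (hasFDerivAt_id _)
  have h5 := mfderiv_comp_model h1.symm (S.par_fib i y hy) (S.mdiff_fib hy) (S.mdiff_par hy) (v, w)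
  have h6 := mfderiv_comp_fderiv (I := (𝓡 n).prod 𝓘(ℝ, V)) (f := (Prod.snd : X × V → V))
    (x := (S.proj y, S.fib i y)) (Filter.EventuallyEq.refl _ _) rfl h3
    mdifferentiableAt_snd (v, w)
  rw [mfderiv_snd] at h6
  refine (h5.symm.trans h6).trans ?_
  change (‖S.fib i y‖⁻¹ • ContinuousLinearMap.id ℝ V +
        (-(‖S.fib i y‖ ^ 2)⁻¹ • (‖S.fib i y‖⁻¹ • innerSL ℝ (S.fib i y))).smulRight (S.fib i y)) w = w
  simp [hw, S.norm_fib i y hy]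

theorem inner_fib_dfib (hy : S.proj y ∈ D.U i) (a : TangentSpace (𝓡 m) y) :
    ⟪S.fib i y, S.dfib i y a⟫ = 0 := by
  have h1 : ((fun v : V => ‖v‖ ^ 2) ∘ S.fib i) =ᶠ[𝓝 y] fun _ => 1 := by
    filter_upwards [S.eventually_mem hy] with y' hy'
    simp [S.norm_fib i y' hy']
  have h3 := (hasStrictFDerivAt_norm_sq (S.fib i y)).hasFDerivAt
  have h2 := h1.mfderiv_eq (I := 𝓡 m) (I' := 𝓘(ℝ, ℝ))
  rw [mfderiv_comp _ h3.differentiableAt.mdifferentiableAt (S.mdiff_fib hy), mfderiv_const,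
    mfderiv_eq_fderiv, h3.fderiv] at h2
  have h4 : (2 • innerSL ℝ (S.fib i y)) (S.dfib i y a) = 0 := DFunLike.congr_fun h2 a
  simpa using h4

theorem mdiff_f (hy : S.proj y ∈ D.U i ∩ D.U j) :
    MDifferentiableAt (𝓡 n) 𝓘(ℝ, ℝ) (D.f i j) (S.proj y) :=
  ((D.smooth_f i j).contMDiffAt (((D.isOpen_U i).inter (D.isOpen_U j)).mem_nhds hy)).mdifferentiableAt
    (by simp)

/-- This is the product rule for `fib_change`; since d(f i j) = lam j - lam i, differentiating the
angle produces the last term, along `J (S.fib j y)`. -/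
theorem dfib_change (hJ : IsComplexStructure J) (hy : S.proj y ∈ D.U i ∩ D.U j) (a : TangentSpace (𝓡 m) y) :
    S.dfib j y a = Real.cos (2 * Real.pi * D.f i j (S.proj y)) • S.dfib i y a -
      Real.sin (2 * Real.pi * D.f i j (S.proj y)) • J (S.dfib i y a) -
      (2 * Real.pi * (D.fn j (S.proj y) (S.dproj y a) - D.fn i (S.proj y) (S.dproj y a))) •
        J (S.fib j y) := by
  have h1 : S.fib j =ᶠ[𝓝 y] (fun p : ℝ × V => Real.cos (2 * Real.pi * p.1) • p.2 -
      Real.sin (2 * Real.pi * p.1) • J p.2) ∘ fun y => (D.f i j (S.proj y), S.fib i y) := by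
    filter_upwards [S.eventually_mem hy.1, S.eventually_mem hy.2] with y' h1 h2
      using S.fib_change i j y' ⟨h1, h2⟩
  obtain ⟨g', hg, hg'⟩ : ∃ g' : ℝ × V →L[ℝ] V,
      HasFDerivAt (fun p : ℝ × V => Real.cos (2 * Real.pi * p.1) • p.2 -
        Real.sin (2 * Real.pi * p.1) • J p.2) g' (D.f i j (S.proj y), S.fib i y) ∧
      ∀ (r : ℝ) (A : V), g' (r, A) = Real.cos (2 * Real.pi * D.f i j (S.proj y)) • A -
        Real.sin (2 * Real.pi * D.f i j (S.proj y)) • J A -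
        (2 * Real.pi * r) • (Real.sin (2 * Real.pi * D.f i j (S.proj y)) • S.fib i y +
          Real.cos (2 * Real.pi * D.f i j (S.proj y)) • J (S.fib i y)) := by
    have hl : HasFDerivAt (fun p : ℝ × V => 2 * Real.pi * p.1)
        ((2 * Real.pi) • ContinuousLinearMap.fst ℝ ℝ V) (D.f i j (S.proj y), S.fib i y) :=
      hasFDerivAt_fst.const_mul _
    refine ⟨_, (hl.cos.smul (hasFDerivAt_snd (p := (D.f i j (S.proj y), S.fib i y)))).sub
      (hl.sin.smul (J.hasFDerivAt.comp _
        (hasFDerivAt_snd (p := (D.f i j (S.proj y), S.fib i y))))), fun r A => ?_⟩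
    simp
    module
  have hf : MDifferentiableAt (𝓡 m) 𝓘(ℝ, ℝ) (fun y => D.f i j (S.proj y)) y :=
    (S.mdiff_f hy).comp y (S.mdiff_proj y)
  have h2 := mfderiv_comp_fderiv h1 rfl hg (hf.prodMk_space (S.mdiff_fib hy.1)) a
  have h3 : mfderiv (𝓡 m) 𝓘(ℝ, ℝ) (fun y => D.f i j (S.proj y)) y a =
      D.fn j (S.proj y) (S.dproj y a) - D.fn i (S.proj y) (S.dproj y a) := by
    have h4 := mfderiv_comp y (S.mdiff_f hy) (S.mdiff_proj y)
    refine (DFunLike.congr_fun h4 a).trans ?_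
    rw [D.fn_apply, D.fn_apply]
    exact D.mfderiv_f i j _ hy _
  have h5 : (mfderiv (𝓡 m) 𝓘(ℝ, ℝ × V) (fun y => (D.f i j (S.proj y), S.fib i y)) y a : ℝ × V) =
      (D.fn j (S.proj y) (S.dproj y a) - D.fn i (S.proj y) (S.dproj y a), S.dfib i y a) := by
    rw [← h3]
    exact mfderiv_prodMk_space hf (S.mdiff_fib hy.1) a
  refine (h2.trans (congrArg _ h5)).trans ((hg' _ _).trans ?_)
  rw [S.fib_change i j y hy]
  simp only [map_sub, map_smul, hJ.sq]
  module

/-- The inhomogeneous term of `dfib_change` is cancelled by the difference of the two primitives, so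
`vert` rotates exactly as `fib` does. Expressions invariant under such rotations are therefore
independent of the trivialization. -/
theorem vert_change (hJ : IsComplexStructure J) (hy : S.proj y ∈ D.U i ∩ D.U j) (a : TangentSpace (𝓡 m) y) :
    S.vert j y a = Real.cos (2 * Real.pi * D.f i j (S.proj y)) • S.vert i y a -
      Real.sin (2 * Real.pi * D.f i j (S.proj y)) • J (S.vert i y a) := by
  rw [vert_apply, vert_apply, S.dfib_change hJ hy, S.fib_change i j y hy]
  simp only [map_add, map_sub, map_smul, hJ.sq, smul_add, smul_sub, smul_smul, mul_sub]
  module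

end

end SphereFibration

end

/-! ### The angular form of a vector-valued function. -/

noncomputable section

open scoped RealInnerProductSpace

variable {n m : ℕ} {X : Type u} [TopologicalSpace X] [ChartedSpace (EuclideanSpace ℝ (Fin n)) X]
  {Y : Type u} [TopologicalSpace Y] [ChartedSpace (EuclideanSpace ℝ (Fin m)) Y]
  {V : Type*} [NormedAddCommGroup V] [InnerProductSpace ℝ V] {J : V →L[ℝ] V}

section angForm

/-- The exterior derivative of a one-form on a vector space. -/
theorem extDeriv_one_apply {E : Type*} [NormedAddCommGroup E] [NormedSpace ℝ E]
    {α : E → E [⋀^Fin 1]→L[ℝ] ℝ} {x : E} (h : DifferentiableAt ℝ α x) (v w : E) :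
    extDeriv α x ![v, w] =
      fderiv ℝ (fun y => α y ![w]) x v - fderiv ℝ (fun y => α y ![v]) x w := by
  have key : ∀ u : Fin 1 → E, ∀ a, fderiv ℝ (fun y => α y u) x a = fderiv ℝ α x a u := by
    intro u a
    have := ((ContinuousAlternatingMap.apply ℝ E ℝ u).hasFDerivAt.comp x h.hasFDerivAt).fderiv
    exact DFunLike.congr_fun this a
  rw [extDeriv_apply h, Fin.sum_univ_two]
  have e0 : Fin.removeNth 0 ![v, w] = ![w] := by
    ext i : 1; fin_cases i; rfl
  have e1 : Fin.removeNth 1 ![v, w] = ![v] := by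
    ext i : 1; fin_cases i; rfl
  simp [e0, e1, key, sub_eq_add_neg]

/-- The one-form `(2π)⁻¹ ⟨J h, dh⟩` of a vector-valued function `h`. -/
def angForm (J : V →L[ℝ] V) (h : Y → V) : DForm m 1 Y := fun y =>
  ContinuousAlternatingMap.ofSubsingleton ℝ _ ℝ (0 : Fin 1) ((2 * Real.pi)⁻¹ •
    (innerSL ℝ (J (h y))).comp (mfderiv (𝓡 m) 𝓘(ℝ, V) h y : TangentSpace (𝓡 m) y →L[ℝ] V))

theorem angForm_apply (h : Y → V) (y : Y) (v : Fin 1 → TangentSpace (𝓡 m) y) :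
    angForm J h y v = (2 * Real.pi)⁻¹ *
      ⟪J (h y), (mfderiv (𝓡 m) 𝓘(ℝ, V) h y : TangentSpace (𝓡 m) y →L[ℝ] V) (v 0)⟫ := rfl

variable [IsManifold (𝓡 m) ∞ Y]

theorem inChart_angForm {h : Y → V} {y₀ : Y} {b : EuclideanSpace ℝ (Fin m)}
    (hb : b ∈ (extChartAt (𝓡 m) y₀).target)
    (hh : MDifferentiableAt (𝓡 m) 𝓘(ℝ, V) h ((extChartAt (𝓡 m) y₀).symm b)) :
    DForm.inChart (angForm J h) y₀ b =
      ContinuousAlternatingMap.ofSubsingleton ℝ _ ℝ (0 : Fin 1) ((2 * Real.pi)⁻¹ •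
        (innerSL ℝ (J ((h ∘ (extChartAt (𝓡 m) y₀).symm) b))).comp
          (fderiv ℝ (h ∘ (extChartAt (𝓡 m) y₀).symm) b)) := by
  ext v
  have h1 := mfderiv_comp_model (Filter.EventuallyEq.refl _ _) rfl hh
    (DForm.mdifferentiableAt_chart_symm hb) (v 0)
  rw [mfderiv_eq_fderiv] at h1
  exact congrArg (fun w : V => (2 * Real.pi)⁻¹ * ⟪J (h ((extChartAt (𝓡 m) y₀).symm b)), w⟫) h1.symm

theorem contDiffAt_comp_chart_symm {h : Y → V} {y₀ : Y} {b : EuclideanSpace ℝ (Fin m)}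
    (hb : b ∈ (extChartAt (𝓡 m) y₀).target)
    (hh : ContMDiffAt (𝓡 m) 𝓘(ℝ, V) ∞ h ((extChartAt (𝓡 m) y₀).symm b)) :
    ContDiffAt ℝ ∞ (h ∘ (extChartAt (𝓡 m) y₀).symm) b := by
  rw [← contMDiffAt_iff_contDiffAt]
  exact hh.comp b (DForm.contMDiffAt_chart_symm hb)

theorem eventually_inChart_angForm {h : Y → V} {y₀ : Y} {b : EuclideanSpace ℝ (Fin m)}
    (hb : b ∈ (extChartAt (𝓡 m) y₀).target)
    (hh : ContMDiffAt (𝓡 m) 𝓘(ℝ, V) ∞ h ((extChartAt (𝓡 m) y₀).symm b)) :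
    DForm.inChart (angForm J h) y₀ =ᶠ[𝓝 b] fun b =>
      ContinuousAlternatingMap.ofSubsingleton ℝ _ ℝ (0 : Fin 1) ((2 * Real.pi)⁻¹ •
        (innerSL ℝ (J ((h ∘ (extChartAt (𝓡 m) y₀).symm) b))).comp
          (fderiv ℝ (h ∘ (extChartAt (𝓡 m) y₀).symm) b)) := by
  have h1 := (DForm.contMDiffAt_chart_symm hb).continuousAt.eventually
    ((contMDiffAt_iff_contMDiffAt_nhds (by simp)).1 (hh.of_le (m := 1) (by simp)))
  filter_upwards [h1, (isOpen_extChartAt_target y₀).mem_nhds hb] with b' h1 h3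
  exact inChart_angForm h3 (h1.mdifferentiableAt (by simp))

theorem smoothAt_angForm {h : Y → V} {y : Y} (hh : ContMDiffAt (𝓡 m) 𝓘(ℝ, V) ∞ h y) :
    DForm.SmoothAt (angForm (m := m) J h) y := by
  have hb := mem_extChartAt_target (I := 𝓡 m) y
  have hh' : ContMDiffAt (𝓡 m) 𝓘(ℝ, V) ∞ h
      ((extChartAt (𝓡 m) y).symm (extChartAt (𝓡 m) y y)) := by simpa
  refine ContDiffAt.congr_of_eventuallyEq ?_ (eventually_inChart_angForm hb hh')
  have h1 := contDiffAt_comp_chart_symm hb hh'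
  refine contDiffAt_alternating fun v => ?_
  change ContDiffAt ℝ ∞ (fun b => (2 * Real.pi)⁻¹ *
    ⟪J ((h ∘ (extChartAt (𝓡 m) y).symm) b), fderiv ℝ (h ∘ (extChartAt (𝓡 m) y).symm) b (v 0)⟫) _
  exact contDiffAt_const.mul ((J.contDiff.contDiffAt.comp _ h1).inner ℝ
    ((h1.fderiv_right (by simp)).clm_apply contDiffAt_const))

/-- Second derivatives of `h` cancel by symmetry. Here `J` is an arbitrary endomorphism: besides
complex structures, the formula is used for the coefficient matrices that correct the primitives. -/
theorem extD_angForm_eq_sub {h : Y → V} {y : Y}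
    (hh : ContMDiffAt (𝓡 m) 𝓘(ℝ, V) ∞ h y) (a b : TangentSpace (𝓡 m) y) :
    DForm.extD (angForm (m := m) J h) y ![a, b] = (2 * Real.pi)⁻¹ *
      (⟪J ((mfderiv (𝓡 m) 𝓘(ℝ, V) h y : TangentSpace (𝓡 m) y →L[ℝ] V) a),
        (mfderiv (𝓡 m) 𝓘(ℝ, V) h y : TangentSpace (𝓡 m) y →L[ℝ] V) b⟫ -
      ⟪J ((mfderiv (𝓡 m) 𝓘(ℝ, V) h y : TangentSpace (𝓡 m) y →L[ℝ] V) b),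
        (mfderiv (𝓡 m) 𝓘(ℝ, V) h y : TangentSpace (𝓡 m) y →L[ℝ] V) a⟫) := by
  have hb := mem_extChartAt_target (I := 𝓡 m) y
  have hh' : ContMDiffAt (𝓡 m) 𝓘(ℝ, V) ∞ h
      ((extChartAt (𝓡 m) y).symm (extChartAt (𝓡 m) y y)) := by simpa
  have hsm := smoothAt_angForm (J := J) hh
  have hd : ∀ a : TangentSpace (𝓡 m) y, (mfderiv (𝓡 m) 𝓘(ℝ, V) h y : TangentSpace (𝓡 m) y →L[ℝ] V) a =
      fderiv ℝ (h ∘ (extChartAt (𝓡 m) y).symm) (extChartAt (𝓡 m) y y) (dChart y y a) := by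
    intro a
    have h1 := mfderiv_comp_model (h := h) (f := extChartAt (𝓡 m) y) (x := y)
      (g := h ∘ (extChartAt (𝓡 m) y).symm) ?_ rfl
      ((contDiffAt_comp_chart_symm hb hh').contMDiffAt.mdifferentiableAt (by simp))
      (DForm.mdifferentiableAt_chart (mem_extChartAt_source y)) a
    · rw [mfderiv_eq_fderiv] at h1
      exact h1
    · filter_upwards [extChartAt_source_mem_nhds (I := 𝓡 m) y] with z hz
      exact (congrArg h ((extChartAt (𝓡 m) y).left_inv hz)).symm
  have h1 := contDiffAt_comp_chart_symm hb hh'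
  rw [hd a, hd b]
  set ĥ := h ∘ (extChartAt (𝓡 m) y).symm
  set b₀ := extChartAt (𝓡 m) y y
  have e1 : DForm.extD (angForm (m := m) J h) y ![a, b] =
      extDeriv (DForm.inChart (angForm J h) y) b₀ ![dChart y y a, dChart y y b] := by
    refine congrArg (extDeriv (DForm.inChart (angForm J h) y) b₀) (funext fun i => ?_)
    fin_cases i <;> rfl
  rw [e1, extDeriv_one_apply (ContDiffAt.differentiableAt hsm (by simp))]
  have e2 : ∀ u v : EuclideanSpace ℝ (Fin m),
      fderiv ℝ (fun z => DForm.inChart (angForm J h) y z ![u]) b₀ v = (2 * Real.pi)⁻¹ *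
        (⟪J (ĥ b₀), fderiv ℝ (fderiv ℝ ĥ) b₀ v u⟫ + ⟪J (fderiv ℝ ĥ b₀ v), fderiv ℝ ĥ b₀ u⟫) := by
    intro u v
    have h2 : (fun z => DForm.inChart (angForm J h) y z ![u]) =ᶠ[𝓝 b₀]
        fun z => (2 * Real.pi)⁻¹ * ⟪J (ĥ z), fderiv ℝ ĥ z u⟫ := by
      filter_upwards [eventually_inChart_angForm (J := J) hb hh'] with z hz
      rw [hz]
      rfl
    have h3 : HasFDerivAt (fun z => J (ĥ z)) (J.comp (fderiv ℝ ĥ b₀)) b₀ :=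
      J.hasFDerivAt.comp b₀ (h1.differentiableAt (by simp)).hasFDerivAt
    have h4 : HasFDerivAt (fun z => fderiv ℝ ĥ z u) ((fderiv ℝ (fderiv ℝ ĥ) b₀).flip u) b₀ := by
      have : ContDiffAt ℝ ∞ (fderiv ℝ ĥ) b₀ := h1.fderiv_right (by simp)
      simpa using (this.differentiableAt (by simp)).hasFDerivAt.clm_apply (hasFDerivAt_const u b₀)
    rw [h2.fderiv_eq, ((h3.inner ℝ h4).const_mul _).fderiv]
    simp
  have hs : IsSymmSndFDerivAt ℝ ĥ b₀ := h1.isSymmSndFDerivAt DForm.two_le_infty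
  rw [e2, e2, hs.eq]
  ring

theorem extD_angForm (hJ : IsComplexStructure J) {h : Y → V} {y : Y}
    (hh : ContMDiffAt (𝓡 m) 𝓘(ℝ, V) ∞ h y) (a b : TangentSpace (𝓡 m) y) :
    DForm.extD (angForm (m := m) J h) y ![a, b] = Real.pi⁻¹ *
      ⟪J ((mfderiv (𝓡 m) 𝓘(ℝ, V) h y : TangentSpace (𝓡 m) y →L[ℝ] V) a),
        (mfderiv (𝓡 m) 𝓘(ℝ, V) h y : TangentSpace (𝓡 m) y →L[ℝ] V) b⟫ := by
  have key : ∀ p q : V, ⟪J p, q⟫ - ⟪J q, p⟫ = 2 * ⟪J p, q⟫ := fun p q => by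
    rw [hJ.inner_left q, real_inner_comm]
    ring
  refine (extD_angForm_eq_sub hh a b).trans ((congrArg _ (key _ _)).trans ?_)
  field_simp

end angForm

end

/-! ### The contact metric structure in a local trivialization. -/

noncomputable section

open scoped RealInnerProductSpace

variable {n m : ℕ} {X : Type u} [TopologicalSpace X] [ChartedSpace (EuclideanSpace ℝ (Fin n)) X]
  {Y : Type u} [TopologicalSpace Y] [ChartedSpace (EuclideanSpace ℝ (Fin m)) Y]
  {V : Type*} [NormedAddCommGroup V] [InnerProductSpace ℝ V] {J : V →L[ℝ] V} {Ω : DForm n 2 X}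

/-- An almost complex structure on `X` together with a metric that is compatible with `Ω`. -/
structure CompatibleTriple (Ω : DForm n 2 X) where
  T : ∀ x : X, TangentSpace (𝓡 n) x →L[ℝ] TangentSpace (𝓡 n) x
  h : ∀ x : X, TangentSpace (𝓡 n) x →L[ℝ] TangentSpace (𝓡 n) x →L[ℝ] ℝ
  sq : ∀ x v, T x (T x v) = -v
  h_T : ∀ x v w, h x (T x v) w = Ω x ![v, w]
  h_map : ∀ x v w, h x (T x v) (T x w) = h x v w
  symm : ∀ x v w, h x v w = h x w v
  pos : ∀ x v, v ≠ 0 → 0 < h x v v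
  smooth_T : ∀ (x₀ : X) (v : EuclideanSpace ℝ (Fin n)), ContDiffAt ℝ ∞
    (fun b => dChart x₀ ((extChartAt (𝓡 n) x₀).symm b)
      (T ((extChartAt (𝓡 n) x₀).symm b) (dSymm x₀ b v))) (extChartAt (𝓡 n) x₀ x₀)
  smooth_h : ∀ (x₀ : X) (v w : EuclideanSpace ℝ (Fin n)), ContDiffAt ℝ ∞
    (fun b => h ((extChartAt (𝓡 n) x₀).symm b) (dSymm x₀ b v) (dSymm x₀ b w))
    (extChartAt (𝓡 n) x₀ x₀)

namespace SphereFibration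

variable {D : IntegralCocycle Ω} (S : SphereFibration D m Y J) (C : CompatibleTriple Ω)

/-- The connection form, in terms of the local trivialization with index `i`. -/
def etaAt (i : D.ι) (y : Y) : TangentSpace (𝓡 m) y →L[ℝ] ℝ :=
  (2 * Real.pi)⁻¹ • (innerSL ℝ (J (S.fib i y))).comp (S.vert i y)

/-- The Reeb field, in terms of the local trivialization with index `i`. -/
def xiAt (i : D.ι) (y : Y) : TangentSpace (𝓡 m) y :=
  S.lift i y (0, (2 * Real.pi) • J (S.fib i y))

/-- The part of a tangent vector along the fibres and orthogonal to the Reeb field. -/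
def horAt (i : D.ι) (y : Y) : TangentSpace (𝓡 m) y →L[ℝ] V :=
  S.vert i y - ((2 * Real.pi) • S.etaAt i y).smulRight (J (S.fib i y))

/-- The structure endomorphism, in terms of the local trivialization with index `i`. -/
def phiAt (i : D.ι) (y : Y) : TangentSpace (𝓡 m) y →L[ℝ] TangentSpace (𝓡 m) y :=
  -- `lift` takes a prescribed value of `dfib`. Subtracting the connection term makes the value of
  -- `vert` equal to J applied to `horAt`.
  (S.lift i y).comp (((C.T (S.proj y)).comp (S.dproj y)).prod (J.comp (S.horAt i y) -
    ((2 * Real.pi) • (D.fn i (S.proj y)).comp ((C.T (S.proj y)).comp (S.dproj y))).smulRight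
      (J (S.fib i y))))

/-- The inner product of a real space as a bilinear map. -/
def realInnerSL (V : Type*) [NormedAddCommGroup V] [InnerProductSpace ℝ V] : V →L[ℝ] V →L[ℝ] ℝ :=
  innerSL ℝ

/-- The contact metric on a model tangent space: `B` is the metric of the base, and `P`, `W`, `e`
are the derivative of the projection, the vertical part and the connection form. -/
def metModel {E F : Type*} [NormedAddCommGroup E] [NormedSpace ℝ E] [NormedAddCommGroup F]
    [NormedSpace ℝ F] (B : F →L[ℝ] F →L[ℝ] ℝ) (P : E →L[ℝ] F) (W : E →L[ℝ] V) (e : E →L[ℝ] ℝ) :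
    E →L[ℝ] E →L[ℝ] ℝ :=
  B.bilinearComp P P + Real.pi⁻¹ • (realInnerSL V).bilinearComp W W +
    -- The component of `vert` along the unit vector J fib is 2πη, so π⁻¹|vert|² contains 4πη². The
    -- coefficient reduces this to η², which gives the Reeb field length one.
    (1 - 4 * Real.pi) • e.smulRight e

/-- The contact metric, in terms of the local trivialization with index `i`. -/
def metAt (i : D.ι) (y : Y) : TangentSpace (𝓡 m) y →L[ℝ] TangentSpace (𝓡 m) y →L[ℝ] ℝ :=
  metModel (E := EuclideanSpace ℝ (Fin m)) (F := EuclideanSpace ℝ (Fin n)) (C.h (S.proj y))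
    (S.dproj y) (S.vert i y) (S.etaAt i y)

variable {S C} {i j : D.ι} {y : Y} (hJ : IsComplexStructure J)

theorem etaAt_apply (a : TangentSpace (𝓡 m) y) :
    S.etaAt i y a = (2 * Real.pi)⁻¹ * ⟪J (S.fib i y), S.vert i y a⟫ := rfl

theorem inner_J_vert (a : TangentSpace (𝓡 m) y) :
    ⟪J (S.fib i y), S.vert i y a⟫ = 2 * Real.pi * S.etaAt i y a := by
  rw [etaAt_apply]
  field_simp

theorem horAt_apply (a : TangentSpace (𝓡 m) y) :
    S.horAt i y a = S.vert i y a - (2 * Real.pi * S.etaAt i y a) • J (S.fib i y) := rfl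

theorem phiAt_apply (a : TangentSpace (𝓡 m) y) :
    S.phiAt C i y a = S.lift i y (C.T (S.proj y) (S.dproj y a), J (S.horAt i y a) -
      (2 * Real.pi * D.fn i (S.proj y) (C.T (S.proj y) (S.dproj y a))) • J (S.fib i y)) := rfl

theorem metAt_apply (a b : TangentSpace (𝓡 m) y) :
    S.metAt C i y a b = C.h (S.proj y) (S.dproj y a) (S.dproj y b) +
      Real.pi⁻¹ * ⟪S.vert i y a, S.vert i y b⟫ +
      (1 - 4 * Real.pi) * (S.etaAt i y a * S.etaAt i y b) := rfl

theorem ext_dfib (hy : S.proj y ∈ D.U i) {a b : TangentSpace (𝓡 m) y}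
    (h1 : S.dproj y a = S.dproj y b) (h2 : S.dfib i y a = S.dfib i y b) : a = b := by
  rw [← S.lift_dproj hy a, ← S.lift_dproj hy b, h1, h2]

theorem ext_vert (hy : S.proj y ∈ D.U i) {a b : TangentSpace (𝓡 m) y}
    (h1 : S.dproj y a = S.dproj y b) (h2 : S.vert i y a = S.vert i y b) : a = b := by
  refine ext_dfib hy h1 ?_
  rw [vert_apply, vert_apply, h1] at h2
  exact add_right_cancel h2

include hJ

theorem inner_J_fib_self (hy : S.proj y ∈ D.U i) : ⟪J (S.fib i y), J (S.fib i y)⟫ = 1 := by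
  rw [hJ.inner_map, S.inner_fib_self hy]

theorem inner_fib_vert (hy : S.proj y ∈ D.U i) (a : TangentSpace (𝓡 m) y) :
    ⟪S.fib i y, S.vert i y a⟫ = 0 := by
  rw [vert_apply, inner_add_right, S.inner_fib_dfib hy, inner_smul_right, hJ.inner_self']
  simp

theorem vert_lift (hy : S.proj y ∈ D.U i) (v : TangentSpace (𝓡 n) (S.proj y)) {w : V}
    (hw : ⟪S.fib i y, w⟫ = 0) :
    S.vert i y (S.lift i y (v, w - (2 * Real.pi * D.fn i (S.proj y) v) • J (S.fib i y))) = w := by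
  rw [vert_apply, S.dproj_lift hy, S.dfib_lift hy]
  · module
  · rw [inner_sub_right, inner_smul_right, hJ.inner_self', hw]
    simp

theorem dproj_xiAt (hy : S.proj y ∈ D.U i) : S.dproj y (S.xiAt i y) = 0 :=
  S.dproj_lift hy _ _

theorem dfib_xiAt (hy : S.proj y ∈ D.U i) :
    S.dfib i y (S.xiAt i y) = (2 * Real.pi) • J (S.fib i y) :=
  S.dfib_lift hy _ (by rw [inner_smul_right, hJ.inner_self', mul_zero])

theorem vert_xiAt (hy : S.proj y ∈ D.U i) :
    S.vert i y (S.xiAt i y) = (2 * Real.pi) • J (S.fib i y) := by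
  rw [vert_apply, dfib_xiAt hJ hy, dproj_xiAt hJ hy]
  simp

theorem inner_J_horAt (hy : S.proj y ∈ D.U i) (a : TangentSpace (𝓡 m) y) :
    ⟪J (S.fib i y), S.horAt i y a⟫ = 0 := by
  rw [horAt_apply, inner_sub_right, inner_smul_right, inner_J_vert, inner_J_fib_self hJ hy]
  ring

theorem inner_horAt (hy : S.proj y ∈ D.U i) (a : TangentSpace (𝓡 m) y) :
    ⟪S.fib i y, S.horAt i y a⟫ = 0 := by
  rw [horAt_apply, inner_sub_right, inner_smul_right, inner_fib_vert hJ hy, hJ.inner_self']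
  ring

theorem dproj_phiAt (hy : S.proj y ∈ D.U i) (a : TangentSpace (𝓡 m) y) :
    S.dproj y (S.phiAt C i y a) = C.T (S.proj y) (S.dproj y a) :=
  S.dproj_lift hy _ _

theorem vert_phiAt (hy : S.proj y ∈ D.U i) (a : TangentSpace (𝓡 m) y) :
    S.vert i y (S.phiAt C i y a) = J (S.horAt i y a) :=
  vert_lift hJ hy _ (by
    have := hJ.inner_left (S.fib i y) (S.horAt i y a)
    rw [inner_J_horAt hJ hy] at this
    exact neg_eq_zero.1 this.symm)

theorem etaAt_xiAt (hy : S.proj y ∈ D.U i) : S.etaAt i y (S.xiAt i y) = 1 := by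
  rw [etaAt_apply, vert_xiAt hJ hy, inner_smul_right, inner_J_fib_self hJ hy]
  field_simp

theorem etaAt_phiAt (hy : S.proj y ∈ D.U i) (a : TangentSpace (𝓡 m) y) :
    S.etaAt i y (S.phiAt C i y a) = 0 := by
  rw [etaAt_apply, vert_phiAt hJ hy, hJ.inner_map, inner_horAt hJ hy, mul_zero]

/-- On the base T² = -1, on the part orthogonal to ξ in the fibre J² = -1, and ξ is killed. A vector
is determined by its values under `dproj` and `vert`. -/
theorem phiAt_sq (hy : S.proj y ∈ D.U i) (a : TangentSpace (𝓡 m) y) :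
    S.phiAt C i y (S.phiAt C i y a) = -a + S.etaAt i y a • S.xiAt i y := by
  refine ext_vert hy ?_ ?_
  · rw [dproj_phiAt hJ hy, dproj_phiAt hJ hy, C.sq, map_add, map_smul, dproj_xiAt hJ hy, map_neg,
      smul_zero, add_zero]
  · rw [vert_phiAt hJ hy, horAt_apply, vert_phiAt hJ hy, etaAt_phiAt hJ hy, map_add, map_smul,
      map_neg, vert_xiAt hJ hy]
    simp only [mul_zero, zero_smul, sub_zero, hJ.sq]
    rw [horAt_apply]
    module

/-- Pythagoras: `horAt` is `vert` without its component 2πη along the unit vector J fib. -/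
theorem inner_horAt_horAt (hy : S.proj y ∈ D.U i) (a b : TangentSpace (𝓡 m) y) :
    ⟪S.horAt i y a, S.horAt i y b⟫ =
      ⟪S.vert i y a, S.vert i y b⟫ - 4 * Real.pi ^ 2 * (S.etaAt i y a * S.etaAt i y b) := by
  nth_rw 1 [horAt_apply]
  rw [inner_sub_left, inner_smul_left, inner_J_horAt hJ hy, horAt_apply, inner_sub_right,
    inner_smul_right, real_inner_comm, real_inner_comm (J (S.fib i y)), inner_J_vert]
  rw [real_inner_comm]
  ring

theorem metAt_phiAt (hy : S.proj y ∈ D.U i) (a b : TangentSpace (𝓡 m) y) :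
    S.metAt C i y (S.phiAt C i y a) (S.phiAt C i y b) =
      S.metAt C i y a b - S.etaAt i y a * S.etaAt i y b := by
  rw [metAt_apply, metAt_apply, dproj_phiAt hJ hy, dproj_phiAt hJ hy, vert_phiAt hJ hy,
    vert_phiAt hJ hy, etaAt_phiAt hJ hy, hJ.inner_map, inner_horAt_horAt hJ hy, C.h_map]
  field_simp
  ring

/-- J applied to `horAt` and J applied to `vert` differ by a multiple of `fib`, which is orthogonal
to every `vert`. What remains is the expression found for dη in `extD_eta` and `inner_J_vert_vert`.
-/
theorem metAt_phiAt_left (hy : S.proj y ∈ D.U i) (a b : TangentSpace (𝓡 m) y) :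
    S.metAt C i y (S.phiAt C i y a) b = Ω (S.proj y) ![S.dproj y a, S.dproj y b] +
      Real.pi⁻¹ * ⟪J (S.vert i y a), S.vert i y b⟫ := by
  rw [metAt_apply, dproj_phiAt hJ hy, vert_phiAt hJ hy, etaAt_phiAt hJ hy, C.h_T, horAt_apply,
    map_sub, map_smul, hJ.sq, inner_sub_left, inner_smul_left, inner_neg_left,
    inner_fib_vert hJ hy]
  simp

theorem metAt_symm (a b : TangentSpace (𝓡 m) y) : S.metAt C i y a b = S.metAt C i y b a := by
  rw [metAt_apply, metAt_apply, C.symm, real_inner_comm]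
  ring

theorem metAt_pos (hy : S.proj y ∈ D.U i) {a : TangentSpace (𝓡 m) y} (ha : a ≠ 0) :
    0 < S.metAt C i y a a := by
  -- In this form the metric is a sum of three nonnegative terms, which together determine the
  -- vector.
  have h1 : S.metAt C i y a a = C.h (S.proj y) (S.dproj y a) (S.dproj y a) +
      Real.pi⁻¹ * ⟪S.horAt i y a, S.horAt i y a⟫ + S.etaAt i y a ^ 2 := by
    rw [metAt_apply, inner_horAt_horAt hJ hy]
    field_simp
    ring
  have h2 : 0 ≤ C.h (S.proj y) (S.dproj y a) (S.dproj y a) := by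
    by_cases h : S.dproj y a = 0
    · simp [h]
    · exact (C.pos _ _ h).le
  have h3 : 0 ≤ Real.pi⁻¹ * ⟪S.horAt i y a, S.horAt i y a⟫ :=
    mul_nonneg (inv_nonneg.2 Real.pi_pos.le) real_inner_self_nonneg
  have h4 := sq_nonneg (S.etaAt i y a)
  rw [h1]
  by_contra hle
  have e2 : C.h (S.proj y) (S.dproj y a) (S.dproj y a) = 0 := by linarith
  have e3 : Real.pi⁻¹ * ⟪S.horAt i y a, S.horAt i y a⟫ = 0 := by linarith
  have e4 : S.etaAt i y a = 0 := by
    have : S.etaAt i y a ^ 2 = 0 := by linarith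
    simpa using this
  have e5 : S.dproj y a = 0 := by
    by_contra h
    exact (C.pos _ _ h).ne' e2
  have e6 : S.horAt i y a = 0 := by
    have := (mul_eq_zero.1 e3).resolve_left (inv_ne_zero Real.pi_ne_zero)
    simpa using this
  rw [horAt_apply, e4] at e6
  refine ha (ext_vert hy (by rw [e5, map_zero]) ?_)
  rw [map_zero]
  simpa using e6

/-- `vert` and `dfib` differ by a multiple of J fib and are both orthogonal to `fib`, so all cross
terms vanish. The connection thus contributes to dη only through its curvature. -/
theorem inner_J_vert_vert (hy : S.proj y ∈ D.U i) (a b : TangentSpace (𝓡 m) y) :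
    ⟪J (S.vert i y a), S.vert i y b⟫ = ⟪J (S.dfib i y a), S.dfib i y b⟫ := by
  rw [vert_apply, map_add, inner_add_left, map_smul, hJ.sq, inner_smul_left, inner_neg_left,
    inner_fib_vert hJ hy, vert_apply, inner_add_right, inner_smul_right, hJ.inner_map,
    real_inner_comm (S.fib i y), S.inner_fib_dfib hy]
  simp

section change

variable (hy : S.proj y ∈ D.U i ∩ D.U j)

include hy

theorem J_fib_change : J (S.fib j y) = Real.cos (2 * Real.pi * D.f i j (S.proj y)) • J (S.fib i y) -
      Real.sin (2 * Real.pi * D.f i j (S.proj y)) • J (J (S.fib i y)) := by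
  rw [S.fib_change i j y hy]
  simp

omit hy in
theorem _root_.IsComplexStructure.inner_rotate (t : ℝ) (a b : V) :
    ⟪Real.cos t • a - Real.sin t • J a, Real.cos t • b - Real.sin t • J b⟫ = ⟪a, b⟫ := by
  simp only [inner_sub_left, inner_sub_right, inner_smul_left, inner_smul_right, hJ.inner_map,
    hJ.inner_left]
  simp only [conj_trivial]
  linear_combination ⟪a, b⟫ * Real.cos_sq_add_sin_sq t

theorem inner_vert_change (a b : TangentSpace (𝓡 m) y) :
    ⟪S.vert j y a, S.vert j y b⟫ = ⟪S.vert i y a, S.vert i y b⟫ := by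
  rw [S.vert_change hJ hy, S.vert_change hJ hy, hJ.inner_rotate]

theorem etaAt_change : S.etaAt j y = S.etaAt i y := by
  ext a
  rw [etaAt_apply, etaAt_apply, S.vert_change hJ hy, J_fib_change hJ hy, hJ.inner_rotate]

theorem xiAt_change : S.xiAt j y = S.xiAt i y := by
  refine (ext_vert hy.2 ?_ ?_).symm
  · rw [dproj_xiAt hJ hy.1, dproj_xiAt hJ hy.2]
  · rw [S.vert_change hJ hy, vert_xiAt hJ hy.1, vert_xiAt hJ hy.2, S.fib_change i j y hy]
    simp only [map_sub, map_smul]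
    module

theorem phiAt_change : S.phiAt C j y = S.phiAt C i y := by
  ext1 a
  refine (ext_vert hy.2 ?_ ?_).symm
  · rw [dproj_phiAt hJ hy.1, dproj_phiAt hJ hy.2]
  · rw [S.vert_change hJ hy, vert_phiAt hJ hy.1, vert_phiAt hJ hy.2, horAt_apply, horAt_apply,
      etaAt_change hJ hy, S.vert_change hJ hy, S.fib_change i j y hy]
    simp only [map_sub, map_smul]
    module

theorem metAt_change : S.metAt C j y = S.metAt C i y := by
  ext a b
  rw [metAt_apply, metAt_apply, inner_vert_change hJ hy, etaAt_change hJ hy]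

end change

section eta

variable (S)

omit hJ

/-- The connection form. -/
def eta : DForm m 1 Y := fun y =>
  ContinuousAlternatingMap.ofSubsingleton ℝ _ ℝ (0 : Fin 1) (S.etaAt (D.idx (S.proj y)) y)

variable {S}

include hJ

theorem eta_apply (hy : S.proj y ∈ D.U i) (v : Fin 1 → TangentSpace (𝓡 m) y) :
    S.eta y v = S.etaAt i y (v 0) := by
  rw [etaAt_change hJ ⟨D.mem_idx (S.proj y), hy⟩]
  rfl

/-- As J fib is a unit vector, the connection term of `vert` contributes exactly the pulled back
primitive. Smoothness of η and the formula for dη are read off from this splitting. -/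
theorem eta_eq (hy : S.proj y ∈ D.U i) :
    S.eta y = DForm.pullback (m := m) S.proj (D.lam i) y + angForm (m := m) J (S.fib i) y := by
  ext v
  rw [eta_apply hJ hy, etaAt_apply, vert_apply, inner_add_right, inner_smul_right,
    inner_J_fib_self hJ hy, ContinuousAlternatingMap.add_apply, angForm_apply]
  have h1 : DForm.pullback (m := m) S.proj (D.lam i) y v = D.fn i (S.proj y) (S.dproj y (v 0)) := by
    refine (congrArg (D.lam i (S.proj y)) (funext fun k => ?_)).trans (D.fn_apply _ _ _).symm
    fin_cases k
    rfl
  rw [h1]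
  change _ = D.fn i (S.proj y) (S.dproj y (v 0)) + (2 * Real.pi)⁻¹ * ⟪_, S.dfib i y (v 0)⟫
  field_simp
  ring

variable [IsManifold (𝓡 n) ∞ X] [IsManifold (𝓡 m) ∞ Y]

omit hJ in
theorem smoothAt_lam (hy : S.proj y ∈ D.U i) : DForm.SmoothAt (D.lam i) (S.proj y) :=
  (DForm.smoothOn_iff (D.isOpen_U i)).1 (D.smooth_lam i) _ hy

theorem eventually_eta_eq (hy : S.proj y ∈ D.U i) : ∀ᶠ y in 𝓝 y,
    (DForm.pullback (m := m) S.proj (D.lam i) + angForm (m := m) J (S.fib i)) y = S.eta y := by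
  filter_upwards [S.eventually_mem hy] with y' hy' using (eta_eq hJ hy').symm

theorem smoothOn_eta : DForm.SmoothOn S.eta univ := by
  refine (DForm.smoothOn_iff isOpen_univ).2 fun y _ => ?_
  have hy := D.mem_idx (S.proj y)
  exact (((smoothAt_lam hy).pullback (m := m) S.smooth_proj.contMDiffAt).add
    (smoothAt_angForm (S.contMDiffAt_fib hy))).congr (eventually_eta_eq hJ hy)

theorem extD_eta (hy : S.proj y ∈ D.U i) (a b : TangentSpace (𝓡 m) y) :
    DForm.extD S.eta y ![a, b] = Ω (S.proj y) ![S.dproj y a, S.dproj y b] +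
      Real.pi⁻¹ * ⟪J (S.dfib i y a), S.dfib i y b⟫ := by
  rw [← DForm.extD_congr (eventually_eta_eq hJ hy),
    ((smoothAt_lam hy).pullback (m := m) S.smooth_proj.contMDiffAt).extD_add
      (smoothAt_angForm (S.contMDiffAt_fib hy)), ContinuousAlternatingMap.add_apply,
    extD_angForm hJ (S.contMDiffAt_fib hy),
    (smoothAt_lam hy).extD_pullback (m := m) S.smooth_proj.contMDiffAt]
  congr 1
  have h1 := D.extD_lam i _ hy
  refine (congrArg (DForm.extD (D.lam i) (S.proj y)) (funext fun k => ?_)).trans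
    (DFunLike.congr_fun h1 _)
  fin_cases k <;> rfl

end eta

end SphereFibration

end

/-! ### Chart expressions of the tensors and their smoothness. -/

noncomputable section

open scoped RealInnerProductSpace

variable {n m : ℕ} {X : Type u} [TopologicalSpace X] [ChartedSpace (EuclideanSpace ℝ (Fin n)) X]
  {Y : Type u} [TopologicalSpace Y] [ChartedSpace (EuclideanSpace ℝ (Fin m)) Y]
  {V : Type*} [NormedAddCommGroup V] [InnerProductSpace ℝ V] {J : V →L[ℝ] V} {Ω : DForm n 2 X}
  [IsManifold (𝓡 n) ∞ X] [IsManifold (𝓡 m) ∞ Y]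

theorem dSymm_dChart {x₀ x : X} (hx : x ∈ (extChartAt (𝓡 n) x₀).source)
    (v : TangentSpace (𝓡 n) x) :
    (dSymm x₀ (extChartAt (𝓡 n) x₀ x) (dChart x₀ x v) : EuclideanSpace ℝ (Fin n)) = v :=
  DForm.mfderiv_symm_comp_chart hx v

theorem dChart_dSymm {x₀ : X} {b : EuclideanSpace ℝ (Fin n)}
    (hb : b ∈ (extChartAt (𝓡 n) x₀).target) (v : EuclideanSpace ℝ (Fin n)) :
    dChart x₀ ((extChartAt (𝓡 n) x₀).symm b) (dSymm x₀ b v) = v :=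
  DForm.mfderiv_chart_comp_symm hb v

/-- The pullback of a bilinear form. -/
def pullBilin {E F : Type*} [NormedAddCommGroup E] [NormedSpace ℝ E] [NormedAddCommGroup F]
    [NormedSpace ℝ F] (B : F →L[ℝ] F →L[ℝ] ℝ) (A : E →L[ℝ] F) : E →L[ℝ] E →L[ℝ] ℝ :=
  B.bilinearComp A A

namespace CompatibleTriple

variable (C : CompatibleTriple Ω)

/-- The metric in a chart. -/
def hHat (x₀ : X) (b : EuclideanSpace ℝ (Fin n)) :
    EuclideanSpace ℝ (Fin n) →L[ℝ] EuclideanSpace ℝ (Fin n) →L[ℝ] ℝ :=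
  pullBilin (E := EuclideanSpace ℝ (Fin n)) (F := EuclideanSpace ℝ (Fin n))
    (C.h ((extChartAt (𝓡 n) x₀).symm b)) (dSymm x₀ b)

/-- The almost complex structure in a chart. -/
def THat (x₀ : X) (b : EuclideanSpace ℝ (Fin n)) :
    EuclideanSpace ℝ (Fin n) →L[ℝ] EuclideanSpace ℝ (Fin n) :=
  (dChart x₀ ((extChartAt (𝓡 n) x₀).symm b)).comp
    ((C.T ((extChartAt (𝓡 n) x₀).symm b)).comp (dSymm x₀ b))

theorem h_eq_hHat {x₀ x : X} (hx : x ∈ (extChartAt (𝓡 n) x₀).source)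
    (v w : TangentSpace (𝓡 n) x) :
    C.h x v w = C.hHat x₀ (extChartAt (𝓡 n) x₀ x) (dChart x₀ x v) (dChart x₀ x w) := by
  have key : ∀ x' : X, x' = x → ∀ v w : EuclideanSpace ℝ (Fin n), C.h x' v w = C.h x v w := by
    rintro _ rfl _ _; rfl
  refine (key _ ((extChartAt (𝓡 n) x₀).left_inv hx) v w).symm.trans ?_
  nth_rw 1 [← dSymm_dChart hx v, ← dSymm_dChart hx w]
  rfl

theorem T_eq_THat {x₀ x : X} (hx : x ∈ (extChartAt (𝓡 n) x₀).source)
    (v : TangentSpace (𝓡 n) x) :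
    dChart x₀ x (C.T x v) = C.THat x₀ (extChartAt (𝓡 n) x₀ x) (dChart x₀ x v) := by
  have key : ∀ x' : X, x' = x → ∀ v : EuclideanSpace ℝ (Fin n),
      dChart x₀ x' (C.T x' v) = dChart x₀ x (C.T x v) := by
    rintro _ rfl _; rfl
  refine (key _ ((extChartAt (𝓡 n) x₀).left_inv hx) v).symm.trans ?_
  nth_rw 1 [← dSymm_dChart hx v]
  rfl

theorem contDiffAt_hHat (x₀ : X) : ContDiffAt ℝ ∞ (C.hHat x₀) (extChartAt (𝓡 n) x₀ x₀) :=
  contDiffAt_clm_iff.2 fun v => contDiffAt_clm_iff.2 fun w => C.smooth_h x₀ v w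

theorem contDiffAt_THat (x₀ : X) : ContDiffAt ℝ ∞ (C.THat x₀) (extChartAt (𝓡 n) x₀ x₀) :=
  contDiffAt_clm_iff.2 fun v => C.smooth_T x₀ v

end CompatibleTriple

namespace IntegralCocycle

variable (D : IntegralCocycle Ω)

/-- The primitives in a chart. -/
def lamHat (i : D.ι) (x₀ : X) (b : EuclideanSpace ℝ (Fin n)) : EuclideanSpace ℝ (Fin n) →L[ℝ] ℝ :=
  (D.fn i ((extChartAt (𝓡 n) x₀).symm b)).comp (dSymm x₀ b)

theorem fn_eq_lamHat (i : D.ι) {x₀ x : X} (hx : x ∈ (extChartAt (𝓡 n) x₀).source)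
    (v : TangentSpace (𝓡 n) x) :
    D.fn i x v = D.lamHat i x₀ (extChartAt (𝓡 n) x₀ x) (dChart x₀ x v) := by
  have key : ∀ x' : X, x' = x → ∀ v : EuclideanSpace ℝ (Fin n), D.fn i x' v = D.fn i x v := by
    rintro _ rfl _; rfl
  refine (key _ ((extChartAt (𝓡 n) x₀).left_inv hx) v).symm.trans ?_
  nth_rw 1 [← dSymm_dChart hx v]
  rfl

theorem contDiffAt_lamHat {i : D.ι} {x₀ : X} (hx : x₀ ∈ D.U i) :
    ContDiffAt ℝ ∞ (D.lamHat i x₀) (extChartAt (𝓡 n) x₀ x₀) := by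
  refine contDiffAt_clm_iff.2 fun v => ?_
  have h1 : DForm.SmoothAt (D.lam i) x₀ := (DForm.smoothOn_iff (D.isOpen_U i)).1 (D.smooth_lam i) _ hx
  refine (ContDiffAt.alternating_apply h1 ![v]).congr_of_eventuallyEq (.of_forall fun b => ?_)
  refine (D.fn_apply _ _ _).trans (congrArg (D.lam i _) (funext fun k => ?_))
  fin_cases k
  rfl

end IntegralCocycle

namespace SphereFibration

variable {D : IntegralCocycle Ω} (S : SphereFibration D m Y J) (C : CompatibleTriple Ω)

/-- The projection in charts. -/
def projHat (y₀ : Y) : EuclideanSpace ℝ (Fin m) → EuclideanSpace ℝ (Fin n) :=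
  extChartAt (𝓡 n) (S.proj y₀) ∘ S.proj ∘ (extChartAt (𝓡 m) y₀).symm

/-- A fibre coordinate in a chart. -/
def fibHat (i : D.ι) (y₀ : Y) : EuclideanSpace ℝ (Fin m) → V := S.fib i ∘ (extChartAt (𝓡 m) y₀).symm

/-- A local parametrization in charts. -/
def parHat (i : D.ι) (y₀ : Y) : EuclideanSpace ℝ (Fin n) × V → EuclideanSpace ℝ (Fin m) := fun q =>
  extChartAt (𝓡 m) y₀ (S.par i ((extChartAt (𝓡 n) (S.proj y₀)).symm q.1, q.2))

/-- The vertical part in a chart. -/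
def vertHat (i : D.ι) (y₀ : Y) (b : EuclideanSpace ℝ (Fin m)) : EuclideanSpace ℝ (Fin m) →L[ℝ] V :=
  fderiv ℝ (S.fibHat i y₀) b + (2 * Real.pi) • ((D.lamHat i (S.proj y₀) (S.projHat y₀ b)).comp
    (fderiv ℝ (S.projHat y₀) b)).smulRight (J (S.fibHat i y₀ b))

/-- The connection form in a chart. -/
def etaHat (i : D.ι) (y₀ : Y) (b : EuclideanSpace ℝ (Fin m)) : EuclideanSpace ℝ (Fin m) →L[ℝ] ℝ :=
  (2 * Real.pi)⁻¹ • (innerSL ℝ (J (S.fibHat i y₀ b))).comp (S.vertHat i y₀ b)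

/-- The contact metric in a chart. -/
def metHat (i : D.ι) (y₀ : Y) (b : EuclideanSpace ℝ (Fin m)) :
    EuclideanSpace ℝ (Fin m) →L[ℝ] EuclideanSpace ℝ (Fin m) →L[ℝ] ℝ :=
  metModel (C.hHat (S.proj y₀) (S.projHat y₀ b)) (fderiv ℝ (S.projHat y₀) b)
    (S.vertHat i y₀ b) (S.etaHat i y₀ b)

/-- The set where the chart expressions around `y₀` are valid. -/
def goodSet (i : D.ι) (y₀ : Y) : Set (EuclideanSpace ℝ (Fin m)) :=
  {b | b ∈ (extChartAt (𝓡 m) y₀).target ∧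
    S.proj ((extChartAt (𝓡 m) y₀).symm b) ∈ (extChartAt (𝓡 n) (S.proj y₀)).source ∧
    S.proj ((extChartAt (𝓡 m) y₀).symm b) ∈ D.U i}

variable {S C} {i : D.ι} {y₀ : Y} {b : EuclideanSpace ℝ (Fin m)}

theorem mem_goodSet (hy : S.proj y₀ ∈ D.U i) : extChartAt (𝓡 m) y₀ y₀ ∈ S.goodSet i y₀ := by
  refine ⟨mem_extChartAt_target y₀, ?_⟩
  rw [extChartAt_to_inv]
  exact ⟨mem_extChartAt_source _, hy⟩

theorem eventually_mem_goodSet (hy : S.proj y₀ ∈ D.U i) :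
    ∀ᶠ b in 𝓝 (extChartAt (𝓡 m) y₀ y₀), b ∈ S.goodSet i y₀ := by
  have h1 : ContinuousAt (S.proj ∘ (extChartAt (𝓡 m) y₀).symm) (extChartAt (𝓡 m) y₀ y₀) :=
    S.smooth_proj.continuous.continuousAt.comp (continuousAt_extChartAt_symm y₀)
  have h0 : (S.proj ∘ (extChartAt (𝓡 m) y₀).symm) (extChartAt (𝓡 m) y₀ y₀) = S.proj y₀ := by simp
  filter_upwards [(isOpen_extChartAt_target y₀).mem_nhds (mem_extChartAt_target y₀),
    h1.eventually_mem (by rw [h0]; exact (isOpen_extChartAt_source (I := 𝓡 n) (S.proj y₀)).mem_nhds (mem_extChartAt_source _)),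
    h1.eventually_mem (by rw [h0]; exact (D.isOpen_U i).mem_nhds hy)] with b h2 h3 h4
    using ⟨h2, h3, h4⟩

theorem contDiffAt_projHat (hb : b ∈ S.goodSet i y₀) : ContDiffAt ℝ ∞ (S.projHat y₀) b :=
  DForm.contDiffAt_chart_comp hb.1 S.smooth_proj.contMDiffAt hb.2.1

theorem contDiffAt_fibHat (hb : b ∈ S.goodSet i y₀) : ContDiffAt ℝ ∞ (S.fibHat i y₀) b :=
  contDiffAt_comp_chart_symm hb.1 (S.contMDiffAt_fib hb.2.2)

theorem dChart_dproj (hb : b ∈ S.goodSet i y₀)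
    (a : TangentSpace (𝓡 m) ((extChartAt (𝓡 m) y₀).symm b)) :
    dChart (S.proj y₀) (S.proj ((extChartAt (𝓡 m) y₀).symm b)) (S.dproj _ a) =
      fderiv ℝ (S.projHat y₀) b (dChart y₀ _ a) := by
  have hs := (extChartAt (𝓡 m) y₀).map_target hb.1
  have h1 := mfderiv_comp_model (I := 𝓡 m) (I'' := 𝓡 n)
    (Filter.EventuallyEq.refl _ (extChartAt (𝓡 n) (S.proj y₀) ∘ S.proj)) rfl
    (DForm.mdifferentiableAt_chart hb.2.1) (S.mdiff_proj _) a
  have h2 := mfderiv_comp_fderiv (I := 𝓡 m) (f := extChartAt (𝓡 m) y₀)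
    (h := extChartAt (𝓡 n) (S.proj y₀) ∘ S.proj) (g := S.projHat y₀)
    (x := (extChartAt (𝓡 m) y₀).symm b) ?_ ((extChartAt (𝓡 m) y₀).right_inv hb.1)
    ((contDiffAt_projHat hb).differentiableAt (by simp)).hasFDerivAt
    (DForm.mdifferentiableAt_chart hs) a
  · exact h1.symm.trans h2
  · filter_upwards [(isOpen_extChartAt_source y₀).mem_nhds hs] with y hy
    simp only [projHat, Function.comp_apply, (extChartAt (𝓡 m) y₀).left_inv hy]

theorem dfib_eq_fibHat (hb : b ∈ S.goodSet i y₀)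
    (a : TangentSpace (𝓡 m) ((extChartAt (𝓡 m) y₀).symm b)) :
    S.dfib i _ a = fderiv ℝ (S.fibHat i y₀) b (dChart y₀ _ a) := by
  have hs := (extChartAt (𝓡 m) y₀).map_target hb.1
  refine mfderiv_comp_fderiv (I := 𝓡 m) (f := extChartAt (𝓡 m) y₀)
    (h := S.fib i) (g := S.fibHat i y₀)
    (x := (extChartAt (𝓡 m) y₀).symm b) ?_ ((extChartAt (𝓡 m) y₀).right_inv hb.1)
    ((contDiffAt_fibHat hb).differentiableAt (by simp)).hasFDerivAt
    (DForm.mdifferentiableAt_chart hs) a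
  filter_upwards [(isOpen_extChartAt_source y₀).mem_nhds hs] with y hy
  simp only [fibHat, Function.comp_apply, (extChartAt (𝓡 m) y₀).left_inv hy]

theorem contDiffAt_parHat (hb : b ∈ S.goodSet i y₀) :
    ContDiffAt ℝ ∞ (S.parHat i y₀) (S.projHat y₀ b, S.fibHat i y₀ b) := by
  have e1 : (extChartAt (𝓡 n) (S.proj y₀)).symm (S.projHat y₀ b) =
      S.proj ((extChartAt (𝓡 m) y₀).symm b) := (extChartAt (𝓡 n) (S.proj y₀)).left_inv hb.2.1
  have e2 : S.par i ((extChartAt (𝓡 n) (S.proj y₀)).symm (S.projHat y₀ b), S.fibHat i y₀ b) =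
      (extChartAt (𝓡 m) y₀).symm b := by
    rw [e1]; exact S.par_fib i _ hb.2.2
  rw [← contMDiffAt_iff_contDiffAt]
  have h1 : ContMDiffAt 𝓘(ℝ, EuclideanSpace ℝ (Fin n) × V) ((𝓡 n).prod 𝓘(ℝ, V)) ∞
      (fun q : EuclideanSpace ℝ (Fin n) × V => ((extChartAt (𝓡 n) (S.proj y₀)).symm q.1, q.2))
      (S.projHat y₀ b, S.fibHat i y₀ b) :=
    ContMDiffAt.prodMk
      ((DForm.contMDiffAt_chart_symm (b := (S.projHat y₀ b, S.fibHat i y₀ b).1)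
        ((extChartAt (𝓡 n) (S.proj y₀)).map_source hb.2.1)).comp
        _ contDiffAt_fst.contMDiffAt) contDiffAt_snd.contMDiffAt
  have h2 : ContMDiffAt ((𝓡 n).prod 𝓘(ℝ, V)) (𝓡 m) ∞ (S.par i)
      ((extChartAt (𝓡 n) (S.proj y₀)).symm (S.projHat y₀ b), S.fibHat i y₀ b) := by
    refine S.contMDiffAt_par ?_ (S.fib_ne_zero hb.2.2)
    rw [e1]; exact hb.2.2
  have h3 : ContMDiffAt (𝓡 m) 𝓘(ℝ, EuclideanSpace ℝ (Fin m)) ∞ (extChartAt (𝓡 m) y₀)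
      (S.par i ((extChartAt (𝓡 n) (S.proj y₀)).symm (S.projHat y₀ b), S.fibHat i y₀ b)) := by
    rw [e2]
    exact contMDiffAt_extChartAt' (by simpa using (extChartAt (𝓡 m) y₀).map_target hb.1)
  exact ContMDiffAt.comp _ h3 (ContMDiffAt.comp _ h2 h1)

theorem dChart_lift (hb : b ∈ S.goodSet i y₀)
    (w : TangentSpace (𝓡 n) (S.proj ((extChartAt (𝓡 m) y₀).symm b))) (A : V) :
    dChart y₀ _ (S.lift i ((extChartAt (𝓡 m) y₀).symm b) (w, A)) =
      fderiv ℝ (S.parHat i y₀) (S.projHat y₀ b, S.fibHat i y₀ b)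
        (dChart (S.proj y₀) _ w, A) := by
  have hs := (extChartAt (𝓡 m) y₀).map_target hb.1
  have h1 := mfderiv_comp_model (I := (𝓡 n).prod 𝓘(ℝ, V)) (I' := 𝓡 m)
    (Filter.EventuallyEq.refl _ (extChartAt (𝓡 m) y₀ ∘ S.par i)) (S.par_fib i ((extChartAt (𝓡 m) y₀).symm b) hb.2.2)
    (DForm.mdifferentiableAt_chart hs) (S.mdiff_par hb.2.2) (w, A)
  have hm : MDifferentiableAt ((𝓡 n).prod 𝓘(ℝ, V)) 𝓘(ℝ, EuclideanSpace ℝ (Fin n))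
      (fun q : X × V => extChartAt (𝓡 n) (S.proj y₀) q.1) (S.proj ((extChartAt (𝓡 m) y₀).symm b), S.fib i ((extChartAt (𝓡 m) y₀).symm b)) :=
    MDifferentiableAt.comp (f := Prod.fst) (g := extChartAt (𝓡 n) (S.proj y₀))
      (S.proj ((extChartAt (𝓡 m) y₀).symm b), S.fib i ((extChartAt (𝓡 m) y₀).symm b)) (DForm.mdifferentiableAt_chart hb.2.1)
      mdifferentiableAt_fst
  have hm2 : MDifferentiableAt ((𝓡 n).prod 𝓘(ℝ, V)) 𝓘(ℝ, V)
      (Prod.snd : X × V → V) (S.proj ((extChartAt (𝓡 m) y₀).symm b), S.fib i ((extChartAt (𝓡 m) y₀).symm b)) := mdifferentiableAt_snd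
  have h2 := mfderiv_comp_fderiv (I := (𝓡 n).prod 𝓘(ℝ, V))
    (f := fun q : X × V => (extChartAt (𝓡 n) (S.proj y₀) q.1, q.2))
    (h := extChartAt (𝓡 m) y₀ ∘ S.par i) (g := S.parHat i y₀)
    (x := (S.proj ((extChartAt (𝓡 m) y₀).symm b), S.fib i ((extChartAt (𝓡 m) y₀).symm b))) ?_ rfl
    ((contDiffAt_parHat hb).differentiableAt (by simp)).hasFDerivAt (hm.prodMk_space hm2) (w, A)
  · have h3 := mfderiv_prodMk_space hm hm2 (w, A)
    have h4 := mfderiv_comp_model (I := (𝓡 n).prod 𝓘(ℝ, V))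
      (f := (Prod.fst : X × V → X)) (x := (S.proj ((extChartAt (𝓡 m) y₀).symm b), S.fib i ((extChartAt (𝓡 m) y₀).symm b)))
      (Filter.EventuallyEq.refl _ (extChartAt (𝓡 n) (S.proj y₀) ∘ Prod.fst)) rfl
      (DForm.mdifferentiableAt_chart hb.2.1) mdifferentiableAt_fst (w, A)
    rw [mfderiv_fst] at h4
    rw [mfderiv_snd] at h3
    refine h1.symm.trans (h2.trans (congrArg _ (h3.trans ?_)))
    exact Prod.ext h4 rfl
  · have : (S.proj ((extChartAt (𝓡 m) y₀).symm b), S.fib i ((extChartAt (𝓡 m) y₀).symm b)).1 ∈ (extChartAt (𝓡 n) (S.proj y₀)).source := hb.2.1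
    filter_upwards [continuousAt_fst.eventually_mem
      ((isOpen_extChartAt_source (S.proj y₀)).mem_nhds this)] with q hq
    simp only [parHat, Function.comp_apply, (extChartAt (𝓡 n) (S.proj y₀)).left_inv hq]

theorem fn_dproj (hb : b ∈ S.goodSet i y₀)
    (a : TangentSpace (𝓡 m) ((extChartAt (𝓡 m) y₀).symm b)) :
    D.fn i (S.proj ((extChartAt (𝓡 m) y₀).symm b)) (S.dproj _ a) =
      D.lamHat i (S.proj y₀) (S.projHat y₀ b) (fderiv ℝ (S.projHat y₀) b (dChart y₀ _ a)) := by
  rw [D.fn_eq_lamHat i hb.2.1, dChart_dproj hb]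
  rfl

/-- Reduces the intrinsic tensors to Fréchet derivatives of `projHat` and `fibHat`, for which
smoothness and derivatives along lines can be computed in normed spaces. -/
theorem vert_eq_vertHat (hb : b ∈ S.goodSet i y₀)
    (a : TangentSpace (𝓡 m) ((extChartAt (𝓡 m) y₀).symm b)) :
    S.vert i _ a = S.vertHat i y₀ b (dChart y₀ _ a) := by
  rw [vert_apply, dfib_eq_fibHat hb, fn_dproj hb]
  simp [vertHat, smul_smul]
  rfl

theorem etaAt_eq_etaHat (hb : b ∈ S.goodSet i y₀)
    (a : TangentSpace (𝓡 m) ((extChartAt (𝓡 m) y₀).symm b)) :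
    S.etaAt i _ a = S.etaHat i y₀ b (dChart y₀ _ a) := by
  rw [etaAt_apply, vert_eq_vertHat hb]
  rfl

theorem metHat_apply (v w : EuclideanSpace ℝ (Fin m)) : S.metHat C i y₀ b v w =
    C.hHat (S.proj y₀) (S.projHat y₀ b) (fderiv ℝ (S.projHat y₀) b v)
      (fderiv ℝ (S.projHat y₀) b w) +
      Real.pi⁻¹ * ⟪S.vertHat i y₀ b v, S.vertHat i y₀ b w⟫ +
      (1 - 4 * Real.pi) * (S.etaHat i y₀ b v * S.etaHat i y₀ b w) := rfl

theorem metAt_eq_metHat (hb : b ∈ S.goodSet i y₀)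
    (a a' : TangentSpace (𝓡 m) ((extChartAt (𝓡 m) y₀).symm b)) :
    S.metAt C i _ a a' = S.metHat C i y₀ b (dChart y₀ _ a) (dChart y₀ _ a') := by
  rw [metAt_apply, etaAt_eq_etaHat hb, etaAt_eq_etaHat hb, vert_eq_vertHat hb, vert_eq_vertHat hb,
    C.h_eq_hHat hb.2.1, dChart_dproj hb, dChart_dproj hb]
  rfl

/-- The inverse chart returns the centre `y₀` only up to a propositional equality, so the formula on
`goodSet` has to be transported along it. -/
theorem metAt_eq_metHat_self (hy : S.proj y₀ ∈ D.U i) (a a' : TangentSpace (𝓡 m) y₀) :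
    S.metAt C i y₀ a a' =
      S.metHat C i y₀ (extChartAt (𝓡 m) y₀ y₀) (dChart y₀ y₀ a) (dChart y₀ y₀ a') := by
  have key : ∀ y, y = y₀ → (∀ a a' : EuclideanSpace ℝ (Fin m), S.metAt C i y a a' =
      S.metHat C i y₀ (extChartAt (𝓡 m) y₀ y₀) (dChart y₀ y a) (dChart y₀ y a')) →
      ∀ a a' : EuclideanSpace ℝ (Fin m), S.metAt C i y₀ a a' =
      S.metHat C i y₀ (extChartAt (𝓡 m) y₀ y₀) (dChart y₀ y₀ a) (dChart y₀ y₀ a') := by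
    rintro _ rfl h
    exact h
  exact key _ (extChartAt_to_inv y₀) (fun a a' => metAt_eq_metHat (mem_goodSet hy) a a') a a'

section smooth

variable (hy : S.proj y₀ ∈ D.U i)

include hy

theorem projHat_self : S.projHat y₀ (extChartAt (𝓡 m) y₀ y₀) =
    extChartAt (𝓡 n) (S.proj y₀) (S.proj y₀) := by
  simp [projHat]

theorem contDiffAt_fderiv_projHat :
    ContDiffAt ℝ ∞ (fderiv ℝ (S.projHat y₀)) (extChartAt (𝓡 m) y₀ y₀) :=
  (contDiffAt_projHat (mem_goodSet hy)).fderiv_right (by simp)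

theorem contDiffAt_fderiv_fibHat :
    ContDiffAt ℝ ∞ (fderiv ℝ (S.fibHat i y₀)) (extChartAt (𝓡 m) y₀ y₀) :=
  (contDiffAt_fibHat (mem_goodSet hy)).fderiv_right (by simp)

theorem contDiffAt_lamHat_projHat :
    ContDiffAt ℝ ∞ (fun b => D.lamHat i (S.proj y₀) (S.projHat y₀ b)) (extChartAt (𝓡 m) y₀ y₀) := by
  refine ContDiffAt.comp (g := D.lamHat i (S.proj y₀)) _ ?_ (contDiffAt_projHat (mem_goodSet hy))
  rw [projHat_self hy]
  exact D.contDiffAt_lamHat hy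

theorem contDiffAt_hHat_projHat :
    ContDiffAt ℝ ∞ (fun b => C.hHat (S.proj y₀) (S.projHat y₀ b)) (extChartAt (𝓡 m) y₀ y₀) := by
  refine ContDiffAt.comp (g := C.hHat (S.proj y₀)) _ ?_ (contDiffAt_projHat (mem_goodSet hy))
  rw [projHat_self hy]
  exact C.contDiffAt_hHat _

theorem contDiffAt_THat_projHat :
    ContDiffAt ℝ ∞ (fun b => C.THat (S.proj y₀) (S.projHat y₀ b)) (extChartAt (𝓡 m) y₀ y₀) := by
  refine ContDiffAt.comp (g := C.THat (S.proj y₀)) _ ?_ (contDiffAt_projHat (mem_goodSet hy))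
  rw [projHat_self hy]
  exact C.contDiffAt_THat _

theorem contDiffAt_J_fibHat :
    ContDiffAt ℝ ∞ (fun b => J (S.fibHat i y₀ b)) (extChartAt (𝓡 m) y₀ y₀) :=
  J.contDiff.contDiffAt.comp _ (contDiffAt_fibHat (mem_goodSet hy))

variable {W W' : EuclideanSpace ℝ (Fin m) → EuclideanSpace ℝ (Fin m)}
  (hW : ContDiffAt ℝ ∞ W (extChartAt (𝓡 m) y₀ y₀)) (hW' : ContDiffAt ℝ ∞ W' (extChartAt (𝓡 m) y₀ y₀))

include hW

/-- The argument may vary with the point: constant `W` serves the smoothness of the tensors, and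
chart expressions of vector fields serve the Killing equation. -/
theorem contDiffAt_vertHat :
    ContDiffAt ℝ ∞ (fun b => S.vertHat i y₀ b (W b)) (extChartAt (𝓡 m) y₀ y₀) := by
  have h1 := (contDiffAt_fderiv_fibHat hy).clm_apply hW
  have h2 := (contDiffAt_lamHat_projHat hy).clm_apply
    ((contDiffAt_fderiv_projHat hy).clm_apply hW)
  exact h1.add ((h2.smul (contDiffAt_J_fibHat hy)).const_smul (2 * Real.pi))

theorem contDiffAt_etaHat :
    ContDiffAt ℝ ∞ (fun b => S.etaHat i y₀ b (W b)) (extChartAt (𝓡 m) y₀ y₀) :=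
  ((contDiffAt_J_fibHat hy).inner ℝ (contDiffAt_vertHat hy hW)).const_smul (2 * Real.pi)⁻¹

include hW' in
theorem contDiffAt_metHat :
    ContDiffAt ℝ ∞ (fun b => S.metHat C i y₀ b (W b) (W' b)) (extChartAt (𝓡 m) y₀ y₀) := by
  have h1 := contDiffAt_fderiv_projHat hy
  simp only [metHat_apply]
  exact ((((contDiffAt_hHat_projHat hy).clm_apply (h1.clm_apply hW)).clm_apply
    (h1.clm_apply hW')).add
    (contDiffAt_const.mul ((contDiffAt_vertHat hy hW).inner ℝ (contDiffAt_vertHat hy hW')))).add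
    (contDiffAt_const.mul ((contDiffAt_etaHat hy hW).mul (contDiffAt_etaHat hy hW')))

omit hW

theorem contDiffAt_fderiv_parHat :
    ContDiffAt ℝ ∞ (fun b => fderiv ℝ (S.parHat i y₀) (S.projHat y₀ b, S.fibHat i y₀ b))
      (extChartAt (𝓡 m) y₀ y₀) := by
  have h1 : ContDiffAt ℝ ∞ (fderiv ℝ (S.parHat i y₀)) (S.projHat y₀ (extChartAt (𝓡 m) y₀ y₀),
      S.fibHat i y₀ (extChartAt (𝓡 m) y₀ y₀)) :=
    (contDiffAt_parHat (mem_goodSet hy)).fderiv_right (by simp)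
  exact ContDiffAt.comp (f := fun b => (S.projHat y₀ b, S.fibHat i y₀ b)) _ h1
    ((contDiffAt_projHat (mem_goodSet hy)).prodMk (contDiffAt_fibHat (mem_goodSet hy)))

theorem contDiffAt_dChart_xiAt :
    ContDiffAt ℝ ∞ (fun b => dChart y₀ _ (S.xiAt i ((extChartAt (𝓡 m) y₀).symm b)))
      (extChartAt (𝓡 m) y₀ y₀) := by
  refine ContDiffAt.congr_of_eventuallyEq (f := fun b =>
    fderiv ℝ (S.parHat i y₀) (S.projHat y₀ b, S.fibHat i y₀ b)
      (0, (2 * Real.pi) • J (S.fibHat i y₀ b))) ?_ ?_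
  · exact (contDiffAt_fderiv_parHat hy).clm_apply
      (contDiffAt_const.prodMk ((contDiffAt_J_fibHat hy).const_smul _))
  · filter_upwards [eventually_mem_goodSet hy] with b hb
    rw [xiAt, dChart_lift hb, map_zero]
    rfl

theorem contDiffAt_dChart_phiAt (v : EuclideanSpace ℝ (Fin m)) :
    ContDiffAt ℝ ∞ (fun b => dChart y₀ _ (S.phiAt C i ((extChartAt (𝓡 m) y₀).symm b) (dSymm y₀ b v)))
      (extChartAt (𝓡 m) y₀ y₀) := by
  have hT := (contDiffAt_THat_projHat (C := C) hy).clm_apply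
    ((contDiffAt_fderiv_projHat hy).clm_apply (contDiffAt_const (c := v)))
  refine ContDiffAt.congr_of_eventuallyEq (f := fun b =>
    fderiv ℝ (S.parHat i y₀) (S.projHat y₀ b, S.fibHat i y₀ b)
      (C.THat (S.proj y₀) (S.projHat y₀ b) (fderiv ℝ (S.projHat y₀) b v),
        J (S.vertHat i y₀ b v - (2 * Real.pi * S.etaHat i y₀ b v) • J (S.fibHat i y₀ b)) -
          (2 * Real.pi * D.lamHat i (S.proj y₀) (S.projHat y₀ b)
            (C.THat (S.proj y₀) (S.projHat y₀ b) (fderiv ℝ (S.projHat y₀) b v))) •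
            J (S.fibHat i y₀ b))) ?_ ?_
  · refine (contDiffAt_fderiv_parHat hy).clm_apply (hT.prodMk ?_)
    refine ContDiffAt.sub ?_ ?_
    · exact J.contDiff.contDiffAt.comp _ ((contDiffAt_vertHat hy contDiffAt_const).sub
        ((contDiffAt_const.mul (contDiffAt_etaHat hy contDiffAt_const)).smul (contDiffAt_J_fibHat hy)))
    · exact (contDiffAt_const.mul ((contDiffAt_lamHat_projHat hy).clm_apply hT)).smul
        (contDiffAt_J_fibHat hy)
  · filter_upwards [eventually_mem_goodSet hy] with b hb
    rw [phiAt_apply, dChart_lift hb, C.T_eq_THat hb.2.1, D.fn_eq_lamHat i hb.2.1,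
      C.T_eq_THat hb.2.1, dChart_dproj hb, dChart_dSymm hb.1, horAt_apply, vert_eq_vertHat hb,
      etaAt_eq_etaHat hb, dChart_dSymm hb.1]
    rfl

end smooth

end SphereFibration

end

/-! ### Compatible almost complex structures on a symplectic manifold. -/

noncomputable section

open scoped RealInnerProductSpace

variable {n : ℕ} {X : Type u} [TopologicalSpace X] [ChartedSpace (EuclideanSpace ℝ (Fin n)) X]
  [IsManifold (𝓡 n) ∞ X] {Ω : DForm n 2 X}

/-- A (pre-)Riemannian metric in terms of charts. -/
structure SmoothInner (n : ℕ) (X : Type u) [TopologicalSpace X]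
    [ChartedSpace (EuclideanSpace ℝ (Fin n)) X] where
  G : ∀ x : X, TangentSpace (𝓡 n) x →L[ℝ] TangentSpace (𝓡 n) x →L[ℝ] ℝ
  isInner : ∀ x, IsInner (E := EuclideanSpace ℝ (Fin n)) (G x)
  smooth : ∀ (x₀ : X) (v w : EuclideanSpace ℝ (Fin n)), ContDiffAt ℝ ∞
    (fun b => G ((extChartAt (𝓡 n) x₀).symm b) (dSymm x₀ b v) (dSymm x₀ b w))
    (extChartAt (𝓡 n) x₀ x₀)

theorem contDiffAt_dChart_dSymm {x₀ x₁ : X} (h : x₀ ∈ (extChartAt (𝓡 n) x₁).source)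
    (v : EuclideanSpace ℝ (Fin n)) :
    ContDiffAt ℝ ∞ (fun b => (dChart x₁ ((extChartAt (𝓡 n) x₀).symm b) (dSymm x₀ b v) :
      EuclideanSpace ℝ (Fin n))) (extChartAt (𝓡 n) x₀ x₀) := by
  have h0 := mem_extChartAt_target (I := 𝓡 n) x₀
  have h1 := DForm.contDiffAt_chart_comp (f := (id : X → X)) (x₀ := x₁) h0 contMDiffAt_id
    (by simpa using h)
  have h2 : ContDiffAt ℝ ∞ (fun b => fderiv ℝ
      (extChartAt (𝓡 n) x₁ ∘ id ∘ (extChartAt (𝓡 n) x₀).symm) b v) (extChartAt (𝓡 n) x₀ x₀) :=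
    (h1.fderiv_right (by simp)).clm_apply contDiffAt_const
  refine h2.congr_of_eventuallyEq ?_
  have h3 : ∀ᶠ b in 𝓝 (extChartAt (𝓡 n) x₀ x₀),
      (extChartAt (𝓡 n) x₀).symm b ∈ (extChartAt (𝓡 n) x₁).source :=
    (continuousAt_extChartAt_symm x₀).eventually_mem
      (by rw [extChartAt_to_inv]; exact (isOpen_extChartAt_source x₁).mem_nhds h)
  filter_upwards [h3, (isOpen_extChartAt_target x₀).mem_nhds h0] with b hb hb0
  have := mfderiv_comp_model (Filter.EventuallyEq.refl _ _) rfl (DForm.mdifferentiableAt_chart hb)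
    (DForm.mdifferentiableAt_chart_symm hb0) v
  rw [mfderiv_eq_fderiv] at this
  exact this.symm

theorem dChart_injective {x₀ x : X} (hx : x ∈ (extChartAt (𝓡 n) x₀).source)
    {v : TangentSpace (𝓡 n) x} (h : (dChart x₀ x v : EuclideanSpace ℝ (Fin n)) = 0) : v = 0 := by
  have h1 := dSymm_dChart hx v
  rw [h, map_zero] at h1
  exact h1.symm

theorem dSymm_injective {x₀ : X} {b : EuclideanSpace ℝ (Fin n)}
    (hb : b ∈ (extChartAt (𝓡 n) x₀).target) {v : EuclideanSpace ℝ (Fin n)}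
    (h : dSymm x₀ b v = 0) : v = 0 := by
  have h1 := dChart_dSymm hb v
  rw [h, map_zero] at h1
  exact h1.symm

/-- The Euclidean metrics of finitely many charts are added with bump functions as weights. No
normalization is needed, since at each point some bump function equals one. -/
theorem nonempty_smoothInner [T2Space X] [CompactSpace X] : Nonempty (SmoothInner n X) := by
  obtain ⟨ι, fs, hfs⟩ := SmoothBumpCovering.exists_isSubordinate (I := 𝓡 n) (s := (univ : Set X))
    isClosed_univ (U := fun x => (extChartAt (𝓡 n) x).source)
    (fun x _ => extChartAt_source_mem_nhds (I := 𝓡 n) x)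
  have : Fintype ι := fs.fintype
  let G : X → EuclideanSpace ℝ (Fin n) →L[ℝ] EuclideanSpace ℝ (Fin n) →L[ℝ] ℝ := fun x =>
    ∑ i, fs i x • pullBilin (SphereFibration.realInnerSL (EuclideanSpace ℝ (Fin n)))
      (dChart (fs.c i) x : EuclideanSpace ℝ (Fin n) →L[ℝ] EuclideanSpace ℝ (Fin n))
  have hG : ∀ x v w, G x v w = ∑ i, fs i x *
      ⟪(dChart (fs.c i) x v : EuclideanSpace ℝ (Fin n)), dChart (fs.c i) x w⟫ := by
    intro x v w
    simp only [G, sum_apply, smul_apply]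
    rfl
  refine ⟨⟨G, fun x => ⟨fun v w => ?_, fun v hv => ?_⟩, fun x₀ v w => ?_⟩⟩
  · rw [hG, hG]
    exact Finset.sum_congr rfl fun i _ => by rw [real_inner_comm]
  · rw [hG]
    refine Finset.sum_pos' (fun i _ => mul_nonneg (fs i).nonneg real_inner_self_nonneg)
      ⟨fs.ind x (mem_univ x), Finset.mem_univ _, ?_⟩
    rw [fs.apply_ind, one_mul, real_inner_self_pos]
    exact fun h => hv (dChart_injective (fs.mem_extChartAt_ind_source x (mem_univ x)) h)
  · have hG' : ∀ b, (G ((extChartAt (𝓡 n) x₀).symm b) (dSymm x₀ b v) (dSymm x₀ b w) : ℝ) =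
        ∑ i, fs i ((extChartAt (𝓡 n) x₀).symm b) *
      ⟪(dChart (fs.c i) ((extChartAt (𝓡 n) x₀).symm b) (dSymm x₀ b v) : EuclideanSpace ℝ (Fin n)),
        dChart (fs.c i) ((extChartAt (𝓡 n) x₀).symm b) (dSymm x₀ b w)⟫ := fun b => hG _ _ _
    refine ContDiffAt.congr_of_eventuallyEq ?_ (.of_forall hG')
    refine ContDiffAt.sum fun i _ => ?_
    by_cases hi : x₀ ∈ tsupport (fs i)
    · have hs : x₀ ∈ (extChartAt (𝓡 n) (fs.c i)).source := hfs i hi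
      refine ContDiffAt.mul ?_ ((contDiffAt_dChart_dSymm hs v).inner ℝ (contDiffAt_dChart_dSymm hs w))
      have h1 : ContMDiffAt (𝓡 n) 𝓘(ℝ, ℝ) ∞ (fs i)
          ((extChartAt (𝓡 n) x₀).symm (extChartAt (𝓡 n) x₀ x₀)) := (fs i).contMDiff _
      rw [← contMDiffAt_iff_contDiffAt]
      exact h1.comp _ (DForm.contMDiffAt_chart_symm (mem_extChartAt_target x₀))
    · refine contDiffAt_const (c := (0 : ℝ)) |>.congr_of_eventuallyEq ?_
      have h1 : ∀ᶠ x in 𝓝 x₀, fs i x = 0 := by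
        filter_upwards [(isClosed_tsupport (fs i)).isOpen_compl.mem_nhds hi] with x hx
        exact image_eq_zero_of_notMem_tsupport hx
      have h2 := (continuousAt_extChartAt_symm (I := 𝓡 n) x₀).eventually (by rw [extChartAt_to_inv]; exact h1)
      filter_upwards [h2] with b hb
      rw [hb, zero_mul]

theorem alternating_update {E : Type*} (v w u : E) : Function.update ![v, w] 1 u = ![v, u] := by
  ext1 i
  fin_cases i <;> rfl

theorem alternating_update' {E : Type*} (v w u : E) : Function.update ![v, w] 0 u = ![u, w] := by
  ext1 i
  fin_cases i <;> rfl

/-- An alternating form of degree two as a bilinear map. -/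
def ContinuousAlternatingMap.bilin {E : Type*} [NormedAddCommGroup E] [NormedSpace ℝ E]
    [FiniteDimensional ℝ E] (a : E [⋀^Fin 2]→L[ℝ] ℝ) : E →L[ℝ] E →L[ℝ] ℝ :=
  (LinearMap.mk₂ ℝ (fun v w : E => a ![v, w])
    (fun v v' w => by
      simpa only [alternating_update'] using a.map_update_add ![v, w] 0 v v')
    (fun c v w => by
      simpa only [alternating_update'] using a.map_update_smul ![v, w] 0 c v)
    (fun v w w' => by
      simpa only [alternating_update] using a.map_update_add ![v, w] 1 w w')
    (fun c v w => by
      simpa only [alternating_update] using a.map_update_smul ![v, w] 1 c w)).toContinuousBilinearMap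

theorem ContinuousAlternatingMap.bilin_neg {E : Type*} [NormedAddCommGroup E] [NormedSpace ℝ E]
    [FiniteDimensional ℝ E] (a : E [⋀^Fin 2]→L[ℝ] ℝ) (v w : E) : a.bilin v w = -a.bilin w v := by
  have := a.toAlternatingMap.map_swap ![w, v] (show (0 : Fin 2) ≠ 1 by decide)
  refine Eq.trans (congrArg a (funext fun i => ?_)) this
  fin_cases i <;> rfl

/-- A two-form as a bilinear map. -/
def DForm.bilin (σ : DForm n 2 X) (x : X) :
    EuclideanSpace ℝ (Fin n) →L[ℝ] EuclideanSpace ℝ (Fin n) →L[ℝ] ℝ :=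
  ContinuousAlternatingMap.bilin (E := EuclideanSpace ℝ (Fin n)) (σ x)

theorem DForm.bilin_neg (σ : DForm n 2 X) (x : X) (v w : EuclideanSpace ℝ (Fin n)) :
    σ.bilin x v w = -σ.bilin x w v :=
  ContinuousAlternatingMap.bilin_neg (E := EuclideanSpace ℝ (Fin n)) _ v w

/-- Polar data are natural under isomorphisms. Their chart expressions are thus polar data of the
chart expressions of the two forms, so `IsPolar.contDiffAt` applies in each chart. -/
theorem IsPolar.conj {E : Type*} [NormedAddCommGroup E] [NormedSpace ℝ E]
    {G W : E →L[ℝ] E →L[ℝ] ℝ} {A R T : E →L[ℝ] E} (h : IsPolar G W A R T) {P Q : E →L[ℝ] E}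
    (hPQ : ∀ v, P (Q v) = v) (hQP : ∀ v, Q (P v) = v) :
    IsPolar (pullBilin G P) (pullBilin W P) (Q.comp (A.comp P)) (Q.comp (R.comp P))
      (Q.comp (T.comp P)) := by
  refine ⟨fun v w => ?_, ⟨fun v w => ?_, fun v hv => ?_⟩, fun v => ?_, fun v => ?_⟩
  · change G (P (Q (A (P v)))) (P w) = W (P v) (P w)
    rw [hPQ, h.apply_A]
  · change G (P (Q (R (P v)))) (P w) = G (P v) (P (Q (R (P w))))
    rw [hPQ, hPQ, h.posSymm.symm]
  · change 0 < G (P (Q (R (P v)))) (P v)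
    rw [hPQ]
    refine h.posSymm.pos _ fun h0 => hv ?_
    rw [← hQP v, h0, map_zero]
  · change Q (R (P (Q (R (P v))))) = -Q (A (P (Q (A (P v)))))
    rw [hPQ, hPQ, h.sq, map_neg]
  · change Q (R (P (Q (T (P v))))) = Q (A (P v))
    rw [hPQ, h.apply_T]

-- Polar decomposition of `Ω` with respect to any metric g: the phase `T` is the almost complex
-- structure, and g(R·, ·) the compatible metric.
set_option maxHeartbeats 1000000 in
theorem DForm.IsSymplectic.nonempty_compatibleTriple [T2Space X] [CompactSpace X]
    (hΩ : DForm.IsSymplectic Ω) : Nonempty (CompatibleTriple Ω) := by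
  obtain ⟨g⟩ := nonempty_smoothInner (n := n) (X := X)
  choose A R T h using fun x => IsPolar.exists_polar (g.isInner x) (Ω.bilin_neg x) (hΩ.nondegenerate x)
  have key : ∀ x₀ : X, ContDiffAt ℝ ∞ (fun b => (dChart x₀ ((extChartAt (𝓡 n) x₀).symm b)).comp
        ((R ((extChartAt (𝓡 n) x₀).symm b)).comp
          (dSymm x₀ b : EuclideanSpace ℝ (Fin n) →L[ℝ] EuclideanSpace ℝ (Fin n))))
        (extChartAt (𝓡 n) x₀ x₀) ∧
      ContDiffAt ℝ ∞ (fun b => (dChart x₀ ((extChartAt (𝓡 n) x₀).symm b)).comp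
        ((T ((extChartAt (𝓡 n) x₀).symm b)).comp
          (dSymm x₀ b : EuclideanSpace ℝ (Fin n) →L[ℝ] EuclideanSpace ℝ (Fin n))))
        (extChartAt (𝓡 n) x₀ x₀) := by
    intro x₀
    refine IsPolar.contDiffAt
      (G := fun b => pullBilin (F := EuclideanSpace ℝ (Fin n)) (g.G ((extChartAt (𝓡 n) x₀).symm b))
        (dSymm x₀ b : EuclideanSpace ℝ (Fin n) →L[ℝ] EuclideanSpace ℝ (Fin n)))
      (W := fun b => pullBilin (Ω.bilin ((extChartAt (𝓡 n) x₀).symm b))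
        (dSymm x₀ b : EuclideanSpace ℝ (Fin n) →L[ℝ] EuclideanSpace ℝ (Fin n)))
      (A := fun b => (dChart x₀ ((extChartAt (𝓡 n) x₀).symm b)).comp
        ((A ((extChartAt (𝓡 n) x₀).symm b)).comp
          (dSymm x₀ b : EuclideanSpace ℝ (Fin n) →L[ℝ] EuclideanSpace ℝ (Fin n)))) ?_ ?_ ?_ ?_
    · exact contDiffAt_clm_iff.2 fun v => contDiffAt_clm_iff.2 fun w => g.smooth x₀ v w
    · refine contDiffAt_clm_iff.2 fun v => contDiffAt_clm_iff.2 fun w => ?_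
      have h1 : DForm.SmoothAt Ω x₀ := (DForm.smoothOn_iff isOpen_univ).1 hΩ.smooth _ (mem_univ _)
      refine (ContDiffAt.alternating_apply h1 ![v, w]).congr_of_eventuallyEq (.of_forall fun b => ?_)
      refine congrArg (Ω _) (funext fun k => ?_)
      fin_cases k <;> rfl
    · filter_upwards [(isOpen_extChartAt_target x₀).mem_nhds (mem_extChartAt_target x₀)] with b hb
      exact ⟨fun v w => (g.isInner _).symm _ _,
        fun v hv => (g.isInner _).pos _ fun h0 => hv (dSymm_injective hb h0)⟩
    · filter_upwards [(isOpen_extChartAt_target x₀).mem_nhds (mem_extChartAt_target x₀)] with b hb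
      have e1 : ∀ v : EuclideanSpace ℝ (Fin n), (dSymm x₀ b (dChart x₀ ((extChartAt (𝓡 n) x₀).symm b) v) :
          EuclideanSpace ℝ (Fin n)) = v := fun v => by
        have := dSymm_dChart ((extChartAt (𝓡 n) x₀).map_target hb) v
        rwa [(extChartAt (𝓡 n) x₀).right_inv hb] at this
      exact IsPolar.conj (E := EuclideanSpace ℝ (Fin n)) (h ((extChartAt (𝓡 n) x₀).symm b))
        (P := dSymm x₀ b) (Q := dChart x₀ ((extChartAt (𝓡 n) x₀).symm b)) e1
        (fun v => dChart_dSymm hb v)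
  refine ⟨⟨T, fun x => (g.G x).comp (R x), fun x => (h x).T_T (g.isInner x),
    fun x => (h x).R_T (g.isInner x), fun x => (h x).map_T (g.isInner x) (Ω.bilin_neg x),
    fun x v w => ?_, fun x => (h x).posSymm.pos, fun x₀ v => ?_, fun x₀ v w => ?_⟩⟩
  · exact ((h x).posSymm.symm v w).trans ((g.isInner x).symm _ _)
  · exact (key x₀).2.clm_apply contDiffAt_const
  · have h1 : ContDiffAt ℝ ∞ (fun b => pullBilin (F := EuclideanSpace ℝ (Fin n))
        (g.G ((extChartAt (𝓡 n) x₀).symm b))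
        (dSymm x₀ b : EuclideanSpace ℝ (Fin n) →L[ℝ] EuclideanSpace ℝ (Fin n)))
        (extChartAt (𝓡 n) x₀ x₀) :=
      contDiffAt_clm_iff.2 fun v => contDiffAt_clm_iff.2 fun w => g.smooth x₀ v w
    refine ((h1.clm_apply ((key x₀).1.clm_apply (contDiffAt_const (c := v)))).clm_apply
      (contDiffAt_const (c := w))).congr_of_eventuallyEq ?_
    filter_upwards [(isOpen_extChartAt_target x₀).mem_nhds (mem_extChartAt_target x₀)] with b hb
    have e := dSymm_dChart ((extChartAt (𝓡 n) x₀).map_target hb)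
      (R ((extChartAt (𝓡 n) x₀).symm b) (dSymm x₀ b v))
    rw [(extChartAt (𝓡 n) x₀).right_inv hb] at e
    exact congrArg (fun u : EuclideanSpace ℝ (Fin n) => (g.G ((extChartAt (𝓡 n) x₀).symm b) u
      (dSymm x₀ b w) : ℝ)) e.symm

end

/-! ### The Reeb field is Killing; the K-contact structure. -/

noncomputable section

open scoped RealInnerProductSpace

variable {n m : ℕ} {X : Type u} [TopologicalSpace X] [ChartedSpace (EuclideanSpace ℝ (Fin n)) X]
  {Y : Type u} [TopologicalSpace Y] [ChartedSpace (EuclideanSpace ℝ (Fin m)) Y]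
  {V : Type*} [NormedAddCommGroup V] [InnerProductSpace ℝ V] {J : V →L[ℝ] V} {Ω : DForm n 2 X}
  [IsManifold (𝓡 n) ∞ X] [IsManifold (𝓡 m) ∞ Y]

/-- A vector field in a chart. -/
def fieldHat (y₀ : Y) (W : ∀ y : Y, TangentSpace (𝓡 m) y) (b : EuclideanSpace ℝ (Fin m)) :
    EuclideanSpace ℝ (Fin m) :=
  dChart y₀ ((extChartAt (𝓡 m) y₀).symm b) (W ((extChartAt (𝓡 m) y₀).symm b))

/-- The Lie bracket of vector fields in a chart. -/
theorem dChart_mlieBracket (y₀ : Y) (W Z : ∀ y : Y, TangentSpace (𝓡 m) y) :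
    dChart y₀ y₀ (VectorField.mlieBracket (𝓡 m) W Z y₀) =
      fderiv ℝ (fieldHat y₀ Z) (extChartAt (𝓡 m) y₀ y₀) (fieldHat y₀ W (extChartAt (𝓡 m) y₀ y₀)) -
      fderiv ℝ (fieldHat y₀ W) (extChartAt (𝓡 m) y₀ y₀)
        (fieldHat y₀ Z (extChartAt (𝓡 m) y₀ y₀)) := by
  have : IsManifold (𝓡 m) 1 Y := .of_le (n := ∞) (by simp)
  have key : ∀ W : ∀ y : Y, TangentSpace (𝓡 m) y,
      (VectorField.mpullbackWithin 𝓘(ℝ, EuclideanSpace ℝ (Fin m)) (𝓡 m) (extChartAt (𝓡 m) y₀).symm W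
        (range (𝓡 m)) : EuclideanSpace ℝ (Fin m) → EuclideanSpace ℝ (Fin m)) =ᶠ[𝓝 (extChartAt (𝓡 m) y₀ y₀)] fieldHat y₀ W := by
    intro W
    filter_upwards [(isOpen_extChartAt_target y₀).mem_nhds (mem_extChartAt_target y₀)] with b hb
    rw [VectorField.mpullbackWithin_apply]
    simp only [modelWithCornersSelf_coe, range_id, mfderivWithin_univ]
    have h1 : (mfderiv 𝓘(ℝ, EuclideanSpace ℝ (Fin m)) (𝓡 m) (extChartAt (𝓡 m) y₀).symm b).inverse =
        dChart y₀ ((extChartAt (𝓡 m) y₀).symm b) := by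
      refine ContinuousLinearMap.inverse_eq ?_ ?_
      · ext1 v
        have := DForm.mfderiv_symm_comp_chart ((extChartAt (𝓡 m) y₀).map_target hb) v
        rw [(extChartAt (𝓡 m) y₀).right_inv hb] at this
        exact this
      · ext1 v
        exact DForm.mfderiv_chart_comp_symm hb v
    rw [h1]
    rfl
  have h2 : (mfderiv (𝓡 m) 𝓘(ℝ, EuclideanSpace ℝ (Fin m)) (extChartAt (𝓡 m) y₀) y₀).inverse =
        dSymm y₀ (extChartAt (𝓡 m) y₀ y₀) := by
    refine ContinuousLinearMap.inverse_eq ?_ ?_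
    · ext1 v
      exact DForm.mfderiv_chart_comp_symm' (mem_extChartAt_source y₀) v
    · ext1 v
      exact DForm.mfderiv_symm_comp_chart (mem_extChartAt_source y₀) v
  rw [← VectorField.mlieBracketWithin_univ, VectorField.mlieBracketWithin_apply, h2]
  refine (DForm.mfderiv_chart_comp_symm' (mem_extChartAt_source y₀) _).trans ?_
  have hl : ∀ A B : EuclideanSpace ℝ (Fin m) → EuclideanSpace ℝ (Fin m),
      A =ᶠ[𝓝 (extChartAt (𝓡 m) y₀ y₀)] fieldHat y₀ W →
      B =ᶠ[𝓝 (extChartAt (𝓡 m) y₀ y₀)] fieldHat y₀ Z →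
      VectorField.lieBracketWithin ℝ A B univ (extChartAt (𝓡 m) y₀ y₀) =
        fderiv ℝ (fieldHat y₀ Z) (extChartAt (𝓡 m) y₀ y₀)
          (fieldHat y₀ W (extChartAt (𝓡 m) y₀ y₀)) -
        fderiv ℝ (fieldHat y₀ W) (extChartAt (𝓡 m) y₀ y₀)
          (fieldHat y₀ Z (extChartAt (𝓡 m) y₀ y₀)) := by
    intro A B hA hB
    rw [VectorField.lieBracketWithin_univ, VectorField.lieBracket, hA.fderiv_eq, hB.fderiv_eq,
      hA.self_of_nhds, hB.self_of_nhds]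
  have hW := key W
  have hZ := key Z
  simp only [modelWithCornersSelf_coe, range_id, preimage_univ, inter_univ] at hW hZ ⊢
  exact hl _ _ hW hZ

/-- The derivative along `Z` of `dk (W)` in terms of the Lie bracket. -/
theorem hasDerivAt_fderiv_apply {E F : Type*} [NormedAddCommGroup E] [NormedSpace ℝ E]
    [NormedAddCommGroup F] [NormedSpace ℝ F] {k : E → F} {W Z : E → E} {b : E} {c : E → F}
    {c' : E →L[ℝ] F} (hk : ContDiffAt ℝ ∞ k b) (hW : DifferentiableAt ℝ W b)
    (hZ : DifferentiableAt ℝ Z b)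
    (hc : (fun b => fderiv ℝ k b (Z b)) =ᶠ[𝓝 b] c) (hc' : HasFDerivAt c c' b) :
    HasDerivAt (fun t : ℝ => fderiv ℝ k (b + t • Z b) (W (b + t • Z b)))
      (fderiv ℝ k b (fderiv ℝ W b (Z b) - fderiv ℝ Z b (W b)) + c' (W b)) 0 := by
  have hk' : ContDiffAt ℝ ∞ (fderiv ℝ k) b := hk.fderiv_right (by simp)
  have h1 : ∀ {U : E → E}, DifferentiableAt ℝ U b → HasFDerivAt (fun b => fderiv ℝ k b (U b))
      ((fderiv ℝ k b).comp (fderiv ℝ U b) + (fderiv ℝ (fderiv ℝ k) b).flip (U b)) b :=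
    fun hU => (hk'.differentiableAt (by simp)).hasFDerivAt.clm_apply hU.hasFDerivAt
  -- Differentiating dk(Z) = c in the direction W expresses D²k(W, Z) through c' and the derivative
  -- of Z. Symmetry of D²k then produces the bracket term.
  have h2 := DFunLike.congr_fun ((h1 hZ).unique (hc'.congr_of_eventuallyEq hc)) (W b)
  have h3 : HasDerivAt (fun t : ℝ => b + t • Z b) (Z b) 0 := by
    simpa using ((hasDerivAt_id (0 : ℝ)).smul_const (Z b)).const_add b
  have h4 := HasFDerivAt.comp_hasDerivAt_of_eq (0 : ℝ) (h1 hW) h3 (by simp)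
  have hs : IsSymmSndFDerivAt ℝ k b := hk.isSymmSndFDerivAt DForm.two_le_infty
  have e := hs.eq (Z b) (W b)
  simp only [add_apply, ContinuousLinearMap.comp_apply,
    ContinuousLinearMap.flip_apply] at h2 h4
  refine h4.congr_deriv ?_
  rw [← h2, map_sub, e]
  abel

theorem hasDerivAt_comp_of_deriv_eq_zero {E F : Type*} [NormedAddCommGroup E] [NormedSpace ℝ E]
    [NormedAddCommGroup F] [NormedSpace ℝ F] {g : E → F} {γ : ℝ → E} {z : E} {t : ℝ}
    (hg : ContDiffAt ℝ ∞ g z) (hγ : HasDerivAt γ 0 t) (hz : z = γ t) :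
    HasDerivAt (fun s => g (γ s)) 0 t := by
  have := (hg.differentiableAt (by simp)).hasFDerivAt.comp_hasDerivAt_of_eq t hγ hz
  rwa [map_zero] at this

-- The base point of the bilinear form is stationary to first order, so its coefficients contribute
-- nothing to the derivative. This is the situation of the base metric along the Reeb flow.
set_option synthInstance.maxHeartbeats 200000 in
theorem hasDerivAt_bilin_comp {E F : Type*} [NormedAddCommGroup E] [NormedSpace ℝ E]
    [NormedAddCommGroup F] [NormedSpace ℝ F] {g : E → F →L[ℝ] F →L[ℝ] ℝ} {γ : ℝ → E} {z : E} {t : ℝ}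
    {P Q : ℝ → F} {P' Q' : F}
    (hg : ContDiffAt ℝ ∞ g z) (hγ : HasDerivAt γ 0 t) (hz : z = γ t) (hP : HasDerivAt P P' t)
    (hQ : HasDerivAt Q Q' t) :
    HasDerivAt (fun s => g (γ s) (P s) (Q s)) (g z P' (Q t) + g z (P t) Q') t := by
  have h1 := hasDerivAt_comp_of_deriv_eq_zero hg hγ hz
  refine ((h1.clm_apply hP).clm_apply hQ).congr_deriv ?_
  simp [hz]

namespace SphereFibration

variable {D : IntegralCocycle Ω} {S : SphereFibration D m Y J} {C : CompatibleTriple Ω}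
  {i : D.ι} {y₀ : Y} {b : EuclideanSpace ℝ (Fin m)} (hJ : IsComplexStructure J)

theorem vertHat_apply (v : EuclideanSpace ℝ (Fin m)) : S.vertHat i y₀ b v =
    fderiv ℝ (S.fibHat i y₀) b v + (2 * Real.pi * D.lamHat i (S.proj y₀) (S.projHat y₀ b)
      (fderiv ℝ (S.projHat y₀) b v)) • J (S.fibHat i y₀ b) := by
  simp [vertHat, smul_smul]

include hJ

/-- The Reeb field is a Killing field, in a chart. -/
theorem fderiv_metHat (hy : S.proj y₀ ∈ D.U i) {W W' Z : EuclideanSpace ℝ (Fin m) → EuclideanSpace ℝ (Fin m)}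
    (hW : ContDiffAt ℝ ∞ W (extChartAt (𝓡 m) y₀ y₀))
    (hW' : ContDiffAt ℝ ∞ W' (extChartAt (𝓡 m) y₀ y₀))
    (hZ : ContDiffAt ℝ ∞ Z (extChartAt (𝓡 m) y₀ y₀))
    (hpZ : ∀ b ∈ S.goodSet i y₀, fderiv ℝ (S.projHat y₀) b (Z b) = 0)
    (hfZ : ∀ b ∈ S.goodSet i y₀, fderiv ℝ (S.fibHat i y₀) b (Z b) =
      (2 * Real.pi) • J (S.fibHat i y₀ b)) :
    HasDerivAt (fun t : ℝ => S.metHat C i y₀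
        (extChartAt (𝓡 m) y₀ y₀ + t • Z (extChartAt (𝓡 m) y₀ y₀))
        (W (extChartAt (𝓡 m) y₀ y₀ + t • Z (extChartAt (𝓡 m) y₀ y₀)))
        (W' (extChartAt (𝓡 m) y₀ y₀ + t • Z (extChartAt (𝓡 m) y₀ y₀))))
      (S.metHat C i y₀ (extChartAt (𝓡 m) y₀ y₀)
        (fderiv ℝ W (extChartAt (𝓡 m) y₀ y₀) (Z (extChartAt (𝓡 m) y₀ y₀)) -
          fderiv ℝ Z (extChartAt (𝓡 m) y₀ y₀) (W (extChartAt (𝓡 m) y₀ y₀)))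
        (W' (extChartAt (𝓡 m) y₀ y₀)) +
       S.metHat C i y₀ (extChartAt (𝓡 m) y₀ y₀)
        (W (extChartAt (𝓡 m) y₀ y₀))
        (fderiv ℝ W' (extChartAt (𝓡 m) y₀ y₀) (Z (extChartAt (𝓡 m) y₀ y₀)) -
          fderiv ℝ Z (extChartAt (𝓡 m) y₀ y₀) (W' (extChartAt (𝓡 m) y₀ y₀)))) 0 := by
  have hb := mem_goodSet (S := S) hy
  have hg := eventually_mem_goodSet (S := S) hy
  have hl : HasFDerivAt (D.lamHat i (S.proj y₀)) (fderiv ℝ (D.lamHat i (S.proj y₀))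
      (S.projHat y₀ (extChartAt (𝓡 m) y₀ y₀))) (S.projHat y₀ (extChartAt (𝓡 m) y₀ y₀)) := by
    rw [projHat_self hy]
    exact ((D.contDiffAt_lamHat hy).differentiableAt (by simp)).hasFDerivAt
  have hh : ContDiffAt ℝ ∞ (C.hHat (S.proj y₀)) (S.projHat y₀ (extChartAt (𝓡 m) y₀ y₀)) := by
    rw [projHat_self hy]
    exact C.contDiffAt_hHat _
  have hf0 : ∀ b ∈ S.goodSet i y₀, ⟪S.fibHat i y₀ b, S.fibHat i y₀ b⟫ = 1 :=
    fun b hb => S.inner_fib_self hb.2.2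
  have hfv : ∀ v, ⟪S.fibHat i y₀ (extChartAt (𝓡 m) y₀ y₀),
      S.vertHat i y₀ (extChartAt (𝓡 m) y₀ y₀) v⟫ = 0 := by
    intro v
    have h1 := inner_fib_vert hJ hb.2.2 (dSymm y₀ _ v)
    rwa [vert_eq_vertHat hb, dChart_dSymm hb.1] at h1
  set b₀ := extChartAt (𝓡 m) y₀ y₀
  have hp := (contDiffAt_projHat hb).differentiableAt (by simp)
  have hf := (contDiffAt_fibHat hb).differentiableAt (by simp)
  have hγ : HasDerivAt (fun t : ℝ => b₀ + t • Z b₀) (Z b₀) 0 := by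
    simpa using ((hasDerivAt_id (0 : ℝ)).smul_const (Z b₀)).const_add b₀
  have hγ0 : b₀ = b₀ + (0 : ℝ) • Z b₀ := by simp
  have dp : HasDerivAt (fun t : ℝ => S.projHat y₀ (b₀ + t • Z b₀)) 0 0 := by
    have := hp.hasFDerivAt.comp_hasDerivAt_of_eq (0 : ℝ) hγ hγ0
    rwa [hpZ _ hb] at this
  have df : HasDerivAt (fun t : ℝ => S.fibHat i y₀ (b₀ + t • Z b₀))
      ((2 * Real.pi) • J (S.fibHat i y₀ b₀)) 0 := by
    have := hf.hasFDerivAt.comp_hasDerivAt_of_eq (0 : ℝ) hγ hγ0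
    rwa [hfZ _ hb] at this
  have dJf : HasDerivAt (fun t : ℝ => J (S.fibHat i y₀ (b₀ + t • Z b₀)))
      (-((2 * Real.pi) • S.fibHat i y₀ b₀)) 0 := by
    have := J.hasFDerivAt.comp_hasDerivAt (0 : ℝ) df
    rwa [map_smul, hJ.sq, smul_neg] at this
  have dl : HasDerivAt (fun t : ℝ => D.lamHat i (S.proj y₀) (S.projHat y₀ (b₀ + t • Z b₀))) 0 0 := by
    have := hl.comp_hasDerivAt_of_eq (0 : ℝ) dp (by simp)
    rwa [map_zero] at this
  have dP : ∀ {U : EuclideanSpace ℝ (Fin m) → EuclideanSpace ℝ (Fin m)}, ContDiffAt ℝ ∞ U b₀ →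
      HasDerivAt (fun t : ℝ => fderiv ℝ (S.projHat y₀) (b₀ + t • Z b₀) (U (b₀ + t • Z b₀)))
        (fderiv ℝ (S.projHat y₀) b₀ (fderiv ℝ U b₀ (Z b₀) - fderiv ℝ Z b₀ (U b₀))) 0 := by
    intro U hU
    have := hasDerivAt_fderiv_apply (contDiffAt_projHat hb) (hU.differentiableAt (by simp))
      (hZ.differentiableAt (by simp)) (c := fun _ => 0)
      (by filter_upwards [hg] with b hb using hpZ b hb) (hasFDerivAt_const 0 b₀)
    simpa using this
  have dF : ∀ {U : EuclideanSpace ℝ (Fin m) → EuclideanSpace ℝ (Fin m)}, ContDiffAt ℝ ∞ U b₀ →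
      HasDerivAt (fun t : ℝ => fderiv ℝ (S.fibHat i y₀) (b₀ + t • Z b₀) (U (b₀ + t • Z b₀)))
        (fderiv ℝ (S.fibHat i y₀) b₀ (fderiv ℝ U b₀ (Z b₀) - fderiv ℝ Z b₀ (U b₀)) +
          (2 * Real.pi) • J (fderiv ℝ (S.fibHat i y₀) b₀ (U b₀))) 0 := by
    intro U hU
    exact hasDerivAt_fderiv_apply (contDiffAt_fibHat hb) (hU.differentiableAt (by simp))
      (hZ.differentiableAt (by simp)) (c := fun b => (2 * Real.pi) • J (S.fibHat i y₀ b))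
      (by filter_upwards [hg] with b hb using hfZ b hb)
      ((J.hasFDerivAt.comp b₀ hf.hasFDerivAt).const_smul (2 * Real.pi))
  -- Along ξ the base point is fixed and `fib` rotates with velocity 2πJ fib, so besides the bracket
  -- term `vert` acquires the infinitesimal rotation 2πJ vert.
  have dv : ∀ {U : EuclideanSpace ℝ (Fin m) → EuclideanSpace ℝ (Fin m)}, ContDiffAt ℝ ∞ U b₀ →
      HasDerivAt (fun t : ℝ => S.vertHat i y₀ (b₀ + t • Z b₀) (U (b₀ + t • Z b₀)))
        (S.vertHat i y₀ b₀ (fderiv ℝ U b₀ (Z b₀) - fderiv ℝ Z b₀ (U b₀)) +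
          (2 * Real.pi) • J (S.vertHat i y₀ b₀ (U b₀))) 0 := by
    intro U hU
    simp only [vertHat_apply]
    have := (dF hU).add (((dl.clm_apply (dP hU)).const_mul (2 * Real.pi)).smul dJf)
    refine this.congr_deriv ?_
    simp only [zero_smul, add_zero, map_add, map_smul, hJ.sq, zero_apply, zero_add]
    module
  have de : ∀ {U : EuclideanSpace ℝ (Fin m) → EuclideanSpace ℝ (Fin m)}, ContDiffAt ℝ ∞ U b₀ →
      HasDerivAt (fun t : ℝ => S.etaHat i y₀ (b₀ + t • Z b₀) (U (b₀ + t • Z b₀)))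
        (S.etaHat i y₀ b₀ (fderiv ℝ U b₀ (Z b₀) - fderiv ℝ Z b₀ (U b₀))) 0 := by
    intro U hU
    have := (dJf.inner ℝ (dv hU)).const_mul (2 * Real.pi)⁻¹
    refine this.congr_deriv ?_
    -- The rotation of J fib and the rotation of `vert` both contribute multiples of ⟨fib, vert⟩,
    -- which is zero.
    rw [zero_smul, add_zero, inner_add_right, inner_neg_left, inner_smul_left, hfv, inner_smul_right,
      hJ.inner_map, hfv]
    simp [etaHat]
  simp only [metHat_apply]
  have := ((hasDerivAt_bilin_comp hh dp (by simp) (dP hW) (dP hW')).add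
    (((dv hW).inner ℝ (dv hW')).const_mul Real.pi⁻¹)).add
    (((de hW).mul (de hW')).const_mul (1 - 4 * Real.pi))
  refine this.congr_deriv ?_
  -- The two rotation terms of the inner product of vertical parts cancel because J is skew.
  simp only [zero_smul, add_zero, inner_add_left, inner_add_right, inner_smul_left, inner_smul_right,
    hJ.inner_left, conj_trivial]
  ring

variable (S C)

omit hJ in
theorem isVonNBounded_of_pos {E : Type*} [NormedAddCommGroup E] [NormedSpace ℝ E]
    [FiniteDimensional ℝ E] (B : E →L[ℝ] E →L[ℝ] ℝ) (hB : ∀ v, v ≠ 0 → 0 < B v v) :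
    Bornology.IsVonNBounded ℝ {v | B v v < 1} := by
  rw [NormedSpace.isVonNBounded_iff]
  obtain ⟨c, hc, hcB⟩ := exists_coercive B hB
  refine (Metric.isBounded_closedBall (x := (0 : E)) (r := √c⁻¹)).subset fun v hv => ?_
  rw [mem_closedBall_zero_iff]
  refine Real.le_sqrt_of_sq_le ?_
  have hv' : B v v < 1 := hv
  rw [inv_eq_one_div, le_div_iff₀ hc]
  linarith [hcB v]

/-- The K-contact structure on a sphere bundle. -/
def kContact : KContactStructure m Y where
  η := S.eta
  ξ y := S.xiAt (D.idx (S.proj y)) y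
  φ y := S.phiAt C (D.idx (S.proj y)) y
  g :=
    { inner := fun y => S.metAt C (D.idx (S.proj y)) y
      symm := fun y => metAt_symm hJ
      pos := fun y _ => metAt_pos hJ (D.mem_idx _)
      isVonNBounded := fun y => isVonNBounded_of_pos (E := EuclideanSpace ℝ (Fin m))
        (S.metAt C (D.idx (S.proj y)) y) fun _ => metAt_pos hJ (D.mem_idx _)
      contMDiff := by
        refine contMDiff_bilin_iff.2 fun y₀ v w => ?_
        have hy := D.mem_idx (S.proj y₀)
        refine (contDiffAt_metHat (C := C) hy (contDiffAt_const (c := v)) (contDiffAt_const (c := w))).congr_of_eventuallyEq ?_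
        filter_upwards [eventually_mem_goodSet hy] with b hb
        rw [metAt_change hJ ⟨hb.2.2, D.mem_idx _⟩, metAt_eq_metHat hb, dChart_dSymm hb.1,
          dChart_dSymm hb.1] }
  smooth_η := smoothOn_eta hJ
  smooth_ξ := by
    refine (smoothVectorField_iff _).2 fun y₀ => ?_
    have hy := D.mem_idx (S.proj y₀)
    refine (contDiffAt_dChart_xiAt hy).congr_of_eventuallyEq ?_
    filter_upwards [eventually_mem_goodSet hy] with b hb
    rw [xiAt_change hJ ⟨hb.2.2, D.mem_idx _⟩]
  smooth_φ := by
    refine contMDiff_endo fun y₀ v => ?_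
    have hy := D.mem_idx (S.proj y₀)
    refine (contDiffAt_dChart_phiAt (C := C) hy v).congr_of_eventuallyEq ?_
    filter_upwards [eventually_mem_goodSet hy] with b hb
    rw [phiAt_change hJ ⟨hb.2.2, D.mem_idx _⟩]
  η_ξ y := (eta_apply hJ (D.mem_idx _) _).trans (etaAt_xiAt hJ (D.mem_idx _))
  φ_sq y v := (phiAt_sq hJ (D.mem_idx _) v).trans
    (by rw [eta_apply hJ (D.mem_idx _)]; rfl)
  compatible y v w := (metAt_phiAt hJ (D.mem_idx _) v w).trans
    (by rw [eta_apply hJ (D.mem_idx _), eta_apply hJ (D.mem_idx _)]; rfl)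
  contact_metric y v w := (metAt_phiAt_left hJ (D.mem_idx _) v w).trans
    (by rw [extD_eta hJ (D.mem_idx _), inner_J_vert_vert hJ (D.mem_idx _)])
  killing W W' hW hW' y₀ := by
    have hy := D.mem_idx (S.proj y₀)
    -- The index is frozen at `y₀`: near `y₀` the tensors computed with the varying index agree with
    -- those computed with `i`, so bracket and derivative may use `i` throughout.
    set i := D.idx (S.proj y₀) with hi
    have hb := mem_goodSet (S := S) hy
    have key := fderiv_metHat (C := C) (S := S) hJ hy (W := fieldHat y₀ W) (W' := fieldHat y₀ W')
      (Z := fieldHat y₀ fun y => S.xiAt i y)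
      ((smoothVectorField_iff W).1 hW y₀) ((smoothVectorField_iff W').1 hW' y₀)
      (contDiffAt_dChart_xiAt hy)
      (fun b hb => by
        rw [fieldHat, ← dChart_dproj hb, dproj_xiAt hJ hb.2.2, map_zero])
      (fun b hb => by
        rw [fieldHat, ← dfib_eq_fibHat hb, dfib_xiAt hJ hb.2.2]
        rfl)
    have hξ : fieldHat y₀ (fun y => S.xiAt (D.idx (S.proj y)) y)
        =ᶠ[𝓝 (extChartAt (𝓡 m) y₀ y₀)] fieldHat y₀ (fun y => S.xiAt i y) := by
      filter_upwards [eventually_mem_goodSet hy] with b hb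
      rw [fieldHat, fieldHat, xiAt_change hJ ⟨hb.2.2, D.mem_idx _⟩]
    have hself : ∀ Z : ∀ y : Y, TangentSpace (𝓡 m) y,
        fieldHat y₀ Z (extChartAt (𝓡 m) y₀ y₀) = dChart y₀ y₀ (Z y₀) := by
      intro Z
      have h : ∀ y, y = y₀ → (dChart y₀ y (Z y) : EuclideanSpace ℝ (Fin m)) = dChart y₀ y₀ (Z y₀) := by
        rintro _ rfl; rfl
      exact h _ (extChartAt_to_inv y₀)
    have hG := contDiffAt_metHat (C := C) (S := S) hy ((smoothVectorField_iff W).1 hW y₀)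
      ((smoothVectorField_iff W').1 hW' y₀)
    have h1 := mfderiv_comp_fderiv (I := 𝓡 m) (f := extChartAt (𝓡 m) y₀)
      (h := fun y => S.metAt C (D.idx (S.proj y)) y (W y) (W' y)) (x := y₀) ?_ rfl
      (hG.differentiableAt (by simp)).hasFDerivAt
      (DForm.mdifferentiableAt_chart (mem_extChartAt_source y₀)) (S.xiAt i y₀)
    · have h3 : HasDerivAt (fun t : ℝ => extChartAt (𝓡 m) y₀ y₀ +
          t • fieldHat y₀ (fun y => S.xiAt i y) (extChartAt (𝓡 m) y₀ y₀))
          (fieldHat y₀ (fun y => S.xiAt i y) (extChartAt (𝓡 m) y₀ y₀)) 0 := by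
        simpa using ((hasDerivAt_id (0 : ℝ)).smul_const _).const_add (extChartAt (𝓡 m) y₀ y₀)
      have h4 := (hG.differentiableAt (by simp)).hasFDerivAt.comp_hasDerivAt_of_eq (0 : ℝ) h3 (by simp)
      -- `h4` (chain rule) and `key` (explicit computation) give the derivative of the same function
      -- along the line in the direction of ξ.
      refine h1.trans ((congrArg _ (hself fun y => S.xiAt i y)).symm.trans ((h4.unique key).trans ?_))
      rw [metAt_eq_metHat_self hy, metAt_eq_metHat_self hy, dChart_mlieBracket, dChart_mlieBracket,
        hξ.fderiv_eq, hξ.self_of_nhds, hself W, hself W']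
    · have hs : ∀ᶠ y in 𝓝 y₀, S.proj y ∈ D.U i ∧ y ∈ (extChartAt (𝓡 m) y₀).source ∧
          extChartAt (𝓡 m) y₀ y ∈ S.goodSet i y₀ :=
        (S.eventually_mem hy).and (Filter.Eventually.and (extChartAt_source_mem_nhds (I := 𝓡 m) y₀)
            ((continuousAt_extChartAt y₀).eventually (eventually_mem_goodSet hy)))
      filter_upwards [hs] with y hy'
      have e := metAt_eq_metHat (C := C) hy'.2.2 (W _) (W' _)
      rw [metAt_change hJ ⟨hy'.1, D.mem_idx _⟩]
      have h : ∀ y', y' = y → S.metAt C i y' (W y') (W' y') = S.metAt C i y (W y) (W' y) := by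
        rintro _ rfl; rfl
      exact (h _ ((extChartAt (𝓡 m) y₀).left_inv hy'.2.1)).symm.trans e

end SphereFibration

end

/-! ### Gluing a smooth structure from local homeomorphisms. -/

noncomputable section

/-- A family of local homeomorphisms from a space to a manifold, with smooth transition maps. -/
structure SmoothGluing {E H : Type*} [NormedAddCommGroup E] [NormedSpace ℝ E] [TopologicalSpace H]
    (I : ModelWithCorners ℝ E H) (N : Type*) [TopologicalSpace N] [ChartedSpace H N]
    (Y : Type*) [TopologicalSpace Y] where
  ι : Type*
  T : ι → OpenPartialHomeomorph Y N
  exists_mem : ∀ y, ∃ i, y ∈ (T i).source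
  smooth : ∀ i j, ContMDiffOn I I ∞ (T j ∘ (T i).symm) ((T i).symm.trans (T j)).source

namespace SmoothGluing

variable {E H : Type*} [NormedAddCommGroup E] [NormedSpace ℝ E] [TopologicalSpace H]
    {I : ModelWithCorners ℝ E H} [I.Boundaryless] {N : Type*} [TopologicalSpace N] [ChartedSpace H N]
    {Y : Type*} [TopologicalSpace Y] (A : SmoothGluing I N Y)
    {F : Type*} [NormedAddCommGroup F] [NormedSpace ℝ F] (L : E ≃L[ℝ] F)

/-- An index whose domain contains the given point. -/
def idx (y : Y) : A.ι := (A.exists_mem y).choose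

theorem mem_idx (y : Y) : y ∈ (A.T (A.idx y)).source := (A.exists_mem y).choose_spec

/-- The chart at a point. -/
def chart (y : Y) : OpenPartialHomeomorph Y F :=
  -- `L` changes the model vector space. For a bundle it identifies ℝⁿ × ℝᵏ with ℝⁿ⁺ᵏ.
  (A.T (A.idx y)).trans ((chartAt H (A.T (A.idx y) y)).trans
    (I.toHomeomorph.trans L.toHomeomorph).toOpenPartialHomeomorph)

theorem chart_apply (y z : Y) :
    A.chart L y z = L (extChartAt I (A.T (A.idx y) y) (A.T (A.idx y) z)) := rfl

theorem chart_symm_apply (y : Y) (b : F) :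
    (A.chart L y).symm b =
      (A.T (A.idx y)).symm ((extChartAt I (A.T (A.idx y) y)).symm (L.symm b)) := rfl

theorem mem_source_chart {y z : Y} : z ∈ (A.chart L y).source ↔
    z ∈ (A.T (A.idx y)).source ∧ A.T (A.idx y) z ∈ (chartAt H (A.T (A.idx y) y)).source := by
  simp [chart]

theorem mem_chart_target {y : Y} {b : F} : b ∈ (A.chart L y).target ↔
    L.symm b ∈ (extChartAt I (A.T (A.idx y) y)).target ∧
    (extChartAt I (A.T (A.idx y) y)).symm (L.symm b) ∈ (A.T (A.idx y)).target := by
  simp [chart, extChartAt, I.range_eq_univ]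

/-- The glued charted space. -/
@[reducible] def chartedSpace : ChartedSpace F Y where
  atlas := range (A.chart L)
  chartAt := A.chart L
  mem_chart_source y := (A.mem_source_chart L).2 ⟨A.mem_idx y, mem_chart_source _ _⟩
  chart_mem_atlas y := ⟨y, rfl⟩

variable [IsManifold I ∞ N]

theorem isManifold : letI := A.chartedSpace L; IsManifold 𝓘(ℝ, F) ∞ Y := by
  let := A.chartedSpace L
  refine isManifold_of_contDiffOn 𝓘(ℝ, F) ∞ Y ?_
  rintro _ _ ⟨y, rfl⟩ ⟨y', rfl⟩
  simp only [modelWithCornersSelf_coe, modelWithCornersSelf_coe_symm, Function.id_comp,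
    Function.comp_id, preimage_id, range_id, inter_univ]
  rw [← contMDiffOn_iff_contDiffOn]
  intro b hb
  simp only [OpenPartialHomeomorph.trans_source, OpenPartialHomeomorph.symm_source, mem_inter_iff,
    mem_preimage, mem_chart_target, mem_source_chart] at hb
  rw [chart_symm_apply] at hb
  obtain ⟨⟨h1, h2⟩, h3, h4⟩ := hb
  refine ContMDiffAt.contMDiffWithinAt ?_
  have e1 : ContMDiffAt 𝓘(ℝ, F) 𝓘(ℝ, E) ∞ L.symm b := L.symm.contDiff.contMDiff b
  have e2 : ContMDiffAt 𝓘(ℝ, E) I ∞ (extChartAt I (A.T (A.idx y) y)).symm (L.symm b) :=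
    (contMDiffOn_extChartAt_symm _).contMDiffAt ((isOpen_extChartAt_target _).mem_nhds h1)
  have e3 := (A.smooth (A.idx y) (A.idx y')).contMDiffAt
    ((OpenPartialHomeomorph.open_source _).mem_nhds
      (show (extChartAt I (A.T (A.idx y) y)).symm (L.symm b) ∈ _ by
        rw [OpenPartialHomeomorph.trans_source]; exact ⟨h2, h3⟩))
  have e4 : ContMDiffAt I 𝓘(ℝ, E) ∞ (extChartAt I (A.T (A.idx y') y')) _ :=
    (contMDiffOn_extChartAt (x := (A.T (A.idx y') y'))).contMDiffAt ((chartAt H _).open_source.mem_nhds h4)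
  have e5 := e4.comp b (e3.comp b (e2.comp b e1))
  exact L.contDiff.contMDiff.contMDiffAt.comp b e5

theorem contMDiffOn_T (i : A.ι) : letI := A.chartedSpace L;
    ContMDiffOn 𝓘(ℝ, F) I ∞ (A.T i) (A.T i).source := by
  let := A.chartedSpace L
  have := A.isManifold L
  intro z hz
  refine ContMDiffAt.contMDiffWithinAt ?_
  have e1 : ContMDiffAt 𝓘(ℝ, F) 𝓘(ℝ, F) ∞ (A.chart L z) z := contMDiffAt_extChartAt (x := z)
  have e2 : ContMDiffAt 𝓘(ℝ, F) 𝓘(ℝ, E) ∞ L.symm (A.chart L z z) := L.symm.contDiff.contMDiff _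
  have h0 : L.symm (A.chart L z z) = extChartAt I (A.T (A.idx z) z) (A.T (A.idx z) z) := by
    rw [chart_apply, L.symm_apply_apply]
  have e3 : ContMDiffAt 𝓘(ℝ, E) I ∞ (extChartAt I (A.T (A.idx z) z)).symm (L.symm (A.chart L z z)) := by
    rw [h0]
    exact (contMDiffOn_extChartAt_symm _).contMDiffAt
      ((isOpen_extChartAt_target _).mem_nhds (mem_extChartAt_target _))
  have h1 : (extChartAt I (A.T (A.idx z) z)).symm (L.symm (A.chart L z z)) = A.T (A.idx z) z := by
    rw [h0, extChartAt_to_inv]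
  have e4 : ContMDiffAt I I ∞ (A.T i ∘ (A.T (A.idx z)).symm)
      ((extChartAt I (A.T (A.idx z) z)).symm (L.symm (A.chart L z z))) := by
    rw [h1]
    refine (A.smooth (A.idx z) i).contMDiffAt ((OpenPartialHomeomorph.open_source _).mem_nhds ?_)
    rw [OpenPartialHomeomorph.trans_source]
    refine ⟨(A.T (A.idx z)).map_source (A.mem_idx z), ?_⟩
    rw [mem_preimage, (A.T (A.idx z)).left_inv (A.mem_idx z)]
    exact hz
  refine (e4.comp z (e3.comp z (e2.comp z e1))).congr_of_eventuallyEq ?_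
  filter_upwards [(A.chart L z).open_source.mem_nhds (mem_chart_source F z)] with y hy
  have hy' := (A.mem_source_chart L).1 hy
  simp only [Function.comp_apply]
  rw [← A.chart_symm_apply L z, (A.chart L z).left_inv hy]

theorem contMDiffOn_T_symm (i : A.ι) : letI := A.chartedSpace L;
    ContMDiffOn I 𝓘(ℝ, F) ∞ (A.T i).symm (A.T i).target := by
  let := A.chartedSpace L
  have := A.isManifold L
  intro p hp
  refine ContMDiffAt.contMDiffWithinAt ?_
  obtain ⟨z, hz, rfl⟩ : ∃ z ∈ (A.T i).source, A.T i z = p :=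
    ⟨_, (A.T i).map_target hp, (A.T i).right_inv hp⟩
  have h1 : (A.T i).symm (A.T i z) = z := (A.T i).left_inv hz
  have e1 : ContMDiffAt I I ∞ (A.T (A.idx z) ∘ (A.T i).symm) (A.T i z) := by
    refine (A.smooth i (A.idx z)).contMDiffAt ((OpenPartialHomeomorph.open_source _).mem_nhds ?_)
    rw [OpenPartialHomeomorph.trans_source]
    refine ⟨hp, ?_⟩
    rw [mem_preimage, h1]
    exact A.mem_idx z
  have e2 : ContMDiffAt I 𝓘(ℝ, E) ∞ (extChartAt I (A.T (A.idx z) z))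
      ((A.T (A.idx z) ∘ (A.T i).symm) (A.T i z)) := by
    rw [Function.comp_apply, h1]
    exact contMDiffAt_extChartAt
  have e3 := L.contDiff.contMDiff.contMDiffAt.comp _ (e2.comp _ e1)
  have h2 : L (extChartAt I (A.T (A.idx z) z) ((A.T (A.idx z) ∘ (A.T i).symm) (A.T i z))) =
      A.chart L z z := by
    rw [Function.comp_apply, h1]; rfl
  have e4 : ContMDiffAt 𝓘(ℝ, F) 𝓘(ℝ, F) ∞ (A.chart L z).symm
      (L (extChartAt I (A.T (A.idx z) z) ((A.T (A.idx z) ∘ (A.T i).symm) (A.T i z)))) := by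
    rw [h2]
    exact (contMDiffOn_extChartAt_symm z).contMDiffAt
      ((isOpen_extChartAt_target z).mem_nhds (mem_extChartAt_target z))
  refine (ContMDiffAt.comp (A.T i z) (f := L ∘ extChartAt I (A.T (A.idx z) z) ∘ A.T (A.idx z) ∘ (A.T i).symm)
    e4 e3).congr_of_eventuallyEq ?_
  have hc : ContinuousAt (A.T i).symm (A.T i z) := (A.T i).continuousAt_symm hp
  filter_upwards [hc ((A.chart L z).open_source.mem_nhds
    (show (A.T i).symm (A.T i z) ∈ (A.chart L z).source by rw [h1]; exact mem_chart_source F z))]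
    with q hq
  exact ((A.chart L z).left_inv hq).symm

end SmoothGluing

end

/-! ### Spheres as fibres and the smooth structure of a sphere bundle. -/

noncomputable section

open scoped RealInnerProductSpace

/-- A manifold identified with the unit sphere of `V`, through the inclusion and the radial
retraction. -/
structure SphereModel (k : ℕ) (F : Type*) [TopologicalSpace F]
    [ChartedSpace (EuclideanSpace ℝ (Fin k)) F] (V : Type*) [NormedAddCommGroup V]
    [NormedSpace ℝ V] where
  coe : F → V
  nrm : V → F
  norm_coe : ∀ u, ‖coe u‖ = 1
  coe_nrm : ∀ v, v ≠ 0 → coe (nrm v) = ‖v‖⁻¹ • v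
  nrm_coe : ∀ u, nrm (coe u) = u
  smooth_coe : ContMDiff (𝓡 k) 𝓘(ℝ, V) ∞ coe
  smooth_nrm : ContMDiffOn 𝓘(ℝ, V) (𝓡 k) ∞ nrm {0}ᶜ

section sphere

variable {k : ℕ} {V : Type*} [NormedAddCommGroup V] [InnerProductSpace ℝ V]
  [Fact (Module.finrank ℝ V = k + 1)]

/-- The chart at `f x` is stereographic projection from the antipode, given by a formula that is
smooth on the ambient space near `f x`. It can therefore be composed with the ambient map. -/
theorem contMDiffAt_sphere {E H M : Type*} [NormedAddCommGroup E] [NormedSpace ℝ E]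
    [TopologicalSpace H] {I : ModelWithCorners ℝ E H} [TopologicalSpace M] [ChartedSpace H M]
    {f : M → Metric.sphere (0 : V) 1} {x : M}
    (hf : ContMDiffAt I 𝓘(ℝ, V) ∞ (fun y => (f y : V)) x) : ContMDiffAt I (𝓡 k) ∞ f x := by
  rw [contMDiffAt_iff_target]
  refine ⟨Topology.IsInducing.subtypeVal.continuousAt_iff.2 hf.continuousAt, ?_⟩
  let U := (OrthonormalBasis.fromOrthogonalSpanSingleton (𝕜 := ℝ) k
    (ne_zero_of_mem_unit_sphere (-(f x)))).repr
  have h1 : ContDiffAt ℝ ∞ (U ∘ stereoToFun (-(f x : V))) (f x : V) := by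
    refine U.contDiff.contDiffAt.comp _ (contDiffOn_stereoToFun.contDiffAt (IsOpen.mem_nhds ?_ ?_))
    · exact isOpen_ne_fun (by fun_prop) continuous_const
    · simp
      norm_num
  exact ContMDiffAt.comp x (f := fun y => (f y : V)) h1.contMDiffAt hf

theorem nonempty_sphere (V : Type*) [NormedAddCommGroup V] [InnerProductSpace ℝ V] (k : ℕ)
    [h : Fact (Module.finrank ℝ V = k + 1)] : Nonempty (Metric.sphere (0 : V) 1) := by
  have h1 := h.out
  have : Nontrivial V := Module.nontrivial_of_finrank_pos (R := ℝ) (by omega)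
  exact (NormedSpace.sphere_nonempty.2 zero_le_one).to_subtype

open Classical in
/-- The radial retraction onto the unit sphere. -/
def sphereNrm [Nonempty (Metric.sphere (0 : V) 1)] (v : V) : Metric.sphere (0 : V) 1 :=
  if h : v = 0 then Classical.arbitrary _ else ⟨‖v‖⁻¹ • v, by simp [norm_smul, h]⟩

theorem coe_sphereNrm [Nonempty (Metric.sphere (0 : V) 1)] {v : V} (h : v ≠ 0) :
    (sphereNrm v : V) = ‖v‖⁻¹ • v := by
  simp [sphereNrm, h]

variable (V) in
/-- The unit sphere. -/
def sphereModel [Nonempty (Metric.sphere (0 : V) 1)] :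
    SphereModel k (Metric.sphere (0 : V) 1) V where
  coe := (↑)
  nrm := sphereNrm
  norm_coe u := by simp
  coe_nrm v hv := coe_sphereNrm hv
  nrm_coe u := by
    refine Subtype.ext ?_
    rw [coe_sphereNrm (ne_zero_of_mem_unit_sphere u)]
    simp
  smooth_coe := contMDiff_coe_sphere
  smooth_nrm v hv := by
    refine (contMDiffAt_sphere ?_).contMDiffWithinAt
    have h1 : ContDiffAt ℝ ∞ (fun v : V => ‖v‖⁻¹ • v) v := by
      have : ContDiffAt ℝ ∞ (fun v : V => ‖v‖) v := contDiffAt_norm ℝ hv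
      exact (this.inv (by simpa using hv)).smul contDiffAt_id
    refine h1.contMDiffAt.congr_of_eventuallyEq ?_
    filter_upwards [isOpen_compl_singleton.mem_nhds hv] with w hw using coe_sphereNrm hw

end sphere

instance : Nonempty (Metric.sphere (0 : ℂ) 1) := ⟨⟨1, by simp⟩⟩

instance : Nonempty S3 := nonempty_sphere _ 3

attribute [local instance] finrank_real_complex_fact' in
/-- The circle group as a unit sphere. -/
def circleModel : SphereModel 1 Circle ℂ := sphereModel ℂ

theorem circleModel_coe (z : Circle) : circleModel.coe z = z := rfl

variable {n m k : ℕ} {X : Type u} [TopologicalSpace X] [ChartedSpace (EuclideanSpace ℝ (Fin n)) X]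
  {Ω : DForm n 2 X} {V : Type*} [NormedAddCommGroup V] [InnerProductSpace ℝ V]
  {F : Type*} [TopologicalSpace F] [ChartedSpace (EuclideanSpace ℝ (Fin k)) F]

/-- Local trivializations of a sphere bundle whose transition maps are the rotations given by an
integral cocycle. -/
structure SphereAtlas (D : IntegralCocycle Ω) (R : SphereModel k F V) (J : V →L[ℝ] V)
    (Y : Type u) [TopologicalSpace Y] where
  proj : Y → X
  T : D.ι → Trivialization F proj
  baseSet_T : ∀ i, (T i).baseSet = D.U i
  change : ∀ i j y, proj y ∈ D.U i ∩ D.U j → R.coe (T j y).2 =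
    Real.cos (2 * Real.pi * D.f i j (proj y)) • R.coe (T i y).2 -
      Real.sin (2 * Real.pi * D.f i j (proj y)) • J (R.coe (T i y).2)

namespace SphereAtlas

variable {D : IntegralCocycle Ω} {R : SphereModel k F V} {J : V →L[ℝ] V}
  {Y : Type u} [TopologicalSpace Y] (A : SphereAtlas D R J Y)

theorem mem_source {i : D.ι} {y : Y} : y ∈ (A.T i).source ↔ A.proj y ∈ D.U i := by
  rw [(A.T i).mem_source, A.baseSet_T]

theorem mem_target {i : D.ι} {p : X × F} : p ∈ (A.T i).target ↔ p.1 ∈ D.U i := by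
  rw [(A.T i).mem_target, A.baseSet_T]

theorem T_apply {i : D.ι} {y : Y} (hy : A.proj y ∈ D.U i) : A.T i y = (A.proj y, (A.T i y).2) :=
  Prod.ext ((A.T i).coe_fst (A.mem_source.2 hy)) rfl

theorem proj_symm {i : D.ι} {p : X × F} (hp : p.1 ∈ D.U i) :
    A.proj ((A.T i).toOpenPartialHomeomorph.symm p) = p.1 :=
  (A.T i).proj_symm_apply (A.mem_target.2 hp)

theorem T_symm {i : D.ι} {p : X × F} (hp : p.1 ∈ D.U i) :
    A.T i ((A.T i).toOpenPartialHomeomorph.symm p) = p :=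
  (A.T i).apply_symm_apply (A.mem_target.2 hp)

theorem symm_T {i : D.ι} {y : Y} (hy : A.proj y ∈ D.U i) :
    (A.T i).toOpenPartialHomeomorph.symm (A.T i y) = y :=
  (A.T i).toOpenPartialHomeomorph.left_inv (A.mem_source.2 hy)

/-- The smooth gluing underlying an atlas of a sphere bundle. -/
def gluing : SmoothGluing ((𝓡 n).prod (𝓡 k)) (X × F) Y where
  ι := D.ι
  T i := (A.T i).toOpenPartialHomeomorph
  exists_mem y := ⟨D.idx (A.proj y), A.mem_source.2 (D.mem_idx _)⟩
  smooth i j := by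
    rintro ⟨x, u⟩ hp
    rw [OpenPartialHomeomorph.trans_source] at hp
    have hi : x ∈ D.U i := A.mem_target.1 hp.1
    have hj : x ∈ D.U j := by
      have := A.mem_source.1 hp.2
      rwa [A.proj_symm hi] at this
    refine ContMDiffAt.contMDiffWithinAt ?_
    have hf : ContMDiffAt ((𝓡 n).prod (𝓡 k)) 𝓘(ℝ, ℝ) ∞ (fun p : X × F => D.f i j p.1) (x, u) :=
      ContMDiffAt.comp (x, u) ((D.smooth_f i j).contMDiffAt
        (((D.isOpen_U i).inter (D.isOpen_U j)).mem_nhds ⟨hi, hj⟩)) contMDiffAt_fst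
    have hu : ContMDiffAt ((𝓡 n).prod (𝓡 k)) 𝓘(ℝ, V) ∞ (fun p : X × F => R.coe p.2) (x, u) :=
      R.smooth_coe.contMDiffAt.comp (x, u) contMDiffAt_snd
    have hr : ContDiff ℝ ∞ (fun q : ℝ × V => Real.cos (2 * Real.pi * q.1) • q.2 -
        Real.sin (2 * Real.pi * q.1) • J q.2) := by fun_prop
    have hc := hr.contMDiff.contMDiffAt.comp (x, u) (hf.prodMk_space hu)
    have hev : ∀ᶠ p in 𝓝 (x, u), p.1 ∈ D.U i ∩ D.U j :=
      (continuous_fst.tendsto (x, u)) (((D.isOpen_U i).inter (D.isOpen_U j)).mem_nhds ⟨hi, hj⟩)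
    have heq : ∀ p : X × F, p.1 ∈ D.U i ∩ D.U j →
        R.coe (A.T j ((A.T i).toOpenPartialHomeomorph.symm p)).2 =
        Real.cos (2 * Real.pi * D.f i j p.1) • R.coe p.2 -
          Real.sin (2 * Real.pi * D.f i j p.1) • J (R.coe p.2) := by
      intro p hp
      rw [A.change i j _ (by rw [A.proj_symm hp.1]; exact hp), A.T_symm hp.1, A.proj_symm hp.1]
    -- The rotated vector is the fibre coordinate in the second trivialization, hence of norm one,
    -- so the radial retraction is smooth there.
    have hne : Real.cos (2 * Real.pi * D.f i j x) • R.coe u -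
          Real.sin (2 * Real.pi * D.f i j x) • J (R.coe u) ≠ 0 := by
      rw [← heq (x, u) ⟨hi, hj⟩]
      intro h
      simpa [h] using R.norm_coe (A.T j ((A.T i).toOpenPartialHomeomorph.symm (x, u))).2
    have hn := ContMDiffAt.comp (x, u) (f := fun p : X × F =>
        Real.cos (2 * Real.pi * D.f i j p.1) • R.coe p.2 -
          Real.sin (2 * Real.pi * D.f i j p.1) • J (R.coe p.2))
      (R.smooth_nrm.contMDiffAt (isOpen_compl_singleton.mem_nhds hne)) hc
    refine (contMDiffAt_fst.prodMk hn).congr_of_eventuallyEq ?_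
    filter_upwards [hev] with p hp
    have h2 := A.T_apply (i := j) (y := (A.T i).toOpenPartialHomeomorph.symm p)
      (by rw [A.proj_symm hp.1]; exact hp.2)
    refine h2.trans (Prod.ext (A.proj_symm hp.1) ?_)
    rw [Function.comp_apply, ← heq p hp, R.nrm_coe]

variable [IsManifold (𝓡 n) ∞ X] [IsManifold (𝓡 k) ∞ F]

/-- The charted space structure of a sphere bundle. -/
@[reducible] def chartedSpace : ChartedSpace (EuclideanSpace ℝ (Fin (n + k))) Y :=
  A.gluing.chartedSpace EuclideanSpace.finAddEquivProd.symm

theorem isManifold : letI := A.chartedSpace; IsManifold (𝓡 (n + k)) ∞ Y :=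
  A.gluing.isManifold EuclideanSpace.finAddEquivProd.symm

theorem contMDiffOn_T (i : D.ι) : letI := A.chartedSpace;
    ContMDiffOn (𝓡 (n + k)) ((𝓡 n).prod (𝓡 k)) ∞ (A.T i) (A.T i).source :=
  A.gluing.contMDiffOn_T EuclideanSpace.finAddEquivProd.symm i

theorem contMDiffOn_T_symm (i : D.ι) : letI := A.chartedSpace;
    ContMDiffOn ((𝓡 n).prod (𝓡 k)) (𝓡 (n + k)) ∞ (A.T i).toOpenPartialHomeomorph.symm
      (A.T i).target :=
  A.gluing.contMDiffOn_T_symm EuclideanSpace.finAddEquivProd.symm i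

/-- An atlas of a sphere bundle gives a sphere fibration. -/
def fibration : letI := A.chartedSpace; SphereFibration D (n + k) Y J :=
  letI := A.chartedSpace
  { proj := A.proj
    fib := fun i y => R.coe (A.T i y).2
    par := fun i p => (A.T i).toOpenPartialHomeomorph.symm (p.1, R.nrm p.2)
    smooth_proj := by
      intro y
      have hy := D.mem_idx (A.proj y)
      have h1 := (A.contMDiffOn_T (D.idx (A.proj y))).contMDiffAt
        ((A.T _).open_source.mem_nhds (A.mem_source.2 hy))
      refine (contMDiffAt_fst.comp y h1).congr_of_eventuallyEq ?_
      filter_upwards [(A.T _).open_source.mem_nhds (A.mem_source.2 hy)] with z hz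
        using ((A.T _).coe_fst hz).symm
    smooth_fib := by
      intro i y hy
      have h1 := (A.contMDiffOn_T i).contMDiffAt ((A.T _).open_source.mem_nhds (A.mem_source.2 hy))
      exact (R.smooth_coe.contMDiffAt.comp y (contMDiffAt_snd.comp y h1)).contMDiffWithinAt
    norm_fib := fun i y _ => R.norm_coe _
    smooth_par := by
      rintro i ⟨x, v⟩ ⟨hx, hv⟩
      refine ContMDiffAt.contMDiffWithinAt ?_
      have h1 : ContMDiffAt ((𝓡 n).prod 𝓘(ℝ, V)) ((𝓡 n).prod (𝓡 k)) ∞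
          (fun p : X × V => (p.1, R.nrm p.2)) (x, v) :=
        contMDiffAt_fst.prodMk (ContMDiffAt.comp (x, v)
          (R.smooth_nrm.contMDiffAt (isOpen_compl_singleton.mem_nhds hv)) contMDiffAt_snd)
      exact ContMDiffAt.comp (x, v) ((A.contMDiffOn_T_symm i).contMDiffAt
        ((A.T i).open_target.mem_nhds (A.mem_target.2 hx))) h1
    proj_par := fun i x v hx hv => A.proj_symm hx
    fib_par := fun i x v hx hv => by
      rw [A.T_symm hx, R.coe_nrm v hv]
    par_fib := fun i y hy => by
      rw [R.nrm_coe, ← A.T_apply hy, A.symm_T hy]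
    fib_change := A.change }

end SphereAtlas

end

/-! ### The circle bundle of an integral cocycle and its connection. -/

noncomputable section

open scoped RealInnerProductSpace

section complexStructure

variable (W : Type*) [NormedAddCommGroup W] [InnerProductSpace ℝ W] [NormedSpace ℂ W]
  [IsScalarTower ℝ ℂ W]

/-- Multiplication by `i`. -/
def mulI : W →L[ℝ] W := (Complex.I • ContinuousLinearMap.id ℂ W).restrictScalars ℝ

variable {W}

theorem mulI_apply (w : W) : mulI W w = Complex.I • w := rfl

/-- Unit complex numbers act by isometries. -/
theorem inner_smul_smul_of_norm_eq_one {c : ℂ} (hc : ‖c‖ = 1) (a b : W) :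
    ⟪c • a, c • b⟫ = ⟪a, b⟫ := by
  have h1 := norm_sub_sq_real (c • a) (c • b)
  rw [← smul_sub, norm_smul, norm_smul, norm_smul, hc, one_mul, one_mul, one_mul,
    norm_sub_sq_real] at h1
  linarith

theorem isComplexStructure_mulI : IsComplexStructure (mulI W) where
  inner_map a b := inner_smul_smul_of_norm_eq_one (by simp) a b
  sq a := by simp [mulI_apply, smul_smul]

/-- Identifies the abstract rotation used in sphere fibrations with multiplication by a unit complex
number, which is how the transition functions act on the circle and on S³. -/
theorem exp_smul_eq (t : ℝ) (w : W) :
    (Circle.exp (-t) : ℂ) • w = Real.cos t • w - Real.sin t • mulI W w := by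
  rw [mulI_apply, ← algebraMap_smul ℂ (Real.cos t), ← algebraMap_smul ℂ (Real.sin t), smul_smul,
    ← sub_smul]
  congr 1
  rw [Circle.coe_exp, Complex.exp_mul_I]
  push_cast
  simp [sub_eq_add_neg]

end complexStructure

/-- The tangent space of the circle at `u` is a line, and an area form vanishes on a line. The
coefficients below are an algebraic certificate of this. -/
theorem Complex.inner_I_mul_eq_zero {u a b : ℂ} (hu : ⟪u, u⟫ = 1) (ha : ⟪u, a⟫ = 0)
    (hb : ⟪u, b⟫ = 0) : ⟪Complex.I * a, b⟫ = 0 := by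
  simp only [Complex.inner, Complex.mul_re, Complex.mul_im, Complex.conj_re, Complex.conj_im,
    Complex.I_re, Complex.I_im] at *
  linear_combination (b.re * a.im - a.re * b.im) * hu + (u.re * b.im - u.im * b.re) * ha +
    (u.im * a.re - u.re * a.im) * hb

theorem Circle.exp_eq_of_int {a b : ℝ} {r : ℤ} (h : a - b = r) :
    Circle.exp (-(2 * Real.pi * a)) = Circle.exp (-(2 * Real.pi * b)) := by
  have h1 : -(2 * Real.pi * a) = -(2 * Real.pi * b) + (-r : ℤ) * (2 * Real.pi) := by
    push_cast
    linear_combination -(2 * Real.pi) * h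
  rw [h1, Circle.exp_add, Circle.exp_intCast_mul]
  simp

variable {n : ℕ} {X : Type u} [TopologicalSpace X] [ChartedSpace (EuclideanSpace ℝ (Fin n)) X]
  {Ω : DForm n 2 X} (D : IntegralCocycle Ω)

namespace IntegralCocycle

/-- The transition functions of the circle bundle. -/
def trans (i j : D.ι) (x : X) : Circle := Circle.exp (-(2 * Real.pi * D.f i j x))

variable {D}

/-- The defect of the functions `f` is an integer, which exp(-2πi ·) sends to one. This is where
integrality of the class is used. -/
theorem trans_mul {i j k : D.ι} {x : X} (hi : x ∈ D.U i) (hj : x ∈ D.U j) (hk : x ∈ D.U k) :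
    D.trans j k x * D.trans i j x = D.trans i k x := by
  obtain ⟨r, hr⟩ := D.int_f i j k x ⟨⟨hi, hj⟩, hk⟩
  rw [trans, trans, ← Circle.exp_add, ← neg_add, ← mul_add]
  exact Circle.exp_eq_of_int (r := r) (by linarith)

theorem trans_self {i : D.ι} {x : X} (hi : x ∈ D.U i) : D.trans i i x = 1 := by
  have := trans_mul hi hi hi
  exact mul_eq_right.1 this

theorem continuousOn_trans (i j : D.ι) : ContinuousOn (D.trans i j) (D.U i ∩ D.U j) :=
  Circle.exp.continuous.comp_continuousOn ((D.smooth_f i j).continuousOn.const_mul _).neg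

variable (D)

/-- The circle bundle defined by an integral cocycle. -/
def core : FiberBundleCore D.ι X Circle where
  baseSet := D.U
  isOpen_baseSet := D.isOpen_U
  indexAt := D.idx
  mem_baseSet_at := D.mem_idx
  coordChange i j x v := D.trans i j x * v
  coordChange_self i x hx v := by rw [trans_self hx, one_mul]
  continuousOn_coordChange i j :=
    ((continuousOn_trans i j).comp continuousOn_fst fun _ h => h.1).mul continuousOn_snd
  coordChange_comp i j k x hx v := by
    rw [← mul_assoc, trans_mul hx.1.1 hx.1.2 hx.2]

/-- The total space of the circle bundle. -/
abbrev Total : Type u := D.core.TotalSpace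

/-- The fibre component of a point. -/
def vec (p : D.Total) : Circle := p.2

theorem localTriv_apply' (i : D.ι) (p : D.Total) :
    D.core.localTriv i p = (p.1, D.trans (D.idx p.1) i p.1 * D.vec p) := rfl

instance : MulAction Circle D.Total where
  smul z p := ⟨p.1, z * D.vec p⟩
  one_smul p := Bundle.TotalSpace.ext rfl (heq_of_eq (one_mul (D.vec p)))
  mul_smul z w p := Bundle.TotalSpace.ext rfl (heq_of_eq (mul_assoc z w (D.vec p)))

/-- The action is defined by the coordinate at the chosen index. As the circle is commutative, it
commutes with the transition functions and is multiplication in every trivialization. -/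
theorem localTriv_smul (i : D.ι) (z : Circle) (p : D.Total) :
    D.core.localTriv i (z • p) = (p.1, z * (D.core.localTriv i p).2) :=
  Prod.ext rfl (mul_left_comm (D.trans (D.idx p.1) i p.1) z (D.vec p))

/-- The trivializations of the circle bundle. -/
def totalAtlas : SphereAtlas D circleModel (mulI ℂ) D.Total where
  proj := D.core.proj
  T := D.core.localTriv
  baseSet_T i := rfl
  change i j p hp := by
    rw [← exp_smul_eq, circleModel_coe, circleModel_coe, localTriv_apply', localTriv_apply',
      ← trans_mul (D.mem_idx p.1) hp.1 hp.2, smul_eq_mul, ← Circle.coe_mul, mul_assoc]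
    rfl

variable [IsManifold (𝓡 n) ∞ X]

instance : ChartedSpace (EuclideanSpace ℝ (Fin (n + 1))) D.Total := D.totalAtlas.chartedSpace

instance : IsManifold (𝓡 (n + 1)) ∞ D.Total := D.totalAtlas.isManifold

/-- The circle bundle as a sphere fibration. -/
def totalFib : SphereFibration D (n + 1) D.Total (mulI ℂ) := D.totalAtlas.fibration

theorem totalFib_smul (i : D.ι) (z : Circle) (p : D.Total) :
    D.totalFib.fib i (z • p) = z * D.totalFib.fib i p := by
  change circleModel.coe (D.core.localTriv i (z • p)).2 = z * circleModel.coe (D.core.localTriv i p).2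
  rw [localTriv_smul]
  rfl

theorem contMDiff_smul_total : ContMDiff ((𝓡 1).prod (𝓡 (n + 1))) (𝓡 (n + 1)) ∞
    (fun a : Circle × D.Total => a.1 • a.2) := by
  rintro ⟨z, p⟩
  have hp := D.mem_idx p.1
  have h1 : ContMDiffAt (𝓡 (n + 1)) ((𝓡 n).prod (𝓡 1)) ∞ (D.core.localTriv (D.idx p.1)) p :=
    (D.totalAtlas.contMDiffOn_T (D.idx p.1)).contMDiffAt
      ((D.totalAtlas.T _).open_source.mem_nhds (D.totalAtlas.mem_source.2 hp))
  have h2 := h1.comp (z, p) (contMDiffAt_snd (I := 𝓡 1) (M := Circle))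
  have h3 : ContMDiffAt ((𝓡 1).prod (𝓡 (n + 1))) (𝓡 1) ∞
      (fun a : Circle × D.Total => a.1 * (D.core.localTriv (D.idx p.1) a.2).2) (z, p) :=
    contMDiffAt_fst.mul (contMDiffAt_snd.comp (z, p) h2)
  have h4 : ContMDiffAt ((𝓡 1).prod (𝓡 (n + 1))) ((𝓡 n).prod (𝓡 1)) ∞
      (fun a : Circle × D.Total => ((D.core.localTriv (D.idx p.1) a.2).1,
        a.1 * (D.core.localTriv (D.idx p.1) a.2).2)) (z, p) :=
    (contMDiffAt_fst.comp (z, p) h2).prodMk h3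
  have h5 : ContMDiffAt ((𝓡 n).prod (𝓡 1)) (𝓡 (n + 1)) ∞
      (D.core.localTriv (D.idx p.1)).toOpenPartialHomeomorph.symm
      ((D.core.localTriv (D.idx p.1) p).1, z * (D.core.localTriv (D.idx p.1) p).2) :=
    (D.totalAtlas.contMDiffOn_T_symm (D.idx p.1)).contMDiffAt
      ((D.totalAtlas.T _).open_target.mem_nhds (D.totalAtlas.mem_target.2 hp))
  refine (ContMDiffAt.comp (z, p) h5 h4).congr_of_eventuallyEq ?_
  have hev : ∀ᶠ a in 𝓝 (z, p), a.2 ∈ (D.core.localTriv (D.idx p.1)).source :=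
    (continuous_snd.tendsto (z, p)) ((D.totalAtlas.T _).open_source.mem_nhds
      (D.totalAtlas.mem_source.2 hp))
  filter_upwards [hev] with a ha
  have h6 := (D.core.localTriv (D.idx p.1)).toOpenPartialHomeomorph.left_inv
    (x := a.1 • a.2) (D.totalAtlas.mem_source.2 (D.totalAtlas.mem_source.1 ha))
  refine h6.symm.trans (congrArg _ ?_)
  exact D.localTriv_smul _ _ _

theorem mdiff_smul (z : Circle) (p : D.Total) :
    MDifferentiableAt (𝓡 (n + 1)) (𝓡 (n + 1)) (fun q : D.Total => z • q) p :=
  (D.contMDiff_smul_total.mdifferentiable (by simp) (z, p)).comp p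
    (mdifferentiableAt_const.prodMk mdifferentiableAt_id)

theorem dproj_smul (z : Circle) (p : D.Total) (v : TangentSpace (𝓡 (n + 1)) p) :
    D.totalFib.dproj (z • p) (mfderiv (𝓡 (n + 1)) (𝓡 (n + 1)) (fun q : D.Total => z • q) p v) =
      D.totalFib.dproj p v :=
  (mfderiv_comp_model (I := 𝓡 (n + 1)) (I' := 𝓡 (n + 1)) (I'' := 𝓡 n) (f := fun q : D.Total => z • q)
    (g := D.totalFib.proj) (h := D.totalFib.proj) (Filter.EventuallyEq.refl _ _) rfl
    (D.totalFib.mdiff_proj _) (D.mdiff_smul z p) v).symm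

theorem dfib_smul {i : D.ι} (z : Circle) {p : D.Total} (hp : D.totalFib.proj p ∈ D.U i)
    (v : TangentSpace (𝓡 (n + 1)) p) :
    D.totalFib.dfib i (z • p) (mfderiv (𝓡 (n + 1)) (𝓡 (n + 1)) (fun q : D.Total => z • q) p v) =
      (z : ℂ) • D.totalFib.dfib i p v := by
  have h1 := mfderiv_comp_model (I := 𝓡 (n + 1)) (I' := 𝓡 (n + 1)) (I'' := 𝓘(ℝ, ℂ))
    (f := fun q : D.Total => z • q) (g := D.totalFib.fib i) (x := p) (Filter.EventuallyEq.refl _ _) rfl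
    (D.totalFib.mdiff_fib (y := z • p) hp) (D.mdiff_smul z p) v
  have h2 : HasFDerivAt (fun w : ℂ => (z : ℂ) • w) ((z : ℂ) • ContinuousLinearMap.id ℝ ℂ)
    (D.totalFib.fib i p) := (hasFDerivAt_id (D.totalFib.fib i p)).const_smul (z : ℂ)
  have h3 := mfderiv_comp_fderiv (I := 𝓡 (n + 1)) (f := D.totalFib.fib i)
    (h := D.totalFib.fib i ∘ fun q : D.Total => z • q) (x := p) (Filter.Eventually.of_forall fun q =>
      D.totalFib_smul i z q) rfl h2 (D.totalFib.mdiff_fib hp) v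
  exact h1.symm.trans h3

/-- The action fixes the base point and multiplies `fib` and `vert` by the same unit complex number,
which preserves the inner product. -/
theorem eta_smul (z : Circle) (p : D.Total) (v : TangentSpace (𝓡 (n + 1)) p) :
    D.totalFib.eta (z • p)
      ![mfderiv (𝓡 (n + 1)) (𝓡 (n + 1)) (fun q : D.Total => z • q) p v] =
    D.totalFib.eta p ![v] := by
  have hp := D.mem_idx (D.totalFib.proj p)
  rw [SphereFibration.eta_apply isComplexStructure_mulI (i := D.idx (D.totalFib.proj p))
      (y := z • p) hp,
    SphereFibration.eta_apply isComplexStructure_mulI hp, SphereFibration.etaAt_apply,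
    SphereFibration.etaAt_apply, SphereFibration.vert_apply, SphereFibration.vert_apply]
  simp only [Matrix.cons_val_fin_one]
  rw [dproj_smul, dfib_smul D z hp, totalFib_smul]
  have h1 : mulI ℂ (z * D.totalFib.fib (D.idx (D.totalFib.proj p)) p) =
      (z : ℂ) • mulI ℂ (D.totalFib.fib (D.idx (D.totalFib.proj p)) p) := by
    simp only [mulI_apply, smul_eq_mul]
    ring
  rw [h1, smul_comm _ (z : ℂ), ← smul_add, inner_smul_smul_of_norm_eq_one z.norm_coe]
  rfl

theorem eta_velocity (p : D.Total) :
    D.totalFib.eta (Circle.exp (2 * Real.pi * 0) • p) ![mfderiv 𝓘(ℝ, ℝ) (𝓡 (n + 1))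
      (fun t : ℝ => Circle.exp (2 * Real.pi * t) • p) 0 (1 : ℝ)] = 1 := by
  set q := Circle.exp (2 * Real.pi * 0) • p with hq
  have hp : D.totalFib.proj q ∈ D.U (D.idx (D.totalFib.proj q)) := D.mem_idx _
  have hγ : MDifferentiableAt 𝓘(ℝ, ℝ) (𝓡 (n + 1))
      (fun t : ℝ => Circle.exp (2 * Real.pi * t) • p) 0 := by
    have h1 : ContMDiffAt 𝓘(ℝ, ℝ) (𝓡 1) ∞ (fun t : ℝ => Circle.exp (2 * Real.pi * t)) 0 :=
      (contMDiff_circleExp).contMDiffAt.comp (0 : ℝ)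
        (contDiff_const.mul contDiff_id).contMDiff.contMDiffAt
    exact (D.contMDiff_smul_total.mdifferentiable (by simp) _).comp (0 : ℝ)
      ((h1.mdifferentiableAt (by simp)).prodMk mdifferentiableAt_const)
  rw [SphereFibration.eta_apply isComplexStructure_mulI hp, SphereFibration.etaAt_apply,
    SphereFibration.vert_apply]
  simp only [Matrix.cons_val_fin_one]
  have h1 : D.totalFib.dproj q (mfderiv 𝓘(ℝ, ℝ) (𝓡 (n + 1))
      (fun t : ℝ => Circle.exp (2 * Real.pi * t) • p) 0 (1 : ℝ)) = 0 := by
    have h2 := mfderiv_comp_model (I := 𝓘(ℝ, ℝ)) (I' := 𝓡 (n + 1)) (I'' := 𝓡 n)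
      (f := fun t : ℝ => Circle.exp (2 * Real.pi * t) • p) (g := D.totalFib.proj)
      (h := fun _ => p.1) (x := 0) (Filter.EventuallyEq.refl _ _) rfl
      (D.totalFib.mdiff_proj _) hγ (1 : ℝ)
    rw [mfderiv_const] at h2
    exact h2.symm
  -- The normalization of the circle to length one shows up as the factor 2π in the velocity,
  -- cancelling the factor (2π)⁻¹ in η.
  have h3 : D.totalFib.dfib (D.idx (D.totalFib.proj q)) q (mfderiv 𝓘(ℝ, ℝ) (𝓡 (n + 1))
      (fun t : ℝ => Circle.exp (2 * Real.pi * t) • p) 0 (1 : ℝ)) =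
      (2 * Real.pi) • mulI ℂ (D.totalFib.fib (D.idx (D.totalFib.proj q)) q) := by
    have h2 := mfderiv_comp_model (I := 𝓘(ℝ, ℝ)) (I' := 𝓡 (n + 1)) (I'' := 𝓘(ℝ, ℂ))
      (f := fun t : ℝ => Circle.exp (2 * Real.pi * t) • p)
      (g := D.totalFib.fib (D.idx (D.totalFib.proj q)))
      (x := 0) (Filter.EventuallyEq.refl _ _) rfl
      (D.totalFib.mdiff_fib hp) hγ (1 : ℝ)
    refine h2.symm.trans ?_
    have h4 : (D.totalFib.fib (D.idx (D.totalFib.proj q)) ∘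
        fun t : ℝ => Circle.exp (2 * Real.pi * t) • p) = fun t : ℝ =>
        Complex.exp (((2 * Real.pi * t : ℝ) : ℂ) * Complex.I) *
          D.totalFib.fib (D.idx (D.totalFib.proj q)) p := by
      funext t
      exact D.totalFib_smul _ _ _
    have h5 : HasDerivAt (fun t : ℝ => Complex.exp (((2 * Real.pi * t : ℝ) : ℂ) * Complex.I) *
          D.totalFib.fib (D.idx (D.totalFib.proj q)) p)
        (Complex.exp (((2 * Real.pi * 0 : ℝ) : ℂ) * Complex.I) * (((2 * Real.pi * 1 : ℝ) : ℂ) * Complex.I) *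
          D.totalFib.fib (D.idx (D.totalFib.proj q)) p) 0 :=
      ((((hasDerivAt_id (0 : ℝ)).const_mul (2 * Real.pi)).ofReal_comp.mul_const Complex.I).cexp).mul_const _
    rw [h4, mfderiv_eq_fderiv]
    refine (DFunLike.congr_fun h5.hasFDerivAt.fderiv (1 : ℝ)).trans ?_
    rw [hq, totalFib_smul, mulI_apply]
    simp
    ring
  rw [h1, h3, map_zero, mul_zero, zero_smul, add_zero, inner_smul_right,
    SphereFibration.inner_J_fib_self isComplexStructure_mulI hp, mul_one]
  exact inv_mul_cancel₀ (by positivity)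

/-- In `extD_eta` the fibre term is the area form evaluated on two tangent vectors of a circle, so
only the curvature survives. -/
theorem extD_eta_total (p : D.Total) (v w : TangentSpace (𝓡 (n + 1)) p) :
    DForm.extD D.totalFib.eta p ![v, w] = Ω (D.core.proj p)
      ![mfderiv (𝓡 (n + 1)) (𝓡 n) D.core.proj p v, mfderiv (𝓡 (n + 1)) (𝓡 n) D.core.proj p w] := by
  have hp : D.totalFib.proj p ∈ D.U (D.idx (D.totalFib.proj p)) := D.mem_idx _
  rw [SphereFibration.extD_eta isComplexStructure_mulI hp, mulI_apply, smul_eq_mul,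
    Complex.inner_I_mul_eq_zero (D.totalFib.inner_fib_self hp) (D.totalFib.inner_fib_dfib hp v)
      (D.totalFib.inner_fib_dfib hp w), mul_zero, add_zero]
  rfl

/-- The Boothby–Wang fibration defined by an integral cocycle. -/
def boothbyWang : BoothbyWang Ω where
  P := D.Total
  smooth_action := D.contMDiff_smul_total
  proj := D.core.proj
  locally_trivial x := ⟨D.core.localTriv (D.idx x), D.mem_idx x, D.totalAtlas.contMDiffOn_T _,
    D.totalAtlas.contMDiffOn_T_symm _, fun p hp z => ⟨hp, D.localTriv_smul _ z p⟩⟩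
  θ := D.totalFib.eta
  smooth_θ := SphereFibration.smoothOn_eta isComplexStructure_mulI
  invariant_θ := D.eta_smul
  vertical_θ := D.eta_velocity
  curvature := D.extD_eta_total

end IntegralCocycle

end

/-! ### The associated bundle of three-spheres. -/

noncomputable section

open scoped RealInnerProductSpace

variable {n : ℕ} {X : Type u} [TopologicalSpace X] [ChartedSpace (EuclideanSpace ℝ (Fin n)) X]
  {Ω : DForm n 2 X} (D : IntegralCocycle Ω)

theorem hopf_mul (z w : Circle) (v : S3) : hopf (z * w) v = hopf z (hopf w v) := by
  refine Subtype.ext ?_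
  simp [hopf, mul_smul]

theorem hopf_one (v : S3) : hopf 1 v = v := by
  refine Subtype.ext ?_
  simp [hopf]

theorem continuous_hopf : Continuous fun a : Circle × S3 => hopf a.1 a.2 := by
  refine Continuous.subtype_mk ?_ _
  fun_prop

namespace IntegralCocycle

variable [IsManifold (𝓡 n) ∞ X]

/-- The associated bundle of three-spheres. -/
abbrev S3Bundle : Type u := D.boothbyWang.SphereBundle

variable {D}

/-- The quotient map onto the associated bundle. -/
abbrev mkS3 (p : D.Total) (v : S3) : D.S3Bundle := D.boothbyWang.quot (p, v)

theorem isQuotientMap_quot : Topology.IsQuotientMap (fun a : D.Total × S3 => mkS3 a.1 a.2) :=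
  isQuotientMap_quot_mk

theorem mkS3_smul (z : Circle) (p : D.Total) (v : S3) : mkS3 (z • p) (hopf z⁻¹ v) = mkS3 p v :=
  (Quotient.sound (s := D.boothbyWang.assocSetoid) ⟨z, rfl⟩ : mkS3 p v = mkS3 (z • p) (hopf z⁻¹ v)).symm

variable (D) in
/-- The projection of the associated bundle. -/
def projS3 : D.S3Bundle → X :=
  Quotient.lift (s := D.boothbyWang.assocSetoid) (fun a : D.Total × S3 => D.core.proj a.1) (by
    rintro a _ ⟨z, rfl⟩
    rfl)

/-- The fibre coordinates of the associated bundle. -/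
def fibS3 (i : D.ι) : D.S3Bundle → S3 :=
  Quotient.lift (s := D.boothbyWang.assocSetoid)
    (fun a : D.Total × S3 => hopf (D.core.localTriv i a.1).2 a.2) (by
    rintro ⟨(p : D.Total), v⟩ _ ⟨z, rfl⟩
    change hopf (D.core.localTriv i p).2 v = hopf (D.core.localTriv i (z • p)).2 (hopf z⁻¹ v)
    have h1 : (D.core.localTriv i (z • p : D.Total)).2 = z * (D.core.localTriv i p).2 :=
      congrArg Prod.snd (D.localTriv_smul i z p)
    refine Eq.trans ?_ (congrArg (fun c => hopf c (hopf z⁻¹ v)) h1).symm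
    rw [← hopf_mul, mul_comm z, mul_assoc, mul_inv_cancel, mul_one])

theorem continuous_projS3 : Continuous D.projS3 :=
  isQuotientMap_quot.continuous_iff.2 (D.core.continuous_proj.comp continuous_fst)

variable (D) in
/-- The section of the circle bundle over a member of the cover. -/
def unitSection (i : D.ι) (x : X) : D.Total :=
  (D.core.localTriv i).toOpenPartialHomeomorph.symm (x, 1)

theorem localTriv_unitSection {i : D.ι} {x : X} (hx : x ∈ D.U i) :
    D.core.localTriv i (D.unitSection i x) = (x, 1) :=
  D.totalAtlas.T_symm (i := i) (p := (x, 1)) hx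

theorem smul_unitSection {i : D.ι} {p : D.Total} (hp : D.core.proj p ∈ D.U i) :
    (D.core.localTriv i p).2 • D.unitSection i (D.core.proj p) = p := by
  have h1 : (D.core.localTriv i).toOpenPartialHomeomorph.symm (D.core.localTriv i p) = p :=
    D.totalAtlas.symm_T (i := i) hp
  have h3 : (D.core.localTriv i).toOpenPartialHomeomorph.symm (D.core.localTriv i
      ((D.core.localTriv i p).2 • D.unitSection i (D.core.proj p))) =
      (D.core.localTriv i p).2 • D.unitSection i (D.core.proj p) :=
    D.totalAtlas.symm_T (i := i) hp
  rw [← h3, localTriv_smul, localTriv_unitSection hp, mul_one]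
  exact h1

variable (D) in
/-- The local trivializations of the associated bundle. -/
def trivS3 (i : D.ι) : Trivialization S3 D.projS3 where
  toFun y := (D.projS3 y, fibS3 i y)
  invFun p := mkS3 (D.unitSection i p.1) p.2
  source := D.projS3 ⁻¹' D.U i
  target := D.U i ×ˢ univ
  map_source' y hy := ⟨hy, mem_univ _⟩
  map_target' p hp := hp.1
  left_inv' y hy := by
    obtain ⟨⟨p, v⟩, rfl⟩ := isQuotientMap_quot.surjective y
    -- Acting by the inverse of the circle coordinate moves the first component to the unit section
    -- without changing the class.
    have h1 := mkS3_smul (D.core.localTriv i p).2⁻¹ p v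
    have h2 : (D.core.localTriv i p).2⁻¹ • p = D.unitSection i (D.core.proj p) := by
      rw [inv_smul_eq_iff, smul_unitSection hy]
    rw [h2, inv_inv] at h1
    exact h1
  right_inv' := by
    rintro ⟨x, v⟩ hp
    refine Prod.ext rfl ?_
    change hopf (D.core.localTriv i (D.unitSection i x)).2 v = v
    rw [localTriv_unitSection hp.1, hopf_one]
  open_source := (D.isOpen_U i).preimage continuous_projS3
  open_target := (D.isOpen_U i).prod isOpen_univ
  continuousOn_toFun := by
    refine continuous_projS3.continuousOn.prodMk ?_
    refine (isQuotientMap_quot.continuousOn_isOpen_iff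
      ((D.isOpen_U i).preimage continuous_projS3)).2 ?_
    have h1 : ContinuousOn (fun a : D.Total × S3 => (D.core.localTriv i a.1).2)
        ((D.core.proj ∘ Prod.fst) ⁻¹' D.U i) :=
      continuous_snd.comp_continuousOn ((D.core.localTriv i).continuousOn.comp
        continuousOn_fst fun a ha => ha)
    exact continuous_hopf.comp_continuousOn (h1.prodMk continuousOn_snd)
  continuousOn_invFun := by
    refine isQuotientMap_quot.continuous.comp_continuousOn (ContinuousOn.prodMk ?_ continuousOn_snd)
    exact (D.core.localTriv i).toOpenPartialHomeomorph.continuousOn_symm.comp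
      (continuousOn_fst.prodMk continuousOn_const) fun p hp => ⟨hp.1, mem_univ _⟩
  baseSet := D.U i
  open_baseSet := D.isOpen_U i
  source_eq := rfl
  target_eq := rfl
  proj_toFun y hy := rfl

variable (D) in
/-- The atlas of the associated bundle. -/
def s3Atlas : SphereAtlas D (sphereModel (k := 3) (EuclideanSpace ℂ (Fin 2)))
    (mulI (EuclideanSpace ℂ (Fin 2))) D.S3Bundle where
  proj := D.projS3
  T := D.trivS3
  baseSet_T i := rfl
  change i j y hy := by
    obtain ⟨⟨p, v⟩, rfl⟩ := isQuotientMap_quot.surjective y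
    rw [← exp_smul_eq]
    change ((hopf (D.core.localTriv j p).2 v : S3) : EuclideanSpace ℂ (Fin 2)) =
      (D.trans i j p.1 : ℂ) • ((hopf (D.core.localTriv i p).2 v : S3) : EuclideanSpace ℂ (Fin 2))
    -- The transition functions of the circle bundle act on the fibre coordinate by scalar
    -- multiplication, so both bundles have the same cocycle.
    rw [localTriv_apply', localTriv_apply', ← trans_mul (D.mem_idx p.1) hy.1 hy.2, mul_assoc,
      hopf_mul]
    rfl

instance : ChartedSpace (EuclideanSpace ℝ (Fin (n + 3))) D.S3Bundle := D.s3Atlas.chartedSpace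

instance : IsManifold (𝓡 (n + 3)) ∞ D.S3Bundle := D.s3Atlas.isManifold

theorem contMDiffAt_localTriv_total {i : D.ι} {p : D.Total} (hp : D.core.proj p ∈ D.U i) :
    ContMDiffAt (𝓡 (n + 1)) ((𝓡 n).prod (𝓡 1)) ∞ (D.core.localTriv i) p :=
  (D.totalAtlas.contMDiffOn_T i).contMDiffAt
    ((D.totalAtlas.T _).open_source.mem_nhds (D.totalAtlas.mem_source.2 hp))

theorem contMDiffAt_localTriv_total_symm {i : D.ι} {a : X × Circle} (ha : a.1 ∈ D.U i) :
    ContMDiffAt ((𝓡 n).prod (𝓡 1)) (𝓡 (n + 1)) ∞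
      (D.core.localTriv i).toOpenPartialHomeomorph.symm a :=
  (D.totalAtlas.contMDiffOn_T_symm i).contMDiffAt
    ((D.totalAtlas.T _).open_target.mem_nhds (D.totalAtlas.mem_target.2 ha))

theorem contMDiffAt_trivS3 {i : D.ι} {y : D.S3Bundle} (hy : D.projS3 y ∈ D.U i) :
    ContMDiffAt (𝓡 (n + 3)) ((𝓡 n).prod (𝓡 3)) ∞ (D.trivS3 i) y :=
  (D.s3Atlas.contMDiffOn_T i).contMDiffAt
    ((D.s3Atlas.T _).open_source.mem_nhds (D.s3Atlas.mem_source.2 hy))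

theorem contMDiffAt_trivS3_symm {i : D.ι} {a : X × S3} (ha : a.1 ∈ D.U i) :
    ContMDiffAt ((𝓡 n).prod (𝓡 3)) (𝓡 (n + 3)) ∞
      (D.trivS3 i).toOpenPartialHomeomorph.symm a :=
  (D.s3Atlas.contMDiffOn_T_symm i).contMDiffAt
    ((D.s3Atlas.T _).open_target.mem_nhds (D.s3Atlas.mem_target.2 ha))

theorem contMDiffAt_hopf {E H M : Type*} [NormedAddCommGroup E] [NormedSpace ℝ E]
    [TopologicalSpace H] {I : ModelWithCorners ℝ E H} [TopologicalSpace M] [ChartedSpace H M]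
    {f : M → Circle} {g : M → S3} {x : M} (hf : ContMDiffAt I (𝓡 1) ∞ f x)
    (hg : ContMDiffAt I (𝓡 3) ∞ g x) : ContMDiffAt I (𝓡 3) ∞ (fun y => hopf (f y) (g y)) x := by
  refine contMDiffAt_sphere ?_
  have h1 : ContMDiffAt I 𝓘(ℝ, ℂ) ∞ (fun y => (f y : ℂ)) x :=
    circleModel.smooth_coe.contMDiffAt.comp x hf
  have h2 : ContMDiffAt I 𝓘(ℝ, EuclideanSpace ℂ (Fin 2)) ∞
      (fun y => (g y : EuclideanSpace ℂ (Fin 2))) x := contMDiff_coe_sphere.contMDiffAt.comp x hg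
  have h3 : ContDiff ℝ ∞ fun a : ℂ × EuclideanSpace ℂ (Fin 2) => a.1 • a.2 := by fun_prop
  exact h3.contMDiff.contMDiffAt.comp x (h1.prodMk_space h2)

theorem contMDiff_quot :
    ContMDiff ((𝓡 (n + 1)).prod (𝓡 3)) (𝓡 (n + 3)) ∞
      (fun a : D.Total × S3 => mkS3 a.1 a.2) := by
  rintro ⟨p, v⟩
  have hp : D.core.proj p ∈ D.U (D.idx (D.core.proj p)) := D.mem_idx _
  have h1 : ContMDiffAt ((𝓡 (n + 1)).prod (𝓡 3)) ((𝓡 n).prod (𝓡 1)) ∞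
      (fun a : D.Total × S3 => D.core.localTriv (D.idx (D.core.proj p)) a.1) (p, v) :=
    (contMDiffAt_localTriv_total hp).comp (p, v) contMDiffAt_fst
  have h2 := (contMDiffAt_fst.comp (p, v) h1).prodMk
    (contMDiffAt_hopf (contMDiffAt_snd.comp (p, v) h1) (contMDiffAt_snd (I := 𝓡 (n + 1))))
  refine (ContMDiffAt.comp (p, v)
    (contMDiffAt_trivS3_symm (i := D.idx (D.core.proj p)) hp) h2).congr_of_eventuallyEq ?_
  have hev : ∀ᶠ a in 𝓝 (p, v), D.core.proj a.1 ∈ D.U (D.idx (D.core.proj p)) :=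
    (D.core.continuous_proj.comp continuous_fst).continuousAt ((D.isOpen_U _).mem_nhds hp)
  filter_upwards [hev] with a ha
  exact (D.s3Atlas.symm_T (y := mkS3 a.1 a.2) ha).symm

/-- Through every point of `P × S³` there passes a smooth local section of the quotient map,
obtained by keeping the circle coordinate equal to its value `c` at that point. -/
theorem surjective_mfderiv_quot (a : D.Total × S3) : Function.Surjective
    (mfderiv ((𝓡 (n + 1)).prod (𝓡 3)) (𝓡 (n + 3)) D.boothbyWang.quot a) := by
  obtain ⟨p, v⟩ := a
  set i := D.idx (D.core.proj p) with hi
  have hp : D.core.proj p ∈ D.U i := D.mem_idx _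
  let c := (D.core.localTriv i p).2
  have hT := contMDiffAt_trivS3 (i := i) (y := mkS3 p v) hp
  have h1 : ContMDiffAt (𝓡 (n + 3)) (𝓡 (n + 1)) ∞ (fun y : D.S3Bundle =>
      (D.core.localTriv i).toOpenPartialHomeomorph.symm ((D.trivS3 i y).1, c)) (mkS3 p v) :=
    ContMDiffAt.comp (mkS3 p v) (contMDiffAt_localTriv_total_symm (i := i)
      (a := ((D.trivS3 i (mkS3 p v)).1, c)) hp)
      ((contMDiffAt_fst.comp (mkS3 p v) hT).prodMk contMDiffAt_const)
  have h2 : ContMDiffAt (𝓡 (n + 3)) (𝓡 3) ∞ (fun y : D.S3Bundle => hopf c⁻¹ (D.trivS3 i y).2)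
      (mkS3 p v) := contMDiffAt_hopf contMDiffAt_const (contMDiffAt_snd.comp (mkS3 p v) hT)
  have h0 : ((D.core.localTriv i).toOpenPartialHomeomorph.symm ((D.trivS3 i (mkS3 p v)).1, c),
      hopf c⁻¹ (D.trivS3 i (mkS3 p v)).2) = (p, v) := by
    refine Prod.ext ?_ ?_
    · exact D.totalAtlas.symm_T (i := i) hp
    · change hopf c⁻¹ (hopf c v) = v
      rw [← hopf_mul, inv_mul_cancel, hopf_one]
  have hev : ∀ᶠ y in 𝓝 (mkS3 p v), D.projS3 y ∈ D.U i :=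
    continuous_projS3.continuousAt ((D.isOpen_U i).mem_nhds hp)
  have h3 : id =ᶠ[𝓝 (mkS3 p v)] (fun a : D.Total × S3 => mkS3 a.1 a.2) ∘ fun y : D.S3Bundle =>
      ((D.core.localTriv i).toOpenPartialHomeomorph.symm ((D.trivS3 i y).1, c),
        hopf c⁻¹ (D.trivS3 i y).2) := by
    filter_upwards [hev] with y hy
    have h4 : (D.core.localTriv i).toOpenPartialHomeomorph.symm ((D.trivS3 i y).1, c) =
        c • D.unitSection i (D.projS3 y) := by
      have h5 : (D.core.localTriv i).toOpenPartialHomeomorph.symm (D.core.localTriv i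
        (c • D.unitSection i (D.projS3 y))) = c • D.unitSection i (D.projS3 y) :=
        D.totalAtlas.symm_T (i := i) hy
      rw [← h5, localTriv_smul, localTriv_unitSection hy, mul_one]
      rfl
    change y = mkS3 ((D.core.localTriv i).toOpenPartialHomeomorph.symm ((D.trivS3 i y).1, c))
      (hopf c⁻¹ (D.trivS3 i y).2)
    rw [h4, mkS3_smul]
    exact (D.s3Atlas.symm_T (i := i) hy).symm
  intro w
  refine ⟨_, (mfderiv_comp_model (I := 𝓡 (n + 3)) (I' := (𝓡 (n + 1)).prod (𝓡 3)) (I'' := 𝓡 (n + 3))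
    h3 h0 (contMDiff_quot.mdifferentiable (by simp) _)
    ((h1.prodMk h2).mdifferentiableAt (by simp)) w).symm.trans ?_⟩
  rw [mfderiv_id]
  rfl

theorem sphereBundleIsKContact (C : CompatibleTriple Ω) :
    D.boothbyWang.SphereBundleIsKContact :=
  ⟨inferInstanceAs (ChartedSpace _ D.S3Bundle), inferInstanceAs (IsManifold _ _ D.S3Bundle),
    contMDiff_quot, surjective_mfderiv_quot,
    ⟨D.s3Atlas.fibration.kContact C isComplexStructure_mulI⟩⟩

end IntegralCocycle

end

/-! ### Lifting in fibre bundles and fundamental groups. -/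

noncomputable section

open unitInterval

section lifting

variable {X Y F : Type*} [TopologicalSpace X] [TopologicalSpace Y] [TopologicalSpace F]
  {p : Y → X} {H : ℝ × ℝ → X} {a b c d e : ℝ}

/-- The left and lower edges of a rectangle. -/
def corner (a b c d : ℝ) : Set (ℝ × ℝ) := ({a} ×ˢ Icc c d) ∪ (Icc a b ×ˢ {c})

/-- Lifts of `H` on the left and lower edges of a rectangle extend to the rectangle. -/
def CornerLifting (p : Y → X) (H : ℝ × ℝ → X) (a b c d : ℝ) : Prop :=
  ∀ g : ℝ × ℝ → Y, ContinuousOn g (corner a b c d) → (∀ z ∈ corner a b c d, p (g z) = H z) →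
    ∃ f : ℝ × ℝ → Y, ContinuousOn f (Icc a b ×ˢ Icc c d) ∧
      (∀ z ∈ Icc a b ×ˢ Icc c d, p (f z) = H z) ∧ EqOn f g (corner a b c d)

theorem cornerLifting_self (p : Y → X) (H : ℝ × ℝ → X) (a c d : ℝ) : CornerLifting p H a a c d := by
  intro g hg hpg
  have h1 : Icc a a ×ˢ Icc c d ⊆ corner a a c d := by
    rw [Icc_self]
    exact subset_union_left
  exact ⟨g, hg.mono h1, fun z hz => hpg z (h1 hz), fun _ _ => rfl⟩

/-- The rectangle retracts onto its left and lower edges along the diagonal direction. The lift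
combines `H` with the fibre coordinate of the given lift at the retracted point. -/
theorem cornerLifting_of_trivialization (t : Trivialization F p) (hH : Continuous H)
    (ht : MapsTo H (Icc a b ×ˢ Icc c d) t.baseSet) (hab : a ≤ b) (hcd : c ≤ d) :
    CornerLifting p H a b c d := by
  intro g hg hpg
  have hsub : corner a b c d ⊆ Icc a b ×ˢ Icc c d := by
    rintro ⟨x, y⟩ (⟨hx, hy⟩ | ⟨hx, hy⟩)
    · obtain rfl : x = a := hx
      exact ⟨⟨le_rfl, hab⟩, hy⟩
    · obtain rfl : y = c := hy
      exact ⟨hx, le_rfl, hcd⟩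
  let r : ℝ × ℝ → ℝ × ℝ := fun z => (z.1 - min (z.1 - a) (z.2 - c), z.2 - min (z.1 - a) (z.2 - c))
  have hr : Continuous r := by fun_prop
  have hr2 : MapsTo r (Icc a b ×ˢ Icc c d) (corner a b c d) := by
    rintro ⟨x, y⟩ ⟨⟨h1, h2⟩, h3, h4⟩
    simp only [r, corner, mem_union, mem_prod, mem_singleton_iff, mem_Icc] at *
    rcases le_total (x - a) (y - c) with h | h
    · rw [min_eq_left h]
      exact .inl ⟨by ring, by linarith, by linarith⟩
    · rw [min_eq_right h]
      exact .inr ⟨⟨by linarith, by linarith⟩, by ring⟩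
  have hr3 : ∀ z ∈ corner a b c d, r z = z := by
    rintro ⟨x, y⟩ (⟨hx, hy, -⟩ | ⟨⟨hx, -⟩, hy⟩)
    · obtain rfl : x = a := hx
      simpa [r] using hy
    · obtain rfl : y = c := hy
      simpa [r] using hx
  have hs : ∀ z ∈ Icc a b ×ˢ Icc c d, g (r z) ∈ t.source := fun z hz => by
    rw [t.mem_source, hpg _ (hr2 hz)]
    exact ht (hsub (hr2 hz))
  have ht' : ContinuousOn t t.source := t.toOpenPartialHomeomorph.continuousOn
  refine ⟨fun z => t.toOpenPartialHomeomorph.symm (H z, (t (g (r z))).2), ?_, fun z hz => ?_,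
    fun z hz => ?_⟩
  · refine t.toOpenPartialHomeomorph.continuousOn_symm.comp
      (hH.continuousOn.prodMk (continuous_snd.comp_continuousOn
        (ht'.comp (hg.comp hr.continuousOn hr2) hs))) fun z hz => ?_
    rw [t.target_eq]
    exact ⟨ht hz, mem_univ _⟩
  · exact t.proj_symm_apply (by rw [t.target_eq]; exact ⟨ht hz, mem_univ _⟩)
  · have h1 := hs z (hsub hz)
    simp only [hr3 z hz] at h1 ⊢
    rw [← hpg z hz, ← t.coe_fst h1]
    exact t.toOpenPartialHomeomorph.left_inv h1

/-- After lifting over the left rectangle, its right edge together with the rest of the lower edge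
is a corner of the right rectangle. -/
theorem CornerLifting.hglue (hab : a ≤ b) (hbe : b ≤ e) (hcd : c ≤ d) (h1 : CornerLifting p H a b c d)
    (h2 : CornerLifting p H b e c d) : CornerLifting p H a e c d := by
  intro g hg hpg
  have hs : corner a b c d ⊆ corner a e c d :=
    union_subset_union_right _ (prod_mono (Icc_subset_Icc_right hbe) subset_rfl)
  obtain ⟨f1, hf1, hpf1, hfg1⟩ := h1 g (hg.mono hs) fun z hz => hpg z (hs hz)
  classical
  have hl : {b} ×ˢ Icc c d ⊆ Icc a b ×ˢ Icc c d :=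
    prod_mono (singleton_subset_iff.2 ⟨hab, le_rfl⟩) subset_rfl
  have hr : Icc b e ×ˢ {c} ⊆ corner a e c d :=
    (prod_mono (Icc_subset_Icc_left hab) subset_rfl).trans subset_union_right
  let g2 : ℝ × ℝ → Y := fun z => if z.1 ≤ b then f1 z else g z
  have e1 : EqOn g2 f1 ({b} ×ˢ Icc c d) := by
    rintro ⟨x, y⟩ ⟨hx, -⟩
    exact if_pos (le_of_eq hx)
  have e2 : EqOn g2 g (Icc b e ×ˢ {c}) := by
    rintro ⟨x, y⟩ ⟨⟨hx, -⟩, hy⟩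
    rcases hx.eq_or_lt with h | h
    · refine (if_pos h.ge).trans (hfg1 (.inr ⟨⟨?_, h.ge⟩, hy⟩))
      exact hab.trans hx
    · exact if_neg (not_le.2 h)
  obtain ⟨f2, hf2, hpf2, hfg2⟩ := h2 g2
    (((hf1.mono hl).congr e1).union_of_isClosed ((hg.mono hr).congr e2)
      (isClosed_singleton.prod isClosed_Icc) (isClosed_Icc.prod isClosed_singleton)) (by
      rintro z (hz | hz)
      · rw [e1 hz, hpf1 z (hl hz)]
      · rw [e2 hz, hpg z (hr hz)])
  have hu : Icc a e ×ˢ Icc c d = Icc a b ×ˢ Icc c d ∪ Icc b e ×ˢ Icc c d := by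
    rw [← union_prod, Icc_union_Icc_eq_Icc hab hbe]
  let f : ℝ × ℝ → Y := fun z => if z.1 ≤ b then f1 z else f2 z
  have e3 : EqOn f f1 (Icc a b ×ˢ Icc c d) := fun z hz => if_pos hz.1.2
  have e4 : EqOn f f2 (Icc b e ×ˢ Icc c d) := by
    rintro ⟨x, y⟩ ⟨⟨hx, hx'⟩, hy⟩
    rcases hx.eq_or_lt with h | h
    · have h3 : (x, y) ∈ ({b} ×ˢ Icc c d : Set (ℝ × ℝ)) := ⟨h.symm, hy⟩
      exact (if_pos h.ge).trans ((e1 h3).symm.trans (hfg2 (.inl h3)).symm)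
    · exact if_neg (not_le.2 h)
  refine ⟨f, ?_, ?_, ?_⟩
  · rw [hu]
    exact (hf1.congr e3).union_of_isClosed (hf2.congr e4) (isClosed_Icc.prod isClosed_Icc)
      (isClosed_Icc.prod isClosed_Icc)
  · rw [hu]
    rintro z (hz | hz)
    · rw [e3 hz, hpf1 z hz]
    · rw [e4 hz, hpf2 z hz]
  · rintro ⟨x, y⟩ (⟨hx, hy⟩ | ⟨⟨hx, hx'⟩, hy⟩)
    · obtain rfl : x = a := hx
      exact (if_pos hab).trans (hfg1 (.inl ⟨rfl, hy⟩))
    · rcases le_total x b with h | h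
      · exact (if_pos h).trans (hfg1 (.inr ⟨⟨hx, h⟩, hy⟩))
      · have h3 : (x, y) ∈ Icc b e ×ˢ ({c} : Set ℝ) := ⟨⟨h, hx'⟩, hy⟩
        obtain rfl : y = c := hy
        exact (e4 ⟨⟨h, hx'⟩, le_rfl, hcd⟩).trans ((hfg2 (.inr h3)).trans (e2 h3))

theorem CornerLifting.swap (h : CornerLifting p (H ∘ Prod.swap) a b c d) : CornerLifting p H c d a b := by
  have hc : ∀ {a b c d : ℝ} {z : ℝ × ℝ}, z ∈ corner a b c d → z.swap ∈ corner c d a b := by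
    rintro a b c d z (⟨h1, h2⟩ | ⟨h1, h2⟩)
    · exact .inr ⟨h2, h1⟩
    · exact .inl ⟨h2, h1⟩
  intro g hg hpg
  obtain ⟨f, hf, hpf, hfg⟩ := h (g ∘ Prod.swap)
    (hg.comp continuous_swap.continuousOn fun z hz => hc hz) fun z hz => hpg _ (hc hz)
  exact ⟨f ∘ Prod.swap, hf.comp continuous_swap.continuousOn fun z hz => ⟨hz.2, hz.1⟩,
    fun z hz => hpf _ ⟨hz.2, hz.1⟩, fun z hz => hfg (hc hz)⟩

theorem CornerLifting.vglue (hab : a ≤ b) (hbe : b ≤ e) (hcd : c ≤ d) (h1 : CornerLifting p H c d a b)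
    (h2 : CornerLifting p H c d b e) : CornerLifting p H c d a e :=
  swap (hglue hab hbe hcd (swap h1) (swap h2))

/-- A Lebesgue number provides a grid whose small squares are mapped into trivializing sets. Squares
are glued to rows, and rows are stacked. -/
theorem cornerLifting_unit (hp : ∀ x, ∃ t : Trivialization F p, x ∈ t.baseSet) (hH : Continuous H) :
    CornerLifting p H 0 1 0 1 := by
  choose t ht using hp
  obtain ⟨δ, hδ, hδ2⟩ := lebesgue_number_lemma_of_metric
    (s := (Icc 0 1 ×ˢ Icc 0 1 : Set (ℝ × ℝ))) (c := fun x : X => H ⁻¹' (t x).baseSet)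
    (isCompact_Icc.prod isCompact_Icc) (fun x => (t x).open_baseSet.preimage hH)
    fun z _ => mem_iUnion.2 ⟨H z, ht _⟩
  obtain ⟨N, hN⟩ := exists_nat_one_div_lt hδ
  set M : ℝ := N + 1 with hM
  have hM0 : 0 < M := by positivity
  have key : ∀ j : ℕ, (j : ℝ) + 1 ≤ M → ∀ k : ℕ, (k : ℝ) ≤ M →
      CornerLifting p H 0 (k / M) (j / M) ((j + 1) / M) := by
    intro j hj k
    have hj1 : (j : ℝ) / M ≤ (j + 1) / M := by gcongr; linarith
    induction k with
    | zero =>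
      intro _
      simpa using cornerLifting_self p H 0 _ _
    | succ k ih =>
      intro hk
      push_cast at hk ⊢
      have hk1 : (k : ℝ) / M ≤ (k + 1) / M := by gcongr; linarith
      refine (ih (by linarith)).hglue (by positivity) hk1 hj1 ?_
      obtain ⟨x, hx⟩ := hδ2 (k / M, j / M)
        ⟨⟨by positivity, (div_le_one hM0).2 (by linarith)⟩, by positivity,
          (div_le_one hM0).2 (by linarith)⟩
      refine cornerLifting_of_trivialization (t x) hH (fun z hz => hx ?_) hk1 hj1
      have e1 : ((k : ℝ) + 1) / M = k / M + 1 / M := add_div _ _ _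
      have e2 : ((j : ℝ) + 1) / M = j / M + 1 / M := add_div _ _ _
      obtain ⟨⟨h1, h2⟩, h3, h4⟩ := hz
      rw [Metric.mem_ball, Prod.dist_eq, max_lt_iff, Real.dist_eq, Real.dist_eq, abs_lt, abs_lt]
      refine ⟨⟨?_, ?_⟩, ?_, ?_⟩ <;> dsimp only <;> linarith
  have key2 : ∀ j : ℕ, (j : ℝ) ≤ M → CornerLifting p H 0 1 0 (j / M) := by
    intro j
    induction j with
    | zero =>
      intro _
      simpa using (cornerLifting_self p (H ∘ Prod.swap) 0 0 1).swap
    | succ j ih =>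
      intro hj
      push_cast at hj ⊢
      refine (ih (by linarith)).vglue (by positivity) (by gcongr; linarith) zero_le_one ?_
      have := key j hj (N + 1) (by push_cast; exact le_rfl)
      push_cast at this
      rwa [← hM, div_self hM0.ne'] at this
  have := key2 (N + 1) (by push_cast; exact le_rfl)
  push_cast at this
  rwa [← hM, div_self hM0.ne'] at this

end lifting

section fundamentalGroup

variable {X Y F : Type*} [TopologicalSpace X] [TopologicalSpace Y] [TopologicalSpace F]

/-- A loop which factors through a simply connected space is null-homotopic. -/
theorem Path.homotopic_refl_of_factor {Z : Type*} [TopologicalSpace Z] [SimplyConnectedSpace Z]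
    {y : Y} (γ : Path y y) (j : C(Z, Y)) (μ : C(I, Z)) (h : ∀ t, j (μ t) = γ t) (h01 : μ 0 = μ 1) :
    Path.Homotopic γ (Path.refl y) := by
  obtain rfl : j (μ 0) = y := (h 0).trans γ.source
  let μ' : Path (μ 0) (μ 0) := ⟨μ, rfl, h01.symm⟩
  have h1 := (SimplyConnectedSpace.paths_homotopic μ' (Path.refl _)).map j
  have h2 : μ'.map j.continuous = γ := Path.ext (funext h)
  rwa [h2] at h1

variable {p : Y → X} (hp : ∀ x, ∃ t : Trivialization F p, x ∈ t.baseSet)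

include hp

theorem exists_lift_path {x x' : X} (γ : Path x x') {y : Y} (hy : p y = x) :
    ∃ (y' : Y) (δ : Path y y'), ∀ t, p (δ t) = γ t := by
  -- The map (s, t) ↦ γ(st) is constant on the left and lower edges, where the constant lift `y` is
  -- admissible. The lift on the edge s = 1 is the desired path.
  obtain ⟨f, hf, hpf, hfg⟩ := cornerLifting_unit hp
    (H := fun z => γ.extend (z.1 * z.2)) (by fun_prop) (fun _ => y) continuousOn_const (by
      rintro ⟨s, t⟩ (⟨hs, -⟩ | ⟨-, ht⟩)
      · obtain rfl : s = 0 := hs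
        simp [hy]
      · obtain rfl : t = 0 := ht
        simp [hy])
  have hm : ∀ t : I, ((1 : ℝ), (t : ℝ)) ∈ (Icc 0 1 ×ˢ Icc 0 1 : Set (ℝ × ℝ)) :=
    fun t => ⟨⟨zero_le_one, le_rfl⟩, t.2⟩
  refine ⟨f (1, 1), ⟨⟨fun t => f (1, t), ?_⟩, ?_, ?_⟩, fun t => ?_⟩
  · exact hf.comp_continuous (by fun_prop) hm
  · exact hfg (.inr ⟨⟨zero_le_one, le_rfl⟩, rfl⟩)
  · rfl
  · exact (hpf _ (hm t)).trans (by simp)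

theorem exists_fibre_path [PathConnectedSpace F] {y y' : Y} (hy : p y' = p y) :
    ∃ δ : Path y y', ∀ t, p (δ t) = p y := by
  obtain ⟨e, he⟩ := hp (p y)
  have h1 : y ∈ e.source := e.mem_source.2 he
  have h2 : y' ∈ e.source := e.mem_source.2 (hy ▸ he)
  let μ := PathConnectedSpace.somePath (e y).2 (e y').2
  have ht : ∀ v, (p y, v) ∈ e.target := fun v => e.mem_target.2 he
  refine ⟨⟨⟨fun t => e.toOpenPartialHomeomorph.symm (p y, μ t), ?_⟩, ?_, ?_⟩, fun t => ?_⟩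
  · exact e.toOpenPartialHomeomorph.continuousOn_symm.comp_continuous (by fun_prop) fun t => ht _
  · change e.toOpenPartialHomeomorph.symm (p y, μ 0) = y
    rw [μ.source, ← e.coe_fst h1]
    exact e.toOpenPartialHomeomorph.left_inv h1
  · change e.toOpenPartialHomeomorph.symm (p y, μ 1) = y'
    rw [μ.target, ← hy, ← e.coe_fst h2]
    exact e.toOpenPartialHomeomorph.left_inv h2
  · exact e.proj_symm_apply (ht _)

theorem homotopic_refl_of_fibre [SimplyConnectedSpace F] {y : Y} (γ : Path y y)
    (hγ : ∀ t, p (γ t) = p y) : Path.Homotopic γ (Path.refl y) := by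
  obtain ⟨e, he⟩ := hp (p y)
  have h1 : ∀ t, γ t ∈ e.source := fun t => e.mem_source.2 ((hγ t).symm ▸ he)
  have he' : ContinuousOn e e.source := e.toOpenPartialHomeomorph.continuousOn
  refine γ.homotopic_refl_of_factor
    ⟨fun v => e.toOpenPartialHomeomorph.symm (p y, v),
      e.toOpenPartialHomeomorph.continuousOn_symm.comp_continuous (by fun_prop)
        fun v => e.mem_target.2 he⟩
    ⟨fun t => (e (γ t)).2, continuous_snd.comp (he'.comp_continuous γ.continuous h1)⟩
    (fun t => ?_) (by simp)
  change e.toOpenPartialHomeomorph.symm (p y, (e (γ t)).2) = γ t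
  rw [← hγ t, ← e.coe_fst (h1 t)]
  exact e.toOpenPartialHomeomorph.left_inv (h1 t)

/-- The null-homotopy is lifted with `γ` on the lower edge and a constant on the left edge. In the
square the lower edge is homotopic to the path along the other three sides, whose lift lies in one
fibre and contracts there. -/
theorem homotopic_refl_of_map [SimplyConnectedSpace F] (hpc : Continuous p) {y : Y} (γ : Path y y)
    (h : Path.Homotopic (γ.map hpc) (Path.refl (p y))) : Path.Homotopic γ (Path.refl y) := by
  obtain ⟨G⟩ := h
  have h01 : (0 : ℝ) ≤ 1 := zero_le_one
  obtain ⟨f, hf, hpf, hfg⟩ := cornerLifting_unit hp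
    (H := fun z => G (projIcc 0 1 h01 z.2, projIcc 0 1 h01 z.1))
    (by fun_prop) (fun z => γ.extend z.1) (by fun_prop) (by
      rintro ⟨s, t⟩ (⟨hs, -⟩ | ⟨-, ht⟩)
      · obtain rfl : s = 0 := hs
        simp
      · obtain rfl : t = 0 := ht
        simp only [projIcc_left]
        exact (G.apply_zero _).symm)
  let cl : ℝ × ℝ → ℝ × ℝ := fun z => (projIcc 0 1 h01 z.1, projIcc 0 1 h01 z.2)
  have hcl : ∀ z, cl z ∈ (Icc 0 1 ×ˢ Icc 0 1 : Set (ℝ × ℝ)) := fun z => ⟨Subtype.prop _, Subtype.prop _⟩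
  have hcl2 : ∀ z ∈ (Icc 0 1 ×ˢ Icc 0 1 : Set (ℝ × ℝ)), cl z = z := fun z hz => by
    simp [cl, projIcc_of_mem h01 hz.1, projIcc_of_mem h01 hz.2]
  let f' : C(ℝ × ℝ, Y) := ⟨fun z => f (cl z), hf.comp_continuous (by fun_prop) hcl⟩
  have hf' : ∀ z ∈ (Icc 0 1 ×ˢ Icc 0 1 : Set (ℝ × ℝ)), f' z = f z := fun z hz => by
    change f (cl z) = f z
    rw [hcl2 z hz]
  let q1 : Path ((0, 0) : ℝ × ℝ) (1, 0) := ⟨⟨fun t => (t, 0), by fun_prop⟩, by simp, by simp⟩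
  -- The path goes up the left side, along the top and down the right side, each in one third of the
  -- time.
  let q2 : Path ((0, 0) : ℝ × ℝ) (1, 0) :=
    ⟨⟨fun t => (min 1 (max 0 (3 * t - 1)), min 1 (min (3 * t) (3 - 3 * t))), by fun_prop⟩,
      by norm_num, by norm_num⟩
  have h1 := (SimplyConnectedSpace.paths_homotopic q1 q2).map f'
  have hb : ∀ t : ℝ, t ∈ Icc (0 : ℝ) 1 → f' (t, 0) = γ.extend t := fun t ht => by
    rw [hf' _ ⟨ht, le_rfl, h01⟩]
    exact hfg (.inr ⟨ht, rfl⟩)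
  have e0 : f' (0, 0) = y := by rw [hb 0 ⟨le_rfl, h01⟩]; simp
  have e1 : f' (1, 0) = y := by rw [hb 1 ⟨h01, le_rfl⟩]; simp
  have h2 := h1.pathCast e0.symm e1.symm
  have h3 : (q1.map f'.continuous).cast e0.symm e1.symm = γ := by
    refine Path.ext (funext fun t => ?_)
    exact (hb t t.2).trans (γ.extend_apply t.2)
  rw [h3] at h2
  refine h2.trans (homotopic_refl_of_fibre hp _ fun t => ?_)
  change p (f' (min 1 (max 0 (3 * (t : ℝ) - 1)), min 1 (min (3 * (t : ℝ)) (3 - 3 * t)))) = p y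
  obtain ⟨ht0, ht1⟩ := t.2
  have hm : (min 1 (max 0 (3 * (t : ℝ) - 1)), min 1 (min (3 * (t : ℝ)) (3 - 3 * t))) ∈
      (Icc 0 1 ×ˢ Icc 0 1 : Set (ℝ × ℝ)) :=
    ⟨⟨le_min h01 (le_max_left _ _), min_le_left _ _⟩,
      le_min h01 (le_min (by linarith) (by linarith)), min_le_left _ _⟩
  rw [hf' _ hm, hpf _ hm]
  rcases le_total (3 * (t : ℝ)) 1 with ht | ht
  · have : min 1 (max 0 (3 * (t : ℝ) - 1)) = 0 := by
      rw [max_eq_left (by linarith)]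
      exact min_eq_right h01
    simp [this]
  rcases le_total (3 * (t : ℝ)) 2 with ht2 | ht2
  · have : min 1 (min (3 * (t : ℝ)) (3 - 3 * t)) = 1 := min_eq_left (le_min ht (by linarith))
    simp only [this, projIcc_right]
    exact G.apply_one _
  · have : min 1 (max 0 (3 * (t : ℝ) - 1)) = 1 :=
      min_eq_left (le_max_of_le_right (by linarith))
    simp [this]

/-- The projection of a fibre bundle with simply connected fibres induces an isomorphism of
fundamental groups. -/
theorem bijective_fundamentalGroup_map [SimplyConnectedSpace F] (hpc : Continuous p) (y : Y) :
    Function.Bijective (FundamentalGroup.map (⟨p, hpc⟩ : C(Y, X)) y) := by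
  constructor
  · rw [injective_iff_map_eq_one]
    intro a
    induction a using Path.Homotopic.Quotient.ind with
    | mk γ =>
      intro h
      have h1 : Path.Homotopic.Quotient.mk (γ.map hpc) = Path.Homotopic.Quotient.mk (Path.refl (p y)) := h
      exact Path.Homotopic.Quotient.eq.2 (homotopic_refl_of_map hp hpc γ
        (Path.Homotopic.Quotient.eq.1 h1))
  · intro a
    induction a using Path.Homotopic.Quotient.ind with
    | mk γ =>
      -- The lift of the loop ends in the fibre over its starting point and is closed up inside this
      -- fibre. The projection is the loop followed by a constant path.
      obtain ⟨y', δ, hδ⟩ := exists_lift_path hp γ (y := y) rfl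
      have hy' : p y = p y' := by
        have := hδ 1
        rw [δ.target, γ.target] at this
        exact this.symm
      obtain ⟨ε, hε⟩ := exists_fibre_path hp hy'
      refine ⟨Path.Homotopic.Quotient.mk (δ.trans ε), ?_⟩
      refine (Path.Homotopic.Quotient.eq (p := (δ.trans ε).map hpc)).2 ?_
      have h1 : (δ.trans ε).map hpc = γ.trans (Path.refl _) := by
        refine Path.ext (funext fun t => ?_)
        rw [Path.map_coe, Function.comp_apply, Path.trans_apply, Path.trans_apply]
        split_ifs
        · exact hδ _
        · exact (hε _).trans hy'.symm
      rw [h1]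
      exact ⟨Path.Homotopy.transRefl γ⟩

theorem pathConnectedSpace_of_bundle [PathConnectedSpace X] [PathConnectedSpace F] :
    PathConnectedSpace Y := by
  obtain ⟨x⟩ := (inferInstance : Nonempty X)
  obtain ⟨v⟩ := (inferInstance : Nonempty F)
  obtain ⟨e, he⟩ := hp x
  refine ⟨⟨e.toOpenPartialHomeomorph.symm (x, v)⟩, fun y y' => ?_⟩
  obtain ⟨y'', δ, hδ⟩ := exists_lift_path hp (PathConnectedSpace.somePath (p y) (p y')) rfl
  have h1 : p y' = p y'' := by
    have := hδ 1
    rw [δ.target, Path.target] at this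
    exact this.symm
  exact ⟨δ.trans (exists_fibre_path hp h1).choose⟩

end fundamentalGroup

end

/-! ### Simple connectivity of spheres; the bundle over an integral form. -/

noncomputable section

open unitInterval

section sphere

variable {V : Type*} [NormedAddCommGroup V] [InnerProductSpace ℝ V]

/-- Stereographic projection from the missed point identifies the rest of the sphere with a vector
space, where loops contract. -/
theorem Path.homotopic_refl_of_notMem_sphere {v u : Metric.sphere (0 : V) 1} (γ : Path v v)
    (h : ∀ t, γ t ≠ u) : Path.Homotopic γ (Path.refl v) := by
  have hu : ‖(u : V)‖ = 1 := norm_eq_of_mem_sphere u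
  have hs : ∀ t, γ t ∈ (stereographic hu).source := fun t => by
    rw [stereographic_source]
    exact h t
  refine γ.homotopic_refl_of_factor
    ⟨(stereographic hu).symm, continuousOn_univ.1 ((stereographic hu).continuousOn_symm)⟩
    ⟨fun t => stereographic hu (γ t), (stereographic hu).continuousOn.comp_continuous γ.continuous hs⟩
    (fun t => (stereographic hu).left_inv (hs t)) (by simp)

/-- At distance less than one from a unit vector, the segment joining the two curves avoids the
origin, so the straight-line homotopy can be normalized. -/
theorem Path.homotopic_normalize {v : Metric.sphere (0 : V) 1} (γ : Path v v) (q : ℝ → V)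
    (hq : Continuous q) (hd : ∀ t : I, ‖q t - γ t‖ < 1) (h0 : q 0 = v) (h1 : q 1 = v) :
    ∃ δ : Path v v, (∀ t : I, (δ t : V) = ‖q t‖⁻¹ • q t) ∧ Path.Homotopic γ δ := by
  have hne : ∀ (s t : I), (γ t : V) + (s : ℝ) • (q t - γ t) ≠ 0 := by
    intro s t h
    have h2 : ‖(γ t : V)‖ = ‖(s : ℝ) • (q t - γ t)‖ := by
      rw [← norm_neg ((s : ℝ) • (q t - (γ t : V))), ← eq_neg_of_add_eq_zero_left h]
    rw [norm_eq_of_mem_sphere, norm_smul, Real.norm_of_nonneg s.2.1] at h2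
    nlinarith [hd t, s.2.2, s.2.1, norm_nonneg (q t - (γ t : V))]
  have hw : Continuous fun p : I × I => (γ p.2 : V) + (p.1 : ℝ) • (q p.2 - γ p.2) := by fun_prop
  let N : I × I → V := fun p => ‖(γ p.2 : V) + (p.1 : ℝ) • (q p.2 - γ p.2)‖⁻¹ •
    ((γ p.2 : V) + (p.1 : ℝ) • (q p.2 - γ p.2))
  have hN : Continuous N := (hw.norm.inv₀ fun p => norm_ne_zero_iff.2 (hne p.1 p.2)).smul hw
  have hmem : ∀ p, N p ∈ Metric.sphere (0 : V) 1 := fun p => by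
    rw [mem_sphere_zero_iff_norm, norm_smul, norm_inv, norm_norm,
      inv_mul_cancel₀ (norm_ne_zero_iff.2 (hne _ _))]
  let G : C(I × I, Metric.sphere (0 : V) 1) := ⟨fun p => ⟨N p, hmem p⟩, hN.subtype_mk hmem⟩
  have hG0 : ∀ t, G (0, t) = γ t := fun t => Subtype.ext (by
    change ‖(γ t : V) + ((0 : I) : ℝ) • (q t - γ t)‖⁻¹ • ((γ t : V) + ((0 : I) : ℝ) • (q t - γ t)) = γ t
    simp)
  have hG1 : ∀ t, (G (1, t) : V) = ‖q t‖⁻¹ • q t := fun t => by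
    change ‖(γ t : V) + ((1 : I) : ℝ) • (q t - γ t)‖⁻¹ • ((γ t : V) + ((1 : I) : ℝ) • (q t - γ t)) = _
    simp
  have he : ∀ (s : I) (t : I), q t = v → γ t = v → G (s, t) = v := fun s t h2 h3 => Subtype.ext (by
    change ‖(γ t : V) + (s : ℝ) • (q t - γ t)‖⁻¹ • ((γ t : V) + (s : ℝ) • (q t - γ t)) = v
    simp [h2, h3])
  let δ : Path v v := ⟨⟨fun t => G (1, t), by fun_prop⟩, he 1 0 h0 γ.source, he 1 1 h1 γ.target⟩
  refine ⟨δ, hG1, ⟨⟨⟨G, hG0, fun t => rfl⟩, ?_⟩⟩⟩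
  rintro s t (rfl | rfl)
  · exact (he s 0 h0 γ.source).trans γ.source.symm
  · exact (he s 1 h1 γ.target).trans γ.target.symm

/-- A loop is homotopic to the normalization of a C¹ curve. The cone over this curve is the image of
ℝ² under a C¹ map, so in dimension greater than two it misses some vector, and the normalized loop
misses the corresponding direction. -/
theorem simplyConnectedSpace_sphere [FiniteDimensional ℝ V] (hV : 2 < Module.finrank ℝ V) :
    SimplyConnectedSpace (Metric.sphere (0 : V) 1) := by
  rw [simply_connected_iff_loops_nullhomotopic]
  constructor
  · refine isPathConnected_iff_pathConnectedSpace.1 (isPathConnected_sphere ?_ 0 zero_le_one)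
    rw [← Module.finrank_eq_rank]
    exact_mod_cast (by omega : 1 < Module.finrank ℝ V)
  intro v γ
  obtain ⟨g, hg, hgd, -⟩ := (show Continuous fun t : ℝ => (γ.extend t : V) by fun_prop).exists_contDiff_approx
    1 (continuous_const (y := (1 / 2 : ℝ))) (fun _ => by norm_num)
  -- The linear correction restores the endpoints. Approximation and correction each contribute an
  -- error below 1/2, so the total stays below 1.
  let q : ℝ → V := fun t => g t + (1 - t) • (v - g 0) + t • (v - g 1)
  have hq : ContDiff ℝ 1 q := by fun_prop
  have e0 : ‖(v : V) - g 0‖ < 1 / 2 := by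
    have := hgd 0
    rwa [dist_comm, dist_eq_norm, Path.extend_zero] at this
  have e1 : ‖(v : V) - g 1‖ < 1 / 2 := by
    have := hgd 1
    rwa [dist_comm, dist_eq_norm, Path.extend_one] at this
  obtain ⟨δ, hδ, hγδ⟩ := γ.homotopic_normalize q hq.continuous (fun t => by
    have h1 := hgd t
    rw [dist_eq_norm, γ.extend_apply t.2] at h1
    have h2 : q t - γ t = (g t - γ t) + ((1 - (t : ℝ)) • (v - g 0) + (t : ℝ) • (v - g 1)) := by
      simp only [q]
      abel
    rw [h2]
    refine (norm_add_le _ _).trans_lt ?_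
    have h3 := norm_add_le ((1 - (t : ℝ)) • ((v : V) - g 0)) ((t : ℝ) • (v - g 1))
    rw [norm_smul, norm_smul, Real.norm_of_nonneg t.2.1,
      Real.norm_of_nonneg (by linarith [t.2.2])] at h3
    have h4 : ‖g t - (γ t : V)‖ < 1 / 2 := h1
    nlinarith [t.2.1, t.2.2]) (by simp [q]) (by simp [q])
  obtain ⟨u, hu⟩ := (ContDiff.dense_compl_range_of_finrank_lt_finrank
    (f := fun p : ℝ × ℝ => p.2 • q p.1) (by fun_prop) (by simpa using hV)).nonempty
  have hu0 : u ≠ 0 := fun h => hu ⟨(0, 0), by simp [h]⟩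
  refine hγδ.trans (δ.homotopic_refl_of_notMem_sphere
    (u := ⟨‖u‖⁻¹ • u, by simp [norm_smul, hu0]⟩) fun t ht => hu ⟨(t, ‖u‖ * ‖q t‖⁻¹), ?_⟩)
  have h1 : ‖q t‖⁻¹ • q t = ‖u‖⁻¹ • u := (hδ t).symm.trans (congrArg Subtype.val ht)
  change (‖u‖ * ‖q t‖⁻¹) • q t = u
  rw [mul_smul, h1, smul_inv_smul₀ (norm_ne_zero_iff.2 hu0)]

end sphere

instance : SimplyConnectedSpace S3 := by
  have h : Module.finrank ℝ (EuclideanSpace ℂ (Fin 2)) = 3 + 1 := Fact.out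
  have : FiniteDimensional ℝ (EuclideanSpace ℂ (Fin 2)) := Module.finite_of_finrank_eq_succ h
  exact simplyConnectedSpace_sphere (by omega)

variable {n : ℕ} {X : Type u} [TopologicalSpace X] [ChartedSpace (EuclideanSpace ℝ (Fin n)) X]
  {Ω : DForm n 2 X} {D : IntegralCocycle Ω}

theorem IntegralCocycle.sphereBundleHasPi1OfBase [IsManifold (𝓡 n) ∞ X] [ConnectedSpace X] :
    D.boothbyWang.SphereBundleHasPi1OfBase := by
  have : LocallyPathConnectedSpace X := ChartedSpace.locallyPathConnectedSpace (EuclideanSpace ℝ (Fin n)) X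
  have : PathConnectedSpace X := pathConnectedSpace_iff_connectedSpace.2 inferInstance
  have hp : ∀ x, ∃ t : Trivialization S3 D.projS3, x ∈ t.baseSet :=
    fun x => ⟨D.trivS3 (D.idx x), D.mem_idx x⟩
  have : PathConnectedSpace D.S3Bundle := pathConnectedSpace_of_bundle hp
  refine ⟨inferInstanceAs (ConnectedSpace D.S3Bundle), fun m x => ⟨?_⟩⟩
  exact (MulEquiv.ofBijective _ (bijective_fundamentalGroup_map hp continuous_projS3 m)).trans
    (FundamentalGroup.fundamentalGroupMulEquivOfPathConnected _ x)

/-- Integral symplectic forms have Boothby–Wang fibrations with the required properties. -/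
theorem exists_boothbyWang [IsManifold (𝓡 n) ∞ X] [T2Space X] [CompactSpace X] [ConnectedSpace X]
    (hΩ : DForm.IsSymplectic Ω) (hi : DForm.IsIntegral Ω) :
    ∃ B : BoothbyWang Ω, B.SphereBundleIsKContact ∧ B.SphereBundleHasPi1OfBase := by
  obtain ⟨D⟩ := hi.nonempty_cocycle
  obtain ⟨C⟩ := hΩ.nonempty_compatibleTriple
  exact ⟨D.boothbyWang, IntegralCocycle.sphereBundleIsKContact C,
    IntegralCocycle.sphereBundleHasPi1OfBase⟩

end

/-! ### Integrals with parameters and the Poincaré lemma for two-forms. -/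

noncomputable section

section parametricIntegral

open MeasureTheory
open scoped Interval

variable {P : Type*} [NormedAddCommGroup P] [NormedSpace ℝ P] {G : P → ℝ → ℝ} {s : Set P}

/-- The integral is the value at 0 of the convolution in t of the indicator of (0, 1] with the
reflected, cut off integrand, so smoothness of convolutions with parameters applies. The larger
interval leaves room for the cut-off. -/
theorem contDiffOn_integral (hs : IsOpen s)
    (hG : ∀ x ∈ s, ∀ t ∈ Ioo (-1 : ℝ) 2, ContDiffAt ℝ ∞ (fun q : P × ℝ => G q.1 q.2) (x, t)) :
    ContDiffOn ℝ ∞ (fun x => ∫ t in (0 : ℝ)..1, G x t) s := by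
  -- This function is 1 on [0, 1] and vanishes outside (-1/2, 3/2), well inside the interval where
  -- the integrand is smooth.
  let χ : ContDiffBump (1 / 2 : ℝ) := ⟨1 / 2, 1, by norm_num, by norm_num⟩
  have hχ0 : ∀ t, t ∉ Metric.ball (1 / 2 : ℝ) 1 → χ t = 0 := fun t ht => by
    rw [← Function.notMem_support, χ.support_eq]; exact ht
  have hχ1 : ∀ t ∈ Ioc (0 : ℝ) 1, χ t = 1 := fun t ht => by
    refine χ.one_of_mem_closedBall ?_
    rw [mem_closedBall_iff_norm, Real.norm_eq_abs, abs_le]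
    constructor <;> dsimp only [χ] <;> linarith [ht.1, ht.2]
  let g : P → ℝ → ℝ := fun p t => χ (-t) * G p (-t)
  let f : ℝ → ℝ := (Ioc (0 : ℝ) 1).indicator 1
  have hf : LocallyIntegrable f volume :=
    ((integrable_indicator_iff measurableSet_Ioc).2
      (integrableOn_const (C := (1 : ℝ)) (by simp))).locallyIntegrable
  have hg : ContDiffOn ℝ ∞ ↿g (s ×ˢ univ) := by
    rintro ⟨p, t⟩ ⟨hp, -⟩
    refine ContDiffAt.contDiffWithinAt ?_
    by_cases ht : -t ∈ Ioo (-1 : ℝ) 2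
    · have h1 : ContDiffAt ℝ ∞ (fun q : P × ℝ => χ (-q.2)) (p, t) :=
        (χ.contDiff.comp contDiff_snd.neg).contDiffAt
      have h2 : ContDiffAt ℝ ∞ (fun q : P × ℝ => (q.1, -q.2)) (p, t) :=
        (contDiff_fst.prodMk contDiff_snd.neg).contDiffAt
      exact h1.mul (ContDiffAt.comp (f := fun q : P × ℝ => (q.1, -q.2)) (p, t) (hG p hp _ ht) h2)
    · have h1 : ∀ᶠ q : P × ℝ in 𝓝 (p, t), ↿g q = 0 := by
        have h2 : (fun q : P × ℝ => -q.2) ⁻¹' (Metric.closedBall (1 / 2 : ℝ) 1)ᶜ ∈ 𝓝 (p, t) := by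
          refine IsOpen.mem_nhds (Metric.isClosed_closedBall.isOpen_compl.preimage (by fun_prop)) ?_
          intro h
          rw [mem_closedBall_iff_norm, Real.norm_eq_abs, abs_le] at h
          exact ht ⟨by linarith [h.1], by linarith [h.2]⟩
        filter_upwards [h2] with q hq
        have : χ (-q.2) = 0 := hχ0 _ fun h => hq (Metric.ball_subset_closedBall h)
        simp [g, Function.HasUncurry.uncurry, this]
      exact (contDiffAt_const (c := (0 : ℝ))).congr_of_eventuallyEq h1
  have h1 := contDiffOn_convolution_right_with_param (n := ⊤) (μ := volume) (f := f) (𝕜 := ℝ)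
    (ContinuousLinearMap.mul ℝ ℝ) (g := g) (k := Metric.closedBall (-1 / 2 : ℝ) 1) hs
    (isCompact_closedBall _ _) (fun p t _ ht => by
      have : χ (-t) = 0 := hχ0 _ fun h => ht (by
        rw [mem_closedBall_iff_norm, Real.norm_eq_abs, abs_le]
        rw [mem_ball_iff_norm, Real.norm_eq_abs, abs_lt] at h
        constructor <;> linarith [h.1, h.2])
      simp [g, this]) hf hg
  have h2 : ContDiffOn ℝ ∞ (fun x : P => (x, (0 : ℝ))) s :=
    (contDiff_id.prodMk contDiff_const).contDiffOn
  refine (h1.comp h2 fun x hx => ⟨hx, mem_univ _⟩).congr fun x hx => ?_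
  rw [Function.comp_apply, convolution, intervalIntegral.integral_of_le zero_le_one,
    ← integral_indicator measurableSet_Ioc]
  refine integral_congr_ae (.of_forall fun t => ?_)
  by_cases ht : t ∈ Ioc (0 : ℝ) 1
  · simp [f, g, ht, hχ1 t ht]
  · simp [f, ht]

theorem intervalIntegrable_fderiv_param
    {x : P} (hG : ∀ t ∈ Icc (0 : ℝ) 1, ContDiffAt ℝ ∞ (fun q : P × ℝ => G q.1 q.2) (x, t)) :
    IntervalIntegrable (fun t => fderiv ℝ (fun y => G y t) x) volume 0 1 := by
  refine ContinuousOn.intervalIntegrable fun t ht => ContinuousAt.continuousWithinAt ?_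
  rw [uIcc_of_le zero_le_one] at ht
  have h2 : ContDiffAt ℝ ∞ (fun q : P × ℝ => fderiv ℝ (fun y => G y q.2) q.1) (x, t) := by
    refine ContDiffAt.fderiv (f := fun (q : P × ℝ) y => G y q.2) (g := fun q : P × ℝ => q.1)
      (n := ∞) ?_ contDiffAt_fst (by simp)
    exact ContDiffAt.comp (f := fun q : (P × ℝ) × P => (q.2, q.1.2)) ((x, t), x) (hG t ht)
      (by fun_prop)
  exact ContinuousAt.comp (f := fun t : ℝ => (x, t)) h2.continuousAt (by fun_prop)

theorem hasFDerivAt_integral_param (hs : IsOpen s)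
    (hG : ∀ x ∈ s, ∀ t ∈ Icc (0 : ℝ) 1, ContDiffAt ℝ ∞ (fun q : P × ℝ => G q.1 q.2) (x, t))
    {x : P} (hx : x ∈ s) :
    HasFDerivAt (fun x => ∫ t in (0 : ℝ)..1, G x t)
      (∫ t in (0 : ℝ)..1, fderiv ℝ (fun y => G y t) x) x := by
  have h2 : ∀ x ∈ s, ∀ t ∈ Icc (0 : ℝ) 1,
      ContDiffAt ℝ ∞ (fun q : P × ℝ => fderiv ℝ (fun y => G y q.2) q.1) (x, t) := by
    intro x hx t ht
    refine ContDiffAt.fderiv (f := fun (q : P × ℝ) y => G y q.2) (g := fun q : P × ℝ => q.1)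
      (n := ∞) ?_ contDiffAt_fst (by simp)
    exact ContDiffAt.comp (f := fun q : (P × ℝ) × P => (q.2, q.1.2)) ((x, t), x) (hG x hx t ht)
      (by fun_prop)
  have hcG : ∀ x ∈ s, ContinuousOn (G x) (Icc 0 1) := fun x hx t ht =>
    (ContinuousAt.comp (f := fun t : ℝ => (x, t)) (hG x hx t ht).continuousAt
      (by fun_prop)).continuousWithinAt
  have hcD : ContinuousOn (fun t => fderiv ℝ (fun y => G y t) x) (Icc 0 1) := fun t ht =>
    (ContinuousAt.comp (f := fun t : ℝ => (x, t)) (h2 x hx t ht).continuousAt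
      (by fun_prop)).continuousWithinAt
  obtain ⟨C, hC⟩ := isCompact_Icc.exists_bound_of_continuousOn hcD
  -- Compactness of [0, 1] makes the bound at `x`, enlarged by one, uniform in t for all nearby
  -- points. It is the dominating function.
  have h3 : ∀ᶠ y in 𝓝 x, ∀ t ∈ Icc (0 : ℝ) 1, ‖fderiv ℝ (fun z => G z t) y‖ < C + 1 := by
    refine isCompact_Icc.eventually_forall_of_forall_eventually fun t ht => ?_
    exact (h2 x hx t ht).continuousAt.norm.eventually_lt continuousAt_const
      (by simpa using (hC t ht).trans_lt (lt_add_one C))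
  have hm : Ι (0 : ℝ) 1 = Ioc 0 1 := uIoc_of_le zero_le_one
  refine intervalIntegral.hasFDerivAt_integral_of_dominated_of_fderiv_le
    (bound := fun _ => C + 1) (F := G)
    (F' := fun y t => fderiv ℝ (fun z => G z t) y) (h3.and (hs.mem_nhds hx)) ?_ ?_ ?_ ?_ ?_ ?_
  · filter_upwards [hs.mem_nhds hx] with y hy
    rw [hm]
    exact ((hcG y hy).mono Ioc_subset_Icc_self).aestronglyMeasurable measurableSet_Ioc
  · exact ContinuousOn.intervalIntegrable (by rw [uIcc_of_le zero_le_one]; exact hcG x hx)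
  · rw [hm]
    exact (hcD.mono Ioc_subset_Icc_self).aestronglyMeasurable measurableSet_Ioc
  · refine .of_forall fun t ht y hy => (hy.1 t ?_).le
    rw [hm] at ht; exact Ioc_subset_Icc_self ht
  · simp
  · refine .of_forall fun t ht y hy => ?_
    rw [hm] at ht
    have h4 : ContDiffAt ℝ ∞ (fun z => G z t) y :=
      ContDiffAt.comp (f := fun z : P => (z, t)) y (hG y hy.2 t (Ioc_subset_Icc_self ht))
        (by fun_prop)
    exact (h4.differentiableAt (by simp)).hasFDerivAt

end parametricIntegral

section poincare

variable {E : Type*} [NormedAddCommGroup E] [NormedSpace ℝ E]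

theorem hasFDerivAt_alternating_apply {k : ℕ} {α : E → E [⋀^Fin k]→L[ℝ] ℝ} {x : E}
    (h : DifferentiableAt ℝ α x) (v : Fin k → E) :
    HasFDerivAt (fun y => α y v)
      ((ContinuousAlternatingMap.apply ℝ E ℝ v).comp (fderiv ℝ α x)) x :=
  (ContinuousAlternatingMap.apply ℝ E ℝ v).hasFDerivAt.comp x h.hasFDerivAt

/-- The exterior derivative of a two-form on a vector space. -/
theorem extDeriv_two_apply {α : E → E [⋀^Fin 2]→L[ℝ] ℝ} {x : E} (h : DifferentiableAt ℝ α x)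
    (u v w : E) : extDeriv α x ![u, v, w] =
      fderiv ℝ α x u ![v, w] - fderiv ℝ α x v ![u, w] + fderiv ℝ α x w ![u, v] := by
  rw [extDeriv_apply h, Fin.sum_univ_three]
  have e0 : Fin.removeNth 0 ![u, v, w] = ![v, w] := by ext i : 1; fin_cases i <;> rfl
  have e1 : Fin.removeNth 1 ![u, v, w] = ![u, w] := by ext i : 1; fin_cases i <;> rfl
  have e2 : Fin.removeNth 2 ![u, v, w] = ![u, v] := by ext i : 1; fin_cases i <;> rfl
  have key : ∀ a : Fin 2 → E, ∀ b, fderiv ℝ (fun y => α y a) x b = fderiv ℝ α x b a := fun a b =>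
    DFunLike.congr_fun (hasFDerivAt_alternating_apply h a).fderiv b
  simp [e0, e1, e2, key, sub_eq_add_neg]

variable [FiniteDimensional ℝ E]

theorem contDiffAt_two_apply {Q : Type*} [NormedAddCommGroup Q] [NormedSpace ℝ Q]
    {α : Q → E [⋀^Fin 2]→L[ℝ] ℝ} {a b : Q → E} {q : Q} (hα : ContDiffAt ℝ ∞ α q)
    (ha : ContDiffAt ℝ ∞ a q) (hb : ContDiffAt ℝ ∞ b q) :
    ContDiffAt ℝ ∞ (fun y => α y ![a y, b y]) q := by
  -- The two vectors form a linear map from ℝ² to `E`; evaluating on them is pulling back along this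
  -- map.
  have h1 : ContDiffAt ℝ ∞ (fun y => (ContinuousLinearMap.fst ℝ ℝ ℝ).smulRight (a y) +
      (ContinuousLinearMap.snd ℝ ℝ ℝ).smulRight (b y)) q :=
    (contDiffAt_const.smulRight ha).add (contDiffAt_const.smulRight hb)
  refine ((hα.alternating_comp h1).alternating_apply ![(1, 0), (0, 1)]).congr_of_eventuallyEq
    (.of_forall fun y => ?_)
  refine congrArg (α y) (funext fun i => ?_)
  fin_cases i <;> simp

variable {α : E → E [⋀^Fin 2]→L[ℝ] ℝ} {a : E} {R : ℝ}

/-- The Poincaré lemma for two-forms on balls. -/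
theorem exists_extDeriv_eq (hα : ∀ x ∈ Metric.ball a (2 * R), ContDiffAt ℝ ∞ α x)
    (hd : ∀ x ∈ Metric.ball a (2 * R), extDeriv α x = 0) :
    ∃ μ : E → E [⋀^Fin 1]→L[ℝ] ℝ, ∀ x ∈ Metric.ball a R,
      ContDiffAt ℝ ∞ μ x ∧ extDeriv μ x = α x := by
  -- The doubled radius allows t to leave [0, 1], as `contDiffOn_integral` requires.
  have hin : ∀ x ∈ Metric.ball a R, ∀ t ∈ Ioo (-1 : ℝ) 2,
      a + t • (x - a) ∈ Metric.ball a (2 * R) := by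
    intro x hx t ht
    rw [mem_ball_iff_norm] at hx ⊢
    have h0 : |t| ≤ 2 := abs_le.2 ⟨by linarith [ht.1], ht.2.le⟩
    rw [add_sub_cancel_left, norm_smul, Real.norm_eq_abs]
    nlinarith [norm_nonneg (x - a), abs_nonneg t]
  have hI : Icc (0 : ℝ) 1 ⊆ Ioo (-1) 2 := fun t ht => ⟨by linarith [ht.1], by linarith [ht.2]⟩
  -- The integrand of the radial homotopy operator, whose value is the primitive ∫ t α(a + t(x -
  -- a))(x - a, ·) dt.
  let G : E → E → ℝ → ℝ := fun v x t => t * (α (a + t • (x - a))).bilin (x - a) v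
  have hG : ∀ v, ∀ x ∈ Metric.ball a R, ∀ t ∈ Ioo (-1 : ℝ) 2,
      ContDiffAt ℝ ∞ (fun q : E × ℝ => G v q.1 q.2) (x, t) := by
    intro v x hx t ht
    refine contDiffAt_snd.mul (contDiffAt_two_apply (α := fun q : E × ℝ => α (a + q.2 • (q.1 - a)))
      ?_ (by fun_prop) contDiffAt_const)
    exact ContDiffAt.comp (f := fun q : E × ℝ => a + q.2 • (q.1 - a)) (x, t)
      (hα _ (hin x hx t ht)) (by fun_prop)
  have hGi : ∀ x ∈ Metric.ball a R, ∀ v, IntervalIntegrable (G v x) MeasureTheory.volume 0 1 := by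
    intro x hx v
    refine ContinuousOn.intervalIntegrable fun t ht => ContinuousAt.continuousWithinAt ?_
    rw [uIcc_of_le zero_le_one] at ht
    exact ContinuousAt.comp (f := fun t : ℝ => (x, t)) (hG v x hx t (hI ht)).continuousAt
      (by fun_prop)
  let L : E → (E → ℝ) := fun x v => ∫ t in (0 : ℝ)..1, G v x t
  classical
  let μ : E → E [⋀^Fin 1]→L[ℝ] ℝ := fun x =>
    if hx : x ∈ Metric.ball a R then
      ContinuousAlternatingMap.ofSubsingleton ℝ E ℝ (0 : Fin 1)
        (LinearMap.toContinuousLinearMap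
          { toFun := L x
            map_add' := fun v w => by
              simp only [L]
              rw [← intervalIntegral.integral_add (hGi x hx v) (hGi x hx w)]
              simp only [G, map_add, mul_add]
            map_smul' := fun c v => by
              simp only [L, RingHom.id_apply, smul_eq_mul]
              rw [← intervalIntegral.integral_const_mul]
              simp only [G, map_smul, smul_eq_mul, mul_left_comm] })
    else 0
  have hμ : ∀ x ∈ Metric.ball a R, ∀ v : Fin 1 → E, μ x v = L x (v 0) := fun x hx v => by
    simp only [μ, dif_pos hx]
    rfl
  have hopen : IsOpen (Metric.ball a R) := Metric.isOpen_ball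
  have hμL : ∀ x ∈ Metric.ball a R, ∀ v : Fin 1 → E, (fun y => μ y v) =ᶠ[𝓝 x] fun y => L y (v 0) :=
    fun x hx v => by filter_upwards [hopen.mem_nhds hx] with y hy using hμ y hy v
  have hsm : ∀ x ∈ Metric.ball a R, ContDiffAt ℝ ∞ μ x := fun x hx =>
    contDiffAt_alternating fun v =>
      ((contDiffOn_integral hopen (hG (v 0))).contDiffAt (hopen.mem_nhds hx)).congr_of_eventuallyEq
        (hμL x hx v)
  refine ⟨μ, fun x hx => ⟨hsm x hx, ?_⟩⟩
  have hDL : ∀ v u, fderiv ℝ (fun y => μ y ![v]) x u =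
      ∫ t in (0 : ℝ)..1, fderiv ℝ (fun y => G v y t) x u := by
    intro v u
    have h0 : (fun y => L y (![v] 0)) = fun y => ∫ t in (0 : ℝ)..1, G v y t := rfl
    rw [(hμL x hx ![v]).fderiv_eq, h0,
      (hasFDerivAt_integral_param hopen (fun x hx t ht => hG v x hx t (hI ht)) hx).fderiv]
    exact ContinuousLinearMap.intervalIntegral_apply
      (intervalIntegrable_fderiv_param fun t ht => hG v x hx t (hI ht)) u
  have hDi : ∀ v u, IntervalIntegrable (fun t => fderiv ℝ (fun y => G v y t) x u)
      MeasureTheory.volume 0 1 := fun v u =>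
    ((ContinuousLinearMap.apply ℝ ℝ u).integrable_comp
      (intervalIntegrable_fderiv_param fun t ht => hG v x hx t (hI ht)).1 |> fun h =>
        ⟨h, by simp⟩)
  let y : ℝ → E := fun t => a + t • (x - a)
  have hy : ∀ t, HasDerivAt y (x - a) t := fun t => by
    have h := ((hasDerivAt_id t).smul_const (x - a)).const_add a
    rwa [one_smul] at h
  have hαd : ∀ t ∈ Icc (0 : ℝ) 1, DifferentiableAt ℝ α (y t) := fun t ht =>
    (hα _ (hin x hx t (hI ht))).differentiableAt (by simp)
  have hDG : ∀ t ∈ Icc (0 : ℝ) 1, ∀ v u, fderiv ℝ (fun y => G v y t) x u =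
      t * (t * fderiv ℝ α (y t) u ![x - a, v] + α (y t) ![u, v]) := by
    intro t ht v u
    have hd1 : DifferentiableAt ℝ (fun y => G v y t) x :=
      (ContDiffAt.comp (f := fun z : E => (z, t)) x (hG v x hx t (hI ht))
        (by fun_prop)).differentiableAt (by simp)
    have hl : HasDerivAt (fun r : ℝ => x + r • u) u 0 := by
      simpa using ((hasDerivAt_id (0 : ℝ)).smul_const u).const_add x
    have h1 : HasDerivAt (fun r : ℝ => G v (x + r • u) t) (fderiv ℝ (fun y => G v y t) x u) 0 :=
      HasFDerivAt.comp_hasDerivAt (l := fun y => G v y t) (f := fun r : ℝ => x + r • u) (0 : ℝ)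
        (by simpa using hd1.hasFDerivAt) hl
    have hz : HasDerivAt (fun r : ℝ => a + t • (x + r • u - a)) (t • u) 0 := by
      simpa using ((hl.sub_const a).const_smul t).const_add a
    have h3 : ∀ w, HasDerivAt (fun r : ℝ => α (a + t • (x + r • u - a)) ![w, v])
        (fderiv ℝ α (y t) (t • u) ![w, v]) 0 := fun w =>
      HasFDerivAt.comp_hasDerivAt (l := fun z => α z ![w, v])
        (l' := (ContinuousAlternatingMap.apply ℝ E ℝ ![w, v]).comp (fderiv ℝ α (y t)))
        (f := fun r : ℝ => a + t • (x + r • u - a)) (0 : ℝ)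
        (by simpa using hasFDerivAt_alternating_apply (hαd t ht) ![w, v]) hz
    have h4 := ((h3 (x - a)).add ((hasDerivAt_id (0 : ℝ)).mul (h3 u))).const_mul t
    have h5 : (fun r : ℝ => G v (x + r • u) t) = fun r => t *
        (α (a + t • (x + r • u - a)) ![x - a, v] + id r * α (a + t • (x + r • u - a)) ![u, v]) := by
      funext r
      simp only [G]
      rw [add_sub_right_comm, map_add, map_smul, add_apply, smul_apply]
      rfl
    rw [h5] at h1
    refine (h1.unique h4).trans ?_
    simp [y, -mul_eq_mul_left_iff]
    ring
  -- Closedness of `α` turns the antisymmetrized derivative of the integrand into the t-derivative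
  -- of t²α along the ray. The integral is then the value at t = 1, which is α(x).
  have hmain : ∀ v w, ∀ t ∈ uIcc (0 : ℝ) 1, HasDerivAt (fun t => t ^ 2 * α (y t) ![v, w])
      (fderiv ℝ (fun y => G w y t) x v - fderiv ℝ (fun y => G v y t) x w) t := by
    intro v w t ht
    rw [uIcc_of_le zero_le_one] at ht
    rw [hDG t ht, hDG t ht]
    have h1 : HasDerivAt (fun t => α (y t) ![v, w]) (fderiv ℝ α (y t) (x - a) ![v, w]) t :=
      (hasFDerivAt_alternating_apply (hαd t ht) ![v, w]).comp_hasDerivAt t (hy t)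
    refine ((hasDerivAt_pow 2 t).mul h1).congr_deriv ?_
    have h2 := DFunLike.congr_fun (hd _ (hin x hx t (hI ht))) ![x - a, v, w]
    rw [extDeriv_two_apply (hαd t ht)] at h2
    have h3 : α (y t) ![w, v] = - α (y t) ![v, w] := by
      have := (α (y t)).map_swap ![v, w] (i := 0) (j := 1) (by decide)
      refine Eq.trans (congrArg (α (y t)) ?_) this
      ext i : 1; fin_cases i <;> rfl
    have h4 : (0 : E [⋀^Fin (2 + 1)]→L[ℝ] ℝ) ![x - a, v, w] = 0 := rfl
    rw [h4] at h2
    rw [h3]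
    simp only [y] at h2 ⊢
    push_cast
    linear_combination t ^ 2 * h2
  ext m
  have hm : m = ![m 0, m 1] := by ext i : 1; fin_cases i <;> rfl
  rw [hm, extDeriv_one_apply ((hsm x hx).differentiableAt (by simp)), hDL, hDL,
    ← intervalIntegral.integral_sub (hDi _ _) (hDi _ _),
    intervalIntegral.integral_eq_sub_of_hasDerivAt (hmain _ _) ((hDi _ _).sub (hDi _ _))]
  simp [y]

end poincare

end

/-! ### Local primitives on a compact manifold. -/

noncomputable section

namespace DForm

variable {d k : ℕ} {X : Type u} [TopologicalSpace X] [ChartedSpace (EuclideanSpace ℝ (Fin d)) X]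
  [IsManifold (𝓡 d) ∞ X]

theorem SmoothAt.of_contDiffAt_chart {σ : DForm d k X} {x₀ x : X}
    (hx : x ∈ (extChartAt (𝓡 d) x₀).source)
    (h : ContDiffAt ℝ ∞ (inChart σ x₀) (extChartAt (𝓡 d) x₀ x)) : SmoothAt σ x := by
  have hb := mem_extChartAt_target (I := 𝓡 d) x
  have hx' : id ((extChartAt (𝓡 d) x).symm (extChartAt (𝓡 d) x x)) ∈ (extChartAt (𝓡 d) x₀).source := by
    simpa using hx
  have h1 := eventually_inChart_pullback σ hb contMDiffAt_id hx'
  rw [pullback_id] at h1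
  have h2 := contDiffAt_chart_comp (f := @id X) hb contMDiffAt_id hx'
  refine ContDiffAt.congr_of_eventuallyEq ?_ h1
  have h3 : ContDiffAt ℝ ∞ (fun b => inChart σ x₀
      ((extChartAt (𝓡 d) x₀ ∘ id ∘ (extChartAt (𝓡 d) x).symm) b)) (extChartAt (𝓡 d) x x) :=
    ContDiffAt.comp (g := inChart σ x₀) _ (by simpa using h) h2
  exact h3.alternating_comp (h2.fderiv_right (m := ∞) (by simp))

theorem eq_of_inChart_eq {σ τ : DForm d k X} {x₀ x : X} (hx : x ∈ (extChartAt (𝓡 d) x₀).source)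
    (h : inChart σ x₀ (extChartAt (𝓡 d) x₀ x) = inChart τ x₀ (extChartAt (𝓡 d) x₀ x)) :
    σ x = τ x := by
  ext v
  have h1 := DFunLike.congr_fun h
    (fun i => (mfderiv (𝓡 d) 𝓘(ℝ, EuclideanSpace ℝ (Fin d)) (extChartAt (𝓡 d) x₀) x (v i) :
      EuclideanSpace ℝ (Fin d)))
  replace h1 := (inChart_chart_apply σ hx _).symm.trans (h1.trans (inChart_chart_apply τ hx _))
  have h2 : (fun i => mfderiv 𝓘(ℝ, EuclideanSpace ℝ (Fin d)) (𝓡 d) (extChartAt (𝓡 d) x₀).symm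
      (extChartAt (𝓡 d) x₀ x)
      (mfderiv (𝓡 d) 𝓘(ℝ, EuclideanSpace ℝ (Fin d)) (extChartAt (𝓡 d) x₀) x (v i))) = v :=
    funext fun i => mfderiv_symm_comp_chart hx (v i)
  rwa [h2] at h1

/-- The form on the domain of a chart with a given coordinate expression. -/
def ofChart (x₀ : X) (α : EuclideanSpace ℝ (Fin d) → EuclideanSpace ℝ (Fin d) [⋀^Fin k]→L[ℝ] ℝ) :
    DForm d k X := fun x =>
  (α (extChartAt (𝓡 d) x₀ x)).compContinuousLinearMap
    (mfderiv (𝓡 d) 𝓘(ℝ, EuclideanSpace ℝ (Fin d)) (extChartAt (𝓡 d) x₀) x)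

theorem inChart_ofChart {x₀ : X}
    (α : EuclideanSpace ℝ (Fin d) → EuclideanSpace ℝ (Fin d) [⋀^Fin k]→L[ℝ] ℝ)
    {b : EuclideanSpace ℝ (Fin d)} (hb : b ∈ (extChartAt (𝓡 d) x₀).target) :
    inChart (ofChart x₀ α) x₀ b = α b := by
  ext v
  have h1 : (fun i => (mfderiv (𝓡 d) 𝓘(ℝ, EuclideanSpace ℝ (Fin d)) (extChartAt (𝓡 d) x₀)
      ((extChartAt (𝓡 d) x₀).symm b)
      (mfderiv 𝓘(ℝ, EuclideanSpace ℝ (Fin d)) (𝓡 d) (extChartAt (𝓡 d) x₀).symm b (v i)) :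
      EuclideanSpace ℝ (Fin d))) = v := funext fun i => mfderiv_chart_comp_symm hb (v i)
  have h2 : extChartAt (𝓡 d) x₀ ((extChartAt (𝓡 d) x₀).symm b) = b :=
    (extChartAt (𝓡 d) x₀).right_inv hb
  calc _ = α (extChartAt (𝓡 d) x₀ ((extChartAt (𝓡 d) x₀).symm b))
        (fun i => (mfderiv (𝓡 d) 𝓘(ℝ, EuclideanSpace ℝ (Fin d)) (extChartAt (𝓡 d) x₀)
      ((extChartAt (𝓡 d) x₀).symm b)
      (mfderiv 𝓘(ℝ, EuclideanSpace ℝ (Fin d)) (𝓡 d) (extChartAt (𝓡 d) x₀).symm b (v i)))) := rfl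
    _ = _ := by rw [h1, h2]

/-- Every one-form that is smooth and closed on `C` has a primitive on `C`. -/
def ClosedOneExact (C : Set X) : Prop :=
  ∀ μ : DForm d 1 X, SmoothOn μ C → (∀ x ∈ C, extD μ x = 0) →
    ∃ f : X → ℝ, ContMDiffOn (𝓡 d) 𝓘(ℝ, ℝ) ∞ f C ∧ ∀ x ∈ C, ∀ v : TangentSpace (𝓡 d) x,
      (mfderiv (𝓡 d) 𝓘(ℝ, ℝ) f x v : ℝ) = μ x ![v]

/-- Every closed two-form has a primitive on `C`. -/
def ClosedTwoExact (C : Set X) : Prop :=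
  ∀ σ : DForm d 2 X, SmoothOn σ univ → extD σ = 0 →
    ∃ μ : DForm d 1 X, SmoothOn μ C ∧ ∀ x ∈ C, extD μ x = σ x

/-- The preimage of a set under a chart. -/
def chartSet (x₀ : X) (B : Set (EuclideanSpace ℝ (Fin d))) : Set X :=
  (extChartAt (𝓡 d) x₀).source ∩ extChartAt (𝓡 d) x₀ ⁻¹' B

theorem isOpen_chartSet (x₀ : X) {B : Set (EuclideanSpace ℝ (Fin d))} (hB : IsOpen B) :
    IsOpen (chartSet x₀ B) :=
  (continuousOn_extChartAt x₀).isOpen_inter_preimage (isOpen_extChartAt_source x₀) hB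

theorem closedTwoExact_chartSet {x₀ : X} {R : ℝ} {a : EuclideanSpace ℝ (Fin d)}
    (hR : Metric.ball a (2 * R) ⊆ (extChartAt (𝓡 d) x₀).target) (hR0 : 0 < R) :
    ClosedTwoExact (d := d) (chartSet x₀ (Metric.ball a R)) := by
  intro σ hs hc
  have hs' := (smoothOn_iff isOpen_univ).1 hs
  have hsub : Metric.ball a R ⊆ Metric.ball a (2 * R) := Metric.ball_subset_ball (by linarith)
  obtain ⟨α, hα⟩ := exists_extDeriv_eq (α := inChart σ x₀) (a := a) (R := R)
    (fun b hb => (hs' _ (mem_univ _)).contDiffAt (hR hb)) (fun b hb => by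
      rw [(hs' _ (mem_univ _)).extDeriv_inChart (hR hb), hc]; rfl)
  have key : ∀ x ∈ chartSet x₀ (Metric.ball a R),
      inChart (ofChart x₀ α) x₀ =ᶠ[𝓝 (extChartAt (𝓡 d) x₀ x)] α := fun x hx => by
    filter_upwards [(isOpen_extChartAt_target x₀).mem_nhds ((extChartAt (𝓡 d) x₀).map_source hx.1)]
      with b hb using inChart_ofChart α hb
  have hsm : ∀ x ∈ chartSet x₀ (Metric.ball a R), SmoothAt (ofChart x₀ α) x := fun x hx =>
    SmoothAt.of_contDiffAt_chart hx.1 ((hα _ hx.2).1.congr_of_eventuallyEq (key x hx))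
  refine ⟨ofChart x₀ α, (smoothOn_iff (isOpen_chartSet x₀ Metric.isOpen_ball)).2 hsm,
    fun x hx => eq_of_inChart_eq hx.1 ?_⟩
  rw [← SmoothAt.extDeriv_inChart ((extChartAt (𝓡 d) x₀).map_source hx.1), (key x hx).extDeriv_eq,
    (hα _ hx.2).2]
  rw [(extChartAt (𝓡 d) x₀).left_inv hx.1]
  exact hsm x hx

theorem closedOneExact_chartSet {x₀ : X} {B : Set (EuclideanSpace ℝ (Fin d))} (hB : IsOpen B)
    (hBc : Convex ℝ B) (hBt : B ⊆ (extChartAt (𝓡 d) x₀).target) :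
    ClosedOneExact (d := d) (chartSet x₀ B) := by
  intro μ hs hc
  have hs' := (smoothOn_iff (isOpen_chartSet x₀ hB)).1 hs
  have hmem : ∀ b ∈ B, (extChartAt (𝓡 d) x₀).symm b ∈ chartSet x₀ B := fun b hb =>
    ⟨(extChartAt (𝓡 d) x₀).map_target (hBt hb), by
      rw [mem_preimage, (extChartAt (𝓡 d) x₀).right_inv (hBt hb)]; exact hb⟩
  let β : EuclideanSpace ℝ (Fin d) → EuclideanSpace ℝ (Fin d) →L[ℝ] ℝ := fun b =>
    (ContinuousAlternatingMap.ofSubsingleton ℝ _ ℝ (0 : Fin 1)).symm (inChart μ x₀ b)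
  have hβ1 : ∀ b v, β b v = inChart μ x₀ b ![v] := fun b v => by
    refine congrArg (inChart μ x₀ b) (funext fun j => ?_)
    fin_cases j
    rfl
  have hm : ∀ b ∈ B, ContDiffAt ℝ ∞ (inChart μ x₀) b := fun b hb =>
    (hs' _ (hmem b hb)).contDiffAt (hBt hb)
  have hβ : ∀ b ∈ B, ContDiffAt ℝ ∞ β b := fun b hb => by
    refine contDiffAt_clm_iff.2 fun v => ?_
    simp only [hβ1]
    exact (hm b hb).alternating_apply ![v]
  -- Closedness of the one-form is symmetry of the derivative of its coefficient map, which on a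
  -- convex set yields a potential.
  obtain ⟨F, hF⟩ := hBc.exists_forall_hasFDerivAt_of_fderiv_symmetric hB
    (show DifferentiableOn ℝ β B from fun b hb =>
      ((hβ b hb).differentiableAt (by simp)).differentiableWithinAt) (fun b hb v w => by
      have h1 : extDeriv (inChart μ x₀) b = 0 := by
        rw [(hs' _ (hmem b hb)).extDeriv_inChart (hBt hb)]
        ext v
        change extD μ _ _ = 0
        rw [hc _ (hmem b hb)]
        rfl
      have h2 := DFunLike.congr_fun h1 ![v, w]
      rw [extDeriv_one_apply ((hm b hb).differentiableAt (by simp))] at h2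
      have h3 : ∀ u, fderiv ℝ (fun y => inChart μ x₀ y ![u]) b = (fderiv ℝ β b).flip u := by
        intro u
        have h4 := (((ContinuousLinearMap.apply ℝ ℝ u).hasFDerivAt).comp b
          ((hβ b hb).differentiableAt (by simp)).hasFDerivAt).fderiv
        have h5 : (fun y => inChart μ x₀ y ![u]) = (ContinuousLinearMap.apply ℝ ℝ u) ∘ β := by
          funext y; exact (hβ1 y u).symm
        rw [h5, h4]
        rfl
      rw [h3, h3] at h2
      have h6 : (0 : EuclideanSpace ℝ (Fin d) [⋀^Fin (1 + 1)]→L[ℝ] ℝ) ![v, w] = 0 := rfl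
      rw [h6] at h2
      exact sub_eq_zero.1 h2)
  have hFs : ContDiffOn ℝ ∞ F B := by
    rw [contDiffOn_infty_iff_fderiv_of_isOpen hB]
    refine ⟨fun b hb => (hF b hb).differentiableAt.differentiableWithinAt, ?_⟩
    exact ContDiffOn.congr (fun b hb => (hβ b hb).contDiffWithinAt) fun b hb => (hF b hb).fderiv
  refine ⟨F ∘ extChartAt (𝓡 d) x₀, fun x hx => ContMDiffAt.contMDiffWithinAt ?_, fun x hx v => ?_⟩
  · exact ContMDiffAt.comp x (f := extChartAt (𝓡 d) x₀) (g := F)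
      (hFs.contDiffAt (hB.mem_nhds hx.2)).contMDiffAt (contMDiffAt_extChartAt' (by simpa using hx.1))
  · have h1 := mfderiv_comp_fderiv (.refl _ _) rfl (hF _ hx.2) (mdifferentiableAt_chart hx.1) v
    refine h1.trans ((hβ1 _ _).trans ((inChart_chart_apply μ hx.1 _).trans ?_))
    refine congrArg (μ x) (funext fun i => ?_)
    fin_cases i
    exact mfderiv_symm_comp_chart hx.1 v

theorem exists_exact_nhds {x₀ : X} {N : Set X} (hN : N ∈ 𝓝 x₀) :
    ∃ C : Set X, IsOpen C ∧ x₀ ∈ C ∧ C ⊆ N ∧ ClosedOneExact (d := d) C ∧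
      ClosedTwoExact (d := d) C := by
  have h1 : (extChartAt (𝓡 d) x₀).target ∩ (extChartAt (𝓡 d) x₀).symm ⁻¹' N ∈
      𝓝 (extChartAt (𝓡 d) x₀ x₀) := by
    refine Filter.inter_mem (extChartAt_target_mem_nhds x₀) ?_
    exact (continuousAt_extChartAt_symm x₀).preimage_mem_nhds (by simpa using hN)
  obtain ⟨r, hr, hsub⟩ := Metric.mem_nhds_iff.1 h1
  have h2 : Metric.ball (extChartAt (𝓡 d) x₀ x₀) (2 * (r / 2)) ⊆ (extChartAt (𝓡 d) x₀).target := by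
    rw [mul_div_cancel₀ _ two_ne_zero]
    exact hsub.trans inter_subset_left
  have h3 : Metric.ball (extChartAt (𝓡 d) x₀ x₀) (r / 2) ⊆ Metric.ball (extChartAt (𝓡 d) x₀ x₀) r :=
    Metric.ball_subset_ball (by linarith)
  refine ⟨chartSet x₀ (Metric.ball (extChartAt (𝓡 d) x₀ x₀) (r / 2)),
    isOpen_chartSet x₀ Metric.isOpen_ball, ⟨mem_extChartAt_source x₀, Metric.mem_ball_self (by linarith)⟩,
    fun x hx => ?_, closedOneExact_chartSet Metric.isOpen_ball (convex_ball _ _)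
      (h3.trans (hsub.trans inter_subset_left)), closedTwoExact_chartSet h2 (by linarith)⟩
  have := (hsub (h3 hx.2)).2
  rwa [mem_preimage, (extChartAt (𝓡 d) x₀).left_inv hx.1] at this

variable (σ : DForm d 2 X) in
/-- Primitives of `σ` on the members of a finite cover `V`, slightly enlarged to `U`, which differ
by exact forms on the overlaps. -/
structure FinitePrimitives where
  ι : Type u
  [fintype : Fintype ι]
  U : ι → Set X
  V : ι → Set X
  lam : ι → DForm d 1 X
  f : ι → ι → X → ℝ
  isOpen_U : ∀ i, IsOpen (U i)
  isOpen_V : ∀ i, IsOpen (V i)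
  closure_V : ∀ i, closure (V i) ⊆ U i
  iUnion_V : (⋃ i, V i) = univ
  smooth_lam : ∀ i, SmoothOn (lam i) (U i)
  extD_lam : ∀ i, ∀ x ∈ U i, extD (lam i) x = σ x
  smooth_f : ∀ i j, ContMDiffOn (𝓡 d) 𝓘(ℝ, ℝ) ∞ (f i j) (U i ∩ U j)
  mfderiv_f : ∀ i j, ∀ x ∈ U i ∩ U j, ∀ v : TangentSpace (𝓡 d) x,
    (mfderiv (𝓡 d) 𝓘(ℝ, ℝ) (f i j) x v : ℝ) = lam j x ![v] - lam i x ![v]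

attribute [instance] FinitePrimitives.fintype

/-- Two scales in an auxiliary metric replace a good cover. Two-forms have primitives on balls of
radius δ, and every ball of a much smaller radius r lies in a set of size comparable to δ/4 on which
closed one-forms are exact. If two r-balls meet, such a set containing one of them covers their
overlap and lies in both δ-balls, so the difference of the primitives is exact there. -/
theorem nonempty_finitePrimitives [T2Space X] [CompactSpace X] {σ : DForm d 2 X}
    (hs : SmoothOn σ univ) (hc : extD σ = 0) : Nonempty (FinitePrimitives σ) := by
  have := Manifold.metrizableSpace (𝓡 d) X
  let := TopologicalSpace.metrizableSpaceMetric X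
  choose W hWo hWx _ _ hW2 using fun x : X =>
    exists_exact_nhds (d := d) (x₀ := x) (N := univ) Filter.univ_mem
  obtain ⟨δ, hδ, hδW⟩ := lebesgue_number_lemma_of_metric (s := univ) isCompact_univ hWo
    (fun x _ => mem_iUnion.2 ⟨x, hWx x⟩)
  choose C hCo hCx hCs hC1 _ using fun x : X =>
    exists_exact_nhds (d := d) (x₀ := x) (Metric.ball_mem_nhds x (by positivity : 0 < δ / 4))
  obtain ⟨r', hr', hrC'⟩ := lebesgue_number_lemma_of_metric (s := univ) isCompact_univ hCo
    (fun x _ => mem_iUnion.2 ⟨x, hCx x⟩)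
  obtain ⟨r, hr, hrδ, hrC⟩ : ∃ r > 0, r ≤ δ / 4 ∧ ∀ x : X, ∃ i, Metric.ball x r ⊆ C i := by
    refine ⟨min r' (δ / 4), by positivity, min_le_right _ _, fun x => ?_⟩
    obtain ⟨i, hi⟩ := hrC' x (mem_univ x)
    exact ⟨i, (Metric.ball_subset_ball (min_le_left _ _)).trans hi⟩
  have hμ : ∀ y : X, ∃ μ : DForm d 1 X, ∀ x ∈ Metric.ball y δ, SmoothAt μ x ∧ extD μ x = σ x := by
    intro y
    obtain ⟨i, hi⟩ := hδW y (mem_univ y)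
    obtain ⟨μ, h1, h2⟩ := hW2 i σ hs hc
    exact ⟨μ, fun x hx => ⟨(smoothOn_iff (hWo i)).1 h1 x (hi hx), h2 x (hi hx)⟩⟩
  choose μ hμ using hμ
  have hf : ∀ y z : X, ∃ f : X → ℝ,
      ContMDiffOn (𝓡 d) 𝓘(ℝ, ℝ) ∞ f (Metric.ball y r ∩ Metric.ball z r) ∧
      ∀ x ∈ Metric.ball y r ∩ Metric.ball z r, ∀ v : TangentSpace (𝓡 d) x,
        (mfderiv (𝓡 d) 𝓘(ℝ, ℝ) f x v : ℝ) = μ z x ![v] - μ y x ![v] := by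
    intro y z
    by_cases hyz : (Metric.ball y r ∩ Metric.ball z r).Nonempty
    · obtain ⟨p, hpy, hpz⟩ := hyz
      obtain ⟨i, hi⟩ := hrC y
      have hp := hCs i (hi hpy)
      have hy := hCs i (hi (Metric.mem_ball_self hr))
      rw [Metric.mem_ball] at hp hy hpz
      -- Points of `C i` are within δ/2 of `y` and of `p`, and `p` is within r ≤ δ/4 of `z`.
      have h1 : ∀ c ∈ C i, c ∈ Metric.ball y δ ∧ c ∈ Metric.ball z δ := fun c hcC => by
        have h2 := hCs i hcC
        rw [Metric.mem_ball] at h2 ⊢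
        rw [Metric.mem_ball]
        have h3 := dist_triangle_right c y i
        have h4 := dist_triangle_right c p i
        have h5 := dist_triangle c p z
        constructor <;> linarith
      obtain ⟨f, hf1, hf2⟩ := hC1 i (μ z + (-1 : ℝ) • μ y)
        ((smoothOn_iff (hCo i)).2 fun x hx =>
          (hμ z x (h1 x hx).2).1.add ((hμ y x (h1 x hx).1).1.smul _))
        (fun x hx => by
          rw [SmoothAt.extD_add (hμ z x (h1 x hx).2).1 ((hμ y x (h1 x hx).1).1.smul _), extD_smul,
            (hμ z x (h1 x hx).2).2, (hμ y x (h1 x hx).1).2]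
          exact (congrArg (σ x + ·) (neg_one_smul ℝ (σ x))).trans (add_neg_cancel _))
      refine ⟨f, hf1.mono (inter_subset_left.trans hi), fun x hx v => ?_⟩
      rw [hf2 x (hi hx.1)]
      change μ z x ![v] + (-1) * μ y x ![v] = _
      ring
    · rw [not_nonempty_iff_eq_empty] at hyz
      exact ⟨0, by simp [hyz], by simp [hyz]⟩
  choose f hf1 hf2 using hf
  obtain ⟨t, ht⟩ := isCompact_univ.elim_finite_subcover (fun y : X => Metric.ball y (r / 2))
    (fun y => Metric.isOpen_ball) (fun x _ => mem_iUnion.2 ⟨x, Metric.mem_ball_self (by positivity)⟩)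
  have hrδ' : r ≤ δ := by linarith
  refine ⟨{
    ι := t
    U := fun y => Metric.ball y r
    V := fun y => Metric.ball y (r / 2)
    lam := fun y => μ y
    f := fun y z => f y z
    isOpen_U := fun _ => Metric.isOpen_ball
    isOpen_V := fun _ => Metric.isOpen_ball
    closure_V := fun y => Metric.closure_ball_subset_closedBall.trans
      (Metric.closedBall_subset_ball (by linarith))
    iUnion_V := eq_univ_of_univ_subset (ht.trans fun x hx => by simpa using hx)
    smooth_lam := fun y => (smoothOn_iff Metric.isOpen_ball).2 fun x hx =>
      (hμ y x (Metric.ball_subset_ball hrδ' hx)).1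
    extD_lam := fun y x hx => (hμ y x (Metric.ball_subset_ball hrδ' hx)).2
    smooth_f := fun y z => hf1 y z
    mfderiv_f := fun y z => hf2 y z }⟩

end DForm

end

/-! ### Rational approximation by additive maps. -/

noncomputable section

section rationalApproximation

/-- Finitely many real numbers are approximated by their images under a `ℚ`-linear map `ℝ → ℚ`. -/
theorem exists_linearMap_approx (s : Finset ℝ) {ε : ℝ} (hε : 0 < ε) :
    ∃ ψ : ℝ →ₗ[ℚ] ℚ, ∀ c ∈ s, |(ψ c : ℝ) - c| < ε := by
  let b := Module.Basis.ofVectorSpace ℚ ℝ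
  -- Each element of a basis of ℝ over ℚ is moved to a nearby rational number. The sum of the
  -- absolute values of the coordinates of `c` bounds how much this can move `c`.
  let N : ℝ → ℝ := fun c => (b.repr c).sum fun _ a => |(a : ℝ)|
  have hN : ∀ c, 0 ≤ N c := fun c => Finset.sum_nonneg fun i _ => abs_nonneg _
  have hM : 0 < 1 + ∑ c ∈ s, N c := by
    have := Finset.sum_nonneg (s := s) fun c _ => hN c
    linarith
  have hq : ∀ i, ∃ q : ℚ, |(q : ℝ) - b i| < ε / (1 + ∑ c ∈ s, N c) := fun i => by
    obtain ⟨q, hq⟩ := exists_rat_near (b i) (div_pos hε hM)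
    exact ⟨q, by rwa [abs_sub_comm]⟩
  choose q hq using hq
  refine ⟨b.constr ℚ q, fun c hc => ?_⟩
  have h1 : ((b.constr ℚ q c : ℚ) : ℝ) - c =
      (b.repr c).sum fun i a => (a : ℝ) * ((q i : ℝ) - b i) := by
    have h2 : c = (b.repr c).sum fun i a => (a : ℝ) * b i := by
      conv_lhs => rw [← b.linearCombination_repr c, Finsupp.linearCombination_apply]
      simp only [Rat.smul_def]
    rw [Module.Basis.constr_apply]
    refine Eq.trans (congrArg (_ - ·) h2) ?_
    simp only [Finsupp.sum, mul_sub, Finset.sum_sub_distrib, smul_eq_mul, Rat.cast_sum, Rat.cast_mul]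
  have h3 : N c ≤ ∑ c ∈ s, N c := Finset.single_le_sum (fun c _ => hN c) hc
  rw [h1]
  calc _ ≤ ∑ i ∈ (b.repr c).support, |(b.repr c i : ℝ) * ((q i : ℝ) - b i)| :=
        Finset.abs_sum_le_sum_abs _ _
    _ ≤ ∑ i ∈ (b.repr c).support, |(b.repr c i : ℝ)| * (ε / (1 + ∑ c ∈ s, N c)) :=
        Finset.sum_le_sum fun i _ => by
          rw [abs_mul]
          exact mul_le_mul_of_nonneg_left (hq i).le (abs_nonneg _)
    _ = N c * (ε / (1 + ∑ c ∈ s, N c)) := by rw [← Finset.sum_mul]; rfl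
    _ < ε := by
        rw [← mul_div_assoc, div_lt_iff₀ hM]
        nlinarith

theorem exists_common_den (s : Finset ℝ) (ψ : ℝ → ℚ) :
    ∃ k : ℕ, 0 < k ∧ ∀ c ∈ s, ∃ m : ℤ, (k : ℝ) * ψ c = m := by
  classical
  refine ⟨∏ c ∈ s, (ψ c).den, Finset.prod_pos fun c _ => (ψ c).pos, fun c hc => ?_⟩
  refine ⟨(∏ c ∈ s.erase c, (ψ c).den : ℕ) * (ψ c).num, ?_⟩
  rw [← Finset.mul_prod_erase s _ hc]
  have h : ((ψ c).den : ℝ) * (ψ c : ℝ) = (ψ c).num := by exact_mod_cast Rat.den_mul_eq_num (ψ c)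
  push_cast
  rw [← h]
  ring

end rationalApproximation

end

/-! ### The Čech cocycle and its correction by a partition of unity. -/

noncomputable section

open scoped RealInnerProductSpace

variable {d : ℕ} {X : Type u} [TopologicalSpace X] [ChartedSpace (EuclideanSpace ℝ (Fin d)) X]
  [IsManifold (𝓡 d) ∞ X]

theorem eventually_eq_of_mfderiv_eq_zero {g : X → ℝ} {x : X}
    (h : ∀ᶠ y in 𝓝 x, MDifferentiableAt (𝓡 d) 𝓘(ℝ, ℝ) g y ∧ ∀ v : TangentSpace (𝓡 d) y,
      (mfderiv (𝓡 d) 𝓘(ℝ, ℝ) g y v : ℝ) = 0) : ∀ᶠ y in 𝓝 x, g y = g x := by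
  have hb := mem_extChartAt_target (I := 𝓡 d) x
  have h1 : ∀ᶠ b in 𝓝 (extChartAt (𝓡 d) x x), b ∈ (extChartAt (𝓡 d) x).target ∧
      MDifferentiableAt (𝓡 d) 𝓘(ℝ, ℝ) g ((extChartAt (𝓡 d) x).symm b) ∧
      ∀ v : TangentSpace (𝓡 d) ((extChartAt (𝓡 d) x).symm b),
        (mfderiv (𝓡 d) 𝓘(ℝ, ℝ) g ((extChartAt (𝓡 d) x).symm b) v : ℝ) = 0 := by
    refine Filter.Eventually.and ((isOpen_extChartAt_target x).mem_nhds hb) ?_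
    refine (DForm.contMDiffAt_chart_symm hb).continuousAt.eventually (p := fun y =>
      MDifferentiableAt (𝓡 d) 𝓘(ℝ, ℝ) g y ∧ ∀ v : TangentSpace (𝓡 d) y,
        (mfderiv (𝓡 d) 𝓘(ℝ, ℝ) g y v : ℝ) = 0) ?_
    simpa using h
  obtain ⟨r, hr, hsub⟩ := Metric.mem_nhds_iff.1 h1
  have h2 : ∀ b ∈ Metric.ball (extChartAt (𝓡 d) x x) r,
      HasFDerivAt (g ∘ (extChartAt (𝓡 d) x).symm) (0 : EuclideanSpace ℝ (Fin d) →L[ℝ] ℝ) b := by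
    intro b hb
    obtain ⟨h3, h4, h5⟩ := hsub hb
    have h6 := DForm.mdifferentiableAt_chart_symm h3
    have h7 : DifferentiableAt ℝ (g ∘ (extChartAt (𝓡 d) x).symm) b :=
      mdifferentiableAt_iff_differentiableAt.1 (h4.comp b h6)
    have h8 : fderiv ℝ (g ∘ (extChartAt (𝓡 d) x).symm) b = 0 := by
      ext v
      have := mfderiv_comp_model (.refl _ _) rfl h4 h6 v
      rw [mfderiv_eq_fderiv] at this
      exact this.trans (h5 _)
    exact h8 ▸ h7.hasFDerivAt
  filter_upwards [(contMDiffAt_extChartAt (I := 𝓡 d) (n := ∞) (x := x)).continuousAt.preimage_mem_nhds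
    (Metric.ball_mem_nhds _ hr), extChartAt_source_mem_nhds (I := 𝓡 d) x] with y hy hys
  have h3 := Metric.isOpen_ball.is_const_of_fderiv_eq_zero (𝕜 := ℝ)
    (convex_ball (extChartAt (𝓡 d) x x) r).isPreconnected
    (fun b hb => (h2 b hb).differentiableAt.differentiableWithinAt) (fun b hb => (h2 b hb).fderiv)
    hy (Metric.mem_ball_self hr)
  rwa [Function.comp_apply, Function.comp_apply, (extChartAt (𝓡 d) x).left_inv hys,
    (extChartAt (𝓡 d) x).left_inv (mem_extChartAt_source x)] at h3

namespace DForm.FinitePrimitives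

variable {σ : DForm d 2 X} (D : FinitePrimitives σ)

/-- The Čech cocycle of a family of primitives. -/
def cocycle (i j k : D.ι) (x : X) : ℝ := D.f j k x - D.f i k x + D.f i j x

variable {D}

/-- The Čech cocycle identity. It is formal in the functions `f` and so holds at every point, even
off the overlaps where their values carry no meaning. -/
theorem cocycle_relation (i j l m : D.ι) (x : X) :
    D.cocycle j l m x - D.cocycle i l m x = D.cocycle i j l x - D.cocycle i j m x := by
  simp only [cocycle]
  ring

theorem V_subset_U (i : D.ι) : D.V i ⊆ D.U i := subset_closure.trans (D.closure_V i)

/-- The derivatives of the three functions are differences of primitives, and their alternating sum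
is zero. -/
theorem eventually_cocycle_eq {i j k : D.ι} {x : X} (hi : x ∈ D.U i) (hj : x ∈ D.U j)
    (hk : x ∈ D.U k) : ∀ᶠ y in 𝓝 x, D.cocycle i j k y = D.cocycle i j k x := by
  refine eventually_eq_of_mfderiv_eq_zero (d := d) ?_
  filter_upwards [(D.isOpen_U i).mem_nhds hi, (D.isOpen_U j).mem_nhds hj,
    (D.isOpen_U k).mem_nhds hk] with y hi hj hk
  have hd : ∀ i j, y ∈ D.U i ∩ D.U j → MDifferentiableAt (𝓡 d) 𝓘(ℝ, ℝ) (D.f i j) y :=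
    fun i j h => ((D.smooth_f i j).contMDiffAt
      (((D.isOpen_U i).inter (D.isOpen_U j)).mem_nhds h)).mdifferentiableAt (by simp)
  have h1 := ((hd j k ⟨hj, hk⟩).hasMFDerivAt.sub (hd i k ⟨hi, hk⟩).hasMFDerivAt).add
    (hd i j ⟨hi, hj⟩).hasMFDerivAt
  have h2 : HasMFDerivAt (𝓡 d) 𝓘(ℝ, ℝ) (D.cocycle i j k) y _ := h1
  refine ⟨h2.mdifferentiableAt, fun v => ?_⟩
  rw [h2.mfderiv]
  have key : ∀ (A B C : EuclideanSpace ℝ (Fin d) →L[ℝ] ℝ) (v : EuclideanSpace ℝ (Fin d))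
      (a b c : ℝ), A v = a → B v = b → C v = c → (A - B + C) v = a - b + c := by
    rintro A B C v _ _ _ rfl rfl rfl
    rfl
  refine (key _ _ _ v _ _ _ (D.mfderiv_f j k y ⟨hj, hk⟩ v)
    (D.mfderiv_f i k y ⟨hi, hk⟩ v) (D.mfderiv_f i j y ⟨hi, hj⟩ v)).trans ?_
  exact (by intros; ring : ∀ a b c : ℝ, (c - b) - (c - a) + (b - a) = 0) _ _ _

-- The cocycle is locally constant near the compact triple intersections of the closures, hence
-- takes finitely many values there. No connectedness of the overlaps is needed, and this is why the
-- cover is shrunk from `U` to `V`.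
variable (D) in
theorem exists_finset_cocycle [CompactSpace X] : ∃ s : Finset ℝ, ∀ i j k, ∀ x ∈ D.V i ∩ D.V j ∩ D.V k,
    D.cocycle i j k x ∈ s := by
  classical
  have h1 : ∀ q : D.ι × D.ι × D.ι, ∃ s : Finset ℝ, ∀ x ∈ D.V q.1 ∩ D.V q.2.1 ∩ D.V q.2.2,
      D.cocycle q.1 q.2.1 q.2.2 x ∈ s := by
    rintro ⟨i, j, k⟩
    have hK : IsCompact (closure (D.V i) ∩ closure (D.V j) ∩ closure (D.V k)) :=
      ((isClosed_closure.inter isClosed_closure).inter isClosed_closure).isCompact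
    obtain ⟨t, -, ht⟩ := hK.elim_nhds_subcover
      (fun x => {y | D.cocycle i j k y = D.cocycle i j k x}) (fun x hx =>
        eventually_cocycle_eq (D.closure_V i hx.1.1) (D.closure_V j hx.1.2) (D.closure_V k hx.2))
    refine ⟨t.image (D.cocycle i j k), fun x hx => ?_⟩
    have := ht ⟨⟨subset_closure hx.1.1, subset_closure hx.1.2⟩, subset_closure hx.2⟩
    simp only [mem_iUnion] at this
    obtain ⟨y, hy, hxy⟩ := this
    exact Finset.mem_image.2 ⟨y, hy, Eq.symm hxy⟩
  choose s hs using h1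
  exact ⟨Finset.univ.biUnion s, fun i j k x hx =>
    Finset.mem_biUnion.2 ⟨(i, j, k), Finset.mem_univ _, hs (i, j, k) x hx⟩⟩

variable {ρ : SmoothPartitionOfUnity D.ι (𝓡 d) X univ} {E : ℝ →+ ℝ}

variable (D ρ) in
/-- The functions of the partition of unity as a map to a Euclidean space. -/
def part (x : X) : EuclideanSpace ℝ D.ι := WithLp.toLp 2 fun l => ρ l x

variable (D ρ) in
/-- The derivatives of the functions of the partition of unity. -/
def dpart (x : X) : TangentSpace (𝓡 d) x →L[ℝ] EuclideanSpace ℝ D.ι :=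
  mfderiv (𝓡 d) 𝓘(ℝ, EuclideanSpace ℝ D.ι) (D.part ρ) x

theorem contMDiff_part : ContMDiff (𝓡 d) 𝓘(ℝ, EuclideanSpace ℝ D.ι) ∞ (D.part ρ) := by
  have h1 : ContMDiff (𝓡 d) 𝓘(ℝ, D.ι → ℝ) ∞ (fun x l => ρ l x) :=
    contMDiff_pi_space.2 fun l => (ρ l).contMDiff
  exact (EuclideanSpace.equiv D.ι ℝ).symm.contDiff.contMDiff.comp h1

theorem mdifferentiableAt_part (x : X) :
    MDifferentiableAt (𝓡 d) 𝓘(ℝ, EuclideanSpace ℝ D.ι) (D.part ρ) x :=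
  contMDiff_part.contMDiffAt.mdifferentiableAt (by simp)

theorem mfderiv_comp_part {g : X → ℝ} (L : EuclideanSpace ℝ D.ι →L[ℝ] ℝ) {x : X}
    (hg : ∀ᶠ y in 𝓝 x, g y = L (D.part ρ y)) (v : TangentSpace (𝓡 d) x) :
    (mfderiv (𝓡 d) 𝓘(ℝ, ℝ) g x v : ℝ) = L (D.dpart ρ x v) :=
  mfderiv_comp_fderiv (g := L) hg rfl L.hasFDerivAt (mdifferentiableAt_part x) v

theorem sum_part (x : X) : ∑ l, ρ l x = 1 := by
  rw [← finsum_eq_sum_of_fintype, ρ.sum_eq_one (mem_univ x)]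

variable (D) in
/-- The linear functional with given coefficients. -/
def coeffs (c : D.ι → ℝ) : EuclideanSpace ℝ D.ι →L[ℝ] ℝ := ∑ l, c l • EuclideanSpace.proj l

theorem coeffs_apply (c : D.ι → ℝ) (z : EuclideanSpace ℝ D.ι) :
    D.coeffs c z = ∑ l, c l * z l := by
  simp [coeffs, sum_apply]

theorem sum_dpart (x : X) (v : TangentSpace (𝓡 d) x) : ∑ l, D.dpart ρ x v l = 0 := by
  have h1 := mfderiv_comp_part (ρ := ρ) (g := fun _ => (1 : ℝ)) (D.coeffs fun _ => 1) (x := x)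
    (.of_forall fun y => by simp [coeffs_apply, part, sum_part]) v
  rw [coeffs_apply, mfderiv_const] at h1
  simpa using! h1.symm

theorem dpart_apply (l : D.ι) (x : X) (v : TangentSpace (𝓡 d) x) :
    D.dpart ρ x v l = mfderiv (𝓡 d) 𝓘(ℝ, ℝ) (ρ l) x v :=
  (mfderiv_comp_part (ρ := ρ) (g := ρ l) (EuclideanSpace.proj l) (.of_forall fun _ => rfl) v).symm

theorem dpart_eq_zero {l : D.ι} {x : X} (hx : x ∉ tsupport (ρ l)) (v : TangentSpace (𝓡 d) x) :
    D.dpart ρ x v l = 0 := by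
  have h1 : (ρ l : X → ℝ) =ᶠ[𝓝 x] fun _ => 0 := notMem_tsupport_iff_eventuallyEq.1 hx
  rw [dpart_apply, h1.mfderiv_eq, mfderiv_const]
  rfl

/-- Off the support of either function of the partition both sides vanish nearby, and on both
supports the cocycle is locally constant. -/
theorem part_mul_dpart_eq (hρ : ρ.IsSubordinate D.V) (i l m : D.ι) {x : X} (hx : x ∈ D.V i) :
    ∀ᶠ y in 𝓝 x, ∀ v : TangentSpace (𝓡 d) y,
      E (D.cocycle i l m y) * (ρ l y * D.dpart ρ y v m) =
        E (D.cocycle i l m x) * (ρ l y * D.dpart ρ y v m) := by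
  by_cases hl : x ∈ tsupport (ρ l)
  · by_cases hm : x ∈ tsupport (ρ m)
    · filter_upwards [eventually_cocycle_eq (V_subset_U i hx) (V_subset_U l (hρ l hl))
        (V_subset_U m (hρ m hm))] with y hy v
      rw [hy]
    · filter_upwards [(isClosed_tsupport _).isOpen_compl.mem_nhds hm] with y hy v
      simp [dpart_eq_zero hy]
  · filter_upwards [(isClosed_tsupport _).isOpen_compl.mem_nhds hl] with y hy v
    simp [image_eq_zero_of_notMem_tsupport hy]

variable (D ρ E) in
/-- The correction of the primitives which changes the cocycle by the values of `E`. -/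
def corrForm (i : D.ι) : DForm d 1 X := fun x =>
  ContinuousAlternatingMap.ofSubsingleton ℝ _ ℝ (0 : Fin 1)
    ((D.coeffs fun m => -∑ l, E (D.cocycle i l m x) * ρ l x).comp (D.dpart ρ x))

variable (D ρ E) in
/-- The correction of the transition functions which changes the cocycle by the values of `E`. -/
def corrFun (i j : D.ι) (x : X) : ℝ := ∑ m, E (D.cocycle i j m x) * ρ m x

theorem corrForm_apply (i : D.ι) (x : X) (v : TangentSpace (𝓡 d) x) : D.corrForm ρ E i x ![v] =
    -∑ l, ∑ m, E (D.cocycle i l m x) * (ρ l x * D.dpart ρ x v m) := by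
  refine (coeffs_apply _ (D.dpart ρ x v)).trans ?_
  rw [Finset.sum_comm, ← Finset.sum_neg_distrib]
  refine Finset.sum_congr rfl fun m _ => ?_
  rw [neg_mul, Finset.sum_mul]
  simp only [mul_assoc]

theorem eventually_corrFun (hρ : ρ.IsSubordinate D.V) {i j : D.ι} {x : X} (hi : x ∈ D.V i)
    (hj : x ∈ D.V j) : ∀ᶠ y in 𝓝 x, D.corrFun ρ E i j y =
      D.coeffs (fun m => E (D.cocycle i j m x)) (D.part ρ y) := by
  have h1 : ∀ m, ∀ᶠ y in 𝓝 x, E (D.cocycle i j m y) * ρ m y = E (D.cocycle i j m x) * ρ m y := by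
    intro m
    by_cases hm : x ∈ tsupport (ρ m)
    · filter_upwards [eventually_cocycle_eq (V_subset_U i hi) (V_subset_U j hj)
        (V_subset_U m (hρ m hm))] with y hy
      rw [hy]
    · filter_upwards [(isClosed_tsupport _).isOpen_compl.mem_nhds hm] with y hy
      simp [image_eq_zero_of_notMem_tsupport hy]
  filter_upwards [Filter.eventually_all.2 h1] with y hy
  rw [coeffs_apply]
  exact Finset.sum_congr rfl fun m _ => hy m

theorem contMDiffAt_corrFun (hρ : ρ.IsSubordinate D.V) {i j : D.ι} {x : X} (hi : x ∈ D.V i)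
    (hj : x ∈ D.V j) : ContMDiffAt (𝓡 d) 𝓘(ℝ, ℝ) ∞ (D.corrFun ρ E i j) x :=
  ContMDiffAt.congr_of_eventuallyEq (ContMDiffAt.comp x
    (D.coeffs fun m => E (D.cocycle i j m x)).contDiff.contMDiff.contMDiffAt
    (contMDiff_part (ρ := ρ)).contMDiffAt) (eventually_corrFun hρ hi hj)

/-- By the cocycle relation the coefficient of ρ_l dρ_m splits into a part depending on l only and a
part depending on m only. The first disappears since the dρ_m add up to zero, and the second loses
its factor ρ_l since the ρ_l add up to one. -/
theorem mfderiv_corrFun (hρ : ρ.IsSubordinate D.V) {i j : D.ι} {x : X} (hi : x ∈ D.V i)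
    (hj : x ∈ D.V j) (v : TangentSpace (𝓡 d) x) :
    (mfderiv (𝓡 d) 𝓘(ℝ, ℝ) (D.corrFun ρ E i j) x v : ℝ) =
      D.corrForm ρ E j x ![v] - D.corrForm ρ E i x ![v] := by
  rw [mfderiv_comp_part _ (eventually_corrFun hρ hi hj), coeffs_apply, corrForm_apply,
    corrForm_apply]
  have h1 : ∀ l m, E (D.cocycle j l m x) * (ρ l x * D.dpart ρ x v m) -
      E (D.cocycle i l m x) * (ρ l x * D.dpart ρ x v m) =
      E (D.cocycle i j l x) * ρ l x * D.dpart ρ x v m -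
        ρ l x * (E (D.cocycle i j m x) * D.dpart ρ x v m) := fun l m => by
    have h2 := congrArg E (cocycle_relation (D := D) i j l m x)
    rw [map_sub, map_sub] at h2
    linear_combination (ρ l x * D.dpart ρ x v m) * h2
  have h3 : ∑ l, ∑ m, E (D.cocycle j l m x) * (ρ l x * D.dpart ρ x v m) -
      ∑ l, ∑ m, E (D.cocycle i l m x) * (ρ l x * D.dpart ρ x v m) =
      -∑ m, E (D.cocycle i j m x) * D.dpart ρ x v m := by
    simp only [← Finset.sum_sub_distrib, h1]
    simp only [Finset.sum_sub_distrib, ← Finset.mul_sum, sum_dpart, mul_zero,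
      zero_sub]
    rw [Finset.sum_neg_distrib, ← Finset.sum_mul, sum_part, one_mul]
  exact (by intros; linarith : ∀ a b c : ℝ, a - b = -c → c = -a - -b) _ _ _ h3

/-- Averaging the last index against the partition of unity is the standard contraction of the Čech
complex. It exhibits the cocycle E(c) as the coboundary of smooth functions. -/
theorem corrFun_relation (i j k : D.ι) (x : X) :
    D.corrFun ρ E j k x - D.corrFun ρ E i k x + D.corrFun ρ E i j x = E (D.cocycle i j k x) := by
  have h1 : ∀ m, E (D.cocycle j k m x) * ρ m x - E (D.cocycle i k m x) * ρ m x +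
      E (D.cocycle i j m x) * ρ m x = E (D.cocycle i j k x) * ρ m x := fun m => by
    have h2 := congrArg E (cocycle_relation (D := D) i j k m x)
    rw [map_sub, map_sub] at h2
    linear_combination ρ m x * h2
  simp only [corrFun, ← Finset.sum_sub_distrib, ← Finset.sum_add_distrib, h1]
  rw [← Finset.mul_sum, sum_part, mul_one]

end DForm.FinitePrimitives

end

/-! ### Size of the correction and its exterior derivative. -/

noncomputable section

open scoped RealInnerProductSpace

variable {d : ℕ} {X : Type u} [TopologicalSpace X] [ChartedSpace (EuclideanSpace ℝ (Fin d)) X]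
  [IsManifold (𝓡 d) ∞ X]

theorem dSymm_surjective {x₀ : X} {b : EuclideanSpace ℝ (Fin d)}
    (hb : b ∈ (extChartAt (𝓡 d) x₀).target)
    (v : TangentSpace (𝓡 d) ((extChartAt (𝓡 d) x₀).symm b)) :
    ∃ w : EuclideanSpace ℝ (Fin d), dSymm x₀ b w = v := by
  have key : ∀ b' : EuclideanSpace ℝ (Fin d), b' = b → ∀ z : EuclideanSpace ℝ (Fin d),
      (dSymm x₀ b' z : EuclideanSpace ℝ (Fin d)) = dSymm x₀ b z := by
    rintro _ rfl z
    rfl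
  refine ⟨dChart x₀ _ v, ?_⟩
  have h1 := dSymm_dChart ((extChartAt (𝓡 d) x₀).map_target hb) v
  exact (key _ ((extChartAt (𝓡 d) x₀).right_inv hb) _).symm.trans h1

variable {V : Type*} [NormedAddCommGroup V] [InnerProductSpace ℝ V] {h : X → V}
  {G : ∀ x : X, TangentSpace (𝓡 d) x →L[ℝ] TangentSpace (𝓡 d) x →L[ℝ] ℝ}

/-- The derivative of a vector-valued function. -/
def vderiv (h : X → V) (x : X) : TangentSpace (𝓡 d) x →L[ℝ] V := mfderiv (𝓡 d) 𝓘(ℝ, V) h x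

theorem eventually_norm_vderiv_le (hh : ContMDiff (𝓡 d) 𝓘(ℝ, V) ∞ h)
    (hpos : ∀ x v, v ≠ 0 → 0 < G x v v) {x₀ : X}
    (hG : ∀ (v w : EuclideanSpace ℝ (Fin d)), ContDiffAt ℝ ∞
      (fun b => G ((extChartAt (𝓡 d) x₀).symm b) (dSymm x₀ b v) (dSymm x₀ b w))
      (extChartAt (𝓡 d) x₀ x₀)) :
    ∃ K, 0 < K ∧ ∀ᶠ x in 𝓝 x₀, ∀ v : TangentSpace (𝓡 d) x,
      ‖vderiv (d := d) h x v‖ ^ 2 ≤ K * G x v v := by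
  have hb₀ := mem_extChartAt_target (I := 𝓡 d) x₀
  let Gc : EuclideanSpace ℝ (Fin d) → EuclideanSpace ℝ (Fin d) →L[ℝ] EuclideanSpace ℝ (Fin d) →L[ℝ] ℝ :=
    fun b => pullBilin (E := EuclideanSpace ℝ (Fin d)) (F := EuclideanSpace ℝ (Fin d))
      (G ((extChartAt (𝓡 d) x₀).symm b)) (dSymm x₀ b)
  have hGc : ContDiffAt ℝ ∞ Gc (extChartAt (𝓡 d) x₀ x₀) :=
    contDiffAt_clm_iff.2 fun v => contDiffAt_clm_iff.2 fun w => hG v w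
  have hĥ : ContDiffAt ℝ ∞ (h ∘ (extChartAt (𝓡 d) x₀).symm) (extChartAt (𝓡 d) x₀ x₀) :=
    contDiffAt_comp_chart_symm hb₀ hh.contMDiffAt
  let A := fderiv ℝ (h ∘ (extChartAt (𝓡 d) x₀).symm)
  have hA : ContinuousAt A (extChartAt (𝓡 d) x₀ x₀) :=
    (hĥ.fderiv_right (m := ∞) (by simp)).continuousAt
  obtain ⟨c, hc, hcoer⟩ := exists_coercive (Gc (extChartAt (𝓡 d) x₀ x₀)) fun v hv =>
    hpos _ _ fun h0 => hv (dSymm_injective hb₀ h0)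
  -- With this constant K G(v, v) - |A v|² is at least ‖v‖² at the centre. Positive definiteness
  -- then persists nearby.
  let K : ℝ := (‖A (extChartAt (𝓡 d) x₀ x₀)‖ ^ 2 + 1) / c
  have hK : 0 < K := by positivity
  let B : EuclideanSpace ℝ (Fin d) → EuclideanSpace ℝ (Fin d) →L[ℝ] EuclideanSpace ℝ (Fin d) →L[ℝ] ℝ :=
    fun b => K • Gc b - pullBilin (SphereFibration.realInnerSL V) (A b)
  have hB : ∀ b v, B b v v = K * Gc b v v - ‖A b v‖ ^ 2 := fun b v => by
    rw [← real_inner_self_eq_norm_sq]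
    rfl
  have h1 : ∀ᶠ b in 𝓝 (extChartAt (𝓡 d) x₀ x₀), ∀ v, v ≠ 0 → 0 < B b v v := by
    refine eventually_posDef (fun v => ?_) fun v hv => ?_
    · simp only [hB]
      have h2 : ContinuousAt (fun q : EuclideanSpace ℝ (Fin d) × EuclideanSpace ℝ (Fin d) => Gc q.1)
        (extChartAt (𝓡 d) x₀ x₀, v) := ContinuousAt.comp (g := Gc) hGc.continuousAt continuousAt_fst
      have h3 : ContinuousAt (fun q : EuclideanSpace ℝ (Fin d) × EuclideanSpace ℝ (Fin d) => A q.1)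
        (extChartAt (𝓡 d) x₀ x₀, v) := ContinuousAt.comp (g := A) hA continuousAt_fst
      exact (continuousAt_const.mul ((h2.clm_apply continuousAt_snd).clm_apply continuousAt_snd)).sub
        ((h3.clm_apply continuousAt_snd).norm.pow 2)
    · rw [hB]
      have h2 : K * (c * ‖v‖ ^ 2) ≤ K * Gc (extChartAt (𝓡 d) x₀ x₀) v v :=
        mul_le_mul_of_nonneg_left (hcoer v) hK.le
      have h3 : K * (c * ‖v‖ ^ 2) = (‖A (extChartAt (𝓡 d) x₀ x₀)‖ ^ 2 + 1) * ‖v‖ ^ 2 := by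
        simp only [K]
        field_simp
      have h4 : ‖A (extChartAt (𝓡 d) x₀ x₀) v‖ ^ 2 ≤ (‖A (extChartAt (𝓡 d) x₀ x₀)‖ * ‖v‖) ^ 2 :=
        pow_le_pow_left₀ (norm_nonneg _) ((A _).le_opNorm v) 2
      have h5 : 0 < ‖v‖ := norm_pos_iff.2 hv
      nlinarith
  refine ⟨K, hK, ?_⟩
  have h2 : ∀ᶠ b in 𝓝 (extChartAt (𝓡 d) x₀ x₀),
      ∀ v : TangentSpace (𝓡 d) ((extChartAt (𝓡 d) x₀).symm b),
      ‖vderiv (d := d) h ((extChartAt (𝓡 d) x₀).symm b) v‖ ^ 2 ≤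
        K * G ((extChartAt (𝓡 d) x₀).symm b) v v := by
    filter_upwards [h1, (isOpen_extChartAt_target x₀).mem_nhds hb₀] with b h1 hb v
    obtain ⟨w, rfl⟩ := dSymm_surjective hb v
    have h3 : 0 ≤ B b w w := by
      by_cases hw : w = 0
      · simp [hw]
      · exact (h1 w hw).le
    rw [hB] at h3
    have h4 := mfderiv_comp_model (.refl _ _) rfl (hh.contMDiffAt.mdifferentiableAt (by simp))
      (DForm.mdifferentiableAt_chart_symm hb) w
    rw [mfderiv_eq_fderiv] at h4
    have h5 : ‖A b w‖ ^ 2 ≤ K * Gc b w w := by linarith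
    refine le_trans (le_of_eq ?_) h5
    exact congrArg (fun z : V => ‖z‖ ^ 2) h4.symm
  filter_upwards [(contMDiffAt_extChartAt (I := 𝓡 d) (n := ∞) (x := x₀)).continuousAt.eventually h2,
    extChartAt_source_mem_nhds (I := 𝓡 d) x₀] with x hx hxs
  rwa [(extChartAt (𝓡 d) x₀).left_inv hxs] at hx

/-- On a compact manifold, derivatives are bounded with respect to a Riemannian metric. -/
theorem exists_norm_vderiv_le [CompactSpace X] (hh : ContMDiff (𝓡 d) 𝓘(ℝ, V) ∞ h)
    (hpos : ∀ x v, v ≠ 0 → 0 < G x v v)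
    (hG : ∀ (x₀ : X) (v w : EuclideanSpace ℝ (Fin d)), ContDiffAt ℝ ∞
      (fun b => G ((extChartAt (𝓡 d) x₀).symm b) (dSymm x₀ b v) (dSymm x₀ b w))
      (extChartAt (𝓡 d) x₀ x₀)) :
    ∃ K, 0 < K ∧ ∀ (x : X) (v : TangentSpace (𝓡 d) x),
      ‖vderiv (d := d) h x v‖ ^ 2 ≤ K * G x v v := by
  choose K hK hloc using fun x₀ : X => eventually_norm_vderiv_le hh hpos (hG x₀)
  obtain ⟨t, -, ht⟩ := isCompact_univ.elim_nhds_subcover _ fun x₀ _ => hloc x₀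
  have hs : 0 ≤ ∑ x ∈ t, K x := Finset.sum_nonneg fun x _ => (hK x).le
  refine ⟨1 + ∑ x ∈ t, K x, by linarith, fun x v => ?_⟩
  have := ht (mem_univ x)
  simp only [mem_iUnion] at this
  obtain ⟨y, hy, hxy⟩ := this
  have h0 : 0 ≤ G x v v := by
    by_cases hv : v = 0
    · simp [hv]
    · exact (hpos x v hv).le
  refine (hxy v).trans (mul_le_mul_of_nonneg_right ?_ h0)
  linarith [Finset.single_le_sum (fun x _ => (hK x).le) hy]

namespace DForm.FinitePrimitives

variable {σ : DForm d 2 X} {D : FinitePrimitives σ}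
  {ρ : SmoothPartitionOfUnity D.ι (𝓡 d) X univ} {E : ℝ →+ ℝ}

variable (D) in
/-- The endomorphism of the Euclidean space with given coefficients. -/
def coeffMap (A : D.ι → D.ι → ℝ) : EuclideanSpace ℝ D.ι →L[ℝ] EuclideanSpace ℝ D.ι := by
  classical
  exact ∑ l, ∑ m, A l m • (EuclideanSpace.proj l).smulRight (EuclideanSpace.single m (1 : ℝ))

theorem inner_coeffMap (A : D.ι → D.ι → ℝ) (a b : EuclideanSpace ℝ D.ι) :
    ⟪D.coeffMap A a, b⟫ = ∑ l, ∑ m, A l m * (a l * b m) := by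
  classical
  simp only [coeffMap, sum_apply, smul_apply, ContinuousLinearMap.smulRight_apply, sum_inner,
    real_inner_smul_left, EuclideanSpace.inner_single_left]
  simp

variable (D E) in
/-- The coefficients of the correction of the primitives near a point. -/
def corrCoeff (i : D.ι) (x : X) (l m : D.ι) : ℝ := -(2 * Real.pi) * E (D.cocycle i l m x)

/-- Near `x` the coefficients can be frozen, and the correction becomes the angular form of the
partition of unity for a constant matrix. The factor -2π in `corrCoeff` accounts for the
normalization of `angForm` and the sign of `corrForm`. -/
theorem eventually_corrForm (hρ : ρ.IsSubordinate D.V) {i : D.ι} {x : X} (hi : x ∈ D.V i) :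
    ∀ᶠ y in 𝓝 x, angForm (D.coeffMap (D.corrCoeff E i x)) (D.part ρ) y = D.corrForm ρ E i y := by
  filter_upwards [Filter.eventually_all.2 fun l => Filter.eventually_all.2 fun m =>
    part_mul_dpart_eq (E := E) hρ i l m hi] with y hy
  ext v
  have hv : v = ![v 0] := by
    ext j : 1
    fin_cases j
    rfl
  rw [hv, corrForm_apply]
  refine (congrArg ((2 * Real.pi)⁻¹ * ·) (inner_coeffMap (D.corrCoeff E i x) (D.part ρ y)
    (D.dpart ρ y (v 0)))).trans ?_
  dsimp only
  rw [Finset.mul_sum, ← Finset.sum_neg_distrib]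
  refine Finset.sum_congr rfl fun l _ => ?_
  rw [Finset.mul_sum, ← Finset.sum_neg_distrib]
  refine Finset.sum_congr rfl fun m _ => ?_
  rw [hy l m, corrCoeff]
  have : D.part ρ y l = ρ l y := rfl
  rw [this]
  field_simp

theorem smoothAt_corrForm (hρ : ρ.IsSubordinate D.V) {i : D.ι} {x : X} (hi : x ∈ D.V i) :
    SmoothAt (D.corrForm ρ E i) x :=
  (smoothAt_angForm contMDiff_part.contMDiffAt).congr (eventually_corrForm hρ hi)

theorem extD_corrForm (hρ : ρ.IsSubordinate D.V) {i : D.ι} {x : X} (hi : x ∈ D.V i)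
    (v w : TangentSpace (𝓡 d) x) : extD (D.corrForm ρ E i) x ![v, w] =
      -∑ l, ∑ m, E (D.cocycle i l m x) *
        (D.dpart ρ x v l * D.dpart ρ x w m - D.dpart ρ x w l * D.dpart ρ x v m) := by
  rw [← extD_congr (eventually_corrForm hρ hi), extD_angForm_eq_sub contMDiff_part.contMDiffAt]
  refine (congrArg ((2 * Real.pi)⁻¹ * ·) (congrArg₂ (· - ·)
    (inner_coeffMap (D.corrCoeff E i x) (D.dpart ρ x v) (D.dpart ρ x w))
    (inner_coeffMap (D.corrCoeff E i x) (D.dpart ρ x w) (D.dpart ρ x v)))).trans ?_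
  dsimp only
  rw [← Finset.sum_sub_distrib, Finset.mul_sum, ← Finset.sum_neg_distrib]
  refine Finset.sum_congr rfl fun l _ => ?_
  rw [← Finset.sum_sub_distrib, Finset.mul_sum, ← Finset.sum_neg_distrib]
  refine Finset.sum_congr rfl fun m _ => ?_
  rw [corrCoeff]
  field_simp
  ring

/-- The exterior derivatives of the corrections agree on the overlaps. -/
theorem extD_corrForm_eq (hρ : ρ.IsSubordinate D.V) {i j : D.ι} {x : X} (hi : x ∈ D.V i)
    (hj : x ∈ D.V j) : extD (D.corrForm ρ E i) x = extD (D.corrForm ρ E j) x := by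
  ext v
  have hv : v = ![v 0, v 1] := by
    ext j : 1
    fin_cases j <;> rfl
  rw [hv, extD_corrForm hρ hi, extD_corrForm hρ hj, neg_inj, ← sub_eq_zero]
  -- The cocycle relation makes the difference of the two coefficients a difference of functions of
  -- m and of l alone. Each resulting double sum contains a factor Σ a or Σ b, which vanishes.
  have h1 : ∀ a b : EuclideanSpace ℝ D.ι, ∑ l, a l = 0 → ∑ l, b l = 0 →
      ∑ l, ∑ m, (E (D.cocycle i j m x) - E (D.cocycle i j l x)) * (a l * b m - b l * a m) = 0 := by
    intro a b ha hb
    have h2 : ∀ l m, (E (D.cocycle i j m x) - E (D.cocycle i j l x)) * (a l * b m - b l * a m) =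
        a l * (E (D.cocycle i j m x) * b m) - b l * (E (D.cocycle i j m x) * a m) -
          (E (D.cocycle i j l x) * a l) * b m + (E (D.cocycle i j l x) * b l) * a m := by
      intros
      ring
    simp only [h2, Finset.sum_sub_distrib, Finset.sum_add_distrib, ← Finset.mul_sum, ha, hb,
      ← Finset.sum_mul, zero_mul, mul_zero, Finset.sum_const_zero]
    ring
  refine Eq.trans ?_ (h1 (D.dpart ρ x (v 0)) (D.dpart ρ x (v 1)) (sum_dpart x _) (sum_dpart x _))
  simp only [← Finset.sum_sub_distrib, ← sub_mul]
  refine Finset.sum_congr rfl fun l _ => Finset.sum_congr rfl fun m _ => ?_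
  congr 1
  have h2 := congrArg E (cocycle_relation (D := D) i j l m x)
  rw [map_sub, map_sub] at h2
  linarith

/-- A term is nonzero only if `x` lies in the supports of both functions involved, so only values of
`E` on the cocycle over triple overlaps of the `V i` matter. There are card² terms, with two
products in each. -/
theorem abs_extD_corrForm_le (hρ : ρ.IsSubordinate D.V) {η : ℝ} (hη : 0 ≤ η)
    (hE : ∀ i j k, ∀ x ∈ D.V i ∩ D.V j ∩ D.V k, |E (D.cocycle i j k x)| ≤ η)
    {i : D.ι} {x : X} (hi : x ∈ D.V i) (v w : TangentSpace (𝓡 d) x) :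
    |extD (D.corrForm ρ E i) x ![v, w]| ≤
      η * (2 * (Fintype.card D.ι : ℝ) ^ 2) * (‖D.dpart ρ x v‖ * ‖D.dpart ρ x w‖) := by
  have hz : ∀ z : EuclideanSpace ℝ D.ι, ∀ l, |z l| ≤ ‖z‖ := fun z l => by
    simpa using PiLp.norm_apply_le z l
  have h1 : ∀ l m, |E (D.cocycle i l m x) *
      (D.dpart ρ x v l * D.dpart ρ x w m - D.dpart ρ x w l * D.dpart ρ x v m)| ≤
      η * (2 * (‖D.dpart ρ x v‖ * ‖D.dpart ρ x w‖)) := by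
    intro l m
    by_cases hl : x ∈ tsupport (ρ l)
    · by_cases hm : x ∈ tsupport (ρ m)
      · rw [abs_mul]
        refine mul_le_mul (hE i l m x ⟨⟨hi, hρ l hl⟩, hρ m hm⟩) ?_ (abs_nonneg _) hη
        refine (abs_sub _ _).trans ?_
        rw [abs_mul, abs_mul]
        have h2 := mul_le_mul (hz (D.dpart ρ x v) l) (hz (D.dpart ρ x w) m) (abs_nonneg _)
          (norm_nonneg _)
        have h3 := mul_le_mul (hz (D.dpart ρ x w) l) (hz (D.dpart ρ x v) m) (abs_nonneg _)
          (norm_nonneg _)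
        linarith
      · rw [dpart_eq_zero hm, dpart_eq_zero hm]
        simp only [mul_zero, sub_zero, abs_zero]
        positivity
    · rw [dpart_eq_zero hl, dpart_eq_zero hl]
      simp only [zero_mul, mul_zero, sub_zero, abs_zero]
      positivity
  rw [extD_corrForm hρ hi, abs_neg]
  refine (Finset.abs_sum_le_sum_abs _ _).trans ((Finset.sum_le_sum fun l _ =>
    (Finset.abs_sum_le_sum_abs _ _).trans (Finset.sum_le_sum fun m _ => h1 l m)).trans (le_of_eq ?_))
  simp only [Finset.sum_const, Finset.card_univ, nsmul_eq_mul]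
  ring

end DForm.FinitePrimitives

end

/-! ### Density of symplectic forms with rational class. -/

noncomputable section

namespace DForm

variable {d : ℕ} {X : Type u} [TopologicalSpace X] [ChartedSpace (EuclideanSpace ℝ (Fin d)) X]
  [IsManifold (𝓡 d) ∞ X]

theorem IsSymplectic.const_smul {σ : DForm d 2 X} (hσ : IsSymplectic σ) {c : ℝ} (hc : c ≠ 0) :
    IsSymplectic (c • σ) where
  smooth := (smoothOn_iff isOpen_univ).2 fun x hx =>
    ((smoothOn_iff isOpen_univ).1 hσ.smooth x hx).smul c
  closed := funext fun x => by
    rw [extD_smul, hσ.closed]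
    exact smul_zero c
  nondegenerate x v hv := hσ.nondegenerate x v fun w =>
    (mul_eq_zero.1 (show c * σ x ![v, w] = 0 from hv w)).resolve_left hc

namespace FinitePrimitives

variable {σ : DForm d 2 X} (D : FinitePrimitives σ)
  (ρ : SmoothPartitionOfUnity D.ι (𝓡 d) X univ) (E : ℝ →+ ℝ)

theorem exists_mem_V (x : X) : ∃ i, x ∈ D.V i := by
  have : x ∈ ⋃ i, D.V i := D.iUnion_V ▸ mem_univ x
  simpa using this

/-- The two-form whose primitives are the corrected primitives. -/
def corrected : DForm d 2 X := fun x => σ x + extD (D.corrForm ρ E (D.exists_mem_V x).choose) x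

variable {D ρ E}

theorem corrected_eq (hρ : ρ.IsSubordinate D.V) {i : D.ι} {x : X} (hi : x ∈ D.V i) :
    D.corrected ρ E x = σ x + extD (D.corrForm ρ E i) x := by
  rw [corrected, extD_corrForm_eq hρ (D.exists_mem_V x).choose_spec hi]

theorem smoothAt_lam {i : D.ι} {x : X} (hi : x ∈ D.V i) : SmoothAt (D.lam i) x :=
  (smoothOn_iff (D.isOpen_U i)).1 (D.smooth_lam i) x (V_subset_U i hi)

theorem extD_lam_add_corrForm (hρ : ρ.IsSubordinate D.V) {i : D.ι} {x : X} (hi : x ∈ D.V i) :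
    extD (D.lam i + D.corrForm ρ E i) x = D.corrected ρ E x := by
  rw [corrected_eq hρ hi, SmoothAt.extD_add (smoothAt_lam hi) (smoothAt_corrForm hρ hi),
    D.extD_lam i x (V_subset_U i hi)]

theorem eventually_smoothAt (hρ : ρ.IsSubordinate D.V) {i : D.ι} {x : X} (hi : x ∈ D.V i) :
    ∀ᶠ y in 𝓝 x, SmoothAt (D.lam i + D.corrForm ρ E i) y := by
  filter_upwards [(D.isOpen_V i).mem_nhds hi] with y hy
  exact (smoothAt_lam hy).add (smoothAt_corrForm hρ hy)

theorem eventually_corrected_eq (hρ : ρ.IsSubordinate D.V) {i : D.ι} {x : X} (hi : x ∈ D.V i) :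
    ∀ᶠ y in 𝓝 x, extD (D.lam i + D.corrForm ρ E i) y = D.corrected ρ E y := by
  filter_upwards [(D.isOpen_V i).mem_nhds hi] with y hy using extD_lam_add_corrForm hρ hy

theorem smoothOn_corrected (hρ : ρ.IsSubordinate D.V) : SmoothOn (D.corrected ρ E) univ :=
  (smoothOn_iff isOpen_univ).2 fun x _ => by
    obtain ⟨i, hi⟩ := D.exists_mem_V x
    exact (SmoothAt.extD (eventually_smoothAt hρ hi)).congr (eventually_corrected_eq hρ hi)

theorem extD_corrected (hρ : ρ.IsSubordinate D.V) : extD (D.corrected ρ E) = 0 := by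
  funext x
  obtain ⟨i, hi⟩ := D.exists_mem_V x
  rw [← extD_congr (eventually_corrected_eq hρ hi)]
  exact extD_extD (eventually_smoothAt hρ hi)

/-- The corrected primitives and transition functions have the Čech cocycle c + E(c), by
`corrFun_relation`. After multiplication by `k` it is integral by assumption. -/
theorem isIntegral_corrected (hρ : ρ.IsSubordinate D.V) {k : ℝ}
    (hk : ∀ i j l, ∀ x ∈ D.V i ∩ D.V j ∩ D.V l,
      ∃ m : ℤ, k * (D.cocycle i j l x + E (D.cocycle i j l x)) = m) :
    IsIntegral (k • D.corrected ρ E) := by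
  have hf : ∀ i j, ∀ x ∈ D.V i ∩ D.V j, ContMDiffAt (𝓡 d) 𝓘(ℝ, ℝ) ∞ (D.f i j) x := fun i j x hx =>
    (D.smooth_f i j).contMDiffAt (((D.isOpen_U i).inter (D.isOpen_U j)).mem_nhds
      ⟨V_subset_U i hx.1, V_subset_U j hx.2⟩)
  refine ⟨D.ι, D.V, fun i => k • (D.lam i + D.corrForm ρ E i),
    fun i j => k • (D.f i j + D.corrFun ρ E i j), D.isOpen_V, D.iUnion_V, fun i => ?_,
    fun i x hx => ?_, fun i j x hx => ?_, fun i j x hx v => ?_, fun i j l x hx => ?_⟩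
  · exact (smoothOn_iff (D.isOpen_V i)).2 fun x hx =>
      (eventually_smoothAt hρ hx).self_of_nhds.smul k
  · rw [extD_smul, extD_lam_add_corrForm hρ hx]
    rfl
  · exact (ContMDiffAt.smul (contMDiffAt_const (I := 𝓡 d) (I' := 𝓘(ℝ, ℝ)) (c := k))
      ((hf i j x hx).add (contMDiffAt_corrFun (E := E) hρ hx.1 hx.2))).contMDiffWithinAt
  · have h1 := (((hf i j x hx).mdifferentiableAt (by simp)).hasMFDerivAt.add
      ((contMDiffAt_corrFun (E := E) hρ hx.1 hx.2).mdifferentiableAt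
        (by simp)).hasMFDerivAt).const_smul k
    rw [h1.mfderiv]
    have key : ∀ (A B : EuclideanSpace ℝ (Fin d) →L[ℝ] ℝ) (v : EuclideanSpace ℝ (Fin d))
        (a b : ℝ), A v = a → B v = b → (k • (A + B)) v = k * (a + b) := by
      rintro A B v _ _ rfl rfl
      rfl
    refine (key _ _ v _ _ (D.mfderiv_f i j x ⟨V_subset_U i hx.1, V_subset_U j hx.2⟩ v)
      (mfderiv_corrFun hρ hx.1 hx.2 v)).trans ?_
    exact (by intros; ring : ∀ a b c e : ℝ, k * (b - a + (e - c)) = k * (b + e) - k * (a + c))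
      _ _ _ _
  · obtain ⟨m, hm⟩ := hk i j l x hx
    refine ⟨m, hm ▸ ?_⟩
    rw [← corrFun_relation (ρ := ρ) (E := E) i j l x]
    simp only [Pi.smul_apply, Pi.add_apply, smul_eq_mul, cocycle]
    ring

theorem abs_corrected_sub_le (hρ : ρ.IsSubordinate D.V) {η : ℝ} (hη : 0 ≤ η)
    (hE : ∀ i j k, ∀ x ∈ D.V i ∩ D.V j ∩ D.V k, |E (D.cocycle i j k x)| ≤ η)
    (x : X) (v w : TangentSpace (𝓡 d) x) :
    |D.corrected ρ E x ![v, w] - σ x ![v, w]| ≤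
      η * (2 * (Fintype.card D.ι : ℝ) ^ 2) * (‖D.dpart ρ x v‖ * ‖D.dpart ρ x w‖) := by
  obtain ⟨i, hi⟩ := D.exists_mem_V x
  have h1 : D.corrected ρ E x ![v, w] - σ x ![v, w] = extD (D.corrForm ρ E i) x ![v, w] := by
    rw [corrected_eq hρ hi]
    exact add_sub_cancel_left (σ x ![v, w]) _
  rw [h1]
  exact abs_extD_corrForm_le hρ hη hE hi v w

end FinitePrimitives

open FinitePrimitives in
/-- On a compact manifold, symplectic forms with rational class are dense. -/
theorem IsSymplectic.exists_integral_multiple [T2Space X] [CompactSpace X] {σ : DForm d 2 X}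
    (hσ : IsSymplectic σ) (g : RMetric d X) {ε : ℝ} (hε : 0 < ε) :
    ∃ (σ' : DForm d 2 X) (k : ℕ), IsSymplectic σ' ∧
      (∀ (x : X) (v w : TangentSpace (𝓡 d) x), g.inner x v v ≤ 1 → g.inner x w w ≤ 1 →
        |σ' x ![v, w] - σ x ![v, w]| ≤ ε) ∧ 0 < k ∧ IsIntegral ((k : ℝ) • σ') := by
  obtain ⟨D⟩ := nonempty_finitePrimitives hσ.smooth hσ.closed
  obtain ⟨ρ, hρ⟩ := SmoothPartitionOfUnity.exists_isSubordinate (𝓡 d) isClosed_univ D.V D.isOpen_V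
    D.iUnion_V.ge
  obtain ⟨C⟩ := hσ.nonempty_compatibleTriple
  obtain ⟨K₁, hK₁, hb₁⟩ := exists_norm_vderiv_le (contMDiff_part (ρ := ρ)) (G := g.inner)
    g.pos (contMDiff_bilin_iff.1 g.contMDiff)
  obtain ⟨K₂, hK₂, hb₂⟩ := exists_norm_vderiv_le (contMDiff_part (ρ := ρ)) (G := C.h) C.pos C.smooth_h
  obtain ⟨s, hs⟩ := D.exists_finset_cocycle
  set M : ℝ := 2 * (Fintype.card D.ι : ℝ) ^ 2
  have hM : 0 ≤ M := by positivity
  have hden : 0 < M * (K₁ + K₂) + 1 := by positivity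
  -- The bound `ε` serves closeness measured by `g`, and the bound 1 serves nondegeneracy measured
  -- by the compatible metric.
  set η : ℝ := min ε 1 / (M * (K₁ + K₂) + 1)
  have hη : 0 < η := div_pos (lt_min hε one_pos) hden
  have hηe : η * (M * (K₁ + K₂) + 1) = min ε 1 := div_mul_cancel₀ _ hden.ne'
  have hη₁ : η * M * K₁ ≤ ε := by
    have h1 : 0 ≤ η * M * K₂ := by positivity
    have h2 := min_le_left ε 1
    nlinarith
  have hη₂ : η * M * K₂ < 1 := by
    have h1 : 0 ≤ η * M * K₁ := by positivity
    have h2 := min_le_right ε 1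
    nlinarith
  obtain ⟨ψ, hψ⟩ := exists_linearMap_approx s hη
  obtain ⟨k, hk0, hk⟩ := exists_common_den s ψ
  -- Adding E(t) to t gives ψ(t), so the corrected cocycle takes rational values, with common
  -- denominator `k`.
  let E : ℝ →+ ℝ := (Rat.castHom ℝ).toAddMonoidHom.comp ψ.toAddMonoidHom - AddMonoidHom.id ℝ
  have hE : ∀ t, E t = (ψ t : ℝ) - t := fun t => rfl
  have hest := abs_corrected_sub_le (E := E) hρ hη.le fun i j l x hx => (hψ _ (hs i j l x hx)).le
  have hprod : ∀ (a b K r : ℝ), a ^ 2 ≤ K * r → b ^ 2 ≤ K * r → a * b ≤ K * r := fun a b K r ha hb => by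
    nlinarith [sq_nonneg (a - b)]
  refine ⟨D.corrected ρ E, k, ⟨smoothOn_corrected hρ, extD_corrected hρ, fun x v hv => ?_⟩,
    fun x v w hvg hwg => ?_, hk0, isIntegral_corrected hρ fun i j l x hx => ?_⟩
  · by_contra hv0
    -- Pairing with T v gives h(v, v) for the original form, while the correction changes this
    -- pairing by at most η M K₂ h(v, v), which is strictly smaller.
    have h1 : σ x ![v, C.T x v] = C.h x v v := by rw [← C.h_T, C.h_map]
    have h2 := C.pos x v hv0
    have h3 := hest x v (C.T x v)
    rw [hv, h1, zero_sub, abs_neg, abs_of_pos h2] at h3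
    have h4 := hb₂ x (C.T x v)
    rw [C.h_map] at h4
    have h5 := mul_le_mul_of_nonneg_left (hprod _ _ _ _ (hb₂ x v) h4) (by positivity : 0 ≤ η * M)
    have h6 : C.h x v v ≤ η * M * (K₂ * C.h x v v) := h3.trans h5
    nlinarith
  · have h1 : K₁ * g.inner x v v ≤ K₁ * 1 := mul_le_mul_of_nonneg_left hvg hK₁.le
    have h2 : K₁ * g.inner x w w ≤ K₁ * 1 := mul_le_mul_of_nonneg_left hwg hK₁.le
    have h3 := mul_le_mul_of_nonneg_left (hprod _ _ _ _ ((hb₁ x v).trans h1) ((hb₁ x w).trans h2))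
      (by positivity : 0 ≤ η * M)
    rw [mul_one] at h3
    exact (hest x v w).trans (h3.trans hη₁)
  · obtain ⟨m, hm⟩ := hk _ (hs i j l x hx)
    exact ⟨m, by rw [hE, add_sub_cancel]; exact hm⟩

end DForm

end

/-! ### The theorem: the integral case, and the general case by approximation. -/

theorem proposition5p1 {n : ℕ} {X : Type u} [TopologicalSpace X]
    [ChartedSpace (EuclideanSpace ℝ (Fin n)) X] [IsManifold (𝓡 n) ∞ X]
    [T2Space X] [CompactSpace X] [ConnectedSpace X]
    (σ : DForm n 2 X) (hσ : DForm.IsSymplectic σ) :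
    (∀ c : ℝ, c ≠ 0 → DForm.IsIntegral (c • σ) →
      ∃ B : BoothbyWang (c • σ), B.SphereBundleIsKContact ∧ B.SphereBundleHasPi1OfBase) ∧
    (∀ (g : RMetric n X) (ε : ℝ), 0 < ε →
      ∃ (σ' : DForm n 2 X) (k : ℕ), DForm.IsSymplectic σ' ∧
        (∀ (x : X) (v w : TangentSpace (𝓡 n) x), g.inner x v v ≤ 1 → g.inner x w w ≤ 1 →
          |σ' x ![v, w] - σ x ![v, w]| ≤ ε) ∧
        0 < k ∧ DForm.IsIntegral ((k : ℝ) • σ') ∧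
        ∃ B : BoothbyWang ((k : ℝ) • σ'),
          B.SphereBundleIsKContact ∧ B.SphereBundleHasPi1OfBase) := by
  refine ⟨fun c hc hi => exists_boothbyWang (hσ.const_smul hc) hi, fun g ε hε => ?_⟩
  obtain ⟨σ', k, hσ', hclose, hk, hi⟩ := hσ.exists_integral_multiple g hε
  exact ⟨σ', k, hσ', hclose, hk, hi,
    exists_boothbyWang (hσ'.const_smul (Nat.cast_ne_zero.2 hk.ne')) hi⟩
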